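/- Let $k$ be an algebraically closed field of characteristic $0$ and $S=k[X_0,X_1,X_2]$. Let $F(t)=F_0+F_1t+F_2t^2+\cdots$, with $F_i\in S$ homogeneous of the same positive degree $d$, be a homogeneous power series with $F_0=E^2A$, where $E,A\in S$ are square-free and coprime. Let $E=E_1\cdots E_m$ be the decomposition of $E$ into irreducible factors, let $C_j$ be the curve $E_j=0$ and $C_A$ the curve $A=0$. Assume that the generic curve $C^*$, given by $F(t)=0$ in $\mathbb P^2_{k((t))}$, is geometrically reduced. For each $j$ put $B_j:=E^2A/E_j^2$, $\Delta_{1,j}:=F_1$ and, for $n\ge 0$, $$\Delta_{n+2,j}:=B_j^{n+1}F_{n+2}-\sum_{\substack{i+r=n+2\\ i,r\ge 1}}\frac{\Delta_{i,j}'}{2}\cdot\frac{\Delta_{r,j}'}{2},\qquad \Delta_{i,j}':=\Delta_{i,j}/E_j,$$ which is defined as long as $E_j$ divides $\Delta_{1,j},\dots,\Delta_{n+1,j}$. The family $F(t)$ is of type $n\ge 1$ for $E_j$ if $E_j$ divides $\Delta_{1,j},\dots,\Delta_{n-1,j}$ but not $\Delta_{n,j}$. The dual curve $C^\vee$ of a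 reduced plane curve $C$ over an algebraically closed field of characteristic $0$ is the divisor in the dual plane that is the sum of the usual dual curves of the components of $C$ (the closures of the sets of tangent lines at simple points; a component that is a line contributes nothing), each with multiplicity $1$, and of the lines $P^\vee$ dual to the singular points $P$ of $C$, each with multiplicity equal to the intersection multiplicity at $P$ of $C$ with a general polar of $C$. For coprime forms $P,Q$ let $[P\cdot Q]^\vee:=\sum_p i_p(P,Q)\,p^\vee$, where $i_p(P,Q)$ is the intersection multiplicity at the point $p$ and $p^\vee$ is the line of the dual plane formed by the lines through $p$. The dual curve $(C^*)^\vee$ is the divisor in the dual plane over $k((t))$ that becomes the dual curve of $C^*$ over an algebraic closure of $k((t))$; its limit is the divisor of $\Phi(0)$, where $\Phi$ is an equation of $(C^*)^\vee$ with coefficients in $k[[t]]$ such that $\Phi(0)\ne 0$. Then for each $j$ there is an integer $n_j\ge 1$ such that $F(t)$ is of type $n_j$ for $E_j$, and the limit of the dual curves of the family is $$\lim_{t\to 0}(C^*)^\vee=2\sum_{j=1}^m C_j^\vee+C_A^\vee+2[E\cdot A]^\vee+\sum_{j=1}^m[\Delta_{n_j,j}\cdot E_j]^\vee-\sum_{j=1}^m(n_j-2)[B_j\cdot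 E_j]^\vee$$ as divisors in the dual plane. -/

import Mathlib

open MvPolynomial
open scoped LinearAlgebra.Projectivization

namespace PlaneCurve

/-! A plane curve over a field `K` is given by a nonzero homogeneous polynomial in three variables,
up to multiplication by a nonzero constant. The dual plane has the same coordinate ring: the point
`w` of the dual plane is the line `w 0 * X 0 + w 1 * X 1 + w 2 * X 2 = 0`. -/

section Field

variable {K : Type*} [Field K]

/-- Divisors on the projective plane: formal integer combinations of curves, the curve `Q = 0`
being represented by the class of `Q` up to units. -/
abbrev Div (K : Type*) [Field K] : Type _ := Associates (MvPolynomial (Fin 3) K) →₀ ℤ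

/-- The curve `Q = 0`, as a divisor with multiplicity one (used for irreducible `Q` only). -/
noncomputable def primeDivisor (Q : MvPolynomial (Fin 3) K) : Div K :=
  Finsupp.single (Associates.mk Q) 1

/-- The divisor of a nonzero form: its irreducible factors, counted with multiplicity. -/
noncomputable def divisor (P : MvPolynomial (Fin 3) K) : Div K :=
  ((UniqueFactorizationMonoid.factors P).map primeDivisor).sum

instance ker_eval_isPrime (v : Fin 3 → K) :
    (RingHom.ker (eval v : MvPolynomial (Fin 3) K →+* K)).IsPrime :=
  RingHom.ker_isPrime _

/-- The local ring at `v` of affine space (polynomials that do not vanish at `v` are inverted). -/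
abbrev LocalRing (v : Fin 3 → K) : Type _ :=
  Localization.AtPrime (RingHom.ker (eval v : MvPolynomial (Fin 3) K →+* K))

/-- If `v i ≠ 0`, the projective plane near the point with homogeneous coordinates `v` is
the affine plane `X i = v i` near `v`. This is the dimension over `K` of the local ring of that
affine plane at `v` modulo the equations `P` and `Q`. -/
noncomputable def localMultiplicity (P Q : MvPolynomial (Fin 3) K) (v : Fin 3 → K) (i : Fin 3) :
    ℕ :=
  Module.finrank K (LocalRing v ⧸ Ideal.span
    (algebraMap (MvPolynomial (Fin 3) K) (LocalRing v) '' {P, Q, X i - C (v i)}))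

/-- A coordinate that does not vanish at `p`. -/
noncomputable def chart (p : ℙ K (Fin 3 → K)) : Fin 3 :=
  (Function.ne_iff.mp p.rep_nonzero).choose

/-- The intersection multiplicity at `p` of the curves `P = 0` and `Q = 0`. -/
noncomputable def intersectionMultiplicity (P Q : MvPolynomial (Fin 3) K)
    (p : ℙ K (Fin 3 → K)) : ℕ :=
  localMultiplicity P Q p.rep (chart p)

/-- The line `p^∨` of the dual plane formed by the lines through `p`. -/
noncomputable def dualLine (p : ℙ K (Fin 3 → K)) : Div K :=
  primeDivisor (∑ i, C (p.rep i) * X i)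

/-- The divisor `[P · Q]^∨` of the dual plane, for coprime `P` and `Q` over an algebraically closed
field: the sum of the dual lines of the points of intersection, counted with multiplicity. -/
noncomputable def intersectionDual (P Q : MvPolynomial (Fin 3) K) : Div K :=
  ∑ᶠ p : ℙ K (Fin 3 → K), (intersectionMultiplicity P Q p : ℤ) • dualLine p

/-- The gradient of `P` at `v`. -/
noncomputable def gradientAt (P : MvPolynomial (Fin 3) K) (v : Fin 3 → K) : Fin 3 → K :=
  fun i => eval v (pderiv i P)

/-- The affine cone over the set of tangent lines to `D = 0` at its simple points. -/
def tangentCone (D : MvPolynomial (Fin 3) K) : Set (Fin 3 → K) :=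
  {w | ∃ (v : Fin 3 → K) (c : K), v ≠ 0 ∧ eval v D = 0 ∧ gradientAt D v ≠ 0 ∧ w = c • gradientAt D v}

open Classical in
/-- The usual dual of an irreducible curve: the closure in the dual plane of the set of tangent
lines at simple points, if this closure is a curve (given by an irreducible `Q`). If `D = 0` is a
line, then the closure is a point, and the divisor is zero. -/
noncomputable def usualDual (D : MvPolynomial (Fin 3) K) : Div K :=
  if h : ∃ Q : MvPolynomial (Fin 3) K, Irreducible Q ∧
      vanishingIdeal K (tangentCone D) = Ideal.span {Q}
  then primeDivisor h.choose else 0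

/-- The singular points of the curve `P = 0`. -/
def singularPoints (P : MvPolynomial (Fin 3) K) : Set (ℙ K (Fin 3 → K)) :=
  {p | eval p.rep P = 0 ∧ gradientAt P p.rep = 0}

/-- The polar of `P = 0` with respect to the point `R`. -/
noncomputable def polar (P : MvPolynomial (Fin 3) K) (R : Fin 3 → K) : MvPolynomial (Fin 3) K :=
  ∑ i, C (R i) * pderiv i P

/-- The intersection multiplicity at `p` of `P = 0` with a general polar: the value that
is taken for all `R` in a nonempty Zariski-open set. -/
noncomputable def polarMultiplicity (P : MvPolynomial (Fin 3) K) (p : ℙ K (Fin 3 → K)) : ℕ :=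
  sInf {n : ℕ | ∃ g : MvPolynomial (Fin 3) K, g ≠ 0 ∧
    ∀ R : Fin 3 → K, eval R g ≠ 0 → intersectionMultiplicity P (polar P R) p = n}

/-- The dual curve `C^∨` of a reduced plane curve `C : P = 0` over an algebraically closed field:
the usual duals of the components of `C`, each with multiplicity one, and the dual lines of
the singular points of `C`, each with the intersection multiplicity of `C` with a general polar. -/
noncomputable def dualCurve (P : MvPolynomial (Fin 3) K) : Div K :=
  ((UniqueFactorizationMonoid.factors P).map usualDual).sum +
    ∑ᶠ (p : ℙ K (Fin 3 → K)) (_ : p ∈ singularPoints P), (polarMultiplicity P p : ℤ) • dualLine p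

open Classical in
/-- The quotient `P / Q` if `Q` divides `P` (and zero otherwise). -/
noncomputable def exactQuotient (P Q : MvPolynomial (Fin 3) K) : MvPolynomial (Fin 3) K :=
  if h : Q ∣ P then h.choose else 0

/-- The discriminants `Δ_n`, `n ≥ 1`, of `F 0 + F 1 t + F 2 t^2 + ⋯` for the factor `E` of `F 0`,
where `F 0 = E^2 * B`. The sum is over the pairs `(i + 1, n + 1 - i)` of positive integers with
sum `n + 2`. The value at `0` is not used, and that at `n` matters only if `E`
divides the earlier ones. -/
noncomputable def discriminant (F : ℕ → MvPolynomial (Fin 3) K) (E B : MvPolynomial (Fin 3) K) :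
    ℕ → MvPolynomial (Fin 3) K
  | 0 => 0
  | 1 => F 1
  | n + 2 => B ^ (n + 1) * F (n + 2) - ∑ i : Fin (n + 1),
      (C (1 / 2) * exactQuotient (discriminant F E B (i + 1)) E) *
        (C (1 / 2) * exactQuotient (discriminant F E B (n + 1 - i)) E)
decreasing_by all_goals omega

/-- The family is of type `n` for `E`. -/
def IsOfType (F : ℕ → MvPolynomial (Fin 3) K) (E B : MvPolynomial (Fin 3) K) (n : ℕ) : Prop :=
  1 ≤ n ∧ (∀ i, 1 ≤ i → i < n → E ∣ discriminant F E B i) ∧ ¬ E ∣ discriminant F E B n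

end Field

section Family

variable {k : Type*} [Field k]

/-- The coefficient `F_i` of `t^i` in a homogeneous power series `F(t) = F_0 + F_1 t + ⋯`, that is,
in a form with coefficients in `k[[t]]`. -/
noncomputable def tCoeff (F : MvPolynomial (Fin 3) (PowerSeries k)) (i : ℕ) :
    MvPolynomial (Fin 3) k :=
  ∑ m ∈ F.support, monomial m (PowerSeries.coeff i (F.coeff m))

/-- An algebraic closure of the field `k((t))`. -/
abbrev GeomField (k : Type*) [Field k] : Type _ := AlgebraicClosure (LaurentSeries k)

/-- The geometric generic member of the family `F`, that is, `F` over an algebraic closure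
of `k((t))`. -/
noncomputable def geomGeneric (F : MvPolynomial (Fin 3) (PowerSeries k)) :
    MvPolynomial (Fin 3) (GeomField k) :=
  map ((algebraMap (LaurentSeries k) (GeomField k)).comp
    (algebraMap (PowerSeries k) (LaurentSeries k))) F

/-- `Γ₀` is the limit as `t → 0` of the curve over `k((t))` which over an algebraic closure
becomes `Γ`: there is a form `Φ` over `k[[t]]` that is not zero for `t = 0` (so that its zero scheme
is flat over `k[[t]]`), whose generic member is `Γ` and whose special member is `Γ₀`. -/
def IsLimitCurve (Γ : Div (GeomField k)) (Γ₀ : Div k) : Prop :=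
  ∃ (e : ℕ) (Φ : MvPolynomial (Fin 3) (PowerSeries k)), Φ.IsHomogeneous e ∧ tCoeff Φ 0 ≠ 0 ∧
    divisor (geomGeneric Φ) = Γ ∧ divisor (tCoeff Φ 0) = Γ₀

end Family

end PlaneCurve

/-!
The dual of a plane curve is computed by a discriminant. For a form `P` of degree `d`, the
discriminant of the restriction of `P` to the line through `a` and `b` is a form `D_P` in the
coordinates `a ⨯₃ b` of the line (`IsDiscriminantForm`). Likewise the resultant of the restrictions
of two forms `P` and `Q` is a form `R_{P,Q}` in these coordinates (`IsResultantForm`).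

* The divisor of `R_{P,Q}` is the sum of the lines dual to the common points of `P` and `Q`, counted
  with their intersection multiplicities (`intersectionDual_eq_divisor`). In an affine chart, the
  length of the local ring at a common point is the order of a resultant, by the Smith normal form
  of the Sylvester map.
* The divisor of `D_P` is the dual curve of `P`, if `P` is reduced
  (`IsDiscriminantForm.dualCurve_eq_divisor`). For irreducible `P` of degree at least two, a
  component of `D_P` is dual to a singular point or is the usual dual. The usual dual occurs with
  multiplicity one, since in characteristic zero the generic tangent line is neither inflectional
  nor a bitangent, as is seen by moving it with a derivation. Products are handled by
  `D_{PQ} = D_P D_Q R_{P,Q}²`, and the multiplicity of a line dual to a singular point is found on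
  the pencil of lines through a general point, where `D_P` is, up to a constant,
  the resultant of `P` and a polar.

It remains to find the limit of the discriminant form `D_F` of the family. On a general line over
`k`, the discriminant of `F(t)` is, up to factors that are nonzero at `t = 0`, the product of the
critical values at the critical points that lift the roots of `E`. They exist by Hensel's lemma. If
`E_j` divides `Δ_{i,j}` for `i < n`, then `B_j^(2n-1) F(t)` is a square up to `t^n B_j^n Δ_{n,j}`
and higher powers of `t` (`exists_sq_approx`). Hence the critical value near a root of `E_j` is
`t^n ψ` with `B_j^(n-1) ψ(0) = Δ_{n,j}` at this root (`exists_eval_critical_point`). Taking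
products over the roots, one obtains `D_F = t^N Φ`, where up to a constant factor
`Φ(0) ∏ R_{E_j,B_j}^(n_j-1) = ± ∏ R_{E_j,Δ_j} (∏ D_{E_j})² ∏ R_{E_j,B_j} R_{E,A}² D_A`
and `Δ_j` is `Δ_{n_j,j}` (`exists_discriminantForm_eq`). If some `E_j` had no type, then `D_F` would
be divisible by all powers of `t`, but it is not zero because the generic curve is reduced. If the
`n_j` are the types, then the right-hand side is not zero, and the divisors of the two sides give
the formula for the limit.
-/

open scoped Matrix

universe u

namespace PlaneCurve

/-! ### Restriction of forms to lines -/

section Line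

variable {R S : Type*} [CommRing R] [CommRing S]

/-- The restriction of a polynomial `P` to the line through `a` and `b`: the polynomial
`P (x a + b)` in the affine coordinate `x`, for which `a` is the point at infinity. -/
noncomputable def linePoly (P : MvPolynomial (Fin 3) R) (a b : Fin 3 → R) : Polynomial R :=
  aeval (fun i => Polynomial.C (a i) * Polynomial.X + Polynomial.C (b i)) P

/-- The derivative of `P` in the direction `c`. -/
noncomputable def dirDeriv (c : Fin 3 → R) (P : MvPolynomial (Fin 3) R) : MvPolynomial (Fin 3) R :=
  ∑ i, C (c i) * pderiv i P

lemma linePoly_mul (P Q : MvPolynomial (Fin 3) R) (a b : Fin 3 → R) :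
    linePoly (P * Q) a b = linePoly P a b * linePoly Q a b := map_mul _ _ _

lemma linePoly_add (P Q : MvPolynomial (Fin 3) R) (a b : Fin 3 → R) :
    linePoly (P + Q) a b = linePoly P a b + linePoly Q a b := map_add _ _ _

lemma linePoly_C (r : R) (a b : Fin 3 → R) : linePoly (C r) a b = Polynomial.C r := by
  simp [linePoly, Polynomial.C_eq_algebraMap]

lemma linePoly_X (i : Fin 3) (a b : Fin 3 → R) : linePoly (X i) a b =
    Polynomial.C (a i) * Polynomial.X + Polynomial.C (b i) := by
  rw [linePoly, aeval_X]

@[simp] lemma linePoly_zero (a b : Fin 3 → R) : linePoly 0 a b = 0 := map_zero _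

lemma linePoly_sum {ι : Type*} (s : Finset ι) (P : ι → MvPolynomial (Fin 3) R) (a b : Fin 3 → R) :
    linePoly (∑ i ∈ s, P i) a b = ∑ i ∈ s, linePoly (P i) a b := map_sum _ _ _

lemma linePoly_prod {ι : Type*} (s : Finset ι) (P : ι → MvPolynomial (Fin 3) R) (a b : Fin 3 → R) :
    linePoly (∏ i ∈ s, P i) a b = ∏ i ∈ s, linePoly (P i) a b := map_prod _ _ _

lemma linePoly_pow (P : MvPolynomial (Fin 3) R) (n : ℕ) (a b : Fin 3 → R) :
    linePoly (P ^ n) a b = linePoly P a b ^ n := map_pow _ _ _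

lemma linePoly_map (φ : R →+* S) (P : MvPolynomial (Fin 3) R) (a b : Fin 3 → R) :
    (linePoly P a b).map φ = linePoly (P.map φ) (φ ∘ a) (φ ∘ b) := by
  induction P using MvPolynomial.induction_on with
  | C r => simp [linePoly_C]
  | add p q hp hq => simp [linePoly_add, hp, hq]
  | mul_X p i hp => rw [linePoly_mul, Polynomial.map_mul, hp, map_mul, linePoly_mul,
      linePoly_X, map_X, linePoly_X]; simp

lemma eval_linePoly (P : MvPolynomial (Fin 3) R) (a b : Fin 3 → R) (x : R) :
    (linePoly P a b).eval x = eval (x • a + b) P := by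
  induction P using MvPolynomial.induction_on with
  | C r => simp [linePoly_C]
  | add p q hp hq => simp [linePoly_add, hp, hq]
  | mul_X p i hp =>
    rw [linePoly_mul, Polynomial.eval_mul, hp, map_mul, linePoly_X]
    simp [mul_comm x]

lemma linePoly_monomial (m : Fin 3 →₀ ℕ) (r : R) (a b : Fin 3 → R) :
    linePoly (monomial m r) a b = Polynomial.C r * ∏ i,
      (Polynomial.C (a i) * Polynomial.X + Polynomial.C (b i)) ^ m i := by
  rw [linePoly, aeval_monomial, Finsupp.prod_fintype _ _ (by simp)]
  simp [Polynomial.C_eq_algebraMap]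

lemma natDegree_linear_pow_le (r s : R) (n : ℕ) :
    ((Polynomial.C r * Polynomial.X + Polynomial.C s) ^ n).natDegree ≤ n := by
  refine (Polynomial.natDegree_pow_le).trans ?_
  calc _ ≤ n * 1 := Nat.mul_le_mul_left _ Polynomial.natDegree_linear_le
    _ = n := mul_one n

lemma natDegree_linePoly_monomial_le (m : Fin 3 →₀ ℕ) (r : R) (a b : Fin 3 → R) :
    (linePoly (monomial m r) a b).natDegree ≤ m.degree := by
  rw [linePoly_monomial]
  refine (Polynomial.natDegree_C_mul_le _ _).trans ((Polynomial.natDegree_prod_le _ _).trans ?_)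
  rw [Finsupp.degree_eq_sum]
  exact Finset.sum_le_sum fun i _ => natDegree_linear_pow_le _ _ _

lemma coeff_linePoly_monomial (m : Fin 3 →₀ ℕ) (r : R) (a b : Fin 3 → R) :
    (linePoly (monomial m r) a b).coeff m.degree = r * ∏ i, a i ^ m i := by
  have h1 : ∀ i, ((Polynomial.C (a i) * Polynomial.X + Polynomial.C (b i)) ^ m i).coeff (m i)
      = a i ^ m i := by
    intro i
    have := Polynomial.coeff_pow_of_natDegree_le (p := Polynomial.C (a i) * Polynomial.X +
      Polynomial.C (b i)) (m := m i) (n := 1) Polynomial.natDegree_linear_le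
    simpa using this
  rw [linePoly_monomial, Polynomial.coeff_C_mul, Finsupp.degree_eq_sum, Fin.sum_univ_three,
    Fin.prod_univ_three, Fin.prod_univ_three,
    Polynomial.coeff_mul_add_eq_of_natDegree_le (Polynomial.natDegree_mul_le_of_le
      (natDegree_linear_pow_le _ _ _) (natDegree_linear_pow_le _ _ _))
      (natDegree_linear_pow_le _ _ _),
    Polynomial.coeff_mul_add_eq_of_natDegree_le (natDegree_linear_pow_le _ _ _)
      (natDegree_linear_pow_le _ _ _), h1, h1, h1]

lemma natDegree_linePoly_le {P : MvPolynomial (Fin 3) R} {d : ℕ} (hP : P.IsHomogeneous d)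
    (a b : Fin 3 → R) : (linePoly P a b).natDegree ≤ d := by
  conv_lhs => rw [P.as_sum, linePoly_sum]
  refine Polynomial.natDegree_sum_le_of_forall_le _ _ fun m hm => ?_
  refine (natDegree_linePoly_monomial_le _ _ _ _).trans (le_of_eq ?_)
  by_contra hne
  exact (mem_support_iff.mp hm) (hP.coeff_eq_zero hne)

lemma coeff_linePoly {P : MvPolynomial (Fin 3) R} {d : ℕ} (hP : P.IsHomogeneous d)
    (a b : Fin 3 → R) : (linePoly P a b).coeff d = eval a P := by
  conv_lhs => rw [P.as_sum, linePoly_sum, Polynomial.finsetSum_coeff]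
  rw [eval_eq']
  refine Finset.sum_congr rfl fun m hm => ?_
  have hd : m.degree = d := by
    by_contra hne
    exact (mem_support_iff.mp hm) (hP.coeff_eq_zero hne)
  rw [← hd, coeff_linePoly_monomial]

lemma natDegree_linePoly {P : MvPolynomial (Fin 3) R} {d : ℕ} (hP : P.IsHomogeneous d)
    {a : Fin 3 → R} (b : Fin 3 → R) (h : eval a P ≠ 0) : (linePoly P a b).natDegree = d :=
  le_antisymm (natDegree_linePoly_le hP a b)
    (Polynomial.le_natDegree_of_ne_zero (by rwa [coeff_linePoly hP]))

lemma leadingCoeff_linePoly {P : MvPolynomial (Fin 3) R} {d : ℕ} (hP : P.IsHomogeneous d)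
    {a : Fin 3 → R} (b : Fin 3 → R) (h : eval a P ≠ 0) :
    (linePoly P a b).leadingCoeff = eval a P := by
  rw [Polynomial.leadingCoeff, natDegree_linePoly hP b h, coeff_linePoly hP]

lemma eval_smul_of_isHomogeneous {P : MvPolynomial (Fin 3) R} {d : ℕ} (hP : P.IsHomogeneous d)
    (s : R) (v : Fin 3 → R) : eval (s • v) P = s ^ d * eval v P := by
  rw [eval_eq', eval_eq', Finset.mul_sum]
  refine Finset.sum_congr rfl fun m hm => ?_
  have hd : m.degree = d := by
    by_contra hne
    exact (mem_support_iff.mp hm) (hP.coeff_eq_zero hne)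
  rw [← hd, Finsupp.degree_eq_sum, ← Finset.prod_pow_eq_pow_sum]
  simp only [Pi.smul_apply, smul_eq_mul, mul_pow, Finset.prod_mul_distrib]
  ring

lemma eval_map_algebraMap' [Algebra R S] (v : Fin 3 → S) (P : MvPolynomial (Fin 3) R) :
    eval v (map (algebraMap R S) P) = aeval v P := by
  rw [eval_map, aeval_def]

lemma aeval_smul_of_isHomogeneous [Algebra R S] {P : MvPolynomial (Fin 3) R} {d : ℕ}
    (hP : P.IsHomogeneous d) (s : S) (v : Fin 3 → S) : aeval (s • v) P = s ^ d * aeval v P := by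
  rw [← eval_map_algebraMap', ← eval_map_algebraMap']
  exact eval_smul_of_isHomogeneous (hP.map _) s v

lemma isHomogeneous_dirDeriv {P : MvPolynomial (Fin 3) R} {d : ℕ} (hP : P.IsHomogeneous d)
    (c : Fin 3 → R) : (dirDeriv c P).IsHomogeneous (d - 1) :=
  IsHomogeneous.sum _ _ _ fun _ _ => (hP.pderiv).C_mul _

lemma map_dirDeriv (φ : R →+* S) (c : Fin 3 → R) (P : MvPolynomial (Fin 3) R) :
    map φ (dirDeriv c P) = dirDeriv (φ ∘ c) (map φ P) := by
  simp [dirDeriv, pderiv_map]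

lemma eval_dirDeriv (c v : Fin 3 → R) (P : MvPolynomial (Fin 3) R) :
    eval v (dirDeriv c P) = ∑ i, c i * eval v (pderiv i P) := by
  simp [dirDeriv]

lemma dirDeriv_mul (c : Fin 3 → R) (P Q : MvPolynomial (Fin 3) R) :
    dirDeriv c (P * Q) = dirDeriv c P * Q + P * dirDeriv c Q := by
  simp only [dirDeriv, pderiv_mul, Finset.sum_mul, Finset.mul_sum, ← Finset.sum_add_distrib]
  refine Finset.sum_congr rfl fun i _ => by ring

lemma dirDeriv_lincomb (r s : R) (a b : Fin 3 → R) (P : MvPolynomial (Fin 3) R) :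
    dirDeriv (r • a + s • b) P = C r * dirDeriv a P + C s * dirDeriv b P := by
  simp only [dirDeriv, Finset.mul_sum, ← Finset.sum_add_distrib]
  refine Finset.sum_congr rfl fun i _ => by simp; ring

lemma dirDeriv_add (c : Fin 3 → R) (P Q : MvPolynomial (Fin 3) R) :
    dirDeriv c (P + Q) = dirDeriv c P + dirDeriv c Q := by
  simp only [dirDeriv, map_add, mul_add, Finset.sum_add_distrib]

lemma dirDeriv_C (c : Fin 3 → R) (r : R) : dirDeriv c (C r) = 0 := by
  simp only [dirDeriv, pderiv_C, mul_zero, Finset.sum_const_zero]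

lemma dirDeriv_X (c : Fin 3 → R) (i : Fin 3) : dirDeriv c (X i) = C (c i) := by
  rw [dirDeriv, Finset.sum_eq_single i]
  · rw [pderiv_X_self, mul_one]
  · intro j _ hj
    rw [pderiv_X_of_ne (Ne.symm hj), mul_zero]
  · simp

lemma derivative_linePoly (P : MvPolynomial (Fin 3) R) (a b : Fin 3 → R) :
    (linePoly P a b).derivative = linePoly (dirDeriv a P) a b := by
  induction P using MvPolynomial.induction_on with
  | C r => rw [linePoly_C, dirDeriv_C, Polynomial.derivative_C, linePoly_zero]
  | add p q hp hq =>
    rw [linePoly_add, Polynomial.derivative_add, hp, hq, ← linePoly_add, dirDeriv_add]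
  | mul_X p i hp =>
    rw [linePoly_mul, Polynomial.derivative_mul, hp, dirDeriv_mul, linePoly_add, linePoly_mul,
      linePoly_mul, dirDeriv_X, linePoly_C, linePoly_X, Polynomial.derivative_add,
      Polynomial.derivative_C, Polynomial.derivative_C_mul, Polynomial.derivative_X, mul_one,
      add_zero]

/-- Euler's relation for the gradient. -/
lemma euler_dirDeriv {P : MvPolynomial (Fin 3) R} {d : ℕ} (hP : P.IsHomogeneous d)
    (v : Fin 3 → R) : eval v (dirDeriv v P) = d * eval v P := by
  have := congrArg (eval v) hP.sum_X_mul_pderiv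
  simpa [eval_dirDeriv] using this

/-- Euler's relation on a line: if `f = P (x a + y b)` at `y = 1`, then `x f_x + f_y = d f`. -/
lemma euler_linePoly {P : MvPolynomial (Fin 3) R} {d : ℕ} (hP : P.IsHomogeneous d)
    (a b : Fin 3 → R) :
    linePoly (dirDeriv b P) a b + linePoly (dirDeriv a P) a b * Polynomial.X =
      Polynomial.C (d : R) * linePoly P a b := by
  have h := congrArg (fun Q => linePoly Q a b) hP.sum_X_mul_pderiv
  have hd : linePoly (d • P) a b = Polynomial.C (d : R) * linePoly P a b := by
    rw [linePoly, map_nsmul, nsmul_eq_mul]; rfl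
  simp only [linePoly_sum, linePoly_mul, linePoly_X] at h
  rw [hd] at h
  rw [← h, dirDeriv, dirDeriv]
  simp only [linePoly_sum, linePoly_mul, linePoly_C, Finset.sum_mul, ← Finset.sum_add_distrib]
  exact Finset.sum_congr rfl fun i _ => by ring

end Line

/-! ### Resultants under change of basis of a line -/

section Equivariance

lemma map_resultant_linePoly {A B : Type*} [CommRing A] [CommRing B] (φ : A →+* B)
    (U V : MvPolynomial (Fin 3) A) (a b : Fin 3 → A) (p q : ℕ) :
    φ (Polynomial.resultant (linePoly U a b) (linePoly V a b) p q) =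
      Polynomial.resultant (linePoly (U.map φ) (φ ∘ a) (φ ∘ b))
        (linePoly (V.map φ) (φ ∘ a) (φ ∘ b)) p q := by
  rw [← Polynomial.resultant_map_map, linePoly_map, linePoly_map]

lemma ringHom_eval {A B : Type*} [CommRing A] [CommRing B] (φ : A →+* B) (v : Fin 3 → A)
    (P : MvPolynomial (Fin 3) A) : φ (eval v P) = eval (φ ∘ v) (P.map φ) := by
  rw [eval_map, eval, coe_eval₂Hom, eval₂_comp_left φ]; rfl

lemma algHom_aeval {R A B : Type*} [CommRing R] [CommRing A] [CommRing B] [Algebra R A]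
    [Algebra R B] (φ : A →ₐ[R] B) {σ : Type*} (v : σ → A) (P : MvPolynomial σ R) :
    φ (aeval v P) = aeval (fun i => φ (v i)) P := by
  rw [← AlgHom.comp_apply, comp_aeval]

lemma comp_lincomb {A B : Type*} [CommRing A] [CommRing B] (φ : A →+* B) (r s : A)
    (a b : Fin 3 → A) : φ ∘ (r • a + s • b) = φ r • (φ ∘ a) + φ s • (φ ∘ b) := by
  ext i; simp

/-- The resultant in formal degrees `p`, `q` of two binary forms, the first of which factors
completely and does not vanish at infinity. -/
lemma resultant_linePoly_eq_prod {Ω : Type*} [Field Ω] [IsAlgClosed Ω]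
    {U V : MvPolynomial (Fin 3) Ω} {p q : ℕ} (hU : U.IsHomogeneous p) (hV : V.IsHomogeneous q)
    {a : Fin 3 → Ω} (b : Fin 3 → Ω) (ha : eval a U ≠ 0) :
    Polynomial.resultant (linePoly U a b) (linePoly V a b) p q =
      eval a U ^ q * ((linePoly U a b).roots.map fun x => eval (x • a + b) V).prod := by
  have h := Polynomial.resultant_eq_prod_eval (linePoly U a b) (linePoly V a b) q
    (natDegree_linePoly_le hV a b) (IsAlgClosed.splits _)
  rw [natDegree_linePoly hU b ha, leadingCoeff_linePoly hU b ha] at h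
  simpa only [eval_linePoly] using h

/-- If `U (x a + b)` has the roots `α`, then `U` restricted to the same line with another basis
has as roots the images of the `α` under the corresponding Moebius transformation. -/
lemma roots_linePoly_lincomb {Ω : Type*} [Field Ω] [IsAlgClosed Ω]
    {U : MvPolynomial (Fin 3) Ω} {p : ℕ} (hU : U.IsHomogeneous p)
    {a b : Fin 3 → Ω} {m₁ m₂ m₃ m₄ : Ω} (ha : eval a U ≠ 0) (ha' : eval (m₁ • a + m₂ • b) U ≠ 0) :
    (∀ α ∈ (linePoly U a b).roots, m₁ - α * m₂ ≠ 0) ∧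
    eval (m₁ • a + m₂ • b) U =
      eval a U * ((linePoly U a b).roots.map fun α => m₁ - α * m₂).prod ∧
    (linePoly U (m₁ • a + m₂ • b) (m₃ • a + m₄ • b)).roots =
      (linePoly U a b).roots.map fun α => - ((m₃ - α * m₄) / (m₁ - α * m₂)) := by
  set s := (linePoly U a b).roots with hs
  have hsplit : linePoly U a b = Polynomial.C (eval a U) *
      (s.map fun α => Polynomial.X - Polynomial.C α).prod := by
    conv_lhs => rw [(IsAlgClosed.splits (linePoly U a b)).eq_prod_roots,
      leadingCoeff_linePoly hU b ha]
  have hcard : s.card = p := by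
    rw [hs, ← (IsAlgClosed.splits (linePoly U a b)).natDegree_eq_card_roots,
      natDegree_linePoly hU b ha]
  -- the factorization of the binary form; at first where `z` can be inverted
  have hval : ∀ y z : Ω, z ≠ 0 → eval (y • a + z • b) U =
      eval a U * (s.map fun α => y - α * z).prod := by
    intro y z hz
    have h1 : y • a + z • b = z • ((y / z) • a + b) := by
      ext i; simp; field_simp
    rw [h1, eval_smul_of_isHomogeneous hU, ← eval_linePoly, hsplit, Polynomial.eval_mul,
      Polynomial.eval_C, Polynomial.eval_multiset_prod, Multiset.map_map, mul_left_comm]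
    congr 1
    have h2 : (s.map fun α => y - α * z) = s.map fun α => z * (y / z - α) := by
      refine Multiset.map_congr rfl fun α _ => by field_simp
    rw [h2, Multiset.prod_map_mul, Multiset.map_const', Multiset.prod_replicate, hcard]
    simp
  have hval' : ∀ y z : Ω, eval (y • a + z • b) U =
      eval a U * (s.map fun α => y - α * z).prod := by
    intro y z
    rcases eq_or_ne z 0 with rfl | hz
    · simp [eval_smul_of_isHomogeneous hU, hcard, mul_comm]
    · exact hval y z hz
  have hne : ∀ α ∈ s, m₁ - α * m₂ ≠ 0 := by
    intro α hα h0
    apply ha'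
    rw [hval', Multiset.prod_eq_zero (Multiset.mem_map.mpr ⟨α, hα, h0⟩), mul_zero]
  refine ⟨hne, hval' _ _, ?_⟩
  have hpoly : linePoly U (m₁ • a + m₂ • b) (m₃ • a + m₄ • b) =
      Polynomial.C (eval (m₁ • a + m₂ • b) U) * ((s.map fun α =>
        - ((m₃ - α * m₄) / (m₁ - α * m₂))).map fun β =>
          Polynomial.X - Polynomial.C β).prod := by
    refine Polynomial.funext fun x => ?_
    have h1 : x • (m₁ • a + m₂ • b) + (m₃ • a + m₄ • b) =
        (x * m₁ + m₃) • a + (x * m₂ + m₄) • b := by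
      ext i; simp; ring
    rw [eval_linePoly, h1, hval', hval', Polynomial.eval_mul, Polynomial.eval_C,
      Polynomial.eval_multiset_prod, Multiset.map_map, Multiset.map_map, mul_assoc,
      ← Multiset.prod_map_mul]
    congr 2
    refine Multiset.map_congr rfl fun α hα => ?_
    have := hne α hα
    simp
    field_simp
    ring
  rw [hpoly, Polynomial.roots_C_mul _ ha', Polynomial.roots_multiset_prod_X_sub_C]

/-- The case in which both points `a` and `m₁ a + m₂ b` taken as the point at infinity of the line
lie off the curve `U = 0`, so that no degree drops. -/
lemma resultant_linePoly_lincomb_of_ne_zero {Ω : Type*} [Field Ω] [IsAlgClosed Ω]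
    {U V : MvPolynomial (Fin 3) Ω} {p q : ℕ} (hU : U.IsHomogeneous p) (hV : V.IsHomogeneous q)
    {a b : Fin 3 → Ω} {m₁ m₂ m₃ m₄ : Ω} (ha : eval a U ≠ 0)
    (ha' : eval (m₁ • a + m₂ • b) U ≠ 0) :
    Polynomial.resultant (linePoly U (m₁ • a + m₂ • b) (m₃ • a + m₄ • b))
        (linePoly V (m₁ • a + m₂ • b) (m₃ • a + m₄ • b)) p q =
      (m₁ * m₄ - m₂ * m₃) ^ (p * q) *
        Polynomial.resultant (linePoly U a b) (linePoly V a b) p q := by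
  obtain ⟨hne, hlc, hroots⟩ := roots_linePoly_lincomb (m₃ := m₃) (m₄ := m₄) hU ha ha'
  have hcard : (linePoly U a b).roots.card = p := by
    rw [← (IsAlgClosed.splits (linePoly U a b)).natDegree_eq_card_roots,
      natDegree_linePoly hU b ha]
  rw [resultant_linePoly_eq_prod hU hV _ ha', resultant_linePoly_eq_prod hU hV _ ha, hroots, hlc,
    Multiset.map_map]
  generalize (linePoly U a b).roots = s at *
  rw [mul_pow, mul_assoc, mul_left_comm _ (eval a U ^ q)]
  congr 1
  rw [← Multiset.prod_map_pow, ← Multiset.prod_map_mul, pow_mul, ← hcard, ← Multiset.card_map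
    (fun _ => ()) s, Multiset.card_map, pow_right_comm, ← Multiset.prod_replicate,
    ← Multiset.map_const', ← Multiset.prod_map_mul]
  congr 1
  refine Multiset.map_congr rfl fun α hα => ?_
  have h0 := hne α hα
  have h1 : (- ((m₃ - α * m₄) / (m₁ - α * m₂))) • (m₁ • a + m₂ • b) + (m₃ • a + m₄ • b) =
      ((m₁ * m₄ - m₂ * m₃) / (m₁ - α * m₂)) • (α • a + b) := by
    ext i; simp; field_simp; ring
  simp only [Function.comp_apply]
  rw [h1, eval_smul_of_isHomogeneous hV, ← mul_assoc, ← mul_pow, mul_div_cancel₀ _ h0]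

/-- Polynomials in the coordinates of two generic vectors and of a generic `2 × 2` matrix. -/
abbrev GenericRing (R : Type*) [CommRing R] : Type _ :=
  MvPolynomial ((Fin 3 ⊕ Fin 3) ⊕ Fin 4) R

/-- The first generic vector. -/
noncomputable def genericA (R : Type*) [CommRing R] : Fin 3 → GenericRing R :=
  fun i => X (Sum.inl (Sum.inl i))

/-- The second generic vector. -/
noncomputable def genericB (R : Type*) [CommRing R] : Fin 3 → GenericRing R :=
  fun i => X (Sum.inl (Sum.inr i))

/-- The generic matrix. -/
noncomputable def genericM (R : Type*) [CommRing R] : Fin 4 → GenericRing R :=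
  fun i => X (Sum.inr i)

/-- Generic vectors and a generic matrix specialize to given ones. -/
lemma exists_specialization {R A : Type*} [CommRing R] [CommRing A] [Algebra R A]
    (a b : Fin 3 → A) (m : Fin 4 → A) : ∃ ψ : GenericRing R →+* A,
      ψ.comp (algebraMap R (GenericRing R)) = algebraMap R A ∧ ψ ∘ genericA R = a ∧
      ψ ∘ genericB R = b ∧ ∀ i, ψ (genericM R i) = m i := by
  refine ⟨(aeval (Sum.elim (Sum.elim a b) m) : GenericRing R →ₐ[R] A), AlgHom.comp_algebraMap _,
    ?_, ?_, ?_⟩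
  · ext i
    exact aeval_X _ _
  · ext i
    exact aeval_X _ _
  · intro i
    exact aeval_X _ _

/-- The resultant of two binary forms of degrees `p` and `q` is an invariant of weight `p q` under
linear changes of the coordinates. -/
theorem resultant_linePoly_lincomb {R A : Type*} [CommRing R] [IsDomain R] [CommRing A]
    [Algebra R A] {U V : MvPolynomial (Fin 3) R} {p q : ℕ} (hU : U.IsHomogeneous p)
    (hV : V.IsHomogeneous q) (a b : Fin 3 → A) (m : Fin 4 → A) :
    Polynomial.resultant
        (linePoly (U.map (algebraMap R A)) (m 0 • a + m 1 • b) (m 2 • a + m 3 • b))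
        (linePoly (V.map (algebraMap R A)) (m 0 • a + m 1 • b) (m 2 • a + m 3 • b)) p q =
      (m 0 * m 3 - m 1 * m 2) ^ (p * q) *
        Polynomial.resultant (linePoly (U.map (algebraMap R A)) a b)
          (linePoly (V.map (algebraMap R A)) a b) p q := by
  rcases eq_or_ne U 0 with rfl | hU0
  · rcases Nat.eq_zero_or_pos q with rfl | hq
    · rw [← totalDegree_zero_iff_isHomogeneous, totalDegree_eq_zero_iff_eq_C] at hV
      rw [hV, map_C, linePoly_C, linePoly_C, Polynomial.resultant_C_right,
        Polynomial.resultant_C_right, pow_zero, pow_zero, mul_zero, pow_zero, one_mul, one_mul]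
    · rw [map_zero, linePoly_zero, linePoly_zero, Polynomial.resultant_zero_left,
        Polynomial.resultant_zero_left, zero_pow hq.ne', zero_mul, zero_mul, mul_zero]
  -- it is enough to consider generic `a`, `b` and `m`
  have hgen : Polynomial.resultant
        (linePoly (U.map (algebraMap R (GenericRing R)))
          (genericM R 0 • genericA R + genericM R 1 • genericB R)
          (genericM R 2 • genericA R + genericM R 3 • genericB R))
        (linePoly (V.map (algebraMap R (GenericRing R)))
          (genericM R 0 • genericA R + genericM R 1 • genericB R)
          (genericM R 2 • genericA R + genericM R 3 • genericB R)) p q =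
      (genericM R 0 * genericM R 3 - genericM R 1 * genericM R 2) ^ (p * q) *
        Polynomial.resultant
          (linePoly (U.map (algebraMap R (GenericRing R))) (genericA R) (genericB R))
          (linePoly (V.map (algebraMap R (GenericRing R))) (genericA R) (genericB R)) p q := by
    let Ω := AlgebraicClosure (FractionRing (GenericRing R))
    let φ : GenericRing R →+* Ω := (algebraMap (FractionRing (GenericRing R)) Ω).comp
      (algebraMap (GenericRing R) (FractionRing (GenericRing R)))
    have hφ : Function.Injective φ :=
      (algebraMap (FractionRing (GenericRing R)) Ω).injective.comp
        (IsFractionRing.injective (GenericRing R) _)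
    have hUa : eval (genericA R) (U.map (algebraMap R (GenericRing R))) ≠ 0 := by
      rw [eval_map_algebraMap']
      intro h
      refine hU0 (rename_injective (R := R) (Sum.inl ∘ Sum.inl : Fin 3 → (Fin 3 ⊕ Fin 3) ⊕ Fin 4)
        (Sum.inl_injective.comp Sum.inl_injective) ?_)
      rw [map_zero, ← h, ← aeval_X_left_apply (rename _ U), aeval_rename]
      rfl
    have hUa' : eval (genericM R 0 • genericA R + genericM R 1 • genericB R)
        (U.map (algebraMap R (GenericRing R))) ≠ 0 := by
      intro h
      -- specialize the matrix so that `m 0 • a + m 1 • b` becomes `a`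
      apply hUa
      have h2 := congrArg (aeval (Sum.elim (Sum.elim (genericA R) (genericB R)) ![1, 0, 0, 0]) :
        GenericRing R →ₐ[R] GenericRing R) h
      rw [eval_map_algebraMap', algHom_aeval, map_zero] at h2
      rw [eval_map_algebraMap', ← h2]
      congr 2
      ext1 i
      fin_cases i <;> simp [genericA, genericB, genericM]
    apply hφ
    rw [map_mul, map_resultant_linePoly, map_resultant_linePoly, comp_lincomb, comp_lincomb,
      resultant_linePoly_lincomb_of_ne_zero]
    · simp
    · exact (hU.map _).map _
    · exact (hV.map _).map _
    · rw [← ringHom_eval]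
      exact (map_ne_zero_iff φ hφ).mpr hUa
    · rw [← comp_lincomb, ← ringHom_eval]
      exact (map_ne_zero_iff φ hφ).mpr hUa'
  obtain ⟨ψ, hψ, ha, hb, hm⟩ := exists_specialization (R := R) a b m
  have h := congrArg ψ hgen
  rw [map_mul, map_resultant_linePoly, map_resultant_linePoly, comp_lincomb, comp_lincomb, ha, hb,
    map_map, map_map, hψ, map_pow, map_sub, map_mul, map_mul, hm, hm, hm, hm] at h
  exact h

/-- The resultant of two linear combinations of `f` and `g`. -/
lemma resultant_lincomb {A : Type*} [CommRing A] [IsDomain A] {f g : Polynomial A} {n : ℕ}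
    (hf : f.natDegree ≤ n) (hg : g.natDegree ≤ n) (m : Fin 4 → A) (hm : m 0 ≠ 0) :
    Polynomial.resultant (Polynomial.C (m 0) * f + Polynomial.C (m 1) * g)
      (Polynomial.C (m 2) * f + Polynomial.C (m 3) * g) n n =
      (m 0 * m 3 - m 1 * m 2) ^ n * Polynomial.resultant f g n n := by
  have hF : (Polynomial.C (m 0) * f + Polynomial.C (m 1) * g).natDegree ≤ n :=
    Polynomial.natDegree_add_le_of_degree_le ((Polynomial.natDegree_C_mul_le _ _).trans hf)
      ((Polynomial.natDegree_C_mul_le _ _).trans hg)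
  apply mul_left_cancel₀ (pow_ne_zero n hm)
  rw [← Polynomial.resultant_C_mul_right]
  have h1 : Polynomial.C (m 0) * (Polynomial.C (m 2) * f + Polynomial.C (m 3) * g) =
      Polynomial.C (m 0 * m 3 - m 1 * m 2) * g +
        (Polynomial.C (m 0) * f + Polynomial.C (m 1) * g) * Polynomial.C (m 2) := by
    simp only [map_sub, map_mul]; ring
  rw [h1, Polynomial.resultant_add_mul_right _ _ _ _ _ (by simp) hF,
    Polynomial.resultant_C_mul_right, mul_comm (Polynomial.C (m 1)),
    Polynomial.resultant_add_mul_left _ _ _ _ _ (by simp) hg, Polynomial.resultant_C_mul_left]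
  ring

/-- The resultant of the two partial derivatives of a binary form of degree `d`, an invariant of
weight `d (d - 1)`. -/
theorem resultant_dirDeriv_lincomb {R A : Type*} [CommRing R] [IsDomain R] [CommRing A]
    [Algebra R A] {P : MvPolynomial (Fin 3) R} {d : ℕ} (hP : P.IsHomogeneous d)
    (a b : Fin 3 → A) (m : Fin 4 → A) :
    Polynomial.resultant
        (linePoly (dirDeriv (m 0 • a + m 1 • b) (P.map (algebraMap R A)))
          (m 0 • a + m 1 • b) (m 2 • a + m 3 • b))
        (linePoly (dirDeriv (m 2 • a + m 3 • b) (P.map (algebraMap R A)))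
          (m 0 • a + m 1 • b) (m 2 • a + m 3 • b)) (d - 1) (d - 1) =
      (m 0 * m 3 - m 1 * m 2) ^ (d * (d - 1)) *
        Polynomial.resultant (linePoly (dirDeriv a (P.map (algebraMap R A))) a b)
          (linePoly (dirDeriv b (P.map (algebraMap R A))) a b) (d - 1) (d - 1) := by
  have hgen : Polynomial.resultant
        (linePoly (dirDeriv (genericM R 0 • genericA R + genericM R 1 • genericB R)
          (P.map (algebraMap R (GenericRing R))))
          (genericM R 0 • genericA R + genericM R 1 • genericB R)
          (genericM R 2 • genericA R + genericM R 3 • genericB R))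
        (linePoly (dirDeriv (genericM R 2 • genericA R + genericM R 3 • genericB R)
          (P.map (algebraMap R (GenericRing R))))
          (genericM R 0 • genericA R + genericM R 1 • genericB R)
          (genericM R 2 • genericA R + genericM R 3 • genericB R))
          (d - 1) (d - 1) =
      (genericM R 0 * genericM R 3 - genericM R 1 * genericM R 2) ^ (d * (d - 1)) *
        Polynomial.resultant (linePoly (dirDeriv (genericA R)
          (P.map (algebraMap R (GenericRing R)))) (genericA R) (genericB R))
          (linePoly (dirDeriv (genericB R) (P.map (algebraMap R (GenericRing R))))
            (genericA R) (genericB R)) (d - 1) (d - 1) := by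
    have hPg : (P.map (algebraMap R (GenericRing R))).IsHomogeneous d := hP.map _
    have h := resultant_linePoly_lincomb (A := (GenericRing R))
      (isHomogeneous_dirDeriv hPg (genericM R 0 • genericA R + genericM R 1 • genericB R))
      (isHomogeneous_dirDeriv hPg (genericM R 2 • genericA R + genericM R 3 • genericB R))
      (genericA R) (genericB R)
      (genericM R)
    rw [Algebra.algebraMap_self, map_id, map_id] at h
    -- both the line and the pair of partial derivatives change: weights `(d - 1) ^ 2` and `d - 1`
    rw [h, dirDeriv_lincomb, dirDeriv_lincomb, linePoly_add, linePoly_add, linePoly_mul,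
      linePoly_mul, linePoly_mul, linePoly_mul, linePoly_C, linePoly_C, linePoly_C, linePoly_C,
      resultant_lincomb (natDegree_linePoly_le (isHomogeneous_dirDeriv hPg _) _ _)
        (natDegree_linePoly_le (isHomogeneous_dirDeriv hPg _) _ _) (genericM R) (X_ne_zero _),
      ← mul_assoc, ← pow_add]
    congr 2
    rcases d with _ | d
    · rfl
    · simp; ring
  obtain ⟨ψ, hψ, ha, hb, hm⟩ := exists_specialization (R := R) a b m
  have h := congrArg ψ hgen
  rw [map_mul, map_resultant_linePoly, map_resultant_linePoly, map_dirDeriv, map_dirDeriv,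
    map_dirDeriv, map_dirDeriv, comp_lincomb, comp_lincomb, ha, hb,
    map_map, hψ, map_pow, map_sub, map_mul, map_mul, hm, hm, hm, hm] at h
  exact h

end Equivariance

/-! ### Resultant and discriminant forms -/

section Forms

/-- The substitution `X i ↦ X i * s` separates the homogeneous components. -/
lemma coeff_aeval_scaling {R : Type*} [CommRing R] (G : MvPolynomial (Fin 3) R) (n : ℕ) :
    (aeval (fun i => Polynomial.C (X i) * Polynomial.X :
      Fin 3 → Polynomial (MvPolynomial (Fin 3) R)) G).coeff n = homogeneousComponent n G := by
  induction G using MvPolynomial.induction_on' with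
  | monomial m c =>
    have h : aeval (fun i => Polynomial.C (X i) * Polynomial.X :
      Fin 3 → Polynomial (MvPolynomial (Fin 3) R)) (monomial m c) =
        Polynomial.C (monomial m c) * Polynomial.X ^ m.degree := by
      rw [aeval_monomial, Finsupp.prod_fintype _ _ (by simp), monomial_eq,
        Finsupp.prod_fintype _ _ (by simp), Finsupp.degree_eq_sum]
      simp only [mul_pow, Finset.prod_mul_distrib, Finset.prod_pow_eq_pow_sum, map_mul, map_prod,
        map_pow, mul_assoc]
      rfl
    rw [h, Polynomial.coeff_C_mul_X_pow,
      homogeneousComponent_of_mem (isHomogeneous_monomial c rfl)]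
  | add p q hp hq => rw [map_add, Polynomial.coeff_add, hp, hq, map_add]

lemma isHomogeneous_of_scaling {R : Type*} [CommRing R] {G : MvPolynomial (Fin 3) R} {N : ℕ}
    (h : aeval (fun i => Polynomial.C (X i) * Polynomial.X :
      Fin 3 → Polynomial (MvPolynomial (Fin 3) R)) G = Polynomial.C G * Polynomial.X ^ N) :
    G.IsHomogeneous N := by
  have h1 := coeff_aeval_scaling G N
  rw [h, Polynomial.coeff_C_mul_X_pow, if_pos rfl] at h1
  rw [h1]
  exact homogeneousComponent_isHomogeneous _ _

/-- The coordinates of the cross product of two generic vectors are algebraically independent. -/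
lemma aeval_cross_injective (R : Type*) [CommRing R] [IsDomain R] :
    Function.Injective (aeval ((fun i => X (Sum.inl i)) ⨯₃ (fun i => X (Sum.inr i))) :
      MvPolynomial (Fin 3) R →ₐ[R] MvPolynomial (Fin 3 ⊕ Fin 3) R) := by
  -- over the fraction field, the generic vector is a cross product
  let F := FractionRing (MvPolynomial (Fin 3) R)
  let x : Fin 3 → F := fun i => algebraMap (MvPolynomial (Fin 3) R) F (X i)
  have hx : x 2 ≠ 0 := by
    simp [x]
  have h : ∀ G : MvPolynomial (Fin 3) R,
      aeval (Sum.elim ![x 2, 0, - x 0] ![0, 1, - (x 1 / x 2)])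
        ((aeval ((fun i => X (Sum.inl i)) ⨯₃ (fun i => X (Sum.inr i))) :
      MvPolynomial (Fin 3) R →ₐ[R] MvPolynomial (Fin 3 ⊕ Fin 3) R) G) =
      algebraMap (MvPolynomial (Fin 3) R) F G := by
    intro G
    rw [algHom_aeval]
    have h1 : (IsScalarTower.toAlgHom R (MvPolynomial (Fin 3) R) F) G =
      algebraMap (MvPolynomial (Fin 3) R) F G := rfl
    rw [← h1, ← aeval_X_left_apply G, algHom_aeval, aeval_X_left_apply]
    congr 2
    ext i
    fin_cases i <;> simp [cross_apply, x]
    have hx' : algebraMap (MvPolynomial (Fin 3) R) F (X 2) ≠ 0 := hx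
    rw [mul_neg, neg_neg, ← mul_div_assoc, mul_div_cancel_left₀ _ hx']
  intro G H hGH
  apply IsFractionRing.injective (MvPolynomial (Fin 3) R) F
  rw [← h, ← h, hGH]

/-- The first fundamental theorem for pairs of vectors in `3`-space: a polynomial in two vectors
`a` and `b` that is multiplied by the `N`-th power of the determinant under linear substitutions
is a form of degree `N` in the cross product of `a` and `b`. -/
theorem exists_form_of_equivariant {R : Type u} [CommRing R] [IsDomain R]
    (ψ : MvPolynomial (Fin 3 ⊕ Fin 3) R) (N : ℕ)
    (h : ∀ (A : Type u) [CommRing A] [Algebra R A] (a b : Fin 3 → A) (m : Fin 4 → A),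
      aeval (Sum.elim (m 0 • a + m 1 • b) (m 2 • a + m 3 • b)) ψ =
        (m 0 * m 3 - m 1 * m 2) ^ N * aeval (Sum.elim a b) ψ) :
    ∃ G : MvPolynomial (Fin 3) R, G.IsHomogeneous N ∧
      ∀ (A : Type u) [CommRing A] [Algebra R A] (a b : Fin 3 → A),
        aeval (Sum.elim a b) ψ = aeval (a ⨯₃ b) G := by
  set a₀ : Fin 3 → MvPolynomial (Fin 3 ⊕ Fin 3) R := fun i => X (Sum.inl i) with ha₀
  set b₀ : Fin 3 → MvPolynomial (Fin 3 ⊕ Fin 3) R := fun i => X (Sum.inr i) with hb₀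
  set κ : MvPolynomial (Fin 3) R →ₐ[R] MvPolynomial (Fin 3 ⊕ Fin 3) R := aeval (a₀ ⨯₃ b₀) with hκ
  have hinj : Function.Injective κ := aeval_cross_injective R
  have hψ : aeval (Sum.elim a₀ b₀) ψ = ψ := by
    have : Sum.elim a₀ b₀ = X := by ext1 i; rcases i with i | i <;> rfl
    rw [this, aeval_X_left_apply]
  have hκX : ∀ i, κ (X i) = (a₀ ⨯₃ b₀) i := fun i => aeval_X _ _
  -- For `w = a₀ × b₀` the vectors `e_i × w` are combinations of `a₀` and `b₀`, by matrices of
  -- determinant `w 2` and `w 0` for the two pairs used below.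
  have key : ∀ (u v : Fin 3 → MvPolynomial (Fin 3) R) (m : Fin 4 → MvPolynomial (Fin 3 ⊕ Fin 3) R),
      (∀ l, κ (u l) = (m 0 • a₀ + m 1 • b₀) l) → (∀ l, κ (v l) = (m 2 • a₀ + m 3 • b₀) l) →
      κ (aeval (Sum.elim u v) ψ) = (m 0 * m 3 - m 1 * m 2) ^ N * ψ := by
    intro u v m hu hv
    rw [algHom_aeval]
    have h1 := h _ a₀ b₀ m
    rw [hψ] at h1
    rw [← h1]
    congr 2
    ext1 i
    rcases i with i | i
    · exact hu i
    · exact hv i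
  have h2 := key (![0, - X 2, X 1] : Fin 3 → MvPolynomial (Fin 3) R)
    (![X 2, 0, - X 0] : Fin 3 → MvPolynomial (Fin 3) R) ![b₀ 0, - a₀ 0, b₀ 1, - a₀ 1]
    (by intro l; fin_cases l <;> simp [hκX, cross_apply] <;> ring)
    (by intro l; fin_cases l <;> simp [hκX, cross_apply] <;> ring)
  have h0 := key (![X 2, 0, - X 0] : Fin 3 → MvPolynomial (Fin 3) R)
    (![- X 1, X 0, 0] : Fin 3 → MvPolynomial (Fin 3) R) ![b₀ 1, - a₀ 1, b₀ 2, - a₀ 2]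
    (by intro l; fin_cases l <;> simp [hκX, cross_apply] <;> ring)
    (by intro l; fin_cases l <;> simp [hκX, cross_apply] <;> ring)
  set G₂ := aeval (Sum.elim (![0, - X 2, X 1] : Fin 3 → MvPolynomial (Fin 3) R)
    (![X 2, 0, - X 0] : Fin 3 → MvPolynomial (Fin 3) R)) ψ with hG₂
  set G₀ := aeval (Sum.elim (![X 2, 0, - X 0] : Fin 3 → MvPolynomial (Fin 3) R)
    (![- X 1, X 0, 0] : Fin 3 → MvPolynomial (Fin 3) R)) ψ with hG₀
  have e2 : (![b₀ 0, - a₀ 0, b₀ 1, - a₀ 1] 0 * ![b₀ 0, - a₀ 0, b₀ 1, - a₀ 1] 3 -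
      ![b₀ 0, - a₀ 0, b₀ 1, - a₀ 1] 1 * ![b₀ 0, - a₀ 0, b₀ 1, - a₀ 1] 2) = κ (X 2) := by
    rw [hκX]; simp [cross_apply]; ring
  have e0 : (![b₀ 1, - a₀ 1, b₀ 2, - a₀ 2] 0 * ![b₀ 1, - a₀ 1, b₀ 2, - a₀ 2] 3 -
      ![b₀ 1, - a₀ 1, b₀ 2, - a₀ 2] 1 * ![b₀ 1, - a₀ 1, b₀ 2, - a₀ 2] 2) = κ (X 0) := by
    rw [hκX]; simp [cross_apply]; ring
  rw [e2] at h2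
  rw [e0] at h0
  have hcomm : (X 0 : MvPolynomial (Fin 3) R) ^ N * G₂ = X 2 ^ N * G₀ := by
    apply hinj
    rw [map_mul, map_mul, map_pow, map_pow, h2, h0]
    ring
  have hdvd : (X 2 : MvPolynomial (Fin 3) R) ^ N ∣ G₂ := by
    refine (X_prime (i := (2 : Fin 3))).pow_dvd_of_dvd_mul_left N ?_ ⟨G₀, hcomm⟩
    intro hd
    have := (X_prime (R := R) (i := (2 : Fin 3))).dvd_of_dvd_pow hd
    simp [X_dvd_X] at this
  obtain ⟨G, hG⟩ := hdvd
  have hκG : κ G = ψ := by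
    rw [hG, map_mul, map_pow] at h2
    refine mul_left_cancel₀ (pow_ne_zero _ ?_) h2
    exact (map_ne_zero_iff κ hinj).mpr (X_ne_zero _)
  have hval : ∀ (A : Type u) [CommRing A] [Algebra R A] (a b : Fin 3 → A),
        aeval (Sum.elim a b) ψ = aeval (a ⨯₃ b) G := by
    intro A _ _ a b
    rw [← hκG, hκ, algHom_aeval]
    congr 2
    ext i
    fin_cases i <;> simp [cross_apply, ha₀, hb₀]
  -- homogeneity: apply equivariance to the substitution `a ↦ s • a`
  refine ⟨G, isHomogeneous_of_scaling ?_, hval⟩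
  apply Polynomial.map_injective (κ : _ →+* MvPolynomial (Fin 3 ⊕ Fin 3) R) hinj
  let A := Polynomial (MvPolynomial (Fin 3 ⊕ Fin 3) R)
  have h3 := h A (fun i => Polynomial.C (a₀ i)) (fun i => Polynomial.C (b₀ i))
    ![Polynomial.X, 0, 0, 1]
  rw [hval, hval] at h3
  have h4 : aeval ((fun i => Polynomial.C (a₀ i)) ⨯₃ (fun i => Polynomial.C (b₀ i)) : Fin 3 → A) G =
      Polynomial.C (κ G) := by
    rw [hκ, ← Polynomial.CAlgHom_apply (R := R), algHom_aeval]
    congr 2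
    ext1 i
    fin_cases i <;> simp [cross_apply]
  rw [h4] at h3
  have h5 : Polynomial.map (κ : _ →+* MvPolynomial (Fin 3 ⊕ Fin 3) R)
      (aeval (fun i => Polynomial.C (X i) * Polynomial.X :
      Fin 3 → Polynomial (MvPolynomial (Fin 3) R)) G) =
      Polynomial.mapAlgHom κ (aeval (fun i => Polynomial.C (X i) * Polynomial.X :
      Fin 3 → Polynomial (MvPolynomial (Fin 3) R)) G) := rfl
  rw [h5, algHom_aeval, Polynomial.map_mul, Polynomial.map_C, Polynomial.map_pow, Polynomial.map_X,
    mul_comm (Polynomial.C _)]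
  convert h3 using 2
  · congr 1
    ext1 i
    fin_cases i <;> simp [hκX, cross_apply] <;> ring
  · simp
  · rfl

/-- `G` is the resultant of the restrictions of the forms `P` and `Q` to a line, as a form in the
coordinates `a × b` of the line through `a` and `b`. The resultant is that of binary forms of
degrees `p` and `q`, and points over all `R`-algebras are allowed. -/
structure IsResultantForm {R : Type u} [CommRing R] (P Q : MvPolynomial (Fin 3) R) (p q : ℕ)
    (G : MvPolynomial (Fin 3) R) : Prop where
  left : P.IsHomogeneous p
  right : Q.IsHomogeneous q
  isHomogeneous : G.IsHomogeneous (p * q)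
  resultant_eq : ∀ (A : Type u) [CommRing A] [Algebra R A] (a b : Fin 3 → A),
    Polynomial.resultant (linePoly (P.map (algebraMap R A)) a b)
      (linePoly (Q.map (algebraMap R A)) a b) p q = aeval (a ⨯₃ b) G

/-- `G` is, up to a constant factor, the discriminant of the restriction of the form `P` to a line,
as a form in the coordinates `a × b` of the line through `a` and `b`. It is given by the resultant
of the two partial derivatives of this binary form. -/
structure IsDiscriminantForm {R : Type u} [CommRing R] (P : MvPolynomial (Fin 3) R) (d : ℕ)
    (G : MvPolynomial (Fin 3) R) : Prop where
  left : P.IsHomogeneous d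
  isHomogeneous : G.IsHomogeneous (d * (d - 1))
  resultant_eq : ∀ (A : Type u) [CommRing A] [Algebra R A] (a b : Fin 3 → A),
    Polynomial.resultant (linePoly (dirDeriv a (P.map (algebraMap R A))) a b)
      (linePoly (dirDeriv b (P.map (algebraMap R A))) a b) (d - 1) (d - 1) = aeval (a ⨯₃ b) G

theorem exists_isResultantForm {R : Type u} [CommRing R] [IsDomain R]
    {P Q : MvPolynomial (Fin 3) R} {p q : ℕ} (hP : P.IsHomogeneous p) (hQ : Q.IsHomogeneous q) :
    ∃ G, IsResultantForm P Q p q G := by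
  let Γ := MvPolynomial (Fin 3 ⊕ Fin 3) R
  let ψ : Γ := Polynomial.resultant
    (linePoly (P.map (algebraMap R Γ)) (fun i => X (Sum.inl i)) (fun i => X (Sum.inr i)))
    (linePoly (Q.map (algebraMap R Γ)) (fun i => X (Sum.inl i)) (fun i => X (Sum.inr i))) p q
  have hψ : ∀ (A : Type u) [CommRing A] [Algebra R A] (a b : Fin 3 → A),
      aeval (Sum.elim a b) ψ = Polynomial.resultant (linePoly (P.map (algebraMap R A)) a b)
      (linePoly (Q.map (algebraMap R A)) a b) p q := by
    intro A _ _ a b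
    have h := map_resultant_linePoly ((aeval (Sum.elim a b) : Γ →ₐ[R] A) : Γ →+* A)
      (P.map (algebraMap R Γ)) (Q.map (algebraMap R Γ)) (fun i => X (Sum.inl i))
      (fun i => X (Sum.inr i)) p q
    rw [map_map, map_map, AlgHom.comp_algebraMap] at h
    refine h.trans ?_
    have ha : ((aeval (Sum.elim a b) : Γ →ₐ[R] A) : Γ →+* A) ∘ (fun i => X (Sum.inl i)) = a := by
      ext i; exact aeval_X _ _
    have hb : ((aeval (Sum.elim a b) : Γ →ₐ[R] A) : Γ →+* A) ∘ (fun i => X (Sum.inr i)) = b := by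
      ext i; exact aeval_X _ _
    rw [ha, hb]
  obtain ⟨G, hG, h⟩ := exists_form_of_equivariant ψ (p * q) (by
    intro A _ _ a b m
    rw [hψ, hψ]
    exact resultant_linePoly_lincomb hP hQ a b m)
  exact ⟨G, hP, hQ, hG, fun A _ _ a b => by rw [← hψ, h]⟩

theorem exists_isDiscriminantForm {R : Type u} [CommRing R] [IsDomain R]
    {P : MvPolynomial (Fin 3) R} {d : ℕ} (hP : P.IsHomogeneous d) :
    ∃ G, IsDiscriminantForm P d G := by
  let Γ := MvPolynomial (Fin 3 ⊕ Fin 3) R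
  let a₀ : Fin 3 → Γ := fun i => X (Sum.inl i)
  let b₀ : Fin 3 → Γ := fun i => X (Sum.inr i)
  let ψ : Γ := Polynomial.resultant (linePoly (dirDeriv a₀ (P.map (algebraMap R Γ))) a₀ b₀)
    (linePoly (dirDeriv b₀ (P.map (algebraMap R Γ))) a₀ b₀) (d - 1) (d - 1)
  have hψ : ∀ (A : Type u) [CommRing A] [Algebra R A] (a b : Fin 3 → A),
      aeval (Sum.elim a b) ψ =
        Polynomial.resultant (linePoly (dirDeriv a (P.map (algebraMap R A))) a b)
      (linePoly (dirDeriv b (P.map (algebraMap R A))) a b) (d - 1) (d - 1) := by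
    intro A _ _ a b
    have h := map_resultant_linePoly ((aeval (Sum.elim a b) : Γ →ₐ[R] A) : Γ →+* A)
      (dirDeriv a₀ (P.map (algebraMap R Γ))) (dirDeriv b₀ (P.map (algebraMap R Γ)))
      a₀ b₀ (d - 1) (d - 1)
    rw [map_dirDeriv, map_dirDeriv, map_map, AlgHom.comp_algebraMap] at h
    refine h.trans ?_
    have ha : ((aeval (Sum.elim a b) : Γ →ₐ[R] A) : Γ →+* A) ∘ a₀ = a := by
      ext i; exact aeval_X _ _
    have hb : ((aeval (Sum.elim a b) : Γ →ₐ[R] A) : Γ →+* A) ∘ b₀ = b := by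
      ext i; exact aeval_X _ _
    rw [ha, hb]
  obtain ⟨G, hG, h⟩ := exists_form_of_equivariant ψ (d * (d - 1)) (by
    intro A _ _ a b m
    rw [hψ, hψ]
    exact resultant_dirDeriv_lincomb hP a b m)
  exact ⟨G, hP, hG, fun A _ _ a b => by rw [← hψ, h]⟩

lemma IsResultantForm.baseChange {R S : Type u} [CommRing R] [CommRing S] [Algebra R S]
    {P Q : MvPolynomial (Fin 3) R} {p q : ℕ} {G : MvPolynomial (Fin 3) R}
    (h : IsResultantForm P Q p q G) :
    IsResultantForm (P.map (algebraMap R S)) (Q.map (algebraMap R S)) p q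
      (G.map (algebraMap R S)) where
  left := h.left.map _
  right := h.right.map _
  isHomogeneous := h.isHomogeneous.map _
  resultant_eq A _ _ a b := by
    let : Algebra R A := ((algebraMap S A).comp (algebraMap R S)).toAlgebra
    have h1 := h.resultant_eq A a b
    rw [aeval_def, ← eval_map, eval_map, eval₂_map, map_map, map_map]
    rw [aeval_def] at h1
    exact h1

lemma IsDiscriminantForm.baseChange {R S : Type u} [CommRing R] [CommRing S] [Algebra R S]
    {P : MvPolynomial (Fin 3) R} {d : ℕ} {G : MvPolynomial (Fin 3) R}
    (h : IsDiscriminantForm P d G) :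
    IsDiscriminantForm (P.map (algebraMap R S)) d (G.map (algebraMap R S)) where
  left := h.left.map _
  isHomogeneous := h.isHomogeneous.map _
  resultant_eq A _ _ a b := by
    let : Algebra R A := ((algebraMap S A).comp (algebraMap R S)).toAlgebra
    have h1 := h.resultant_eq A a b
    rw [aeval_def, ← eval_map, eval_map, eval₂_map, map_map]
    rw [aeval_def] at h1
    exact h1

lemma IsResultantForm.resultant_eq_eval {R : Type u} [CommRing R]
    {P Q : MvPolynomial (Fin 3) R} {p q : ℕ} {G : MvPolynomial (Fin 3) R}
    (h : IsResultantForm P Q p q G) (a b : Fin 3 → R) :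
    Polynomial.resultant (linePoly P a b) (linePoly Q a b) p q = eval (a ⨯₃ b) G := by
  have h1 := h.resultant_eq R a b
  rw [Algebra.algebraMap_self, map_id, map_id, aeval_eq_eval] at h1
  exact h1

lemma IsDiscriminantForm.resultant_eq_eval {R : Type u} [CommRing R]
    {P : MvPolynomial (Fin 3) R} {d : ℕ} {G : MvPolynomial (Fin 3) R}
    (h : IsDiscriminantForm P d G) (a b : Fin 3 → R) :
    Polynomial.resultant (linePoly (dirDeriv a P) a b) (linePoly (dirDeriv b P) a b)
      (d - 1) (d - 1) = eval (a ⨯₃ b) G := by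
  have h1 := h.resultant_eq R a b
  rw [Algebra.algebraMap_self, map_id, aeval_eq_eval] at h1
  exact h1

/-- The resultant of a binary form and its derivative in the direction of the point at infinity is,
up to constants and the value at infinity, the discriminant. -/
lemma IsDiscriminantForm.resultant_dirDeriv {R : Type u} [CommRing R]
    {P : MvPolynomial (Fin 3) R} {d : ℕ} {G : MvPolynomial (Fin 3) R}
    (h : IsDiscriminantForm P d G) (hd : 0 < d) (a b : Fin 3 → R) :
    ∃ s : ℕ, (d : R) ^ (d - 1) *
      Polynomial.resultant (linePoly P a b) (linePoly (dirDeriv a P) a b) d (d - 1) =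
        (-1) ^ s * (d * eval a P) * eval (a ⨯₃ b) G := by
  have hb := natDegree_linePoly_le (isHomogeneous_dirDeriv h.left b) a b
  have ha := natDegree_linePoly_le (isHomogeneous_dirDeriv h.left a) a b
  have hlc : (linePoly (dirDeriv a P) a b).coeff (d - 1) = d * eval a P := by
    rw [coeff_linePoly (isHomogeneous_dirDeriv h.left a), euler_dirDeriv h.left]
  have hX : (Polynomial.X : Polynomial R).natDegree + (d - 1) ≤ d := by
    have := Polynomial.natDegree_X_le (R := R)
    omega
  obtain ⟨e, rfl⟩ : ∃ e, d = e + 1 := ⟨d - 1, by omega⟩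
  have h1 := h.resultant_eq_eval a b
  simp only [Nat.add_sub_cancel] at *
  -- by Euler's relation `d f = x f' + f_y`, and the multiple `x f'` of `f'` can be dropped
  rw [← Polynomial.resultant_C_mul_left, ← euler_linePoly h.left,
    mul_comm (linePoly (dirDeriv a P) a b) Polynomial.X, mul_comm Polynomial.X,
    Polynomial.resultant_add_mul_left _ _ _ _ _ hX ha,
    Polynomial.resultant_succ_left_deg _ _ _ _ hb,
    Polynomial.resultant_comm, hlc, h1]
  refine ⟨e + e * e, ?_⟩
  rw [pow_add]
  ring

end Forms

/-! ### Divisors, linear forms and lines -/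

section Factors

/-- A factor of a nonzero form is a form. -/
lemma isHomogeneous_of_dvd {R : Type*} [CommRing R] [IsDomain R] {P Q : MvPolynomial (Fin 3) R}
    {d : ℕ} (hP : P.IsHomogeneous d) (hP0 : P ≠ 0) (h : Q ∣ P) : ∃ e, Q.IsHomogeneous e := by
  obtain ⟨Q', rfl⟩ := h
  -- `σ G` is `G (s X)`; if a product is a monomial in `s`, then so are the factors
  obtain ⟨σ, hσ⟩ : ∃ σ : MvPolynomial (Fin 3) R →ₐ[R] Polynomial (MvPolynomial (Fin 3) R),
      ∀ G n, (σ G).coeff n = homogeneousComponent n G := ⟨_, coeff_aeval_scaling⟩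
  have hσ0 : ∀ G, G ≠ 0 → σ G ≠ 0 := by
    intro G hG h0
    apply hG
    rw [← sum_homogeneousComponent G]
    refine Finset.sum_eq_zero fun n _ => ?_
    rw [← hσ, h0, Polynomial.coeff_zero]
  have hQ0 := hσ0 _ (left_ne_zero_of_mul hP0)
  have hQ0' := hσ0 _ (right_ne_zero_of_mul hP0)
  have h1 : σ (Q * Q') = Polynomial.monomial d (Q * Q') := by
    ext1 n
    rw [hσ, homogeneousComponent_of_mem hP, Polynomial.coeff_monomial]
    simp only [eq_comm]
  have hdeg : (σ Q).natDegree + (σ Q').natDegree = d := by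
    rw [← Polynomial.natDegree_mul hQ0 hQ0', ← map_mul, h1,
      Polynomial.natDegree_monomial_eq _ hP0]
  have htr : (σ Q).natTrailingDegree + (σ Q').natTrailingDegree = d := by
    rw [← Polynomial.natTrailingDegree_mul hQ0 hQ0', ← map_mul, h1,
      Polynomial.natTrailingDegree_monomial hP0]
  have h2 := Polynomial.natTrailingDegree_le_natDegree (σ Q)
  have h3 := Polynomial.natTrailingDegree_le_natDegree (σ Q')
  refine ⟨(σ Q).natDegree, ?_⟩
  have h4 : Q = homogeneousComponent (σ Q).natDegree Q := by
    conv_lhs => rw [← sum_homogeneousComponent Q]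
    have h5 : ∀ n, n ≠ (σ Q).natDegree → homogeneousComponent n Q = 0 := by
      intro n hn
      rw [← hσ]
      rcases lt_or_gt_of_ne hn with hn | hn
      · exact Polynomial.coeff_eq_zero_of_lt_natTrailingDegree (by omega)
      · exact Polynomial.coeff_eq_zero_of_natDegree_lt hn
    by_cases hm : (σ Q).natDegree ∈ Finset.range (Q.totalDegree + 1)
    · exact Finset.sum_eq_single_of_mem _ hm fun n _ hn => h5 n hn
    · rw [Finset.sum_eq_zero fun n hn => h5 n (fun h => hm (h ▸ hn)), eq_comm]
      apply homogeneousComponent_eq_zero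
      simpa using hm
  have h5 := homogeneousComponent_isHomogeneous (σ Q).natDegree Q
  rwa [← h4] at h5

lemma exists_eq_C_of_isUnit {K : Type*} [Field K] {P : MvPolynomial (Fin 3) K}
    (h : IsUnit P) : ∃ c : K, c ≠ 0 ∧ P = C c := by
  obtain ⟨c, hc, rfl⟩ := MvPolynomial.isUnit_iff_eq_C_of_isReduced.mp h
  exact ⟨c, hc.ne_zero, rfl⟩

lemma isUnit_of_isHomogeneous_zero {K : Type*} [Field K] {P : MvPolynomial (Fin 3) K}
    (h : P.IsHomogeneous 0) (h0 : P ≠ 0) : IsUnit P := by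
  obtain ⟨c, rfl⟩ : ∃ c, P = C c :=
    ⟨_, totalDegree_eq_zero_iff_eq_C.mp (Nat.le_zero.mp h.totalDegree_le)⟩
  have : c ≠ 0 := by rintro rfl; exact h0 (map_zero _)
  exact (isUnit_iff_ne_zero.mpr this).map C

lemma degree_pos_of_irreducible {K : Type*} [Field K] {P : MvPolynomial (Fin 3) K} {d : ℕ}
    (h : P.IsHomogeneous d) (hP : Irreducible P) : 0 < d := by
  rcases Nat.eq_zero_or_pos d with rfl | hd
  · exact absurd (isUnit_of_isHomogeneous_zero h hP.ne_zero) hP.not_isUnit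
  · exact hd

end Factors

section Divisors

variable {K : Type*} [Field K]

lemma primeDivisor_congr {P Q : MvPolynomial (Fin 3) K} (h : Associated P Q) :
    primeDivisor P = primeDivisor Q := by
  rw [primeDivisor, primeDivisor, Associates.mk_eq_mk_iff_associated.mpr h]

lemma sum_map_congr_of_rel_associated {f : MvPolynomial (Fin 3) K → Div K}
    (hf : ∀ P Q, Associated P Q → f P = f Q) {s t : Multiset (MvPolynomial (Fin 3) K)}
    (h : Multiset.Rel Associated s t) : (s.map f).sum = (t.map f).sum := by
  induction h with
  | zero => rfl
  | cons hab _ ih =>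
    rw [Multiset.map_cons, Multiset.map_cons, Multiset.sum_cons, Multiset.sum_cons, ih,
      hf _ _ hab]

lemma divisor_congr {P Q : MvPolynomial (Fin 3) K} (h : Associated P Q) :
    divisor P = divisor Q :=
  sum_map_congr_of_rel_associated (fun _ _ => primeDivisor_congr)
    (UniqueFactorizationMonoid.factors_rel_of_associated h)

lemma divisor_mul {P Q : MvPolynomial (Fin 3) K} (hP : P ≠ 0) (hQ : Q ≠ 0) :
    divisor (P * Q) = divisor P + divisor Q := by
  rw [divisor, sum_map_congr_of_rel_associated (fun _ _ => primeDivisor_congr)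
      (UniqueFactorizationMonoid.factors_mul hP hQ),
    Multiset.map_add, Multiset.sum_add, divisor, divisor]

lemma divisor_one : divisor (1 : MvPolynomial (Fin 3) K) = 0 := by
  rw [divisor, UniqueFactorizationMonoid.factors_one, Multiset.map_zero, Multiset.sum_zero]

lemma divisor_of_isUnit {P : MvPolynomial (Fin 3) K} (h : IsUnit P) : divisor P = 0 := by
  rw [divisor_congr (associated_one_iff_isUnit.mpr h), divisor_one]

lemma divisor_pow {P : MvPolynomial (Fin 3) K} (hP : P ≠ 0) (n : ℕ) :
    divisor (P ^ n) = n • divisor P := by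
  induction n with
  | zero => rw [pow_zero, divisor_one, zero_smul]
  | succ n ih => rw [pow_succ, divisor_mul (pow_ne_zero _ hP) hP, ih, succ_nsmul]

lemma divisor_prod {ι : Type*} (s : Finset ι) (P : ι → MvPolynomial (Fin 3) K)
    (h : ∀ i ∈ s, P i ≠ 0) : divisor (∏ i ∈ s, P i) = ∑ i ∈ s, divisor (P i) := by
  classical
  induction s using Finset.induction_on with
  | empty => rw [Finset.prod_empty, Finset.sum_empty, divisor_one]
  | insert a s ha ih =>
    rw [Finset.prod_insert ha, Finset.sum_insert ha,
      divisor_mul (h a (Finset.mem_insert_self _ _))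
        (Finset.prod_ne_zero_iff.mpr fun i hi => h i (Finset.mem_insert_of_mem hi)),
      ih fun i hi => h i (Finset.mem_insert_of_mem hi)]

lemma divisor_irreducible {Q : MvPolynomial (Fin 3) K} (hQ : Irreducible Q) :
    divisor Q = primeDivisor Q := by
  obtain ⟨Q', hQ', h⟩ := prime_factors_irreducible hQ
    ⟨fun _ => UniqueFactorizationMonoid.prime_of_factor _,
      UniqueFactorizationMonoid.factors_prod hQ.ne_zero⟩
  rw [divisor, h, Multiset.map_singleton, Multiset.sum_singleton, primeDivisor_congr hQ'.symm]

/-- Only the irreducible factors of `P` occur in its divisor. -/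
lemma divisor_apply_eq_zero {P : MvPolynomial (Fin 3) K}
    {c : Associates (MvPolynomial (Fin 3) K)}
    (h : ∀ Q, Irreducible Q → Q ∣ P → Associates.mk Q ≠ c) : divisor P c = 0 := by
  rw [divisor]
  have h1 : ∀ Q ∈ UniqueFactorizationMonoid.factors P, Associates.mk Q ≠ c := fun Q hQ =>
    h Q (UniqueFactorizationMonoid.irreducible_of_factor Q hQ)
      (UniqueFactorizationMonoid.dvd_of_mem_factors hQ)
  clear h
  revert h1
  induction UniqueFactorizationMonoid.factors P using Multiset.induction_on with
  | empty => exact fun _ => rfl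
  | cons Q s ih =>
    intro h1
    rw [Multiset.map_cons, Multiset.sum_cons, Finsupp.add_apply,
      ih fun Q' hQ' => h1 Q' (Multiset.mem_cons_of_mem hQ'), primeDivisor,
      Finsupp.single_eq_of_ne (h1 Q (Multiset.mem_cons_self _ _)).symm, add_zero]

lemma divisor_apply_of_not_dvd {P Q : MvPolynomial (Fin 3) K}
    (h : ¬ Q ∣ P) : divisor P (Associates.mk Q) = 0 :=
  divisor_apply_eq_zero fun _ _ hQ' h' =>
    h ((Associates.mk_eq_mk_iff_associated.mp h').symm.dvd.trans hQ')

lemma divisor_apply_eq {Q H : MvPolynomial (Fin 3) K} (hQ : Irreducible Q)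
    (h : ¬ Q ∣ H) (n : ℕ) : divisor (Q ^ n * H) (Associates.mk Q) = n := by
  have hH : H ≠ 0 := by rintro rfl; exact h (dvd_zero _)
  rw [divisor_mul (pow_ne_zero _ hQ.ne_zero) hH, divisor_pow hQ.ne_zero, divisor_irreducible hQ,
    Finsupp.add_apply, divisor_apply_of_not_dvd h, primeDivisor, Finsupp.smul_apply,
    Finsupp.single_eq_same]
  simp

/-- The exact power of an irreducible polynomial that divides a nonzero polynomial. -/
lemma exists_eq_pow_mul {P Q : MvPolynomial (Fin 3) K} (hP : P ≠ 0) (hQ : Irreducible Q) :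
    ∃ (n : ℕ) (H : MvPolynomial (Fin 3) K), P = Q ^ n * H ∧ ¬ Q ∣ H := by
  obtain ⟨n, H, h, rfl⟩ := WfDvdMonoid.max_power_factor hP hQ
  exact ⟨n, H, rfl, h⟩

end Divisors

section LinearForms

/-- The linear form with the coefficients `v`: the equation of the line `v` of the plane, or that
of the line of the dual plane formed by the lines through the point `v`. -/
noncomputable def linForm {R : Type*} [CommRing R] (v : Fin 3 → R) : MvPolynomial (Fin 3) R :=
  ∑ i, C (v i) * X i

lemma eval_linForm {R : Type*} [CommRing R] (v w : Fin 3 → R) : eval w (linForm v) = v ⬝ᵥ w := by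
  simp [linForm, dotProduct]

lemma isHomogeneous_linForm {R : Type*} [CommRing R] (v : Fin 3 → R) :
    (linForm v).IsHomogeneous 1 :=
  IsHomogeneous.sum _ _ _ fun i _ => (isHomogeneous_X _ i).C_mul _

lemma map_linForm {R S : Type*} [CommRing R] [CommRing S] (φ : R →+* S) (v : Fin 3 → R) :
    map φ (linForm v) = linForm (φ ∘ v) := by
  simp [linForm]

lemma linForm_smul {R : Type*} [CommRing R] (c : R) (v : Fin 3 → R) :
    linForm (c • v) = C c * linForm v := by
  simp only [linForm, Finset.mul_sum]
  refine Finset.sum_congr rfl fun i _ => ?_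
  rw [Pi.smul_apply, smul_eq_mul, C_mul, mul_assoc]

lemma coeff_linForm {R : Type*} [CommRing R] (v : Fin 3 → R) (i : Fin 3) :
    (linForm v).coeff (Finsupp.single i 1) = v i := by
  rw [linForm, coeff_sum, Finset.sum_eq_single i]
  · simp [coeff_C_mul]
  · intro j _ hj
    rw [coeff_C_mul, coeff_X, if_neg, mul_zero]
    intro h
    exact hj ((Finsupp.single_left_inj one_ne_zero).mp h)
  · simp

lemma linForm_injective {R : Type*} [CommRing R] :
    Function.Injective (linForm : (Fin 3 → R) → MvPolynomial (Fin 3) R) := by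
  intro v w h
  ext i
  rw [← coeff_linForm v, h, coeff_linForm]

/-- A form of degree one is a linear form. -/
lemma exists_eq_linForm {R : Type*} [CommRing R] {L : MvPolynomial (Fin 3) R}
    (h : L.IsHomogeneous 1) : ∃ v, L = linForm v := by
  refine ⟨fun i => L.coeff (Finsupp.single i 1), ?_⟩
  have h1 := h.sum_X_mul_pderiv
  rw [one_smul] at h1
  rw [← h1, linForm]
  refine Finset.sum_congr rfl fun i _ => ?_
  have h2 : (pderiv i L).IsHomogeneous 0 := h.pderiv
  rw [totalDegree_eq_zero_iff_eq_C.mp (Nat.le_zero.mp h2.totalDegree_le), mul_comm]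
  congr 2
  rw [coeff_pderiv]
  simp [h1]

variable {K : Type*} [Field K]

lemma linForm_ne_zero {v : Fin 3 → K} (hv : v ≠ 0) : linForm v ≠ 0 := by
  intro h
  apply hv
  apply linForm_injective
  rw [h]
  simp [linForm]

lemma irreducible_linForm {v : Fin 3 → K} (hv : v ≠ 0) : Irreducible (linForm v) := by
  obtain ⟨i, hi⟩ := Function.ne_iff.mp hv
  apply irreducible_of_totalDegree_eq_one
  · exact (isHomogeneous_linForm v).totalDegree (linForm_ne_zero hv)
  · intro x hx
    have h := hx (Finsupp.single i 1)
    rw [coeff_linForm] at h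
    exact isUnit_of_dvd_unit h (isUnit_iff_ne_zero.mpr hi)

/-- A polynomial is divisible by a linear form if it vanishes where the linear form does. -/
lemma linForm_dvd_of_forall [Infinite K] {v : Fin 3 → K} (hv : v ≠ 0) {G : MvPolynomial (Fin 3) K}
    (h : ∀ w, v ⬝ᵥ w = 0 → eval w G = 0) : linForm v ∣ G := by
  obtain ⟨i, hi⟩ := Function.ne_iff.mp hv
  -- substitute for the `i`-th variable its value on the line
  let y : Fin 3 → MvPolynomial (Fin 3) K :=
    fun j => X j - C ((v i)⁻¹ * (if j = i then 1 else 0)) * linForm v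
  have hmod : ∀ P : MvPolynomial (Fin 3) K, linForm v ∣ P - aeval y P := by
    intro P
    rw [← Ideal.mem_span_singleton, ← Ideal.Quotient.eq]
    have : Ideal.Quotient.mkₐ K (Ideal.span {linForm v}) (aeval y P) =
        Ideal.Quotient.mkₐ K (Ideal.span {linForm v}) P := by
      conv_rhs => rw [← aeval_X_left_apply P]
      rw [algHom_aeval, algHom_aeval]
      congr 2
      ext1 j
      rw [Ideal.Quotient.mkₐ_eq_mk, Ideal.Quotient.eq, Ideal.mem_span_singleton]
      exact ⟨- C ((v i)⁻¹ * (if j = i then 1 else 0)), by simp only [y]; ring⟩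
    exact this.symm
  have h0 : aeval y G = 0 := by
    apply MvPolynomial.funext
    intro w
    rw [map_zero, ← aeval_eq_eval, algHom_aeval, aeval_eq_eval]
    apply h
    have hy : ∀ j, aeval w (y j) = w j - ((v i)⁻¹ * (if j = i then 1 else 0)) * (v ⬝ᵥ w) := by
      intro j
      simp only [y, aeval_eq_eval, map_sub, map_mul, eval_X, eval_C]
      rw [← eval_linForm]
    simp only [hy, dotProduct, mul_sub, Finset.sum_sub_distrib]
    rw [sub_eq_zero]
    have : ∀ j, v j * ((v i)⁻¹ * (if j = i then 1 else 0) * ∑ i, v i * w i) =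
        if j = i then ∑ i, v i * w i else 0 := by
      intro j
      split_ifs with hj
      · subst hj
        rw [mul_one, ← mul_assoc, mul_inv_cancel₀ hi, one_mul]
      · ring
    simp only [this, Finset.sum_ite_eq', Finset.mem_univ, if_true]
  have := hmod G
  rwa [h0, sub_zero] at this

lemma exists_smul_of_linForm_dvd {v w : Fin 3 → K} (h : linForm v ∣ linForm w) :
    ∃ c : K, w = c • v := by
  by_cases hw : w = 0
  · exact ⟨0, by rw [hw, zero_smul]⟩
  have h0 := linForm_ne_zero hw
  obtain ⟨H, hH⟩ := h
  have hv : linForm v ≠ 0 := by intro h; rw [h, zero_mul] at hH; exact h0 hH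
  have hH0 : H ≠ 0 := by rintro rfl; rw [mul_zero] at hH; exact h0 hH
  obtain ⟨e, he⟩ := isHomogeneous_of_dvd (isHomogeneous_linForm w) h0
    ⟨linForm v, by rw [hH, mul_comm]⟩
  have h1 := ((isHomogeneous_linForm v).mul he).inj_right (hH ▸ isHomogeneous_linForm w) (hH ▸ h0)
  have he0 : e = 0 := by omega
  subst he0
  obtain ⟨c, rfl⟩ : ∃ c, H = C c :=
    ⟨_, totalDegree_eq_zero_iff_eq_C.mp (Nat.le_zero.mp he.totalDegree_le)⟩
  refine ⟨c, linForm_injective ?_⟩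
  rw [hH, linForm_smul, mul_comm]

end LinearForms

section Cross

variable {K : Type*} [Field K]

/-- A line through the point `a` is spanned by `a` and some `b`. -/
lemma exists_cross_eq {a w : Fin 3 → K} (ha : a ≠ 0) (h : a ⬝ᵥ w = 0) : ∃ b, a ⨯₃ b = w := by
  obtain ⟨i, hi⟩ := Function.ne_iff.mp ha
  have h' : a 0 * w 0 + a 1 * w 1 + a 2 * w 2 = 0 := by
    rw [← h, dotProduct, Fin.sum_univ_three]
  fin_cases i
  · have hi : a 0 ≠ 0 := hi
    refine ⟨![0, w 2 / a 0, - w 1 / a 0], ?_⟩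
    ext j
    fin_cases j <;> simp [cross_apply] <;> field_simp
    linear_combination - h'
  · have hi : a 1 ≠ 0 := hi
    refine ⟨![- w 2 / a 1, 0, w 0 / a 1], ?_⟩
    ext j
    fin_cases j <;> simp [cross_apply] <;> field_simp
    linear_combination - h'
  · have hi : a 2 ≠ 0 := hi
    refine ⟨![w 1 / a 2, - w 0 / a 2, 0], ?_⟩
    ext j
    fin_cases j <;> simp [cross_apply] <;> field_simp
    linear_combination - h'

/-- Every line has a point. -/
lemma exists_dotProduct_eq_zero (w : Fin 3 → K) : ∃ a : Fin 3 → K, a ≠ 0 ∧ a ⬝ᵥ w = 0 := by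
  by_cases h : w 0 = 0
  · exact ⟨![1, 0, 0], by intro h; simpa using congrFun h 0,
      by simp [dotProduct, Fin.sum_univ_three, h]⟩
  · exact ⟨![- w 1, w 0, 0], by intro h'; exact h (by simpa using congrFun h' 1),
      by simp [dotProduct, Fin.sum_univ_three]; ring⟩

/-- The points of the line through `a` and `b` are the combinations of `a` and `b`. -/
lemma exists_lincomb_of_dotProduct_cross {a b u : Fin 3 → K} (hab : a ⨯₃ b ≠ 0)
    (h : u ⬝ᵥ (a ⨯₃ b) = 0) : ∃ x y : K, u = x • a + y • b := by
  have hli := crossProduct_ne_zero_iff_linearIndependent.mp hab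
  by_contra hne
  push Not at hne
  have h3 : LinearIndependent K ![u, a, b] := by
    rw [LinearIndependent.pair_iff] at hli
    rw [Fintype.linearIndependent_iff]
    intro g hg
    simp only [Fin.sum_univ_three, Matrix.cons_val_zero, Matrix.cons_val_one, Matrix.cons_val] at hg
    by_cases h0 : g 0 = 0
    · rw [h0, zero_smul, zero_add] at hg
      obtain ⟨h1, h2⟩ := hli _ _ hg
      intro i; fin_cases i <;> assumption
    · exfalso
      apply hne (- g 1 / g 0) (- g 2 / g 0)
      have : g 0 • u = - (g 1 • a) - g 2 • b := by
        rw [← sub_eq_zero, ← hg]; abel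
      rw [← inv_smul_smul₀ h0 u, this]
      ext i
      simp only [Pi.smul_apply, Pi.sub_apply, Pi.neg_apply, Pi.add_apply, smul_eq_mul]
      ring
  have hdet : Matrix.det ![u, a, b] ≠ 0 := by
    have := Matrix.linearIndependent_rows_iff_isUnit (A := ![u, a, b]) |>.mp h3
    exact ((Matrix.isUnit_iff_isUnit_det _).mp this).ne_zero
  apply hdet
  rw [← triple_product_eq_det, h]

/-- Vectors orthogonal to two independent vectors are multiples of their cross product. -/
lemma exists_smul_cross {a b u : Fin 3 → K} (hab : a ⨯₃ b ≠ 0) (h1 : a ⬝ᵥ u = 0)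
    (h2 : b ⬝ᵥ u = 0) : ∃ c : K, u = c • (a ⨯₃ b) := by
  obtain ⟨i, hi⟩ := Function.ne_iff.mp hab
  refine ⟨u i / (a ⨯₃ b) i, ?_⟩
  have e1 : a 0 * u 0 + a 1 * u 1 + a 2 * u 2 = 0 := by rw [← h1, dotProduct, Fin.sum_univ_three]
  have e2 : b 0 * u 0 + b 1 * u 1 + b 2 * u 2 = 0 := by rw [← h2, dotProduct, Fin.sum_univ_three]
  have key : ∀ j k, u j * (a ⨯₃ b) k = u k * (a ⨯₃ b) j := by
    intro j k
    fin_cases j <;> fin_cases k <;> simp [cross_apply] <;>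
      first
      | ring1
      | linear_combination (b 0) * e1 - (a 0) * e2
      | linear_combination (a 0) * e2 - (b 0) * e1
      | linear_combination (b 1) * e1 - (a 1) * e2
      | linear_combination (a 1) * e2 - (b 1) * e1
      | linear_combination (b 2) * e1 - (a 2) * e2
      | linear_combination (a 2) * e2 - (b 2) * e1
  ext j
  rw [Pi.smul_apply, smul_eq_mul, div_mul_eq_mul_div, eq_div_iff hi, key]

end Cross

section GenericPoint

/-- The generic point of (the affine cone over) an irreducible curve, with coordinates in an
algebraically closed field. -/
theorem exists_generic_point {K : Type u} [Field K] {G : MvPolynomial (Fin 3) K}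
    (hG : Irreducible G) : ∃ (Ω : Type u) (_ : Field Ω) (_ : IsAlgClosed Ω) (_ : Algebra K Ω)
      (ω : Fin 3 → Ω), ∀ H : MvPolynomial (Fin 3) K, aeval ω H = 0 ↔ G ∣ H := by
  have hp : (Ideal.span {G}).IsPrime :=
    (Ideal.span_singleton_prime hG.ne_zero).mpr hG.prime
  let A := MvPolynomial (Fin 3) K ⧸ Ideal.span {G}
  let F := FractionRing A
  let Ω := AlgebraicClosure F
  let φ : MvPolynomial (Fin 3) K →ₐ[K] Ω :=
    ((IsScalarTower.toAlgHom K F Ω).comp (IsScalarTower.toAlgHom K A F)).comp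
      (Ideal.Quotient.mkₐ K (Ideal.span {G}))
  refine ⟨Ω, inferInstance, inferInstance, inferInstance, fun i => φ (X i), fun H => ?_⟩
  have h1 : aeval (fun i => φ (X i)) H = φ H := by
    conv_rhs => rw [← aeval_X_left_apply H]
    rw [algHom_aeval]
  rw [h1, ← Ideal.mem_span_singleton, ← Ideal.Quotient.eq_zero_iff_mem]
  have h2 : φ H = algebraMap F Ω (algebraMap A F (Ideal.Quotient.mk _ H)) := rfl
  rw [h2, map_eq_zero, map_eq_zero_iff _ (IsFractionRing.injective A F)]

end GenericPoint

/-! ### Nonvanishing and zeros of resultant and discriminant forms -/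

section Nonvanishing

variable {K : Type u} [Field K]

/-- The substitution `X i ↦ X i + c i * x` in polynomials in `x` and the `X i`. -/
noncomputable def shear (c : Fin 3 → K) :
    Polynomial (MvPolynomial (Fin 3) K) →+* Polynomial (MvPolynomial (Fin 3) K) :=
  Polynomial.eval₂RingHom
    (aeval (fun i => Polynomial.C (X i) + Polynomial.C (C (c i)) * Polynomial.X) :
      MvPolynomial (Fin 3) K →ₐ[K] Polynomial (MvPolynomial (Fin 3) K)).toRingHom Polynomial.X

lemma shear_C_X (c : Fin 3 → K) (i : Fin 3) : shear c (Polynomial.C (X i)) =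
    Polynomial.C (X i) + Polynomial.C (C (c i)) * Polynomial.X := by
  simp [shear]

lemma shear_C_C (c : Fin 3 → K) (r : K) : shear c (Polynomial.C (C r)) = Polynomial.C (C r) := by
  simp only [shear, AlgHom.toRingHom_eq_coe, Polynomial.coe_eval₂RingHom, Polynomial.eval₂_C,
    RingHom.coe_coe]
  rw [aeval_C]
  rfl

lemma shear_X (c : Fin 3 → K) : shear c Polynomial.X = Polynomial.X := by
  simp [shear]

lemma shear_neg_shear (c : Fin 3 → K) (h : Polynomial (MvPolynomial (Fin 3) K)) :
    shear (-c) (shear c h) = h := by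
  have : (shear (-c)).comp (shear c) = RingHom.id _ := by
    apply Polynomial.ringHom_ext'
    · apply MvPolynomial.ringHom_ext
      · intro r
        simp only [RingHom.comp_apply, shear_C_C, RingHom.id_apply]
      · intro i
        simp only [RingHom.comp_apply, shear_C_C, shear_C_X, shear_X, RingHom.id_apply, map_add,
          map_mul, Pi.neg_apply, map_neg]
        ring
    · simp only [RingHom.comp_apply, shear_X, RingHom.id_apply]
  exact RingHom.congr_fun this h

lemma shear_linePoly (c : Fin 3 → K) (Q : MvPolynomial (Fin 3) K) :
    shear (-c) (linePoly (map C Q) (C ∘ c) X) = Polynomial.C Q := by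
  induction Q using MvPolynomial.induction_on with
  | C r => rw [map_C, linePoly_C, shear_C_C]
  | add p q hp hq => rw [map_add, linePoly_add, map_add, hp, hq, map_add]
  | mul_X p i hp =>
    rw [map_mul, linePoly_mul, map_mul, hp, map_X, linePoly_X, map_mul]
    congr 1
    simp only [map_add, map_mul, shear_C_X, shear_C_C, shear_X, Pi.neg_apply, map_neg,
      Function.comp_apply]
    ring

/-- Gauss's lemma for the restriction of a form to the line through a fixed point `c` and a
generic point: factors of this restriction come from factors of the form. The restriction to the
line is `P (x c + X)`, and the substitution `X ↦ X - x c` turns it into `P (X)`, which does not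
involve `x`. -/
lemma exists_dvd_of_dvd_linePoly {P : MvPolynomial (Fin 3) K} {d : ℕ} (hP : P.IsHomogeneous d)
    {F : Type u} [Field F] [Algebra (MvPolynomial (Fin 3) K) F]
    [IsFractionRing (MvPolynomial (Fin 3) K) F] {c : Fin 3 → K} (hc : eval c P ≠ 0)
    {h : Polynomial F}
    (hu : ¬ IsUnit h)
    (hdvd : h ∣ (linePoly (map C P) (C ∘ c) X).map
      (algebraMap (MvPolynomial (Fin 3) K) F)) :
    ∃ u : MvPolynomial (Fin 3) K, ¬ IsUnit u ∧ ∀ Q n,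
      h ^ n ∣ (linePoly (map C Q) (C ∘ c) X).map
        (algebraMap (MvPolynomial (Fin 3) K) F) →
      u ^ n ∣ Q := by
  obtain ⟨f, hf⟩ : ∃ f : Polynomial (MvPolynomial (Fin 3) K), f = linePoly (map C P) (C ∘ c) X :=
    ⟨_, rfl⟩
  rw [← hf] at hdvd
  have hev : eval (C ∘ c) (map C P) = (C (eval c P) : MvPolynomial (Fin 3) K) :=
    (ringHom_eval C c P).symm
  have hev0 : eval (C ∘ c) (map C P) ≠ (0 : MvPolynomial (Fin 3) K) := by
    rw [hev]; simpa using hc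
  have hlc : f.leadingCoeff = C (eval c P) := by
    rw [hf, leadingCoeff_linePoly (hP.map _) _ hev0, hev]
  have hmon : (Polynomial.C (C (eval c P)⁻¹) * f).Monic := by
    rw [Polynomial.Monic, Polynomial.leadingCoeff_mul, Polynomial.leadingCoeff_C, hlc, ← C_mul,
      inv_mul_cancel₀ hc, C_1]
  -- up to a constant, the factor `h` has a monic model `g` over the polynomial ring
  obtain ⟨g, hg⟩ := IsIntegrallyClosed.eq_map_mul_C_of_dvd F hmon (g := h) (by
    rw [Polynomial.map_mul]; exact hdvd.mul_left _)
  have hf0 : f.map (algebraMap (MvPolynomial (Fin 3) K) F) ≠ 0 := by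
    rw [Polynomial.map_ne_zero_iff (IsFractionRing.injective (MvPolynomial (Fin 3) K) F)]
    intro h0
    rw [h0, Polynomial.leadingCoeff_zero] at hlc
    apply hc
    rw [eq_comm, map_eq_zero_iff _ (C_injective _ _)] at hlc
    exact hlc
  have hh0 : h ≠ 0 := ne_zero_of_dvd_ne_zero hf0 hdvd
  have hlh : h.leadingCoeff ≠ 0 := Polynomial.leadingCoeff_ne_zero.mpr hh0
  have hgm : g.Monic := by
    apply Polynomial.monic_of_injective (IsFractionRing.injective (MvPolynomial (Fin 3) K) F)
    have := congrArg Polynomial.leadingCoeff hg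
    rw [Polynomial.leadingCoeff_mul, Polynomial.leadingCoeff_C] at this
    exact mul_right_cancel₀ hlh (by rw [this, one_mul])
  have hCu : IsUnit (Polynomial.C h.leadingCoeff) :=
    (isUnit_iff_ne_zero.mpr hlh).map Polynomial.C
  have hgdvd : ∀ Q n, h ^ n ∣ (linePoly (map C Q) (C ∘ c) X).map
        (algebraMap (MvPolynomial (Fin 3) K) F) →
      g ^ n ∣ linePoly (map C Q) (C ∘ c) X := by
    intro Q n hQ
    rw [← Polynomial.map_dvd_map _ (IsFractionRing.injective (MvPolynomial (Fin 3) K) F)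
      (hgm.pow n), Polynomial.map_pow]
    refine (pow_dvd_pow_of_dvd ?_ n).trans hQ
    exact ⟨_, hg.symm⟩
  have hθ : ∀ Q n, h ^ n ∣ (linePoly (map C Q) (C ∘ c) X).map
        (algebraMap (MvPolynomial (Fin 3) K) F) →
      shear (-c) g ^ n ∣ Polynomial.C Q := by
    intro Q n hQ
    rw [← shear_linePoly c, ← map_pow]
    exact map_dvd _ (hgdvd Q n hQ)
  have hP0 : P ≠ 0 := by rintro rfl; exact hc (map_zero _)
  obtain ⟨u, hu'⟩ : ∃ u, shear (-c) g = Polynomial.C u := by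
    obtain ⟨k, hk⟩ := hθ P 1 (by rwa [pow_one, ← hf])
    rw [pow_one] at hk
    have hne : shear (-c) g * k ≠ 0 := by rw [← hk]; simpa using hP0
    have hdeg := congrArg Polynomial.natDegree hk
    rw [Polynomial.natDegree_C, Polynomial.natDegree_mul (left_ne_zero_of_mul hne)
      (right_ne_zero_of_mul hne)] at hdeg
    exact ⟨_, Polynomial.eq_C_of_natDegree_eq_zero (by omega)⟩
  refine ⟨u, ?_, fun Q n hQ => ?_⟩
  · intro hunit
    apply hu
    have h1 : IsUnit g := by
      have := shear_neg_shear (-c) g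
      rw [hu'] at this
      rw [← this]
      exact (hunit.map Polynomial.C).map _
    rw [← hg]
    exact (h1.map (Polynomial.mapRingHom (algebraMap (MvPolynomial (Fin 3) K) F))).mul hCu
  · have := hθ Q n hQ
    rw [hu', ← Polynomial.C_pow, Polynomial.C_dvd_iff_dvd_coeff] at this
    simpa using this 0

lemma exists_eval_ne_zero [Infinite K] {G : MvPolynomial (Fin 3) K} (hG : G ≠ 0) :
    ∃ c : Fin 3 → K, eval c G ≠ 0 := by
  by_contra! h
  exact hG (MvPolynomial.funext fun c => by rw [h, map_zero])

/-- The resultant form of coprime forms does not vanish. -/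
theorem IsResultantForm.ne_zero [Infinite K] {P Q G : MvPolynomial (Fin 3) K} {p q : ℕ}
    (h : IsResultantForm P Q p q G) (hP : P ≠ 0) (hQ : Q ≠ 0) (hPQ : IsRelPrime P Q) : G ≠ 0 := by
  classical
  rintro rfl
  obtain ⟨c, hc⟩ := exists_eval_ne_zero (mul_ne_zero hP hQ)
  rw [map_mul] at hc
  have hcP := left_ne_zero_of_mul hc
  have hcQ := right_ne_zero_of_mul hc
  let F := FractionRing (MvPolynomial (Fin 3) K)
  have hinj := IsFractionRing.injective (MvPolynomial (Fin 3) K) F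
  have hdeg : ∀ {U : MvPolynomial (Fin 3) K} {e : ℕ}, U.IsHomogeneous e → eval c U ≠ 0 →
      ((linePoly (map C U) (C ∘ c) (X : Fin 3 → MvPolynomial (Fin 3) K)).map
        (algebraMap (MvPolynomial (Fin 3) K) F)).natDegree = e := by
    intro U e hU hcU
    rw [Polynomial.natDegree_map_eq_of_injective hinj]
    refine natDegree_linePoly (hU.map _) _ ?_
    rw [← ringHom_eval]
    simpa using hcU
  have h1 := h.resultant_eq (MvPolynomial (Fin 3) K) (C ∘ c) X
  rw [map_zero] at h1
  have h2 := congrArg (algebraMap (MvPolynomial (Fin 3) K) F) h1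
  rw [← Polynomial.resultant_map_map, map_zero] at h2
  have h3 := (Polynomial.resultant_eq_zero_iff (K := F)).mp (by
    rw [← hdeg h.left hcP, ← hdeg h.right hcQ] at h2
    exact h2)
  have h4 := h3.2
  rw [← EuclideanDomain.gcd_isUnit_iff] at h4
  obtain ⟨u, hu, hdvd⟩ := exists_dvd_of_dvd_linePoly h.left hcP h4
    (EuclideanDomain.gcd_dvd_left _ _)
  apply hu
  have hdP := hdvd P 1 (by rw [pow_one]; exact EuclideanDomain.gcd_dvd_left _ _)
  have hdQ := hdvd Q 1 (by rw [pow_one]; exact EuclideanDomain.gcd_dvd_right _ _)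
  rw [pow_one] at hdP hdQ
  exact hPQ hdP hdQ

/-- The discriminant form of a square-free form does not vanish. -/
theorem IsDiscriminantForm.ne_zero [CharZero K] {P G : MvPolynomial (Fin 3) K} {d : ℕ}
    (h : IsDiscriminantForm P d G) (hP : Squarefree P) : G ≠ 0 := by
  rintro rfl
  rcases Nat.eq_zero_or_pos d with rfl | hd
  · have := h.resultant_eq_eval 0 0
    rw [map_zero, Polynomial.resultant_zero_left_deg] at this
    simp at this
  obtain ⟨c, hc⟩ := exists_eval_ne_zero hP.ne_zero
  let F := FractionRing (MvPolynomial (Fin 3) K)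
  have hinj := IsFractionRing.injective (MvPolynomial (Fin 3) K) F
  obtain ⟨f, hf⟩ : ∃ f : Polynomial (MvPolynomial (Fin 3) K), f = linePoly (map C P) (C ∘ c) X :=
    ⟨_, rfl⟩
  have hcA : eval (C ∘ c) (map C P) ≠ (0 : MvPolynomial (Fin 3) K) := by
    rw [← ringHom_eval]
    simpa using hc
  have hdeg : (f.map (algebraMap (MvPolynomial (Fin 3) K) F)).natDegree = d := by
    rw [Polynomial.natDegree_map_eq_of_injective hinj, hf]
    exact natDegree_linePoly (h.left.map _) _ hcA
  have : CharZero F := charZero_of_injective_algebraMap (algebraMap K F).injective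
  have hdeg' : (f.map (algebraMap (MvPolynomial (Fin 3) K) F)).derivative.natDegree = d - 1 := by
    rw [Polynomial.natDegree_derivative, hdeg]
  obtain ⟨s, hs⟩ := (h.baseChange (S := MvPolynomial (Fin 3) K)).resultant_dirDeriv hd (C ∘ c) X
  rw [map_zero, map_zero, mul_zero, mul_eq_zero] at hs
  have : CharZero (MvPolynomial (Fin 3) K) :=
    charZero_of_injective_algebraMap (algebraMap K (MvPolynomial (Fin 3) K)).injective
  have hs := hs.resolve_left (pow_ne_zero _ (by exact_mod_cast hd.ne'))
  rw [← derivative_linePoly, algebraMap_eq, ← hf] at hs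
  have h2 := congrArg (algebraMap (MvPolynomial (Fin 3) K) F) hs
  rw [← Polynomial.resultant_map_map, map_zero, ← Polynomial.derivative_map] at h2
  have h3 := (Polynomial.resultant_eq_zero_iff
    (f := f.map (algebraMap (MvPolynomial (Fin 3) K) F))
    (g := (f.map (algebraMap (MvPolynomial (Fin 3) K) F)).derivative)).mp (by
    rw [hdeg', hdeg]
    exact h2)
  have h4 : ¬ Squarefree (f.map (algebraMap (MvPolynomial (Fin 3) K) F)) := fun h4 =>
    h3.2 (PerfectField.separable_iff_squarefree.mpr h4)
  rw [Squarefree] at h4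
  push Not at h4
  obtain ⟨g, hg, hgu⟩ := h4
  obtain ⟨u, hu, hdvd⟩ := exists_dvd_of_dvd_linePoly h.left hc hgu
    (by rw [← hf]; exact (dvd_mul_left _ _).trans hg)
  apply hu
  have := hdvd P 2 (by rw [pow_two, ← hf]; exact hg)
  rw [pow_two] at this
  exact hP u this

end Nonvanishing

section Zeros

/-- Two binary forms with vanishing resultant have a common zero, possibly at infinity (`y = 0`). -/
lemma exists_common_zero {Ω : Type*} [Field Ω] [IsAlgClosed Ω] {U V : MvPolynomial (Fin 3) Ω}
    {p q : ℕ} (hU : U.IsHomogeneous p) (hV : V.IsHomogeneous q) {a b : Fin 3 → Ω}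
    (h : Polynomial.resultant (linePoly U a b) (linePoly V a b) p q = 0) :
    ∃ x y : Ω, (x ≠ 0 ∨ y ≠ 0) ∧ eval (x • a + y • b) U = 0 ∧ eval (x • a + y • b) V = 0 := by
  have key : ∀ {U V : MvPolynomial (Fin 3) Ω} {p q : ℕ} (_ : U.IsHomogeneous p)
      (_ : V.IsHomogeneous q), eval a U ≠ 0 →
      Polynomial.resultant (linePoly U a b) (linePoly V a b) p q = 0 →
      ∃ x : Ω, eval (x • a + b) U = 0 ∧ eval (x • a + b) V = 0 := by
    intro U V p q hU hV ha h
    rw [resultant_linePoly_eq_prod hU hV b ha, mul_eq_zero] at h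
    have h := h.resolve_left (pow_ne_zero _ ha)
    rw [Multiset.prod_eq_zero_iff, Multiset.mem_map] at h
    obtain ⟨x, hx, hx'⟩ := h
    refine ⟨x, ?_, hx'⟩
    have := Polynomial.isRoot_of_mem_roots hx
    rwa [Polynomial.IsRoot, eval_linePoly] at this
  by_cases haU : eval a U = 0
  · by_cases haV : eval a V = 0
    · exact ⟨1, 0, Or.inl one_ne_zero, by simpa using haU, by simpa using haV⟩
    · rw [Polynomial.resultant_comm] at h
      have h := (mul_eq_zero.mp h).resolve_left (pow_ne_zero _ (neg_ne_zero.mpr one_ne_zero))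
      obtain ⟨x, h1, h2⟩ := key hV hU haV h
      exact ⟨x, 1, Or.inr one_ne_zero, by rwa [one_smul], by rwa [one_smul]⟩
  · obtain ⟨x, h1, h2⟩ := key hU hV haU h
    exact ⟨x, 1, Or.inr one_ne_zero, by rwa [one_smul], by rwa [one_smul]⟩

lemma resultant_linePoly_eq_zero {R : Type*} [CommRing R] {U V : MvPolynomial (Fin 3) R}
    {p q : ℕ} (hU : U.IsHomogeneous p) (hV : V.IsHomogeneous q) (hp : 0 < p) (hq : 0 < q)
    {a : Fin 3 → R} (b : Fin 3 → R) (haU : eval a U = 0) (haV : eval a V = 0) :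
    Polynomial.resultant (linePoly U a b) (linePoly V a b) p q = 0 := by
  have key : ∀ {U : MvPolynomial (Fin 3) R} {p : ℕ}, U.IsHomogeneous p → 0 < p → eval a U = 0 →
      (linePoly U a b).natDegree < p := by
    intro U p hU hp h
    refine lt_of_le_of_ne (natDegree_linePoly_le hU a b) fun he => ?_
    have h1 := coeff_linePoly hU a b
    rw [h, ← he, Polynomial.coeff_natDegree, Polynomial.leadingCoeff_eq_zero] at h1
    rw [h1, Polynomial.natDegree_zero] at he
    omega
  exact Polynomial.resultant_eq_zero_of_lt_lt _ _ _ _ (key hU hp haU) (key hV hq haV)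

lemma eval_dirDeriv_eq_dotProduct {K : Type*} [Field K] (P : MvPolynomial (Fin 3) K)
    (a v : Fin 3 → K) : eval v (dirDeriv a P) = a ⬝ᵥ gradientAt P v := by
  rw [eval_dirDeriv]
  rfl

lemma dotProduct_gradientAt {K : Type*} [Field K] {P : MvPolynomial (Fin 3) K} {d : ℕ}
    (hP : P.IsHomogeneous d) (v : Fin 3 → K) : v ⬝ᵥ gradientAt P v = d * eval v P := by
  rw [← eval_dirDeriv_eq_dotProduct, euler_dirDeriv hP]

lemma lincomb_ne_zero {K : Type*} [Field K] {a b : Fin 3 → K} (hab : a ⨯₃ b ≠ 0) {x y : K}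
    (h : x ≠ 0 ∨ y ≠ 0) : x • a + y • b ≠ 0 := by
  intro h0
  have hli := crossProduct_ne_zero_iff_linearIndependent.mp hab
  rw [LinearIndependent.pair_iff] at hli
  obtain ⟨h1, h2⟩ := hli _ _ h0
  exact h.elim (fun h => h h1) (fun h => h h2)

lemma lincomb_dotProduct_cross {R : Type*} [CommRing R] (a b : Fin 3 → R) (x y : R) :
    (x • a + y • b) ⬝ᵥ (a ⨯₃ b) = 0 := by
  rw [add_dotProduct, smul_dotProduct, smul_dotProduct, dot_self_cross, dot_cross_self]
  simp

variable {Ω : Type u} [Field Ω]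

/-- The lines on which two forms have a common zero. -/
theorem IsResultantForm.exists_of_eval_eq_zero [IsAlgClosed Ω] {P Q G : MvPolynomial (Fin 3) Ω}
    {p q : ℕ} (h : IsResultantForm P Q p q G) {w : Fin 3 → Ω} (hw : w ≠ 0) (h0 : eval w G = 0) :
    ∃ v : Fin 3 → Ω, v ≠ 0 ∧ v ⬝ᵥ w = 0 ∧ eval v P = 0 ∧ eval v Q = 0 := by
  obtain ⟨a, ha, haw⟩ := exists_dotProduct_eq_zero w
  obtain ⟨b, rfl⟩ := exists_cross_eq ha haw
  rw [← h.resultant_eq_eval] at h0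
  obtain ⟨x, y, hxy, h1, h2⟩ := exists_common_zero h.left h.right h0
  exact ⟨_, lincomb_ne_zero hw hxy, lincomb_dotProduct_cross _ _ _ _, h1, h2⟩

theorem IsResultantForm.eval_eq_zero {P Q G : MvPolynomial (Fin 3) Ω}
    {p q : ℕ} (h : IsResultantForm P Q p q G) (hp : 0 < p) (hq : 0 < q) {v w : Fin 3 → Ω}
    (hv : v ≠ 0) (hvw : v ⬝ᵥ w = 0) (hP : eval v P = 0) (hQ : eval v Q = 0) : eval w G = 0 := by
  obtain ⟨b, rfl⟩ := exists_cross_eq hv hvw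
  rw [← h.resultant_eq_eval]
  exact resultant_linePoly_eq_zero h.left h.right hp hq b hP hQ

/-- The lines that are tangent to a curve, in the sense that at a point of the line the gradient is
a multiple (possibly zero) of the equation of the line. -/
theorem IsDiscriminantForm.exists_of_eval_eq_zero [IsAlgClosed Ω] {P G : MvPolynomial (Fin 3) Ω}
    {d : ℕ} (h : IsDiscriminantForm P d G) {w : Fin 3 → Ω} (hw : w ≠ 0) (h0 : eval w G = 0) :
    ∃ (v : Fin 3 → Ω) (s : Ω), v ≠ 0 ∧ v ⬝ᵥ w = 0 ∧ gradientAt P v = s • w := by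
  obtain ⟨a, ha, haw⟩ := exists_dotProduct_eq_zero w
  obtain ⟨b, rfl⟩ := exists_cross_eq ha haw
  rw [← h.resultant_eq_eval] at h0
  obtain ⟨x, y, hxy, h1, h2⟩ := exists_common_zero (isHomogeneous_dirDeriv h.left a)
    (isHomogeneous_dirDeriv h.left b) h0
  rw [eval_dirDeriv_eq_dotProduct] at h1 h2
  obtain ⟨s, hs⟩ := exists_smul_cross hw h1 h2
  exact ⟨_, s, lincomb_ne_zero hw hxy, lincomb_dotProduct_cross _ _ _ _, hs⟩

theorem IsDiscriminantForm.eval_eq_zero {P G : MvPolynomial (Fin 3) Ω}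
    {d : ℕ} (h : IsDiscriminantForm P d G) (hd : 1 < d) {v w : Fin 3 → Ω} {s : Ω}
    (hv : v ≠ 0) (hvw : v ⬝ᵥ w = 0) (hP : gradientAt P v = s • w) : eval w G = 0 := by
  obtain ⟨b, rfl⟩ := exists_cross_eq hv hvw
  rw [← h.resultant_eq_eval]
  refine resultant_linePoly_eq_zero (isHomogeneous_dirDeriv h.left v)
    (isHomogeneous_dirDeriv h.left b) (by omega) (by omega) b ?_ ?_
  · rw [eval_dirDeriv_eq_dotProduct, hP, dotProduct_smul, dot_self_cross, smul_zero]
  · rw [eval_dirDeriv_eq_dotProduct, hP, dotProduct_smul, dot_cross_self, smul_zero]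

/-- If a nonzero form over an algebraically closed field `K` vanishes on the dual line of a point
`v` over an extension, then this point is rational over `K`. -/
theorem exists_smul_of_forall_eval {K : Type u} [Field K] [IsAlgClosed K] [Algebra K Ω]
    {G : MvPolynomial (Fin 3) K} {e : ℕ} (hG : G.IsHomogeneous e) (hG0 : G ≠ 0) {v : Fin 3 → Ω}
    (h : ∀ w : Fin 3 → Ω, v ⬝ᵥ w = 0 → aeval w G = 0) (hv : v ≠ 0) :
    ∃ (x : Fin 3 → K) (c : Ω), x ≠ 0 ∧ c ≠ 0 ∧ v = c • (algebraMap K Ω ∘ x) := by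
  obtain ⟨w₀, hw₀⟩ := exists_eval_ne_zero hG0
  have hinj := (algebraMap K Ω).injective
  have hne : v ⬝ᵥ (algebraMap K Ω ∘ w₀) ≠ 0 := by
    intro h0
    have := h _ h0
    rw [← eval_map_algebraMap', ← ringHom_eval, map_eq_zero] at this
    exact hw₀ this
  set z := v ⬝ᵥ (algebraMap K Ω ∘ w₀) with hz
  -- The dual line of `v` meets the line through the rational points `w₀` and `β` in a point whose
  -- coordinate is algebraic over `K`, being a root of the restriction of `G`.
  have key : ∀ β : Fin 3 → K, ∃ x : K, algebraMap K Ω x = v ⬝ᵥ (algebraMap K Ω ∘ β) / z := by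
    intro β
    set f := linePoly G w₀ β with hf
    have hf0 : f ≠ 0 := by
      intro h0
      have := coeff_linePoly hG w₀ β
      rw [← hf, h0, Polynomial.coeff_zero] at this
      exact hw₀ this.symm
    have hroot : Polynomial.aeval (- (v ⬝ᵥ (algebraMap K Ω ∘ β) / z)) f = 0 := by
      rw [Polynomial.aeval_def, ← Polynomial.eval_map, hf, linePoly_map, eval_linePoly,
        eval_map_algebraMap']
      apply h
      rw [dotProduct_add, dotProduct_smul, ← hz, smul_eq_mul, neg_mul, div_mul_cancel₀ _ hne]
      ring
    have hint : IsIntegral K (- (v ⬝ᵥ (algebraMap K Ω ∘ β) / z)) :=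
      IsAlgebraic.isIntegral ⟨f, hf0, hroot⟩
    obtain ⟨x, hx⟩ := minpoly.mem_range_of_degree_eq_one K _
      (IsAlgClosed.degree_eq_one_of_irreducible K (minpoly.irreducible hint))
    exact ⟨-x, by rw [map_neg, hx, neg_neg]⟩
  choose x hx using fun i => key (Pi.single i 1)
  have hvx : v = z • (algebraMap K Ω ∘ x) := by
    ext i
    have h1 : v ⬝ᵥ (algebraMap K Ω ∘ (Pi.single i 1)) = v i := by
      rw [dotProduct, Finset.sum_eq_single i]
      · simp
      · intro j _ hj
        simp [Pi.single_eq_of_ne hj]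
      · simp
    rw [Pi.smul_apply, Function.comp_apply, hx, h1, smul_eq_mul, mul_div_cancel₀ _ hne]
  refine ⟨x, z, ?_, hne, hvx⟩
  rintro rfl
  apply hv
  rw [hvx]
  ext i
  simp

/-- A common zero of two coprime forms over an algebraically closed field is rational. -/
theorem IsResultantForm.exists_smul_of_common_zero {K : Type u} [Field K] [IsAlgClosed K]
    [Algebra K Ω] {P Q G : MvPolynomial (Fin 3) K} {p q : ℕ} (h : IsResultantForm P Q p q G)
    (hG : G ≠ 0) (hp : 0 < p) (hq : 0 < q) {v : Fin 3 → Ω} (hv : v ≠ 0) (hP : aeval v P = 0)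
    (hQ : aeval v Q = 0) :
    ∃ (x : Fin 3 → K) (c : Ω), x ≠ 0 ∧ c ≠ 0 ∧ v = c • (algebraMap K Ω ∘ x) := by
  refine exists_smul_of_forall_eval h.isHomogeneous hG (fun w hw => ?_) hv
  rw [← eval_map_algebraMap'] at hP hQ ⊢
  exact (h.baseChange (S := Ω)).eval_eq_zero hp hq hv hw hP hQ

end Zeros

/-! ### The length of `K[u][s] / (f, g)` at `u = 0` -/

section Smith

variable {K : Type*} [Field K]

lemma natTrailingDegree_finset_prod {ι : Type*} (s : Finset ι) (a : ι → Polynomial K)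
    (h : ∀ i ∈ s, a i ≠ 0) :
    (∏ i ∈ s, a i).natTrailingDegree = ∑ i ∈ s, (a i).natTrailingDegree := by
  classical
  induction s using Finset.induction_on with
  | empty => rw [Finset.prod_empty, Finset.sum_empty, Polynomial.natTrailingDegree_one]
  | insert i s hi ih =>
    rw [Finset.prod_insert hi, Finset.sum_insert hi, Polynomial.natTrailingDegree_mul
      (h i (Finset.mem_insert_self _ _))
      (Finset.prod_ne_zero_iff.mpr fun j hj => h j (Finset.mem_insert_of_mem hj)),
      ih fun j hj => h j (Finset.mem_insert_of_mem hj)]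

lemma exists_eq_X_pow_natTrailingDegree_mul {a : Polynomial K} (ha : a ≠ 0) :
    ∃ h : Polynomial K, a = Polynomial.X ^ a.natTrailingDegree * h ∧ IsCoprime h Polynomial.X := by
  obtain ⟨h, hh⟩ := Polynomial.X_pow_dvd_iff.mpr
    (fun d hd => Polynomial.coeff_eq_zero_of_lt_natTrailingDegree (p := a) hd)
  refine ⟨h, hh, ?_⟩
  have h0 : h.coeff 0 ≠ 0 := by
    have h1 := congrArg (fun P => Polynomial.coeff P a.natTrailingDegree) hh
    simp only [Polynomial.coeff_X_pow_mul', le_refl, if_true, Nat.sub_self] at h1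
    rw [← h1]
    exact Polynomial.trailingCoeff_nonzero_iff_nonzero.mpr ha
  rw [isCoprime_comm, (Polynomial.prime_X).irreducible.coprime_iff_not_dvd, Polynomial.X_dvd_iff]
  exact h0

/-- The Smith normal form of an injective endomorphism of a free `K[X]`-module; the determinant
gives the sum of the orders at `0` of the elementary divisors. -/
lemma exists_smith_of_det_eq {ι M M' : Type*} [Fintype ι] [DecidableEq ι]
    [AddCommGroup M] [AddCommGroup M'] [Module (Polynomial K) M] [Module (Polynomial K) M']
    (b : Module.Basis ι (Polynomial K) M) (b' : Module.Basis ι (Polynomial K) M')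
    (φ : M' →ₗ[Polynomial K] M) {m : ℕ} {h : Polynomial K} (h0 : h.coeff 0 ≠ 0)
    (hdet : (LinearMap.toMatrix b' b φ).det = Polynomial.X ^ m * h) :
    ∃ (bM : Module.Basis ι (Polynomial K) M) (a : ι → Polynomial K)
      (bN : Module.Basis ι (Polynomial K) (LinearMap.range φ)),
      (∀ i, (bN i : M) = a i • bM i) ∧ (∀ i, a i ≠ 0) ∧ ∑ i, (a i).natTrailingDegree = m := by
  have hh0 : h ≠ 0 := by rintro rfl; exact h0 rfl
  have hdet0 : (LinearMap.toMatrix b' b φ).det ≠ 0 := by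
    rw [hdet]; exact mul_ne_zero (pow_ne_zero _ Polynomial.X_ne_zero) hh0
  have hinj : Function.Injective φ := by
    rw [injective_iff_map_eq_zero]
    intro y hy
    have h1 := LinearMap.toMatrix_mulVec_repr b' b φ y
    rw [hy, map_zero] at h1
    have h2 := Matrix.eq_zero_of_mulVec_eq_zero hdet0 (by rw [h1]; rfl)
    apply b'.repr.injective
    rw [map_zero]
    exact DFunLike.coe_injective h2
  let N := LinearMap.range φ
  let ε : M' ≃ₗ[Polynomial K] N := LinearEquiv.ofInjective φ hinj
  have hrank : Module.finrank (Polynomial K) N = Module.finrank (Polynomial K) M := by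
    rw [Module.finrank_eq_card_basis (b'.map ε), Module.finrank_eq_card_basis b]
  obtain ⟨bM, a, bN, hab⟩ := Submodule.exists_smith_normal_form_of_rank_eq b hrank
  have hdiag : LinearMap.toMatrix bN bM N.subtype = Matrix.diagonal a := by
    ext i j
    rw [LinearMap.toMatrix_apply, Submodule.subtype_apply, hab, map_smul, Module.Basis.repr_self,
      Finsupp.smul_apply, Matrix.diagonal_apply, Finsupp.single_apply]
    by_cases hij : i = j
    · subst hij; simp
    · rw [if_neg hij, if_neg (Ne.symm hij), smul_zero]
  have hcomp : φ = LinearMap.id ∘ₗ N.subtype ∘ₗ ε.toLinearMap := by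
    ext y; rfl
  have hdet' : (LinearMap.toMatrix b' b φ).det = (LinearMap.toMatrix bM b LinearMap.id).det *
      ((∏ i, a i) * (LinearMap.toMatrix b' bN ε.toLinearMap).det) := by
    rw [hcomp, LinearMap.toMatrix_comp b' bM b, LinearMap.toMatrix_comp b' bN bM, Matrix.det_mul,
      Matrix.det_mul, hdiag, Matrix.det_diagonal]
  have hu1 : IsUnit (LinearMap.toMatrix bM b LinearMap.id).det :=
    LinearEquiv.isUnit_det (LinearEquiv.refl _ M) bM b
  have hu2 : IsUnit (LinearMap.toMatrix b' bN ε.toLinearMap).det := LinearEquiv.isUnit_det ε b' bN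
  have hprod0 : ∏ i, a i ≠ 0 := by
    intro h1
    rw [hdet', h1, zero_mul, mul_zero] at hdet0
    exact hdet0 rfl
  have ha0 : ∀ i, a i ≠ 0 := fun i => Finset.prod_ne_zero_iff.mp hprod0 i (Finset.mem_univ _)
  have hsum : ∑ i, (a i).natTrailingDegree = m := by
    have h1 := congrArg Polynomial.natTrailingDegree (hdet'.symm.trans hdet)
    have h2 : ∀ {c : Polynomial K}, IsUnit c → c.natTrailingDegree = 0 := by
      intro c hc
      obtain ⟨r, _, rfl⟩ := Polynomial.isUnit_iff.mp hc
      exact Polynomial.natTrailingDegree_C r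
    rw [Polynomial.natTrailingDegree_mul hu1.ne_zero (mul_ne_zero hprod0 hu2.ne_zero),
      Polynomial.natTrailingDegree_mul hprod0 hu2.ne_zero, h2 hu1, h2 hu2,
      natTrailingDegree_finset_prod _ _ fun i _ => ha0 i,
      Polynomial.natTrailingDegree_mul (pow_ne_zero _ Polynomial.X_ne_zero) hh0,
      Polynomial.natTrailingDegree_X_pow,
      Polynomial.natTrailingDegree_eq_zero_of_constantCoeff_ne_zero h0] at h1
    omega
  exact ⟨bM, a, bN, hab, ha0, hsum⟩

lemma repr_eq_mul_of_smith {ι M : Type*} [Fintype ι] [AddCommGroup M] [Module (Polynomial K) M]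
    {N : Submodule (Polynomial K) M} {bM : Module.Basis ι (Polynomial K) M} {a : ι → Polynomial K}
    {bN : Module.Basis ι (Polynomial K) N} (hab : ∀ i, (bN i : M) = a i • bM i) (y : N) (i : ι) :
    bM.repr (y : M) i = bN.repr y i * a i := by
  conv_lhs => rw [← bN.sum_repr y]
  rw [Submodule.coe_sum, map_sum, Finsupp.finsetSum_apply, Finset.sum_eq_single i]
  · rw [Submodule.coe_smul, hab, map_smul, map_smul, Module.Basis.repr_self, Finsupp.smul_apply,
      Finsupp.smul_apply, Finsupp.single_eq_same, smul_eq_mul, smul_eq_mul, mul_one]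
  · intro j _ hj
    rw [Submodule.coe_smul, hab, map_smul, map_smul, Module.Basis.repr_self, Finsupp.smul_apply,
      Finsupp.smul_apply, Finsupp.single_eq_of_ne hj.symm, smul_zero, smul_zero]
  · intro h
    exact absurd (Finset.mem_univ i) h

/-- The cokernel of a linear map between free modules of the same rank over `K[X]`, modulo the
exact power of `X` that divides the determinant: by the Smith normal form, it is a sum of
modules `K[X] / (X ^ e i)`, whose exponents have the sum `m`. -/
theorem exists_surjective_of_det_eq {ι M M' : Type*} [Fintype ι] [DecidableEq ι]
    [AddCommGroup M] [AddCommGroup M'] [Module (Polynomial K) M] [Module (Polynomial K) M']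
    (b : Module.Basis ι (Polynomial K) M) (b' : Module.Basis ι (Polynomial K) M')
    (φ : M' →ₗ[Polynomial K] M) {m : ℕ} {h : Polynomial K} (h0 : h.coeff 0 ≠ 0)
    (hdet : (LinearMap.toMatrix b' b φ).det = Polynomial.X ^ m * h) :
    ∃ e : ι → ℕ, ∑ i, e i = m ∧
      ∃ Ψ : M →ₗ[Polynomial K]
          (∀ i, Polynomial K ⧸ Ideal.span {(Polynomial.X : Polynomial K) ^ e i}),
        Function.Surjective Ψ ∧
        ∀ x, Ψ x = 0 ↔ ∃ (y : M') (z : M), x = φ y + (Polynomial.X : Polynomial K) ^ m • z := by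
  obtain ⟨bM, a, bN, hab, ha0, hsum⟩ := exists_smith_of_det_eq b b' φ h0 hdet
  refine ⟨fun i => (a i).natTrailingDegree, hsum, ?_⟩
  let Ψ : M →ₗ[Polynomial K] (∀ i, Polynomial K ⧸
      Ideal.span {(Polynomial.X : Polynomial K) ^ (a i).natTrailingDegree}) :=
    LinearMap.pi fun i => (Submodule.mkQ _) ∘ₗ bM.coord i
  have hΨ : ∀ x, Ψ x = 0 ↔ ∀ i, Polynomial.X ^ (a i).natTrailingDegree ∣ bM.repr x i := by
    intro x
    rw [funext_iff]
    refine forall_congr' fun i => ?_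
    rw [← Ideal.mem_span_singleton]
    exact Submodule.Quotient.mk_eq_zero _
  refine ⟨Ψ, ?_, ?_⟩
  · intro y
    choose z hz using fun i => Submodule.mkQ_surjective _ (y i)
    refine ⟨bM.equivFun.symm z, ?_⟩
    ext1 i
    rw [← hz]
    change Submodule.mkQ _ (bM.repr (bM.equivFun.symm z) i) = _
    congr 1
    rw [← Module.Basis.equivFun_apply, LinearEquiv.apply_symm_apply]
  · intro x
    rw [hΨ]
    constructor
    · intro hx
      choose y hy using hx
      choose g hg hgc using fun i => exists_eq_X_pow_natTrailingDegree_mul (ha0 i)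
      have hle : ∀ i, (a i).natTrailingDegree ≤ m := fun i => by
        rw [← hsum]
        exact Finset.single_le_sum (f := fun i => (a i).natTrailingDegree)
          (fun _ _ => Nat.zero_le _) (Finset.mem_univ i)
      -- the cofactor `g i` of the power of `X` in `a i` is invertible modulo powers of `X`
      have hbez : ∀ i, ∃ α β : Polynomial K, Polynomial.X ^ (a i).natTrailingDegree =
          α * a i + Polynomial.X ^ m * β := by
        intro i
        obtain ⟨α, β, hαβ⟩ := (hgc i).pow_right (n := m - (a i).natTrailingDegree)
        refine ⟨α, β, ?_⟩
        calc Polynomial.X ^ (a i).natTrailingDegree = Polynomial.X ^ (a i).natTrailingDegree *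
              (α * g i + β * Polynomial.X ^ (m - (a i).natTrailingDegree)) := by
              rw [hαβ, mul_one]
          _ = α * (Polynomial.X ^ (a i).natTrailingDegree * g i) + Polynomial.X ^
              ((a i).natTrailingDegree + (m - (a i).natTrailingDegree)) * β := by
              rw [pow_add]; ring
          _ = _ := by rw [← hg, Nat.add_sub_cancel' (hle i)]
      choose α β hαβ using hbez
      obtain ⟨y', hy'⟩ := (∑ i, (y i * α i) • bN i : LinearMap.range φ).2
      refine ⟨y', ∑ i, (y i * β i) • bM i, ?_⟩
      rw [hy', Submodule.coe_sum, Finset.smul_sum, ← Finset.sum_add_distrib]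
      conv_lhs => rw [← bM.sum_repr x]
      refine Finset.sum_congr rfl fun i _ => ?_
      rw [Submodule.coe_smul, hab, smul_smul, smul_smul, ← add_smul, hy i, hαβ i]
      congr 1
      ring
    · rintro ⟨y, z, rfl⟩ i
      rw [map_add, Finsupp.add_apply, map_smul, Finsupp.smul_apply, smul_eq_mul]
      refine dvd_add ?_ ?_
      · obtain ⟨g, hg, _⟩ := exists_eq_X_pow_natTrailingDegree_mul (ha0 i)
        have h2 := repr_eq_mul_of_smith hab ⟨φ y, LinearMap.mem_range_self φ y⟩ i
        rw [h2]
        exact (Dvd.intro g hg.symm).mul_left _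
      · refine Dvd.dvd.mul_right (pow_dvd_pow _ ?_) _
        rw [← hsum]
        exact Finset.single_le_sum (f := fun i => (a i).natTrailingDegree)
          (fun _ _ => Nat.zero_le _) (Finset.mem_univ i)

lemma finrank_quotient_X_pow (n : ℕ) :
    Module.finrank K (Polynomial K ⧸ Ideal.span {(Polynomial.X : Polynomial K) ^ n}) = n := by
  rw [finrank_quotient_span_eq_natDegree, Polynomial.natDegree_X_pow]

/-- The dimension of `K[u][s] / (f, g, u ^ m)`, where `u ^ m` is the exact power of `u` that divides
the resultant of `f` and `g` with respect to `s`. The Sylvester map `(y, z) ↦ f z + g y` presents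
`K[u][s] / (f, g)` as a `K[u]`-module, since `f` is monic up to a unit. -/
theorem finrank_quotient_of_resultant_eq {f g : Polynomial (Polynomial K)} {p q m : ℕ}
    {h : Polynomial K} (hf : f.natDegree ≤ p) (hg : g.natDegree ≤ q) (hfp : IsUnit (f.coeff p))
    (h0 : h.coeff 0 ≠ 0) (hres : Polynomial.resultant f g p q = Polynomial.X ^ m * h) :
    Module.finrank K (Polynomial (Polynomial K) ⧸
      Ideal.span {f, g, Polynomial.C (Polynomial.X ^ m)}) = m := by
  set I := Ideal.span {f, g, Polynomial.C (Polynomial.X ^ m)} with hI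
  let b := Polynomial.degreeLT.basis (Polynomial K) (p + q)
  let b' := ((Polynomial.degreeLT.basis (Polynomial K) p).prod
    (Polynomial.degreeLT.basis (Polynomial K) q)).reindex finSumFinEquiv
  obtain ⟨e, he, Ψ, hΨs, hΨ⟩ := exists_surjective_of_det_eq b b' (Polynomial.sylvesterMap f g hf hg)
    h0 (by rw [Polynomial.toMatrix_sylvesterMap']; exact hres)
  let Θ : Polynomial.degreeLT (Polynomial K) (p + q) →ₗ[Polynomial K]
      (Polynomial (Polynomial K) ⧸ I) :=
    (Ideal.Quotient.mkₐ (Polynomial K) I).toLinearMap ∘ₗ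
      (Polynomial.degreeLT (Polynomial K) (p + q)).subtype
  have hΘmk : ∀ x, Θ x = Ideal.Quotient.mk I x := fun _ => rfl
  -- division by `f`
  have hdiv : ∀ x : Polynomial (Polynomial K), ∃ y z : Polynomial (Polynomial K),
      x = f * y + z ∧ z.degree < p := by
    intro x
    obtain ⟨c, hc⟩ := hfp.exists_left_inv
    have hmon : (Polynomial.C c * f).Monic := Polynomial.monic_of_natDegree_le_of_coeff_eq_one p
      ((Polynomial.natDegree_C_mul_le _ _).trans hf) (by rw [Polynomial.coeff_C_mul, hc])
    have hnd : (Polynomial.C c * f).natDegree = p := by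
      refine le_antisymm ((Polynomial.natDegree_C_mul_le _ _).trans hf)
        (Polynomial.le_natDegree_of_ne_zero ?_)
      rw [Polynomial.coeff_C_mul, hc]; exact one_ne_zero
    refine ⟨Polynomial.C c * (x /ₘ (Polynomial.C c * f)), x %ₘ (Polynomial.C c * f), ?_, ?_⟩
    · conv_lhs => rw [← Polynomial.modByMonic_add_div x (Polynomial.C c * f)]
      ring
    · have := Polynomial.degree_modByMonic_lt x hmon
      rwa [Polynomial.degree_eq_natDegree hmon.ne_zero, hnd] at this
  have hlt : ∀ {x : Polynomial (Polynomial K)}, x.degree < p →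
      x ∈ Polynomial.degreeLT (Polynomial K) (p + q) := by
    intro x hx
    rw [Polynomial.mem_degreeLT]
    refine hx.trans_le ?_
    exact_mod_cast Nat.le_add_right p q
  have hΘs : Function.Surjective Θ := by
    intro y
    obtain ⟨x, rfl⟩ := Ideal.Quotient.mk_surjective y
    obtain ⟨y, z, hyz, hz⟩ := hdiv x
    refine ⟨⟨z, hlt hz⟩, ?_⟩
    rw [hΘmk, Ideal.Quotient.eq, hyz]
    have : z - (f * y + z) = f * (-y) := by ring
    rw [this]
    exact Ideal.mul_mem_right _ _ (Ideal.subset_span (by simp))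
  have hΘ : ∀ x, Θ x = 0 ↔ ∃ y z, x = Polynomial.sylvesterMap f g hf hg y +
      (Polynomial.X : Polynomial K) ^ m • z := by
    intro x
    rw [hΘmk, Ideal.Quotient.eq_zero_iff_mem]
    constructor
    · intro hx
      rw [hI, Ideal.mem_span_insert] at hx
      obtain ⟨α, w, hw, hx⟩ := hx
      rw [Ideal.mem_span_pair] at hw
      obtain ⟨β, γ, rfl⟩ := hw
      -- reduce the coefficients modulo `f` so that the degrees fit the Sylvester map
      obtain ⟨γ₁, γ₂, hγ, hγ₂⟩ := hdiv γ
      obtain ⟨β₁, β₂, hβ, hβ₂⟩ := hdiv β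
      have hz : (x : Polynomial (Polynomial K)) - Polynomial.C (Polynomial.X ^ m) * γ₂ - g * β₂ =
          f * (α + Polynomial.C (Polynomial.X ^ m) * γ₁ + g * β₁) := by
        rw [hx, hγ, hβ]; ring
      have hdeg : (α + Polynomial.C (Polynomial.X ^ m) * γ₁ + g * β₁).degree < (q : WithBot ℕ) := by
        set y := α + Polynomial.C (Polynomial.X ^ m) * γ₁ + g * β₁
        have h1 : (f * y).degree < (p + q : ℕ) := by
          rw [← hz]
          refine (Polynomial.degree_sub_le _ _).trans_lt (max_lt
            ((Polynomial.degree_sub_le _ _).trans_lt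
              (max_lt (Polynomial.mem_degreeLT.mp x.2) ?_)) ?_)
          · rw [← Polynomial.smul_eq_C_mul]
            refine (Polynomial.degree_smul_le _ _).trans_lt (hγ₂.trans_le ?_)
            exact_mod_cast Nat.le_add_right p q
          · by_cases hg0 : g = 0
            · rw [hg0, zero_mul, Polynomial.degree_zero]
              exact WithBot.bot_lt_coe _
            refine (Polynomial.degree_mul_le _ _).trans_lt ?_
            rw [add_comm p q, Nat.cast_add]
            exact WithBot.add_lt_add_of_le_of_lt (by simpa using hg0)
              (Polynomial.degree_le_of_natDegree_le hg) hβ₂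
        have h2 : (p : WithBot ℕ) ≤ f.degree := Polynomial.le_degree_of_ne_zero hfp.ne_zero
        rw [Polynomial.degree_mul, Nat.cast_add] at h1
        by_contra hcon
        exact absurd h1 (not_lt.mpr (add_le_add h2 (not_lt.mp hcon)))
      refine ⟨⟨⟨β₂, Polynomial.mem_degreeLT.mpr hβ₂⟩, ⟨_, Polynomial.mem_degreeLT.mpr hdeg⟩⟩,
        ⟨γ₂, hlt hγ₂⟩, ?_⟩
      ext1
      rw [Submodule.coe_add, Submodule.coe_smul, Polynomial.sylvesterMap_apply_coe, ← hz,
        Polynomial.smul_eq_C_mul]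
      ring
    · rintro ⟨y, z, rfl⟩
      rw [Submodule.coe_add, Submodule.coe_smul, Polynomial.sylvesterMap_apply_coe,
        Polynomial.smul_eq_C_mul]
      refine Ideal.add_mem _ (Ideal.add_mem _ ?_ ?_) ?_
      · exact Ideal.mul_mem_right _ _ (Ideal.subset_span (by simp))
      · exact Ideal.mul_mem_right _ _ (Ideal.subset_span (by simp))
      · exact Ideal.mul_mem_right _ _ (Ideal.subset_span (by simp))
  have hker : LinearMap.ker Θ = LinearMap.ker Ψ := by
    ext x
    rw [LinearMap.mem_ker, LinearMap.mem_ker, hΘ, hΨ]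
  let eq := (LinearMap.quotKerEquivOfSurjective Θ hΘs).symm.trans
    ((Submodule.quotEquivOfEq _ _ hker).trans (LinearMap.quotKerEquivOfSurjective Ψ hΨs))
  rw [(eq.restrictScalars K).finrank_eq]
  have hfin : ∀ i, Module.Finite K
      (Polynomial K ⧸ Ideal.span {(Polynomial.X : Polynomial K) ^ e i}) := fun i =>
    (Polynomial.monic_X_pow (e i)).finite_quotient
  rw [Module.finrank_pi_fintype]
  simp only [finrank_quotient_X_pow, he]

end Smith

/-! ### Intersection multiplicities in an affine chart -/

section LocalChart

variable {K : Type u} [Field K]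

lemma X_eq_linForm (i : Fin 3) : (X i : MvPolynomial (Fin 3) K) = linForm (Pi.single i 1) := by
  rw [linForm, Finset.sum_eq_single i]
  · simp
  · intro j _ hj
    simp [Pi.single_eq_of_ne hj]
  · simp

/-- A direction in the plane `X i = 0` which is general with respect to two polynomials. -/
lemma exists_direction [Infinite K] {v : Fin 3 → K} {i : Fin 3} (hv : v i ≠ 0)
    {P H : MvPolynomial (Fin 3) K} (hP : ¬ X i ∣ P) (hH : ¬ linForm v ∣ H) :
    ∃ c : Fin 3 → K, c i = 0 ∧ c ≠ 0 ∧ eval c P ≠ 0 ∧ eval (c ⨯₃ v) H ≠ 0 := by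
  have hv0 : v ≠ 0 := fun h => hv (congrFun h i)
  set H' : MvPolynomial (Fin 3) K :=
    aeval ((X : Fin 3 → MvPolynomial (Fin 3) K) ⨯₃ (C ∘ v)) H with hH'
  have hev : ∀ c, eval c H' = eval (c ⨯₃ v) H := by
    intro c
    rw [hH', ← aeval_eq_eval, algHom_aeval, ← aeval_eq_eval]
    congr 2
    ext j
    fin_cases j <;> simp [cross_apply]
  have hX : Prime (X i : MvPolynomial (Fin 3) K) := X_prime
  have hH'd : ¬ X i ∣ H' := by
    intro hd
    apply hH
    refine linForm_dvd_of_forall hv0 fun w hw => ?_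
    obtain ⟨b, rfl⟩ := exists_cross_eq hv0 hw
    have h1 : v ⨯₃ b = ((b i / v i) • v - b) ⨯₃ v := by
      rw [LinearMap.map_sub₂, LinearMap.map_smul₂, cross_self, smul_zero, zero_sub, cross_anticomm]
    rw [h1, ← hev]
    obtain ⟨G, hG⟩ := hd
    rw [hG, map_mul, eval_X, Pi.sub_apply, Pi.smul_apply, smul_eq_mul, div_mul_cancel₀ _ hv,
      sub_self, zero_mul]
  -- the factor `X l` makes the direction nonzero
  obtain ⟨l, hl⟩ : ∃ l : Fin 3, l ≠ i := exists_ne i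
  have hXl : ¬ (X i : MvPolynomial (Fin 3) K) ∣ X l := by
    rw [X_dvd_X]
    exact fun h => hl h.symm
  have hall : ¬ X i ∣ P * H' * X l := fun h => by
    rcases hX.dvd_or_dvd h with h | h
    · exact (hX.dvd_or_dvd h).elim hP hH'd
    · exact hXl h
  have hs : (Pi.single i 1 : Fin 3 → K) ≠ 0 := by simp
  obtain ⟨c, hc, hc0⟩ : ∃ c : Fin 3 → K, Pi.single i 1 ⬝ᵥ c = 0 ∧ eval c (P * H' * X l) ≠ 0 := by
    by_contra! hcon
    exact hall (by rw [X_eq_linForm i]; exact linForm_dvd_of_forall hs hcon)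
  rw [map_mul, map_mul, eval_X, hev] at hc0
  refine ⟨c, by simpa using hc, ?_, left_ne_zero_of_mul (left_ne_zero_of_mul hc0),
    right_ne_zero_of_mul (left_ne_zero_of_mul hc0)⟩
  intro h
  apply right_ne_zero_of_mul hc0
  rw [h, Pi.zero_apply]

/-- The coordinates `u` and `s` of the affine plane through `v` that is spanned by `r` and `c`:
the restriction of polynomials to this plane. -/
noncomputable def chartHom (c r v : Fin 3 → K) :
    MvPolynomial (Fin 3) K →ₐ[K] Polynomial (Polynomial K) :=
  aeval (fun j => Polynomial.C (Polynomial.C (c j)) * Polynomial.X +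
    Polynomial.C (Polynomial.C (v j) + Polynomial.C (r j) * Polynomial.X))

lemma chartHom_eq_linePoly (c r v : Fin 3 → K) (G : MvPolynomial (Fin 3) K) :
    chartHom c r v G = linePoly (map (algebraMap K (Polynomial K)) G) (Polynomial.C ∘ c)
      (fun j => Polynomial.C (v j) + Polynomial.C (r j) * Polynomial.X) := by
  rw [linePoly, aeval_map_algebraMap]
  rfl

lemma chartHom_linForm (c r v y : Fin 3 → K) : chartHom c r v (linForm y) =
    Polynomial.C (Polynomial.C (y ⬝ᵥ c)) * Polynomial.X +
      Polynomial.C (Polynomial.C (y ⬝ᵥ v) + Polynomial.C (y ⬝ᵥ r) * Polynomial.X) := by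
  simp only [chartHom, linForm, map_mul, aeval_X, dotProduct, Fin.sum_univ_three,
    map_add, ← algebraMap_eq, AlgHom.commutes]
  simp only [Polynomial.algebraMap_apply, Algebra.algebraMap_self, RingHom.id_apply]
  ring

lemma chartHom_C (c r v : Fin 3 → K) (y : K) :
    chartHom c r v (C y) = Polynomial.C (Polynomial.C y) := by
  rw [← algebraMap_eq, AlgHom.commutes]
  rfl

/-- The polynomials that restrict to the coordinates `u` and `s`. -/
lemma chartHom_coordinates {c r v : Fin 3 → K} (hδ : r ⬝ᵥ (c ⨯₃ v) ≠ 0) :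
    chartHom c r v (C (r ⬝ᵥ (c ⨯₃ v))⁻¹ * linForm (c ⨯₃ v)) = Polynomial.C Polynomial.X ∧
    chartHom c r v (C (r ⬝ᵥ (c ⨯₃ v))⁻¹ * linForm (v ⨯₃ r)) = Polynomial.X := by
  have e1 : (c ⨯₃ v) ⬝ᵥ c = 0 := by rw [dotProduct_comm, dot_self_cross]
  have e2 : (c ⨯₃ v) ⬝ᵥ v = 0 := by rw [dotProduct_comm, dot_cross_self]
  have e3 : (c ⨯₃ v) ⬝ᵥ r = r ⬝ᵥ (c ⨯₃ v) := dotProduct_comm _ _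
  have e4 : (v ⨯₃ r) ⬝ᵥ c = r ⬝ᵥ (c ⨯₃ v) := by
    rw [dotProduct_comm, ← triple_product_permutation]
  have e5 : (v ⨯₃ r) ⬝ᵥ v = 0 := by rw [dotProduct_comm, dot_self_cross]
  have e6 : (v ⨯₃ r) ⬝ᵥ r = 0 := by rw [dotProduct_comm, dot_cross_self]
  rw [map_mul, map_mul, chartHom_C, chartHom_linForm, chartHom_linForm, e1, e2, e3, e4, e5, e6]
  constructor
  · simp only [map_zero, zero_mul, zero_add]
    rw [← map_mul]
    rw [← mul_assoc, ← map_mul, inv_mul_cancel₀ hδ, map_one, one_mul]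
  · simp only [map_zero, zero_mul, add_zero]
    rw [← mul_assoc, ← map_mul, ← map_mul, inv_mul_cancel₀ hδ, map_one, map_one, one_mul]

/-- Modulo the equation `X i = v i` of the affine plane, each coordinate function is its
restriction to the plane, written in terms of the polynomials that restrict to `u` and `s`. -/
lemma X_eq_chart {c r v : Fin 3 → K} {i : Fin 3} (hv : v i ≠ 0) (hc : c i = 0) (hr : r i = 0)
    (hδ : r ⬝ᵥ (c ⨯₃ v) ≠ 0) (l : Fin 3) : (X l : MvPolynomial (Fin 3) K) =
      C (c l) * (C (r ⬝ᵥ (c ⨯₃ v))⁻¹ * linForm (v ⨯₃ r)) + (C (v l) + C (r l) *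
        (C (r ⬝ᵥ (c ⨯₃ v))⁻¹ * linForm (c ⨯₃ v))) + C (v l * (v i)⁻¹) * (X i - C (v i)) := by
  have h1 : C (r ⬝ᵥ (c ⨯₃ v)) * (X l : MvPolynomial (Fin 3) K) =
      C (c l) * linForm (v ⨯₃ r) + C (r l) * linForm (c ⨯₃ v) +
        C (v l) * linForm (r ⨯₃ c) := by
    simp only [linForm, Fin.sum_univ_three, dotProduct, cross_apply, Matrix.cons_val_zero,
      Matrix.cons_val_one, Matrix.cons_val, map_add, map_sub, map_mul]
    fin_cases l <;> simp <;> ring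
  have h2 : C (v i) * linForm (r ⨯₃ c) = C (r ⬝ᵥ (c ⨯₃ v)) * (X i : MvPolynomial (Fin 3) K) := by
    simp only [linForm, Fin.sum_univ_three, dotProduct, cross_apply, Matrix.cons_val_zero,
      Matrix.cons_val_one, Matrix.cons_val, map_add, map_sub, map_mul]
    fin_cases i <;> simp at hc hr ⊢ <;> rw [hc, hr] <;> simp <;> ring
  have hvC : (C (v i) : MvPolynomial (Fin 3) K) * C (v i)⁻¹ = 1 := by
    rw [← C_mul, mul_inv_cancel₀ hv, C_1]
  have hδC : (C (r ⬝ᵥ (c ⨯₃ v)) : MvPolynomial (Fin 3) K) * C (r ⬝ᵥ (c ⨯₃ v))⁻¹ = 1 := by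
    rw [← C_mul, mul_inv_cancel₀ hδ, C_1]
  rw [C_mul]
  generalize (C (r ⬝ᵥ (c ⨯₃ v)) : MvPolynomial (Fin 3) K) = D at *
  generalize (C (r ⬝ᵥ (c ⨯₃ v))⁻¹ : MvPolynomial (Fin 3) K) = D' at *
  linear_combination D' * h1 - (X l - C (v l) * C (v i)⁻¹ * X i) * hδC +
    D' * C (v l) * C (v i)⁻¹ * h2 - C (v l) * (1 + D' * linForm (r ⨯₃ c)) * hvC + 2 * C (v l) * hvC

end LocalChart

section LocalRing

variable {K : Type u} [Field K]

/-- If `0` is the only common zero of `f` and `g` on the line `u = 0`, then `u` and `s` are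
nilpotent in `K[u][s] / (f, g, u ^ m)`. -/
lemma isNilpotent_coordinates [IsAlgClosed K] {f g : Polynomial (Polynomial K)} {m : ℕ}
    {W : Type*} [CommRing W] [Algebra K W] (π : Polynomial (Polynomial K) →ₐ[K] W)
    (hπ : ∀ x ∈ Ideal.span {f, g, Polynomial.C (Polynomial.X ^ m)}, π x = 0)
    (hf : f.map (Polynomial.evalRingHom 0) ≠ 0)
    (h : ∀ x : K, (f.map (Polynomial.evalRingHom 0)).eval x = 0 →
      (g.map (Polynomial.evalRingHom 0)).eval x = 0 → x = 0) :
    IsNilpotent (π (Polynomial.C Polynomial.X)) ∧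
    IsNilpotent (π Polynomial.X) := by
  have hu : IsNilpotent (π (Polynomial.C Polynomial.X)) := by
    refine ⟨m, ?_⟩
    rw [← map_pow, ← map_pow]
    exact hπ _ (Ideal.subset_span (by simp))
  refine ⟨hu, ?_⟩
  let q : Polynomial (Polynomial K) →ₐ[K] W ⧸ nilradical W :=
    (Ideal.Quotient.mkₐ K _).comp π
  have hqu : q (Polynomial.C Polynomial.X) = 0 :=
    Ideal.Quotient.eq_zero_iff_mem.mpr (mem_nilradical.mpr hu)
  have hq0 : ∀ {x}, x ∈ Ideal.span {f, g, Polynomial.C (Polynomial.X ^ m)} → q x = 0 := by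
    intro x hx
    have : q x = Ideal.Quotient.mk _ (π x) := rfl
    rw [this, hπ x hx, map_zero]
  -- modulo the nilradical, `π` factors through the restriction to the line `u = 0`
  let τ : Polynomial K →ₐ[K] W ⧸ nilradical W :=
    Polynomial.aeval (q Polynomial.X)
  have hτ : ∀ x, q x = τ (x.map (Polynomial.evalRingHom 0)) := by
    intro x
    have : (q : Polynomial (Polynomial K) →+* _) =
        (τ : Polynomial K →+* W ⧸ nilradical W).comp
          (Polynomial.mapRingHom (Polynomial.evalRingHom 0)) := by
      apply Polynomial.ringHom_ext'
      · apply Polynomial.ringHom_ext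
        · intro a
          have h1 : q (Polynomial.C (Polynomial.C a)) = algebraMap K _ a := q.commutes a
          simp only [RingHom.comp_apply, RingHom.coe_coe, Polynomial.coe_mapRingHom,
            Polynomial.map_C, Polynomial.coe_evalRingHom, Polynomial.eval_C, h1]
          exact (τ.commutes a).symm
        · simp only [RingHom.comp_apply, RingHom.coe_coe, Polynomial.coe_mapRingHom,
            Polynomial.map_C, Polynomial.coe_evalRingHom, Polynomial.eval_X, hqu, map_zero]
      · simp [τ]
    exact RingHom.congr_fun this x
  -- the generator `e` of the kernel divides `f` and `g` on that line, so `0` is its only root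
  obtain ⟨e, he⟩ := (IsPrincipalIdealRing.principal (RingHom.ker τ)).principal
  have hmem : ∀ x, τ x = 0 ↔ e ∣ x := by
    intro x
    rw [← RingHom.mem_ker, he, Submodule.mem_span_singleton]
    simp only [Dvd.dvd, smul_eq_mul, mul_comm, eq_comm]
  have hef : e ∣ f.map (Polynomial.evalRingHom 0) := by
    rw [← hmem, ← hτ]; exact hq0 (Ideal.subset_span (by simp))
  have heg : e ∣ g.map (Polynomial.evalRingHom 0) := by
    rw [← hmem, ← hτ]; exact hq0 (Ideal.subset_span (by simp))
  have he0 : e ≠ 0 := by rintro rfl; exact hf (zero_dvd_iff.mp hef)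
  have hroots : ∀ x ∈ e.roots, x = 0 := by
    intro x hx
    have hx0 : e.eval x = 0 := Polynomial.isRoot_of_mem_roots hx
    refine h x ?_ ?_
    · obtain ⟨y, hy⟩ := hef; rw [hy, Polynomial.eval_mul, hx0, zero_mul]
    · obtain ⟨y, hy⟩ := heg; rw [hy, Polynomial.eval_mul, hx0, zero_mul]
  obtain ⟨a, n, ha, h1⟩ : ∃ (a : K) (n : ℕ), a ≠ 0 ∧ e = Polynomial.C a * Polynomial.X ^ n := by
    refine ⟨_, e.roots.card, Polynomial.leadingCoeff_ne_zero.mpr he0, ?_⟩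
    have h1 := (IsAlgClosed.splits e).eq_prod_roots
    rwa [Multiset.eq_replicate_card.mpr hroots, Multiset.map_replicate, Multiset.prod_replicate,
      map_zero, sub_zero] at h1
  have hX : e ∣ Polynomial.X ^ n := by
    refine ⟨Polynomial.C a⁻¹, ?_⟩
    rw [h1, mul_right_comm, ← map_mul, mul_inv_cancel₀ ha, map_one, one_mul]
  have hqX : q Polynomial.X ^ n = 0 := by
    have := (hmem _).mpr hX
    rwa [map_pow, Polynomial.aeval_X] at this
  have hred : IsReduced (W ⧸ nilradical W) :=
    (Ideal.isRadical_iff_quotient_reduced _).mp (Ideal.radical_isRadical _)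
  have h2 : q Polynomial.X = 0 := eq_zero_of_pow_eq_zero hqX
  exact mem_nilradical.mp (Ideal.Quotient.eq_zero_iff_mem.mp h2)

/-- The local ring of the intersection of two curves at `v`, in the coordinates `u` and `s` of
an affine plane: it is the quotient of `K[u][s]` by the restrictions of the two forms and by the
power of `u` that is the local part of their resultant with respect to `s`. -/
theorem nonempty_localRing_equiv {P Q : MvPolynomial (Fin 3) K} {c r v : Fin 3 → K} {i : Fin 3}
    (hv : v i ≠ 0) (hc : c i = 0) (hr : r i = 0) (hδ : r ⬝ᵥ (c ⨯₃ v) ≠ 0) {m : ℕ}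
    {h : Polynomial K} (h0 : h.coeff 0 ≠ 0)
    (hbez : ∃ x y, chartHom c r v P * x + chartHom c r v Q * y =
      Polynomial.C (Polynomial.X ^ m * h))
    {W : Type*} [CommRing W] [Algebra K W] (π : Polynomial (Polynomial K) →ₐ[K] W)
    (hπs : Function.Surjective π)
    (hπ : ∀ x, π x = 0 ↔ x ∈ Ideal.span {chartHom c r v P, chartHom c r v Q,
      Polynomial.C (Polynomial.X ^ m)})
    (hnil : IsNilpotent (π (Polynomial.C Polynomial.X)) ∧ IsNilpotent (π Polynomial.X))
    {L : Type*} [CommRing L] [Algebra (MvPolynomial (Fin 3) K) L] [Algebra K L]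
    [IsScalarTower K (MvPolynomial (Fin 3) K) L]
    [IsLocalization.AtPrime L (RingHom.ker (eval v : MvPolynomial (Fin 3) K →+* K))] :
    Nonempty ((L ⧸ Ideal.span
      (algebraMap (MvPolynomial (Fin 3) K) L '' {P, Q, X i - C (v i)})) ≃ₗ[K] W) := by
  let ψ : MvPolynomial (Fin 3) K →ₐ[K] W := π.comp (chartHom c r v)
  have hψ : ∀ G, ψ G = π (chartHom c r v G) := fun _ => rfl
  have hπC : ∀ a, π (Polynomial.C (Polynomial.C a)) = algebraMap K W a := π.commutes
  -- `ψ G` is the sum of the constant `eval v G` and a nilpotent element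
  have hunit : ∀ G, eval v G ≠ 0 → IsUnit (ψ G) := by
    intro G hG
    have h1 : ∀ G, IsNilpotent (ψ G - algebraMap K W (eval v G)) := by
      intro G
      have h2 : (Ideal.Quotient.mkₐ K (nilradical W)).comp ψ =
          (Algebra.ofId K (W ⧸ nilradical W)).comp (aeval v) := by
        apply MvPolynomial.algHom_ext
        intro j
        have h3 : ψ (X j) = algebraMap K W (c j) * π Polynomial.X + (algebraMap K W (v j) +
              algebraMap K W (r j) * π (Polynomial.C Polynomial.X)) := by
          rw [hψ, chartHom, aeval_X, map_add, map_mul, map_add, map_add, map_mul, map_mul, hπC,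
            hπC, hπC]
        have h4 : (Ideal.Quotient.mk (nilradical W)) (π Polynomial.X) = 0 :=
          Ideal.Quotient.eq_zero_iff_mem.mpr (mem_nilradical.mpr hnil.2)
        have h5 : (Ideal.Quotient.mk (nilradical W)) (π (Polynomial.C Polynomial.X)) = 0 :=
          Ideal.Quotient.eq_zero_iff_mem.mpr (mem_nilradical.mpr hnil.1)
        change Ideal.Quotient.mk (nilradical W) (ψ (X j)) = algebraMap K _ (aeval v (X j))
        rw [h3, aeval_X, map_add, map_mul, map_add, map_mul, h4, h5, mul_zero, mul_zero, add_zero,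
          zero_add]
        rfl
      have h6 := AlgHom.congr_fun h2 G
      rw [← mem_nilradical, ← Ideal.Quotient.eq]
      change Ideal.Quotient.mk (nilradical W) (ψ G) = algebraMap K _ (aeval v G) at h6
      rw [aeval_eq_eval] at h6
      exact h6
    have h7 := (h1 G).isUnit_add_left_of_commute
      ((isUnit_iff_ne_zero.mpr hG).map (algebraMap K W)) (Commute.all _ _)
    rwa [add_sub_cancel] at h7
  have hcompl : ∀ G, G ∈ (RingHom.ker (eval v : MvPolynomial (Fin 3) K →+* K)).primeCompl ↔
      eval v G ≠ 0 := fun G => Iff.rfl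
  -- the map from the local ring to the quotient of `K[u][s]`
  let Λ : L →ₐ[K] W := IsLocalization.liftAlgHom
    (M := (RingHom.ker (eval v : MvPolynomial (Fin 3) K →+* K)).primeCompl) (f := ψ)
    (fun y => hunit _ ((hcompl _).mp y.2))
  have hΛ : ∀ G, Λ (algebraMap _ L G) = ψ G := fun G => IsLocalization.lift_eq _ G
  obtain ⟨J, hJ⟩ : ∃ J, J = Ideal.span
    (algebraMap (MvPolynomial (Fin 3) K) L '' {P, Q, X i - C (v i)}) := ⟨_, rfl⟩
  rw [← hJ]
  have hmemJ : ∀ G ∈ ({P, Q, X i - C (v i)} : Set (MvPolynomial (Fin 3) K)),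
      algebraMap _ L G ∈ J := fun G hG => hJ ▸ Ideal.subset_span ⟨G, hG, rfl⟩
  have hker : ∀ x ∈ J, Λ x = 0 := by
    intro x hx
    rw [← RingHom.mem_ker]
    revert x hx
    change J ≤ _
    rw [hJ, Ideal.span_le]
    rintro _ ⟨G, hG, rfl⟩
    rw [SetLike.mem_coe, RingHom.mem_ker, hΛ, hψ, hπ]
    rcases hG with rfl | rfl | rfl
    · exact Ideal.subset_span (by simp)
    · exact Ideal.subset_span (by simp)
    · rw [map_sub, chartHom_C, chartHom, aeval_X, hc, hr]
      simp
  let Φ : (L ⧸ J) →ₐ[K] W := Ideal.Quotient.liftₐ J Λ hker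
  have hΦ : ∀ x, Φ (Ideal.Quotient.mk J x) = Λ x := fun _ => rfl
  -- the inverse map
  let Γ : MvPolynomial (Fin 3) K →ₐ[K] (L ⧸ J) :=
    (Ideal.Quotient.mkₐ K J).comp (IsScalarTower.toAlgHom K (MvPolynomial (Fin 3) K) L)
  have hΓ : ∀ G, Γ G = Ideal.Quotient.mk J (algebraMap _ L G) := fun _ => rfl
  obtain ⟨pu, hpu⟩ : ∃ pu : MvPolynomial (Fin 3) K,
    pu = C (r ⬝ᵥ (c ⨯₃ v))⁻¹ * linForm (c ⨯₃ v) := ⟨_, rfl⟩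
  obtain ⟨ps, hps⟩ : ∃ ps : MvPolynomial (Fin 3) K,
    ps = C (r ⬝ᵥ (c ⨯₃ v))⁻¹ * linForm (v ⨯₃ r) := ⟨_, rfl⟩
  obtain ⟨hu, hs⟩ := chartHom_coordinates hδ
  rw [← hpu] at hu
  rw [← hps] at hs
  let χ : Polynomial (Polynomial K) →+* (L ⧸ J) := Polynomial.eval₂RingHom
    (Polynomial.aeval (Γ pu) : Polynomial K →ₐ[K] L ⧸ J).toRingHom (Γ ps)
  have hχX : χ Polynomial.X = Γ ps := Polynomial.eval₂_X _ _
  have hχC : ∀ a, χ (Polynomial.C a) = Polynomial.aeval (Γ pu) a := fun a => Polynomial.eval₂_C _ _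
  have hχ : ∀ G, χ (chartHom c r v G) = Γ G := by
    intro G
    have : χ.comp (chartHom c r v : MvPolynomial (Fin 3) K →+* _) = (Γ : _ →+* L ⧸ J) := by
      apply MvPolynomial.ringHom_ext
      · intro a
        rw [RingHom.comp_apply, RingHom.coe_coe, chartHom_C, hχC, Polynomial.aeval_C,
          RingHom.coe_coe, ← algebraMap_eq, AlgHom.commutes]
      · intro j
        have h1 : Γ (X i - C (v i)) = 0 := Ideal.Quotient.eq_zero_iff_mem.mpr (hmemJ _ (by simp))
        have hΓC : ∀ a, Γ (C a) = algebraMap K _ a := fun a => by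
          rw [← algebraMap_eq, AlgHom.commutes]
        rw [RingHom.comp_apply, RingHom.coe_coe, RingHom.coe_coe, X_eq_chart hv hc hr hδ j, ← hpu,
          ← hps]
        simp only [map_add, map_mul, hu, hs, chartHom_C]
        rw [h1, mul_zero, add_zero]
        simp only [hχX, hχC, Polynomial.aeval_C, Polynomial.aeval_X, hΓC]
        have h2 : chartHom c r v (X i) - Polynomial.C (Polynomial.C (v i)) = 0 := by
          rw [chartHom, aeval_X, hc, hr]; simp
        rw [map_sub, chartHom_C, h2, map_zero χ, mul_zero, add_zero]
    exact RingHom.congr_fun this G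
  have hχI : ∀ x, π x = 0 → χ x = 0 := by
    intro x hx
    rw [hπ] at hx
    rw [← RingHom.mem_ker]
    revert x hx
    change Ideal.span _ ≤ _
    rw [Ideal.span_le]
    have hP : χ (chartHom c r v P) = 0 := by
      rw [hχ]; exact Ideal.Quotient.eq_zero_iff_mem.mpr (hmemJ _ (by simp))
    have hQ : χ (chartHom c r v Q) = 0 := by
      rw [hχ]; exact Ideal.Quotient.eq_zero_iff_mem.mpr (hmemJ _ (by simp))
    rintro y (rfl | rfl | rfl)
    · exact hP
    · exact hQ
    · -- `u ^ m * h` is a combination of the two forms, and `h` is a unit in the local ring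
      obtain ⟨x, y, hxy⟩ := hbez
      have h1 := congrArg χ hxy
      rw [map_add, map_mul, map_mul, hP, hQ, zero_mul, zero_mul, zero_add, map_mul, map_mul,
        hχC h] at h1
      have h2 : IsUnit (Polynomial.aeval (Γ pu) h) := by
        rw [Polynomial.aeval_algHom_apply, hΓ]
        refine IsUnit.map _ (IsLocalization.map_units (M := (RingHom.ker
          (eval v : MvPolynomial (Fin 3) K →+* K)).primeCompl) L ⟨_, (hcompl _).mpr ?_⟩)
        rw [← aeval_eq_eval, ← Polynomial.aeval_algHom_apply]
        have h3 : (aeval v : MvPolynomial (Fin 3) K →ₐ[K] K) pu = 0 := by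
          rw [aeval_eq_eval, hpu, map_mul, eval_linForm, dotProduct_comm _ v, dot_cross_self,
            mul_zero]
        rw [h3, ← Polynomial.coeff_zero_eq_aeval_zero]
        exact h0
      exact h2.mul_left_eq_zero.mp h1.symm
  have hleft : ∀ x, ∀ y, π y = Φ x → χ y = x := by
    obtain ⟨Ξ, hΞ⟩ : ∃ Ξ : W →+* L ⧸ J, ∀ y, Ξ (π y) = χ y := by
      refine ⟨RingHom.liftOfSurjective (π : _ →+* W) hπs ⟨χ, ?_⟩, fun y => ?_⟩
      · intro x hx; exact hχI x hx
      · exact RingHom.liftOfRightInverse_comp_apply _ _ _ _ _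
    have hcomp : Ξ.comp (Φ : (L ⧸ J) →+* W) = RingHom.id _ := by
      apply Ideal.Quotient.ringHom_ext
      apply IsLocalization.ringHom_ext
        (RingHom.ker (eval v : MvPolynomial (Fin 3) K →+* K)).primeCompl
      refine RingHom.ext fun G => ?_
      simp only [RingHom.comp_apply, RingHom.coe_coe, hΦ, hΛ, hψ, hΞ, hχ, hΓ, RingHom.id_apply]
    intro x y hxy
    rw [← hΞ, hxy]
    exact RingHom.congr_fun hcomp x
  refine ⟨LinearEquiv.ofBijective Φ.toLinearMap ⟨?_, ?_⟩⟩
  · intro x x' hxx'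
    obtain ⟨y, hy⟩ := hπs (Φ x)
    rw [← hleft x y hy]
    exact hleft x' y (hy.trans hxx')
  · have hcomp : (Φ : (L ⧸ J) →+* W).comp χ = π := by
      apply Polynomial.ringHom_ext'
      · apply Polynomial.ringHom_ext
        · intro a
          simp only [RingHom.comp_apply, RingHom.coe_coe, hχC, Polynomial.aeval_C, hπC,
            AlgHom.commutes]
        · simp only [RingHom.comp_apply, RingHom.coe_coe, hχC, Polynomial.aeval_X, hΓ, hΦ, hΛ, hψ,
            hu]
      · simp only [RingHom.comp_apply, RingHom.coe_coe, hχX, hΓ, hΦ, hΛ, hψ, hs]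
    intro w
    obtain ⟨y, rfl⟩ := hπs w
    exact ⟨χ y, RingHom.congr_fun hcomp y⟩

end LocalRing

section IntersectionMultiplicity

variable {K : Type u} [Field K]

lemma IsResultantForm.symm {P Q G : MvPolynomial (Fin 3) K} {p q : ℕ}
    (h : IsResultantForm P Q p q G) :
    IsResultantForm Q P q p (C ((-1) ^ (q * p)) * G) where
  left := h.right
  right := h.left
  isHomogeneous := by rw [mul_comm q p]; exact h.isHomogeneous.C_mul _
  resultant_eq A _ _ a b := by
    rw [Polynomial.resultant_comm, h.resultant_eq, map_mul, aeval_C, map_pow, map_neg, map_one]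

/-- The resultant form of two curves vanishes on the dual lines of their common points. -/
lemma IsResultantForm.linForm_dvd [Infinite K] {P Q G : MvPolynomial (Fin 3) K} {p q : ℕ}
    (h : IsResultantForm P Q p q G) (hp : 0 < p) (hq : 0 < q) {v : Fin 3 → K} (hv : v ≠ 0)
    (hP : eval v P = 0) (hQ : eval v Q = 0) : linForm v ∣ G :=
  linForm_dvd_of_forall hv fun _ hw => h.eval_eq_zero hp hq hv hw hP hQ

lemma degree_pos_of_eval_eq_zero {P : MvPolynomial (Fin 3) K} {p : ℕ} (h : P.IsHomogeneous p)
    (hP : P ≠ 0) {v : Fin 3 → K} (hv : eval v P = 0) : 0 < p := by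
  rcases Nat.eq_zero_or_pos p with rfl | hp
  · obtain ⟨c, hc, rfl⟩ := exists_eq_C_of_isUnit (isUnit_of_isHomogeneous_zero h hP)
    rw [eval_C] at hv
    exact absurd hv hc
  · exact hp

lemma linForm_dvd_linForm_of_apply_eq {v w : Fin 3 → K} {i : Fin 3} (hv : v i ≠ 0)
    (h : w i = v i) (hd : linForm w ∣ linForm v) : v = w := by
  obtain ⟨c, hc⟩ := exists_smul_of_linForm_dvd hd
  have h1 := congrFun hc i
  rw [Pi.smul_apply, smul_eq_mul, h] at h1
  have h2 : c = 1 := by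
    have : (c - 1) * v i = 0 := by rw [sub_mul, ← h1, one_mul, sub_self]
    exact sub_eq_zero.mp ((mul_eq_zero.mp this).resolve_right hv)
  rw [hc, h2, one_smul]

/-- The equation of the dual line of `v`, at the lines through `c` and the points `v + u * r`. -/
lemma aeval_linForm_chart (c r v : Fin 3 → K) :
    aeval ((Polynomial.C ∘ c) ⨯₃ (fun j => Polynomial.C (v j) + Polynomial.C (r j) * Polynomial.X))
      (linForm v) = Polynomial.X * Polynomial.C (- (r ⬝ᵥ (c ⨯₃ v))) := by
  simp only [linForm, Fin.sum_univ_three, map_add, map_mul, aeval_X, aeval_C, cross_apply,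
    dotProduct, Polynomial.algebraMap_eq, Function.comp_apply, Matrix.cons_val_zero,
    Matrix.cons_val_one, Matrix.cons_val, map_neg, map_sub]
  ring

/-- A second direction of the plane `X i = 0`, independent of `c`. -/
lemma exists_dual_direction {c v : Fin 3 → K} {i : Fin 3} (hv : v i ≠ 0) (hc : c i = 0)
    (hc0 : c ≠ 0) : ∃ r : Fin 3 → K, r i = 0 ∧ r ⬝ᵥ (c ⨯₃ v) ≠ 0 := by
  by_contra! h
  have h1 : ∀ j, j ≠ i → (c ⨯₃ v) j = 0 := by
    intro j hj
    have := h (Pi.single j 1) (Pi.single_eq_of_ne hj.symm 1)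
    simpa using this
  have h2 : v i * (c ⨯₃ v) i = 0 := by
    have h3 := dot_cross_self c v
    rw [dotProduct, Finset.sum_eq_single i (fun j _ hj => by rw [h1 j hj, mul_zero])
      (fun h => absurd (Finset.mem_univ i) h)] at h3
    exact h3
  have h4 : c ⨯₃ v = 0 := by
    ext j
    by_cases hj : j = i
    · subst hj
      exact (mul_eq_zero.mp h2).resolve_left hv
    · exact h1 j hj
  apply hc0
  have h5 : v i • c = 0 := by
    have h6 := cross_cross_eq_smul_sub_smul' v c v
    ext j
    have h7 := fun l => congrFun h4 l
    have a0 := h7 0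
    have a1 := h7 1
    have a2 := h7 2
    simp only [cross_apply, Matrix.cons_val_zero, Matrix.cons_val_one, Matrix.cons_val,
      Pi.zero_apply] at a0 a1 a2
    simp only [Pi.smul_apply, smul_eq_mul, Pi.zero_apply]
    fin_cases i <;> fin_cases j <;> simp at hc ⊢ <;> simp [hc] at a0 a1 a2 ⊢ <;> tauto
  exact (smul_eq_zero.mp h5).resolve_left hv

/-- The resultant lies in the ideal generated by the two polynomials. The hypothesis on the
coefficient of `f` is needed only for `p = q = 0`, where the resultant is `1`. -/
lemma exists_bezout_resultant {f g : Polynomial (Polynomial K)} {p q : ℕ} (hf : f.natDegree ≤ p)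
    (hg : g.natDegree ≤ q) (hfp : IsUnit (f.coeff p)) :
    ∃ x y, f * x + g * y = Polynomial.C (Polynomial.resultant f g p q) := by
  by_cases h : p ≠ 0 ∨ q ≠ 0
  · obtain ⟨x, y, _, _, hxy⟩ := Polynomial.exists_mul_add_mul_eq_C_resultant f g hf hg h
    exact ⟨x, y, hxy⟩
  · push Not at h
    obtain ⟨rfl, rfl⟩ := h
    obtain ⟨y, hy⟩ := hfp.exists_right_inv
    refine ⟨Polynomial.C y, 0, ?_⟩
    rw [Polynomial.eq_C_of_natDegree_eq_zero (Nat.le_zero.mp hf), ← Polynomial.C_mul, hy]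
    simp

lemma exists_quotient_algHom {A : Type u} [CommRing A] [Algebra K A] (I : Ideal A) {m : ℕ}
    (h : Module.finrank K (A ⧸ I) = m) :
    ∃ (W : Type u) (_ : CommRing W) (_ : Algebra K W) (π : A →ₐ[K] W), Function.Surjective π ∧
      (∀ x, π x = 0 ↔ x ∈ I) ∧ Module.finrank K W = m :=
  ⟨A ⧸ I, inferInstance, inferInstance, Ideal.Quotient.mkₐ K I,
    Ideal.Quotient.mkₐ_surjective K I, fun _ => Ideal.Quotient.eq_zero_iff_mem, h⟩

/-- The intersection multiplicity as the order of a resultant in an affine chart, if the origin is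
the only common zero of the two curves on the line `u = 0`. -/
lemma localMultiplicity_eq_of_chart [IsAlgClosed K] {P Q : MvPolynomial (Fin 3) K} {p q : ℕ}
    {c r v : Fin 3 → K} {i : Fin 3} (hv : v i ≠ 0) (hc : c i = 0) (hr : r i = 0)
    (hδ : r ⬝ᵥ (c ⨯₃ v) ≠ 0) {m : ℕ} {h : Polynomial K} (h0 : h.coeff 0 ≠ 0)
    (hP : (chartHom c r v P).natDegree ≤ p) (hQ : (chartHom c r v Q).natDegree ≤ q)
    (hPp : IsUnit ((chartHom c r v P).coeff p))
    (hres : Polynomial.resultant (chartHom c r v P) (chartHom c r v Q) p q = Polynomial.X ^ m * h)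
    (hP0 : (chartHom c r v P).map (Polynomial.evalRingHom 0) ≠ 0)
    (hzero : ∀ x : K, ((chartHom c r v P).map (Polynomial.evalRingHom 0)).eval x = 0 →
      ((chartHom c r v Q).map (Polynomial.evalRingHom 0)).eval x = 0 → x = 0) :
    localMultiplicity P Q v i = m := by
  obtain ⟨W, _, _, π, hπs, hπ, hW⟩ : ∃ (W : Type _) (_ : CommRing W) (_ : Algebra K W)
      (π : Polynomial (Polynomial K) →ₐ[K] W), Function.Surjective π ∧
      (∀ x, π x = 0 ↔ x ∈ Ideal.span {chartHom c r v P, chartHom c r v Q,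
        Polynomial.C (Polynomial.X ^ m)}) ∧ Module.finrank K W = m :=
    exists_quotient_algHom _ (finrank_quotient_of_resultant_eq hP hQ hPp h0 hres)
  have hnil : IsNilpotent (π (Polynomial.C Polynomial.X)) ∧ IsNilpotent (π Polynomial.X) :=
    isNilpotent_coordinates (f := chartHom c r v P) (g := chartHom c r v Q) (m := m) π
      (fun x hx => (hπ x).mpr hx) hP0 hzero
  have hbez : ∃ x y, chartHom c r v P * x + chartHom c r v Q * y =
      Polynomial.C (Polynomial.X ^ m * h) := by
    rw [← hres]
    exact exists_bezout_resultant hP hQ hPp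
  obtain ⟨eq⟩ := nonempty_localRing_equiv (L := LocalRing v) hv hc hr hδ h0 hbez π hπs hπ hnil
  rw [localMultiplicity, eq.finrank_eq, hW]

/-- The intersection multiplicity at a point is the multiplicity of the dual line in the
resultant form. Here the first form is not divisible by the coordinate that defines the chart, so
that the direction `c` of the lines of the chart can be chosen off the first curve and such that no
other common point of the two curves lies on the line through `c` and `v`. -/
lemma localMultiplicity_eq_of_not_dvd [IsAlgClosed K] {P Q R H : MvPolynomial (Fin 3) K} {p q : ℕ}
    (h : IsResultantForm P Q p q R) (hP : P ≠ 0) (hQ : Q ≠ 0) {v : Fin 3 → K} {i : Fin 3}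
    (hv : v i ≠ 0) {m : ℕ} (hR : R = linForm v ^ m * H) (hH : ¬ linForm v ∣ H)
    (hPi : ¬ X i ∣ P) : localMultiplicity P Q v i = m := by
  obtain ⟨c, hci, hc0, hcP, hcH⟩ := exists_direction hv hPi hH
  obtain ⟨r, hri, hδ⟩ := exists_dual_direction hv hci hc0
  obtain ⟨f, hf⟩ : ∃ f, f = chartHom c r v P := ⟨_, rfl⟩
  obtain ⟨g, hg⟩ : ∃ g, g = chartHom c r v Q := ⟨_, rfl⟩
  obtain ⟨b, hb⟩ : ∃ b : Fin 3 → Polynomial K,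
    b = fun j => Polynomial.C (v j) + Polynomial.C (r j) * Polynomial.X := ⟨_, rfl⟩
  have hf' : f = linePoly (map (algebraMap K (Polynomial K)) P) (Polynomial.C ∘ c) b :=
    by rw [hf, hb, chartHom_eq_linePoly]
  have hg' : g = linePoly (map (algebraMap K (Polynomial K)) Q) (Polynomial.C ∘ c) b :=
    by rw [hg, hb, chartHom_eq_linePoly]
  have hfd : f.natDegree ≤ p := by
    rw [hf']; exact natDegree_linePoly_le (h.left.map _) _ _
  have hgd : g.natDegree ≤ q := by
    rw [hg']; exact natDegree_linePoly_le (h.right.map _) _ _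
  have hfp : IsUnit (f.coeff p) := by
    rw [hf', coeff_linePoly (h.left.map _), Polynomial.algebraMap_eq, ← ringHom_eval]
    exact (isUnit_iff_ne_zero.mpr hcP).map Polynomial.C
  obtain ⟨h', hh'⟩ : ∃ h' : Polynomial K, h' = Polynomial.C (- (r ⬝ᵥ (c ⨯₃ v))) ^ m *
    aeval ((Polynomial.C ∘ c) ⨯₃ b) H := ⟨_, rfl⟩
  have hres : Polynomial.resultant f g p q = Polynomial.X ^ m * h' := by
    rw [hf', hg', h.resultant_eq (Polynomial K), hR, map_mul, map_pow, hb,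
      aeval_linForm_chart, mul_pow,
      hh', hb, mul_assoc]
  have h0 : h'.coeff 0 ≠ 0 := by
    rw [hh', Polynomial.mul_coeff_zero, ← Polynomial.C_pow, Polynomial.coeff_C_zero]
    refine mul_ne_zero (pow_ne_zero _ (neg_ne_zero.mpr hδ)) ?_
    rw [Polynomial.coeff_zero_eq_aeval_zero, algHom_aeval]
    convert hcH using 1
    rw [← aeval_eq_eval]
    congr 2
    ext j
    fin_cases j <;> simp [cross_apply, hb]
  -- on the line `u = 0` the chart is the line through `c` and `v`
  have hspec : ∀ G, (chartHom c r v G).map (Polynomial.evalRingHom 0) = linePoly G c v := by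
    intro G
    rw [chartHom_eq_linePoly, linePoly_map, map_map]
    have e1 : (Polynomial.evalRingHom (0 : K)).comp (algebraMap K (Polynomial K)) =
        RingHom.id K := by
      ext x; simp
    have e2 : (Polynomial.evalRingHom (0 : K)) ∘ Polynomial.C ∘ c = c := by ext x; simp
    have e3 : (Polynomial.evalRingHom (0 : K)) ∘ (fun j => Polynomial.C (v j) +
      Polynomial.C (r j) * Polynomial.X) = v := by ext x; simp
    rw [e1, e2, e3, map_id]
  have hf0 : f.map (Polynomial.evalRingHom 0) ≠ 0 := by
    rw [hf, hspec]
    intro hz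
    apply hcP
    rw [← coeff_linePoly h.left c v, hz, Polynomial.coeff_zero]
  have hzero : ∀ x : K, (f.map (Polynomial.evalRingHom 0)).eval x = 0 →
      (g.map (Polynomial.evalRingHom 0)).eval x = 0 → x = 0 := by
    intro x hx hx'
    rw [hf, hspec, eval_linePoly] at hx
    rw [hg, hspec, eval_linePoly] at hx'
    have hvi : (x • c + v) i = v i := by rw [Pi.add_apply, Pi.smul_apply, hci, smul_zero, zero_add]
    have hne : x • c + v ≠ 0 := fun h0 => hv (by rw [← hvi, h0, Pi.zero_apply])
    -- the dual line of a common point divides `R = linForm v ^ m * H`, but not `H`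
    have hd := h.linForm_dvd (degree_pos_of_eval_eq_zero h.left hP hx)
      (degree_pos_of_eval_eq_zero h.right hQ hx') hne hx hx'
    have hirr := irreducible_linForm hne
    rw [hR] at hd
    rcases hirr.prime.dvd_or_dvd hd with hd | hd
    · have h1 := linForm_dvd_linForm_of_apply_eq hv hvi (hirr.prime.dvd_of_dvd_pow hd)
      have h2 : x • c = 0 := by
        have := congrArg (fun y => y - v) h1
        simpa using this.symm
      exact (smul_eq_zero.mp h2).resolve_right hc0
    · exfalso
      obtain ⟨G, rfl⟩ := hd
      apply hcH
      rw [map_mul, eval_linForm, add_dotProduct, smul_dotProduct, dot_self_cross, dot_cross_self]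
      simp
  subst hf hg
  exact localMultiplicity_eq_of_chart hv hci hri hδ h0 hfd hgd hfp hres hf0 hzero

lemma localMultiplicity_comm (P Q : MvPolynomial (Fin 3) K) (v : Fin 3 → K) (i : Fin 3) :
    localMultiplicity P Q v i = localMultiplicity Q P v i := by
  rw [localMultiplicity, localMultiplicity, Set.insert_comm]

/-- The intersection multiplicity at a point is the multiplicity of the dual line in the
resultant form. -/
theorem localMultiplicity_eq [IsAlgClosed K] {P Q R H : MvPolynomial (Fin 3) K} {p q : ℕ}
    (h : IsResultantForm P Q p q R) (hP : P ≠ 0) (hQ : Q ≠ 0) {v : Fin 3 → K} {i : Fin 3}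
    (hv : v i ≠ 0) {m : ℕ} (hR : R = linForm v ^ m * H) (hH : ¬ linForm v ∣ H) :
    localMultiplicity P Q v i = m := by
  by_cases hPi : X i ∣ P
  · have hQi : ¬ X i ∣ Q := by
      intro hQi
      -- a common component would make the resultant form vanish
      have h0 : R = 0 := by
        apply MvPolynomial.funext
        intro w
        rw [map_zero]
        obtain ⟨u, hu, huw⟩ : ∃ u : Fin 3 → K, u ≠ 0 ∧ u i = 0 ∧ u ⬝ᵥ w = 0 := by
          by_cases hw : (Pi.single i 1) ⨯₃ w = 0
          · obtain ⟨l, hl⟩ := exists_ne i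
            refine ⟨Pi.single l 1, by simp, Pi.single_eq_of_ne hl.symm 1, ?_⟩
            have : w l = 0 := by
              have h0 := congrFun hw 0
              have h1 := congrFun hw 1
              have h2 := congrFun hw 2
              fin_cases i <;> fin_cases l <;> simp [cross_apply] at hl h0 h1 h2 ⊢ <;> assumption
            simpa using this
          · refine ⟨_, hw, ?_, by rw [dotProduct_comm, dot_cross_self]⟩
            have := dot_self_cross (Pi.single i 1) w
            simpa using this
        have huP : eval u P = 0 := by
          obtain ⟨G, rfl⟩ := hPi; rw [map_mul, eval_X, huw.1, zero_mul]
        have huQ : eval u Q = 0 := by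
          obtain ⟨G, rfl⟩ := hQi; rw [map_mul, eval_X, huw.1, zero_mul]
        exact h.eval_eq_zero (degree_pos_of_eval_eq_zero h.left hP huP)
          (degree_pos_of_eval_eq_zero h.right hQ huQ) hu huw.2 huP huQ
      rw [h0, eq_comm, mul_eq_zero] at hR
      rcases hR with hR | hR
      · exact linForm_ne_zero (fun h0 => hv (congrFun h0 i)) (eq_zero_of_pow_eq_zero hR)
      · exact hH (hR ▸ dvd_zero _)
    rw [localMultiplicity_comm]
    refine localMultiplicity_eq_of_not_dvd h.symm hQ hP hv (H := C ((-1) ^ (q * p)) * H)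
      (by rw [hR]; ring) ?_ hQi
    intro hd
    apply hH
    have hu : IsUnit (C ((-1) ^ (q * p)) : MvPolynomial (Fin 3) K) :=
      (isUnit_one.neg.pow _).map C
    exact hu.dvd_mul_left.mp hd
  · exact localMultiplicity_eq_of_not_dvd h hP hQ hv hR hH hPi

end IntersectionMultiplicity

/-! ### Sums of dual lines as divisors of resultant forms -/

section DualLines

variable {K : Type u} [Field K]

lemma dualLine_eq (p : ℙ K (Fin 3 → K)) : dualLine p = primeDivisor (linForm p.rep) := rfl

lemma irreducible_linForm_rep (p : ℙ K (Fin 3 → K)) : Irreducible (linForm p.rep) :=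
  irreducible_linForm p.rep_nonzero

lemma eq_of_linForm_dvd {p p' : ℙ K (Fin 3 → K)} (h : linForm p.rep ∣ linForm p'.rep) :
    p = p' := by
  obtain ⟨c, hc⟩ := exists_smul_of_linForm_dvd h
  have hc0 : c ≠ 0 := by rintro rfl; exact p'.rep_nonzero (by rw [hc, zero_smul])
  rw [← p.mk_rep, ← p'.mk_rep, Projectivization.mk_eq_mk_iff']
  refine ⟨c⁻¹, ?_⟩
  rw [hc, inv_smul_smul₀ hc0]

lemma mk_linForm_injective : Function.Injective
    (fun p : ℙ K (Fin 3 → K) => Associates.mk (linForm p.rep)) := fun _ _ h =>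
  eq_of_linForm_dvd (Associates.mk_eq_mk_iff_associated.mp h).dvd

/-- A nonzero vector is proportional to the representative of a point. -/
lemma exists_rep_eq_smul {v : Fin 3 → K} (hv : v ≠ 0) :
    ∃ (p : ℙ K (Fin 3 → K)) (c : K), c ≠ 0 ∧ p.rep = c • v := by
  obtain ⟨a, ha⟩ := Projectivization.exists_smul_eq_mk_rep K v hv
  exact ⟨Projectivization.mk K v hv, a, a.ne_zero, ha.symm⟩

lemma exists_associated_linForm_rep {x : Fin 3 → K} (hx : x ≠ 0) :
    ∃ y : ℙ K (Fin 3 → K), Associated (linForm x) (linForm y.rep) := by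
  obtain ⟨y, c, hc, hy⟩ := exists_rep_eq_smul hx
  refine ⟨y, (irreducible_linForm hx).associated_of_dvd (irreducible_linForm_rep y) ?_⟩
  rw [hy, linForm_smul]
  exact dvd_mul_left _ _

section Sums

variable (S : Set (ℙ K (Fin 3 → K))) (n : ℙ K (Fin 3 → K) → ℕ) {D : MvPolynomial (Fin 3) K}
  (hn : ∀ p ∈ S, ∃ H, D = linForm p.rep ^ n p * H ∧ ¬ linForm p.rep ∣ H)

include hn

lemma finite_support_dualLine : (Function.support
    (fun p => ∑ᶠ _ : p ∈ S, (n p : ℤ) • dualLine p)).Finite := by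
  classical
  have hfin : ((divisor D).support : Set (Associates (MvPolynomial (Fin 3) K))).Finite :=
    Finset.finite_toSet _
  refine (hfin.preimage (mk_linForm_injective (K := K)).injOn).subset ?_
  intro p hp
  rw [Function.mem_support] at hp
  by_cases hpS : p ∈ S
  · rw [finsum_eq_if, if_pos hpS] at hp
    obtain ⟨H, hD, hH⟩ := hn p hpS
    have h1 := divisor_apply_eq (irreducible_linForm_rep p) hH (n p)
    rw [← hD] at h1
    rw [Set.mem_preimage, Finset.mem_coe, Finsupp.mem_support_iff, h1]
    intro h0
    exact hp (by rw [h0, zero_smul])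
  · rw [finsum_eq_if, if_neg hpS] at hp
    exact absurd rfl hp

lemma finsum_dualLine_apply (c : Associates (MvPolynomial (Fin 3) K)) :
    (∑ᶠ (p : ℙ K (Fin 3 → K)) (_ : p ∈ S), (n p : ℤ) • dualLine p) c =
      ∑ᶠ (p : ℙ K (Fin 3 → K)), (∑ᶠ _ : p ∈ S, (n p : ℤ) • dualLine p) c :=
  (Finsupp.applyAddHom c).map_finsum (finite_support_dualLine S n hn)

/-- The multiplicity of the dual line of a point in a sum of dual lines. -/
lemma finsum_dualLine_apply_mk {p : ℙ K (Fin 3 → K)} (hp : p ∈ S) :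
    (∑ᶠ (p : ℙ K (Fin 3 → K)) (_ : p ∈ S), (n p : ℤ) • dualLine p)
      (Associates.mk (linForm p.rep)) = divisor D (Associates.mk (linForm p.rep)) := by
  classical
  rw [finsum_dualLine_apply S n hn, finsum_eq_single _ p]
  · rw [finsum_eq_if, if_pos hp, dualLine_eq, primeDivisor]
    obtain ⟨H, hD, hH⟩ := hn p hp
    have h1 := divisor_apply_eq (irreducible_linForm_rep p) hH (n p)
    rw [← hD] at h1
    rw [h1, Finsupp.smul_apply, Finsupp.single_eq_same]
    simp
  · intro p' hp'
    by_cases hpS : p' ∈ S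
    · rw [finsum_eq_if, if_pos hpS, dualLine_eq, primeDivisor, Finsupp.smul_apply,
        Finsupp.single_eq_of_ne, smul_zero]
      intro h
      exact hp' (mk_linForm_injective h).symm
    · rw [finsum_eq_if, if_neg hpS, Finsupp.zero_apply]

lemma finsum_dualLine_apply_eq_zero {c : Associates (MvPolynomial (Fin 3) K)}
    (hc : ∀ p ∈ S, Associates.mk (linForm p.rep) ≠ c) :
    (∑ᶠ (p : ℙ K (Fin 3 → K)) (_ : p ∈ S), (n p : ℤ) • dualLine p) c = 0 := by
  classical
  rw [finsum_dualLine_apply S n hn]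
  refine finsum_eq_zero_of_forall_eq_zero fun p => ?_
  by_cases hpS : p ∈ S
  · rw [finsum_eq_if, if_pos hpS, dualLine_eq, primeDivisor, Finsupp.smul_apply,
      Finsupp.single_eq_of_ne (hc p hpS).symm, smul_zero]
  · rw [finsum_eq_if, if_neg hpS, Finsupp.zero_apply]

end Sums

/-- The irreducible factors of the resultant form of two curves are dual lines of common points. -/
theorem IsResultantForm.exists_associated_linForm [IsAlgClosed K] {P Q R D : MvPolynomial (Fin 3) K}
    {p q : ℕ} (h : IsResultantForm P Q p q R) (hP : P ≠ 0) (hQ : Q ≠ 0) (hR : R ≠ 0)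
    (hD : Irreducible D) (hDR : D ∣ R) :
    ∃ x : Fin 3 → K, x ≠ 0 ∧ eval x P = 0 ∧ eval x Q = 0 ∧ Associated D (linForm x) := by
  -- the two curves have a common point on the generic line of the component `D`, and their common
  -- points are rational
  obtain ⟨Ω, _, _, _, ω, hω⟩ := exists_generic_point hD
  have hinj := (algebraMap K Ω).injective
  have hω0 : ω ≠ 0 := by
    rintro rfl
    have h1 : ∀ j, D ∣ X j := fun j => (hω (X j)).mp (by rw [aeval_X, Pi.zero_apply])
    have h01 : Associated (X 0 : MvPolynomial (Fin 3) K) (X 1) :=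
      ((X_prime.irreducible.dvd_iff.mp (h1 0)).resolve_left hD.not_isUnit).trans
        ((X_prime.irreducible.dvd_iff.mp (h1 1)).resolve_left hD.not_isUnit).symm
    have := h01.dvd
    rw [X_dvd_X] at this
    simp at this
  have h0 := (hω R).mpr hDR
  rw [← eval_map_algebraMap'] at h0
  obtain ⟨u, hu, huω, huP, huQ⟩ := (h.baseChange (S := Ω)).exists_of_eval_eq_zero hω0 h0
  have hPΩ : map (algebraMap K Ω) P ≠ 0 := by
    rwa [Ne, map_eq_zero_iff _ (MvPolynomial.map_injective _ hinj)]
  have hQΩ : map (algebraMap K Ω) Q ≠ 0 := by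
    rwa [Ne, map_eq_zero_iff _ (MvPolynomial.map_injective _ hinj)]
  obtain ⟨x, c, hx, hc, hux⟩ := h.exists_smul_of_common_zero hR
    (degree_pos_of_eval_eq_zero (h.left.map _) hPΩ huP)
    (degree_pos_of_eval_eq_zero (h.right.map _) hQΩ huQ) hu
    (by rwa [← eval_map_algebraMap']) (by rwa [← eval_map_algebraMap'])
  have hev : ∀ (U : MvPolynomial (Fin 3) K) (r : ℕ), U.IsHomogeneous r →
      eval u (map (algebraMap K Ω) U) = 0 → eval x U = 0 := fun U r hU hU0 => by
    rw [hux, eval_smul_of_isHomogeneous (hU.map _), ← ringHom_eval] at hU0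
    have h1 := (mul_eq_zero.mp hU0).resolve_left (pow_ne_zero _ hc)
    rwa [map_eq_zero] at h1
  refine ⟨x, hx, hev P p h.left huP, hev Q q h.right huQ, ?_⟩
  refine hD.associated_of_dvd (irreducible_linForm hx) ?_
  rw [← hω, ← eval_map_algebraMap' _ (linForm x), map_linForm, eval_linForm]
  rw [hux, smul_dotProduct, smul_eq_mul, mul_eq_zero] at huω
  exact huω.resolve_left hc

/-- The sum of the dual lines of the points of intersection, counted with multiplicity, is the
divisor of the resultant form. -/
theorem intersectionDual_eq_divisor [IsAlgClosed K] {P Q R : MvPolynomial (Fin 3) K}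
    {p q : ℕ} (h : IsResultantForm P Q p q R) (hP : P ≠ 0) (hQ : Q ≠ 0) (hR : R ≠ 0) :
    intersectionDual P Q = divisor R := by
  have hn : ∀ y ∈ (Set.univ : Set (ℙ K (Fin 3 → K))), ∃ H,
      R = linForm y.rep ^ intersectionMultiplicity P Q y * H ∧ ¬ linForm y.rep ∣ H := by
    intro y _
    obtain ⟨n, H, hRH, hH⟩ := exists_eq_pow_mul hR (irreducible_linForm_rep y)
    refine ⟨H, ?_, hH⟩
    have hy : y.rep (chart y) ≠ 0 := (Function.ne_iff.mp y.rep_nonzero).choose_spec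
    rw [intersectionMultiplicity, localMultiplicity_eq h hP hQ hy hRH hH, ← hRH]
  have h1 : intersectionDual P Q = ∑ᶠ (y : ℙ K (Fin 3 → K)) (_ : y ∈ Set.univ),
      (intersectionMultiplicity P Q y : ℤ) • dualLine y := by
    rw [intersectionDual]
    simp
  rw [h1]
  ext c
  by_cases hc : ∃ y : ℙ K (Fin 3 → K), Associates.mk (linForm y.rep) = c
  · obtain ⟨y, rfl⟩ := hc
    exact finsum_dualLine_apply_mk _ _ hn (Set.mem_univ y)
  · push Not at hc
    rw [finsum_dualLine_apply_eq_zero _ _ hn fun y _ => hc y, divisor_apply_eq_zero]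
    intro D hD hDR hDc
    obtain ⟨x, hx, _, _, hDx⟩ := h.exists_associated_linForm hP hQ hR hD hDR
    obtain ⟨y, hy⟩ := exists_associated_linForm_rep hx
    replace hy := hDx.trans hy
    exact hc y (by rw [← hDc, Associates.mk_eq_mk_iff_associated]; exact hy.symm)

end DualLines

/-! ### Critical points and critical values over power series -/

section PowerSeriesRoots

variable {k : Type*} [Field k]

/-- Hensel's lemma for power series. -/
lemma exists_powerSeries_root {f : Polynomial (PowerSeries k)} (hf : IsUnit f.leadingCoeff)
    {θ : k} (h0 : (f.map PowerSeries.constantCoeff).eval θ = 0)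
    (h1 : (f.map PowerSeries.constantCoeff).derivative.eval θ ≠ 0) :
    ∃ c, f.eval c = 0 ∧ PowerSeries.constantCoeff c = θ := by
  have hI : ∀ x : PowerSeries k, x ∈ Ideal.span {(PowerSeries.X : PowerSeries k)} ↔
      PowerSeries.constantCoeff x = 0 := fun x => by
    rw [Ideal.mem_span_singleton, PowerSeries.X_dvd_iff]
  have hev : ∀ g : Polynomial (PowerSeries k), PowerSeries.constantCoeff
      (g.eval (PowerSeries.C θ)) = (g.map PowerSeries.constantCoeff).eval θ := fun g => by
    rw [Polynomial.eval_map, ← Polynomial.eval₂_at_apply]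
    simp
  obtain ⟨u, hu⟩ := hf
  have hmon : (Polynomial.C (↑u⁻¹ : PowerSeries k) * f).Monic := by
    refine Polynomial.monic_C_mul_of_mul_leadingCoeff_eq_one ?_
    rw [← hu, Units.inv_mul]
  have hun : IsUnit (PowerSeries.constantCoeff (↑u⁻¹ : PowerSeries k)) :=
    (u⁻¹).isUnit.map PowerSeries.constantCoeff
  obtain ⟨c, hc, hc'⟩ := HenselianRing.is_henselian
    (I := Ideal.span {(PowerSeries.X : PowerSeries k)}) _ hmon (PowerSeries.C θ) (by
      rw [hI, Polynomial.eval_C_mul, map_mul, hev, h0, mul_zero]) (by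
      refine IsUnit.map _ (PowerSeries.isUnit_iff_constantCoeff.mpr ?_)
      rw [Polynomial.derivative_C_mul, Polynomial.eval_C_mul, map_mul, hev,
        ← Polynomial.derivative_map]
      exact hun.mul (isUnit_iff_ne_zero.mpr h1))
  refine ⟨c, ?_, ?_⟩
  · rw [Polynomial.IsRoot, Polynomial.eval_C_mul] at hc
    exact (Units.mul_right_eq_zero _).mp hc
  · rw [hI, map_sub, PowerSeries.constantCoeff_C, sub_eq_zero] at hc'
    exact hc'

/-- If `f` specializes to `e ^ 2 * a` at `t = 0`, then the roots `θ` of `e` lift to roots `c θ`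
of the derivative of `f`, and the discriminant of `f` is, up to sign, the product of the
critical values `f (c θ)` and of the resultant with the remaining factor of the derivative. -/
lemma exists_critical_points [CharZero k] {f : Polynomial (PowerSeries k)} {d : ℕ} (hd : 0 < d)
    (hfd : f.natDegree = d) (hf : IsUnit f.leadingCoeff) {s : Finset k} {a : Polynomial k}
    (h0 : f.map PowerSeries.constantCoeff = (∏ θ ∈ s, (Polynomial.X - Polynomial.C θ)) ^ 2 * a)
    (ha : ∀ θ ∈ s, a.eval θ ≠ 0) :
    ∃ c : k → PowerSeries k,
      (∀ θ ∈ s, PowerSeries.constantCoeff (c θ) = θ ∧ f.derivative.eval (c θ) = 0) ∧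
      ∀ g : Polynomial k, (∏ θ ∈ s, (Polynomial.X - Polynomial.C θ)) * g =
          (f.map PowerSeries.constantCoeff).derivative →
        ∃ ρ : PowerSeries k,
          (Polynomial.resultant f f.derivative d (d - 1)) ^ 2 =
            ((∏ θ ∈ s, f.eval (c θ)) * ρ) ^ 2 ∧
          PowerSeries.constantCoeff ρ = Polynomial.resultant (f.map PowerSeries.constantCoeff) g
            d (d - 1 - s.card) := by
  classical
  have hder : f.derivative.coeff (d - 1) = f.leadingCoeff * d := by
    rw [Polynomial.coeff_derivative, Nat.sub_add_cancel hd, Polynomial.leadingCoeff, hfd]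
    congr 1
    have : ((d - 1 : ℕ) : PowerSeries k) + 1 = ((d - 1 + 1 : ℕ) : PowerSeries k) := by
      push_cast; rfl
    rw [this, Nat.sub_add_cancel hd]
  have hdu : IsUnit (d : PowerSeries k) := by
    rw [PowerSeries.isUnit_iff_constantCoeff, map_natCast, isUnit_iff_ne_zero]
    exact Nat.cast_ne_zero.mpr hd.ne'
  have hderu : IsUnit (f.derivative.coeff (d - 1)) := by rw [hder]; exact hf.mul hdu
  have hderd : f.derivative.natDegree = d - 1 := by
    refine le_antisymm ?_ (Polynomial.le_natDegree_of_ne_zero hderu.ne_zero)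
    rw [← hfd]; exact Polynomial.natDegree_derivative_le f
  have hderl : IsUnit f.derivative.leadingCoeff := by
    rw [Polynomial.leadingCoeff, hderd]; exact hderu
  have hdm : f.derivative.map PowerSeries.constantCoeff =
      (f.map PowerSeries.constantCoeff).derivative := (Polynomial.derivative_map _ _).symm
  obtain ⟨e, he⟩ : ∃ e : Polynomial k, e = ∏ θ ∈ s, (Polynomial.X - Polynomial.C θ) := ⟨_, rfl⟩
  have hroot : ∀ θ ∈ s, e.eval θ = 0 := fun θ hθ => by
    rw [he, Polynomial.eval_prod]
    exact Finset.prod_eq_zero hθ (by simp)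
  have hder0 : ∀ θ ∈ s, e.derivative.eval θ ≠ 0 := fun θ hθ => by
    rw [he, ← Finset.mul_prod_erase s _ hθ, Polynomial.derivative_mul]
    simp only [Polynomial.derivative_X_sub_C, Polynomial.eval_add, Polynomial.eval_mul,
      Polynomial.eval_prod, one_mul, Polynomial.eval_sub, Polynomial.eval_X,
      Polynomial.eval_C, sub_self, zero_mul, add_zero]
    exact Finset.prod_ne_zero_iff.mpr fun η hη => sub_ne_zero.mpr (Finset.ne_of_mem_erase hη).symm
  rw [← he] at h0
  -- at `t = 0` the derivative has a simple root at `θ`, with slope `2 * e' ^ 2 * a`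
  have hex : ∀ θ ∈ s, ∃ c, f.derivative.eval c = 0 ∧ PowerSeries.constantCoeff c = θ := by
    intro θ hθ
    apply exists_powerSeries_root hderl
    · rw [hdm, h0]
      simp [Polynomial.derivative_mul, Polynomial.derivative_pow, hroot θ hθ]
    · rw [hdm, h0]
      simp only [Polynomial.derivative_mul, Polynomial.derivative_pow, Polynomial.derivative_add,
        Polynomial.eval_add, Polynomial.eval_mul, Polynomial.eval_pow, hroot θ hθ]
      simp [hder0 θ hθ, ha θ hθ]
  choose! c hc hc' using hex
  refine ⟨c, fun θ hθ => ⟨hc' θ hθ, hc θ hθ⟩, fun g hg => ?_⟩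
  have hinj : Set.InjOn c s := fun x hx y hy h => by rw [← hc' x hx, ← hc' y hy, h]
  obtain ⟨h, hh⟩ : ∃ h : Polynomial (PowerSeries k),
    h = ∏ θ ∈ s, (Polynomial.X - Polynomial.C (c θ)) := ⟨_, rfl⟩
  have hder_ne : f.derivative ≠ 0 := fun h => by simp [h] at hderl
  have hdvd : h ∣ f.derivative := by
    have : h = ((s.image c).val.map (fun x => Polynomial.X - Polynomial.C x)).prod := by
      rw [hh, ← Finset.prod_image (g := c) hinj (f := fun x => Polynomial.X - Polynomial.C x)]
      rfl
    rw [this, Multiset.prod_X_sub_C_dvd_iff_le_roots hder_ne,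
      Multiset.le_iff_subset (s.image c).nodup]
    intro x hx
    obtain ⟨θ, hθ, rfl⟩ := Finset.mem_image.mp (Finset.mem_val.mp hx)
    exact (Polynomial.mem_roots hder_ne).mpr (hc θ hθ)
  have hmonic : h.Monic := by
    rw [hh]; exact Polynomial.monic_prod_of_monic _ _ fun _ _ => Polynomial.monic_X_sub_C _
  have hhd : h.natDegree = s.card := by
    rw [hh, Polynomial.natDegree_prod_of_monic _ _ fun _ _ => Polynomial.monic_X_sub_C _]
    simp
  have hhm : h.map PowerSeries.constantCoeff = e := by
    rw [hh, he, Polynomial.map_prod]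
    refine Finset.prod_congr rfl fun θ hθ => ?_
    simp [hc' θ hθ]
  -- the cofactor `g'` of the roots `c θ` in the derivative lifts `g`
  obtain ⟨g', hg'⟩ := hdvd
  have hg0 : g' ≠ 0 := fun h => hder_ne (by rw [hg', h, mul_zero])
  have hgd : h.natDegree + g'.natDegree = d - 1 := by
    rw [← hderd, hg', hmonic.natDegree_mul' hg0]
  have hgm : g'.map PowerSeries.constantCoeff = g := by
    have h1 : e * g'.map PowerSeries.constantCoeff = e * g := by
      rw [he, hg, ← he, ← hhm, ← Polynomial.map_mul, ← hg', hdm]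
    refine mul_left_cancel₀ (fun h => ?_) h1
    rw [h] at hhm
    exact (hmonic.map PowerSeries.constantCoeff).ne_zero hhm
  refine ⟨Polynomial.resultant f g' d g'.natDegree, ?_, ?_⟩
  · -- the resultant of `f` with `h` is, up to sign, the product of the values of `f` at the roots
    have h2 := Polynomial.resultant_mul_right f h g' d hfd.le
    rw [hgd, ← hg'] at h2
    rw [h2, hh, Polynomial.resultant_prod_right _ _ _ _ hfd.le (by simp)]
    simp only [Polynomial.natDegree_X_sub_C, Polynomial.resultant_X_sub_C_right _ _ _ hfd.le,
      Finset.prod_mul_distrib, Finset.prod_const, mul_pow]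
    have : ((((-1 : PowerSeries k) ^ d) ^ s.card) ^ 2) = 1 := by
      rw [← pow_mul, ← pow_mul, mul_comm, pow_mul]
      simp
    rw [this, one_mul]
  · rw [← Polynomial.resultant_map_map, hgm, ← hhd, ← hgd, Nat.add_sub_cancel_left]

/-- The order and the leading coefficient of a critical value, from an approximate square root
`h` of `b ^ (2 * n - 1) * f`. -/
lemma exists_eval_critical_point [CharZero k] {f h b δ G : Polynomial (PowerSeries k)} {n : ℕ}
    (hn : 1 ≤ n) (hf : b ^ (2 * n - 1) * f = h ^ 2 +
      Polynomial.C (PowerSeries.X ^ n) * (b ^ n * δ) + Polynomial.C (PowerSeries.X ^ (n + 1)) * G)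
    {c : PowerSeries k} (hc : f.derivative.eval c = 0)
    (h0 : PowerSeries.constantCoeff (h.eval c) = 0)
    (h1 : PowerSeries.constantCoeff (h.derivative.eval c) ≠ 0)
    (hb : PowerSeries.constantCoeff (b.eval c) ≠ 0) :
    ∃ ψ, f.eval c = PowerSeries.X ^ n * ψ ∧
      PowerSeries.constantCoeff (b.eval c) ^ (n - 1) * PowerSeries.constantCoeff ψ =
        PowerSeries.constantCoeff (δ.eval c) := by
  obtain ⟨m, rfl⟩ : ∃ m, n = m + 1 := ⟨n - 1, by omega⟩
  rw [show 2 * (m + 1) - 1 = 2 * m + 1 by omega] at hf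
  have e0 := congrArg (Polynomial.eval c) hf
  have e1 := congrArg (fun p => Polynomial.eval c p.derivative) hf
  simp only [Polynomial.derivative_mul, Polynomial.derivative_pow, Polynomial.derivative_add,
    Polynomial.eval_add, Polynomial.eval_mul, Polynomial.eval_pow, hc, Polynomial.derivative_C,
    Polynomial.eval_C, zero_mul, mul_zero, add_zero, zero_add,
    Nat.add_sub_cancel, Nat.cast_ofNat] at e0 e1
  have hbu : IsUnit (b.eval c) :=
    PowerSeries.isUnit_iff_constantCoeff.mpr (isUnit_iff_ne_zero.mpr hb)
  set b0 := b.eval c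
  set b1 := b.derivative.eval c
  set H0 := h.eval c
  set H1 := h.derivative.eval c
  set D0 := δ.eval c
  set D1 := δ.derivative.eval c
  set G0 := G.eval c
  set G1 := G.derivative.eval c
  set T : PowerSeries k := PowerSeries.X
  have hunit : IsUnit ((2 * m + 1) * b1 * H0 - b0 * (2 * H1)) := by
    rw [PowerSeries.isUnit_iff_constantCoeff, isUnit_iff_ne_zero]
    simp [h0, h1, hb, map_ofNat (PowerSeries.constantCoeff (R := k)) 2]
  -- the relation `hf` and its derivative at the critical point force `h` to vanish there modulo
  -- `t ^ n`: eliminating the value of `f`, they give a unit times `h (c)`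
  have hdvd : T ^ (m + 1) ∣ H0 := by
    rw [← hunit.dvd_mul_left]
    refine ⟨b0 * (b0 ^ (m + 1) * D1 + (m + 1) * b0 ^ m * b1 * D0 + T * G1)
      - (2 * m + 1) * b1 * (b0 ^ (m + 1) * D0 + T * G0), ?_⟩
    push_cast at e1
    simp only [pow_one] at e1
    linear_combination b0 * e1 - (2 * m + 1) * b1 * e0
  obtain ⟨y, hy⟩ := hdvd
  obtain ⟨v, hv⟩ := (hbu.pow (2 * m + 1)).exists_right_inv
  refine ⟨v * (T ^ (m + 1) * y ^ 2 + b0 ^ (m + 1) * D0 + T * G0), ?_, ?_⟩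
  · rw [hy] at e0
    linear_combination v * e0 - f.eval c * hv
  · have hv' := congrArg (PowerSeries.constantCoeff (R := k)) hv
    simp only [map_mul, map_pow, map_one, map_add, PowerSeries.constantCoeff_X, Nat.add_sub_cancel,
      zero_mul, add_zero, T, zero_pow (Nat.succ_ne_zero m), zero_add] at hv' ⊢
    linear_combination PowerSeries.constantCoeff D0 * hv'

end PowerSeriesRoots

/-! ### Derivations of extension fields and generic points -/

section Derivations

open TensorProduct

variable {K Ω : Type u} [Field K] [CharZero K] [Field Ω] [Algebra K Ω]

/-- In characteristic zero a partial derivative with respect to a member of a transcendence basis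
extends to the whole field, which is formally étale over the polynomial ring of the basis. -/
lemma exists_derivation_ne_zero {z : Ω} (hz : Transcendental K z) :
    ∃ δ : Derivation K Ω Ω, δ z ≠ 0 := by
  obtain ⟨s, hs, hb⟩ := exists_isTranscendenceBasis_superset (s := {z}) (R := K) (A := Ω) (by
    rwa [AlgebraicIndepOn, algebraicIndependent_unique_type_iff])
  let A := MvPolynomial s K
  let φ : A →ₐ[K] Ω := MvPolynomial.aeval ((↑) : s → Ω)
  have hφ : Function.Injective φ := hb.1
  let : Algebra A Ω := φ.toAlgebra
  have : IsScalarTower K A Ω := IsScalarTower.of_algebraMap_eq fun x => (φ.commutes x).symm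
  have : FaithfulSMul A Ω := (faithfulSMul_iff_algebraMap_injective A Ω).mpr hφ
  let : Algebra (FractionRing A) Ω := FractionRing.liftAlgebra A Ω
  have : IsScalarTower A (FractionRing A) Ω := FractionRing.isScalarTower_liftAlgebra A Ω
  have : Algebra.IsAlgebraic A Ω := by
    have := hb.isAlgebraic
    refine Algebra.IsAlgebraic.ringHom_of_comp_eq
      (hb.1.aevalEquiv.symm : _ ≃ₐ[K] A) (RingHom.id Ω)
      (EquivLike.injective _) Function.surjective_id (RingHom.ext fun x => ?_)
    obtain ⟨y, rfl⟩ := hb.1.aevalEquiv.surjective x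
    simp only [RingHom.comp_apply, RingHom.coe_coe, AlgEquiv.symm_apply_apply, RingHom.id_apply]
    exact (hb.1.algebraMap_aevalEquiv y).symm
  have : Algebra.IsAlgebraic (FractionRing A) Ω :=
    IsFractionRing.comap_isAlgebraic_iff.mp ‹Algebra.IsAlgebraic A Ω›
  have : CharZero (FractionRing A) :=
    charZero_of_injective_algebraMap (IsFractionRing.injective A (FractionRing A))
  have : Algebra.FormallyEtale (FractionRing A) Ω := Algebra.FormallyEtale.of_isSeparable _ _
  have : Algebra.FormallyEtale A (FractionRing A) :=
    Algebra.FormallyEtale.of_isLocalization (nonZeroDivisors A)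
  have : Algebra.FormallyEtale A Ω := Algebra.FormallyEtale.comp A (FractionRing A) Ω
  classical
  let i : s := ⟨z, hs rfl⟩
  let D0 : Derivation K A Ω := MvPolynomial.mkDerivation K (Pi.single i 1)
  let e := KaehlerDifferential.tensorKaehlerEquivOfFormallyEtale K A Ω
  let l : (Ω ⊗[A] Ω[A⁄K]) →ₗ[Ω] Ω := D0.liftKaehlerDifferential.liftBaseChange Ω
  refine ⟨(l ∘ₗ e.symm.toLinearMap).compDer (KaehlerDifferential.D K Ω), ?_⟩
  have hz' : z = algebraMap A Ω (MvPolynomial.X i) :=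
    (MvPolynomial.aeval_X (R := K) ((↑) : s → Ω) i).symm
  have : l (e.symm (KaehlerDifferential.D K Ω z)) = 1 := by
    rw [hz', KaehlerDifferential.tensorKaehlerEquivOfFormallyEtale_symm_D_algebraMap]
    simp only [LinearMap.liftBaseChange_tmul, one_smul, Derivation.liftKaehlerDifferential_comp_D,
      l, D0]
    exact (MvPolynomial.mkDerivation_X K _ i).trans (Pi.single_eq_same i 1)
  intro h
  exact one_ne_zero (this.symm.trans h)

lemma mul_eq_mul_of_cross_eq_zero {R : Type*} [CommRing R] {v w : Fin 3 → R} (h : v ⨯₃ w = 0)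
    (i j : Fin 3) : v i * w j = v j * w i := by
  have h0 := congrFun h 0
  have h1 := congrFun h 1
  have h2 := congrFun h 2
  simp only [cross_apply, Matrix.cons_val_zero, Matrix.cons_val_one, Matrix.cons_val,
    Pi.zero_apply] at h0 h1 h2
  fin_cases i <;> fin_cases j <;> simp only [Fin.zero_eta, Fin.mk_one, Fin.reduceFinMk] <;>
    first | rfl | linear_combination h0 | linear_combination h1 | linear_combination h2 |
      linear_combination -h0 | linear_combination -h1 | linear_combination -h2

/-- A point that is not rational moves under some derivation. -/
lemma exists_derivation_cross_ne_zero [IsAlgClosed K] {w : Fin 3 → Ω}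
    (hw : ¬ ∃ (c : Ω) (x : Fin 3 → K), w = c • (algebraMap K Ω ∘ x)) :
    ∃ δ : Derivation K Ω Ω, w ⨯₃ (δ ∘ w) ≠ 0 := by
  have hw0 : w ≠ 0 := fun h => hw ⟨0, 0, by simp [h]⟩
  obtain ⟨j, hj⟩ := Function.ne_iff.mp hw0
  rw [Pi.zero_apply] at hj
  obtain ⟨i, hi⟩ : ∃ i, Transcendental K (w i / w j) := by
    by_contra! h
    have : ∀ i, ∃ x : K, algebraMap K Ω x = w i / w j := fun i =>
      minpoly.mem_range_of_degree_eq_one K _ (IsAlgClosed.degree_eq_one_of_irreducible K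
        (minpoly.irreducible (not_not.mp (h i)).isIntegral))
    choose x hx using this
    refine hw ⟨w j, x, funext fun i => ?_⟩
    simp only [Pi.smul_apply, Function.comp_apply, hx, smul_eq_mul]
    field_simp
  obtain ⟨δ, hδ⟩ := exists_derivation_ne_zero hi
  refine ⟨δ, fun h => hδ ?_⟩
  have h1 := mul_eq_mul_of_cross_eq_zero h i j
  have h2 : δ (w i) = (w i / w j) * δ (w j) + w j * δ (w i / w j) := by
    have h3 := δ.leibniz (w i / w j) (w j)
    rw [div_mul_cancel₀ _ hj, smul_eq_mul, smul_eq_mul] at h3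
    exact h3
  simp only [Function.comp_apply] at h1
  have h4 : w j ^ 2 * δ (w i / w j) = 0 := by
    have h5 : w j * (w i / w j) = w i := by field_simp
    linear_combination -h1 - w j * h2 - δ (w j) * h5
  exact (mul_eq_zero.mp h4).resolve_left (pow_ne_zero 2 hj)

omit [CharZero K] in
lemma derivation_aeval (δ : Derivation K Ω Ω) (H : MvPolynomial (Fin 3) K) (v : Fin 3 → Ω) :
    δ (aeval v H) = (δ ∘ v) ⬝ᵥ gradientAt (H.map (algebraMap K Ω)) v := by
  have h : ∀ i, gradientAt (H.map (algebraMap K Ω)) v i = aeval v (pderiv i H) := fun i => by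
    rw [gradientAt, pderiv_map, eval_map_algebraMap']
  simp only [dotProduct, h, Function.comp_apply]
  induction H using MvPolynomial.induction_on with
  | C a => simp
  | add p q hp hq =>
    simp only [map_add, mul_add, Finset.sum_add_distrib] at *
    rw [hp fun i => by rw [gradientAt, pderiv_map, eval_map_algebraMap'],
      hq fun i => by rw [gradientAt, pderiv_map, eval_map_algebraMap']]
  | mul_X p j hp =>
    have hp' := hp fun i => by rw [gradientAt, pderiv_map, eval_map_algebraMap']
    simp only [map_mul, Derivation.leibniz, aeval_X, smul_eq_mul, hp', map_add, mul_add,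
      Finset.sum_add_distrib]
    have h1 : ∑ i, δ (v i) * ((aeval v) p * (aeval v) (pderiv i (X j : MvPolynomial (Fin 3) K))) =
        aeval v p * δ (v j) := by
      rw [Finset.sum_eq_single j]
      · rw [pderiv_X_self, map_one]; ring
      · intro i _ hij
        rw [pderiv_X_of_ne hij.symm, map_zero, mul_zero, mul_zero]
      · simp
    rw [h1, Finset.mul_sum]
    congr 1
    exact Finset.sum_congr rfl fun i _ => by ring

end Derivations

section Duals

variable {K : Type u} [Field K]

lemma not_dvd_of_degree_lt {P Q : MvPolynomial (Fin 3) K} {d e : ℕ} (hP : P.IsHomogeneous d)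
    (hQ : Q.IsHomogeneous e) (h : e < d) (hQ0 : Q ≠ 0) : ¬ P ∣ Q := by
  rintro ⟨H, rfl⟩
  have h1 := hQ.totalDegree hQ0
  rw [totalDegree_mul_of_isDomain (left_ne_zero_of_mul hQ0) (right_ne_zero_of_mul hQ0),
    hP.totalDegree (left_ne_zero_of_mul hQ0)] at h1
  omega

lemma dvd_of_forall_eval_eq_zero [IsAlgClosed K] {D H : MvPolynomial (Fin 3) K}
    (hD : Irreducible D) (h : ∀ v, eval v D = 0 → eval v H = 0) : D ∣ H := by
  have hp : (Ideal.span {D}).IsPrime := (Ideal.span_singleton_prime hD.ne_zero).mpr hD.prime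
  have hI : vanishingIdeal K (zeroLocus K (Ideal.span {D})) = Ideal.span {D} :=
    (vanishingIdeal_zeroLocus_eq_radical _).trans hp.radical
  rw [← Ideal.mem_span_singleton, ← hI]
  intro v hv
  have : aeval v D = 0 := hv D (Ideal.mem_span_singleton_self D)
  rw [aeval_eq_eval] at this ⊢
  exact h v this

variable [IsAlgClosed K] [CharZero K]

/-- An irreducible curve of degree at least two is not a cone: if the derivative in the direction
`x` vanishes, then the curve contains the line that joins `x` to any of its points. -/
lemma dirDeriv_ne_zero {D : MvPolynomial (Fin 3) K} {d : ℕ} (hD : Irreducible D)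
    (hd : D.IsHomogeneous d) (hd2 : 2 ≤ d) {x : Fin 3 → K} (hx : x ≠ 0) : dirDeriv x D ≠ 0 := by
  intro h0
  have htrans : ∀ (v : Fin 3 → K) (t : K), eval (t • x + v) D = eval v D := fun v t => by
    have h1 : (linePoly D x v).natDegree = 0 :=
      Polynomial.derivative_eq_zero.mp (by
        rw [derivative_linePoly, h0, linePoly, map_zero])
    have h2 : ∀ s, (linePoly D x v).eval s = (linePoly D x v).coeff 0 := fun s => by
      rw [Polynomial.eq_C_of_natDegree_eq_zero h1]; simp
    have h3 := (h2 t).trans (h2 0).symm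
    rwa [eval_linePoly, eval_linePoly, zero_smul, zero_add] at h3
  obtain ⟨j, hj⟩ := Function.ne_iff.mp hx
  have hj : x j ≠ 0 := hj
  obtain ⟨R, hR⟩ := exists_isResultantForm hd (isHomogeneous_linForm (Pi.single j (1 : K)))
  obtain ⟨a, b, hab, hab0⟩ : ∃ a b : Fin 3 → K, a ⨯₃ b ≠ 0 ∧
      (a ⨯₃ b = 0 ∨ a ⨯₃ b = Pi.single j 1) := by
    have hs : (Pi.single j 1 : Fin 3 → K) ≠ 0 := by simp
    obtain ⟨a, ha, haw⟩ := exists_dotProduct_eq_zero (Pi.single j (1 : K))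
    obtain ⟨b, hb⟩ := exists_cross_eq ha haw
    exact ⟨a, b, by rw [hb]; exact hs, Or.inr hb⟩
  replace hab0 := hab0.resolve_left hab
  -- a zero of `D` on the line `X j = 0`
  obtain ⟨v, hv0, hvj, hvD⟩ : ∃ v : Fin 3 → K, v ≠ 0 ∧ v j = 0 ∧ eval v D = 0 := by
    have hline : ∀ s t : K, (s • a + t • b) j = 0 := fun s t => by
      have h1 := lincomb_dotProduct_cross a b s t
      rw [hab0, dotProduct_single, mul_one] at h1
      exact h1
    by_cases ha : eval a D = 0
    · refine ⟨a, fun h => hab (by rw [h]; simp), ?_, ha⟩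
      simpa using hline 1 0
    · have h1 := natDegree_linePoly hd b ha
      obtain ⟨t, ht⟩ := IsAlgClosed.exists_root (linePoly D a b) (fun h => by
        rw [Polynomial.degree_eq_natDegree (fun h => by rw [h] at h1; simp at h1; omega), h1] at h
        have : d = 0 := by exact_mod_cast h
        omega)
      rw [Polynomial.IsRoot, eval_linePoly] at ht
      refine ⟨t • a + b, ?_, ?_, ht⟩
      · simpa using lincomb_ne_zero hab (x := t) (y := 1) (Or.inr one_ne_zero)
      · simpa using hline t 1
  have hxv : x ⨯₃ v ≠ 0 := fun h => hv0 (funext fun i => by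
    have h1 := mul_eq_mul_of_cross_eq_zero h i j
    rw [hvj, mul_zero] at h1
    exact (mul_eq_zero.mp h1.symm).resolve_left hj)
  have hdvd : linForm (x ⨯₃ v) ∣ D := linForm_dvd_of_forall hxv fun w hw => by
    obtain ⟨s, t, rfl⟩ := exists_lincomb_of_dotProduct_cross hxv (dotProduct_comm w _ ▸ hw)
    rw [htrans, eval_smul_of_isHomogeneous hd, hvD, mul_zero]
  have hass := (irreducible_linForm hxv).associated_of_dvd hD hdvd
  exact not_dvd_of_degree_lt hd (isHomogeneous_linForm _) (by omega) (linForm_ne_zero hxv)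
    hass.symm.dvd

omit [CharZero K] in
/-- A point of an irreducible curve in an extension field is generic or rational: a common point
with a curve that does not contain the given one is rational. -/
lemma dvd_or_exists_smul {Ω : Type u} [Field Ω] [Algebra K Ω] {D : MvPolynomial (Fin 3) K} {d : ℕ}
    (hD : Irreducible D) (hd : D.IsHomogeneous d) {v : Fin 3 → Ω} (hv : v ≠ 0)
    (hvD : aeval v D = 0) :
    (∀ (H : MvPolynomial (Fin 3) K) (e : ℕ), H.IsHomogeneous e → aeval v H = 0 → D ∣ H) ∨
    ∃ (x : Fin 3 → K) (c : Ω), x ≠ 0 ∧ c ≠ 0 ∧ v = c • (algebraMap K Ω ∘ x) := by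
  by_cases h : ∀ (H : MvPolynomial (Fin 3) K) (e : ℕ), H.IsHomogeneous e → aeval v H = 0 → D ∣ H
  · exact Or.inl h
  · right
    push Not at h
    obtain ⟨H, e, he, hH, hDH⟩ := h
    have hH0 : H ≠ 0 := fun h => hDH (h ▸ dvd_zero D)
    have hep : 0 < e := by
      rw [Nat.pos_iff_ne_zero]
      rintro rfl
      obtain ⟨c, hc, rfl⟩ := exists_eq_C_of_isUnit (isUnit_of_isHomogeneous_zero he hH0)
      rw [aeval_C, map_eq_zero] at hH
      exact hc hH
    obtain ⟨R, hR⟩ := exists_isResultantForm hd he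
    exact hR.exists_smul_of_common_zero
      (hR.ne_zero hD.ne_zero hH0 (hD.isRelPrime_iff_not_dvd.mpr hDH))
      (degree_pos_of_irreducible hd hD) hep hv hvD hH

omit [IsAlgClosed K] [CharZero K] in
lemma aeval_dirDeriv {Ω : Type u} [Field Ω] [Algebra K Ω] (D : MvPolynomial (Fin 3) K)
    (x : Fin 3 → K) (v : Fin 3 → Ω) : aeval v (dirDeriv x D) =
      (algebraMap K Ω ∘ x) ⬝ᵥ gradientAt (D.map (algebraMap K Ω)) v := by
  rw [← eval_map_algebraMap', map_dirDeriv, eval_dirDeriv_eq_dotProduct]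

end Duals

/-! ### Components of the discriminant form of an irreducible curve -/

section DualOfIrreducible

variable {K : Type u} [Field K] [IsAlgClosed K] [CharZero K]

lemma not_dvd_dirDeriv {D : MvPolynomial (Fin 3) K} {d : ℕ} (hD : Irreducible D)
    (hd : D.IsHomogeneous d) (hd2 : 2 ≤ d) {x : Fin 3 → K} (hx : x ≠ 0) : ¬ D ∣ dirDeriv x D :=
  not_dvd_of_degree_lt hd (isHomogeneous_dirDeriv hd x) (by omega) (dirDeriv_ne_zero hD hd hd2 hx)

omit [IsAlgClosed K] [CharZero K] in
lemma pderiv_eq_dirDeriv (i : Fin 3) (D : MvPolynomial (Fin 3) K) :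
    pderiv i D = dirDeriv (Pi.single i 1) D := by
  rw [dirDeriv, Finset.sum_eq_single i]
  · simp
  · intro j _ hj
    rw [Pi.single_eq_of_ne hj, map_zero, zero_mul]
  · simp

omit [IsAlgClosed K] [CharZero K] in
lemma gradientAt_map_apply {Ω : Type u} [Field Ω] [Algebra K Ω] (D : MvPolynomial (Fin 3) K)
    (v : Fin 3 → Ω) (i : Fin 3) :
    gradientAt (D.map (algebraMap K Ω)) v i = aeval v (pderiv i D) := by
  rw [gradientAt, pderiv_map, eval_map_algebraMap']

omit [IsAlgClosed K] [CharZero K] in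
lemma gradientAt_map_rational {Ω : Type u} [Field Ω] [Algebra K Ω] (D : MvPolynomial (Fin 3) K)
    (x : Fin 3 → K) :
    gradientAt (D.map (algebraMap K Ω)) (algebraMap K Ω ∘ x) = algebraMap K Ω ∘ gradientAt D x := by
  ext i
  rw [gradientAt_map_apply, Function.comp_apply, gradientAt, ← aeval_eq_eval,
    ← aeval_algebraMap_apply]

omit [IsAlgClosed K] [CharZero K] in
lemma gradientAt_smul {D : MvPolynomial (Fin 3) K} {d : ℕ} (hd : D.IsHomogeneous d) (c : K)
    (v : Fin 3 → K) : gradientAt D (c • v) = c ^ (d - 1) • gradientAt D v := by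
  ext i
  exact eval_smul_of_isHomogeneous (hd.pderiv) c v

omit [IsAlgClosed K] in
/-- A rational point is not the generic point of an irreducible curve of the dual plane. -/
lemma not_rational_of_generic {Ω : Type u} [Field Ω] [Algebra K Ω] {G : MvPolynomial (Fin 3) K}
    (hG : Irreducible G) {ω : Fin 3 → Ω} (hω : ∀ H : MvPolynomial (Fin 3) K, aeval ω H = 0 ↔ G ∣ H)
    (c : Ω) (x : Fin 3 → K) : ω ≠ c • (algebraMap K Ω ∘ x) := by
  intro h
  have hdvd : ∀ y : Fin 3 → K, y ⬝ᵥ x = 0 → G ∣ linForm y := fun y hy => by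
    rw [← hω, ← eval_map_algebraMap', map_linForm, eval_linForm, h, dotProduct_smul,
      ← RingHom.map_dotProduct, hy, map_zero, smul_zero]
  obtain ⟨y, hy, hyx⟩ := exists_dotProduct_eq_zero x
  obtain ⟨z, hz⟩ := exists_cross_eq hy hyx
  have hyG := hG.associated_of_dvd (irreducible_linForm hy) (hdvd y hyx)
  by_cases hx : x = 0
  · have h1 : ∀ w : Fin 3 → K, ∃ c : K, w = c • y := fun w =>
      exists_smul_of_linForm_dvd (hyG.symm.dvd.trans (hdvd w (by rw [hx, dotProduct_zero])))
    obtain ⟨a, ha⟩ := h1 (Pi.single 0 1)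
    obtain ⟨b, hb⟩ := h1 (Pi.single 1 1)
    have ha0 := congrFun ha 0
    have ha1 := congrFun ha 1
    have hb0 := congrFun hb 0
    have hb1 := congrFun hb 1
    simp at ha0 ha1 hb0 hb1
    rcases ha1 with rfl | h1
    · simp at ha0
    · simp [h1] at hb1
  · obtain ⟨c, hc⟩ := exists_smul_of_linForm_dvd (hyG.symm.dvd.trans (hdvd z (by
      rw [← hz, dotProduct_comm, dotProduct_comm]; exact dot_cross_self y z)))
    rw [hc, map_smul, cross_self, smul_zero] at hz
    exact hx hz.symm

omit [IsAlgClosed K] [CharZero K] in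
lemma comp_algebraMap_ne_zero {Ω : Type u} [Field Ω] [Algebra K Ω] {x : Fin 3 → K} (hx : x ≠ 0) :
    algebraMap K Ω ∘ x ≠ 0 := fun h => hx (funext fun i => by
  have := congrFun h i
  simpa using this)

/-- The components of the discriminant form of an irreducible curve: the duals of its singular
points and its usual dual. The generic line `ω` of a component is tangent to the curve at a point
`v` in an extension field, that is, the gradient at `v` is `s • ω`. If `s = 0`, then `v` is
singular, so it is rational. Otherwise `v` is the generic point, since the tangent line at a
rational point is rational, and `ω` is the tangent line at the generic point. -/
theorem IsDiscriminantForm.exists_of_dvd {D R G : MvPolynomial (Fin 3) K} {d : ℕ}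
    (h : IsDiscriminantForm D d R) (hD : Irreducible D) (hd : 2 ≤ d) (hG : Irreducible G)
    (hGR : G ∣ R) :
    (∃ x : Fin 3 → K, x ≠ 0 ∧ gradientAt D x = 0 ∧ Associated G (linForm x)) ∨
      vanishingIdeal K (tangentCone D) = Ideal.span {G} := by
  have hR0 := h.ne_zero hD.squarefree
  obtain ⟨Ω, _, _, _, ω, hω⟩ := exists_generic_point hG
  have hω0 : ω ≠ 0 := fun h0 => not_rational_of_generic hG hω 0 0 (by rw [h0, zero_smul])
  have hΩ := h.baseChange (S := Ω)
  have hRω : eval ω (R.map (algebraMap K Ω)) = 0 := by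
    rw [eval_map_algebraMap']; exact (hω R).mpr hGR
  obtain ⟨v, s, hv, hvω, hgrad⟩ := hΩ.exists_of_eval_eq_zero hω0 hRω
  have : CharZero Ω := charZero_of_injective_algebraMap (algebraMap K Ω).injective
  have hvD : aeval v D = 0 := by
    have h1 := dotProduct_gradientAt hΩ.left v
    rw [hgrad, dotProduct_smul, hvω, smul_zero, eval_map_algebraMap'] at h1
    exact (mul_eq_zero.mp h1.symm).resolve_left (Nat.cast_ne_zero.mpr (by omega))
  have hrat : ∀ (x : Fin 3 → K) (c : Ω), x ≠ 0 → c ≠ 0 → v = c • (algebraMap K Ω ∘ x) →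
      s = 0 ∧ Associated G (linForm x) := fun x c hx hc hvx => by
    constructor
    · by_contra hs
      rw [hvx, gradientAt_smul hΩ.left, gradientAt_map_rational] at hgrad
      refine not_rational_of_generic hG hω (s⁻¹ * c ^ (d - 1)) (gradientAt D x) ?_
      rw [mul_smul, hgrad, smul_smul, inv_mul_cancel₀ hs, one_smul]
    · refine hG.associated_of_dvd (irreducible_linForm hx) ?_
      rw [← hω, ← eval_map_algebraMap', map_linForm, eval_linForm]
      rw [hvx, smul_dotProduct, smul_eq_mul] at hvω
      exact (mul_eq_zero.mp hvω).resolve_left hc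
  by_cases hs : s = 0
  · left
    rw [hs, zero_smul] at hgrad
    rcases dvd_or_exists_smul hD h.left hv hvD with hgen | ⟨x, c, hx, hc, hvx⟩
    · exfalso
      refine not_dvd_dirDeriv hD h.left hd (x := Pi.single 0 1) (by simp) ?_
      refine hgen _ _ (isHomogeneous_dirDeriv h.left _) ?_
      rw [aeval_dirDeriv, hgrad, dotProduct_zero]
    · refine ⟨x, hx, ?_, (hrat x c hx hc hvx).2⟩
      rw [hvx, gradientAt_smul hΩ.left, gradientAt_map_rational, smul_eq_zero] at hgrad
      by_contra h1
      exact comp_algebraMap_ne_zero h1 (hgrad.resolve_left (pow_ne_zero _ hc))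
  · right
    have hgen : ∀ (H : MvPolynomial (Fin 3) K) (e : ℕ), H.IsHomogeneous e → aeval v H = 0 → D ∣ H :=
      (dvd_or_exists_smul hD h.left hv hvD).resolve_right fun ⟨x, c, hx, hc, hvx⟩ =>
        hs (hrat x c hx hc hvx).1
    -- the normalization `s = 1`
    obtain ⟨r, hr⟩ := IsAlgClosed.exists_pow_nat_eq s⁻¹ (n := d - 1) (by omega)
    have hr0 : r ≠ 0 := fun h0 => by
      rw [h0, zero_pow (by omega)] at hr
      exact hs (inv_eq_zero.mp hr.symm)
    have hω' : ω = gradientAt (D.map (algebraMap K Ω)) (r • v) := by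
      rw [gradientAt_smul hΩ.left, hr, hgrad, smul_smul, inv_mul_cancel₀ hs, one_smul]
    have hrvD : aeval (r • v) D = 0 := by
      rw [aeval_smul_of_isHomogeneous h.left, hvD, mul_zero]
    have hcomp : ∀ H : MvPolynomial (Fin 3) K,
        aeval (r • v) (aeval (fun i => pderiv i D) H) = aeval ω H := fun H => by
      rw [← AlgHom.comp_apply, comp_aeval]
      congr 2
      funext i
      rw [hω', gradientAt_map_apply]
    have heval : ∀ (H : MvPolynomial (Fin 3) K) (x : Fin 3 → K),
        eval x (aeval (fun i => pderiv i D) H) = eval (gradientAt D x) H := fun H x => by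
      rw [← aeval_eq_eval, ← AlgHom.comp_apply, comp_aeval, ← aeval_eq_eval]
      rfl
    obtain ⟨e, he⟩ := isHomogeneous_of_dvd h.isHomogeneous hR0 hGR
    ext H
    rw [Ideal.mem_span_singleton, mem_vanishingIdeal_iff]
    constructor
    · intro hH
      rw [← hω, ← hcomp]
      -- the two factors that `D` does not divide take care of the origin and of singular points
      obtain ⟨i, hi⟩ : ∃ i : Fin 3, ¬ D ∣ X i := by
        refine ⟨0, not_dvd_of_degree_lt h.left (isHomogeneous_X K 0) (by omega) (X_ne_zero 0)⟩
      have hdvd : D ∣ aeval (fun i => pderiv i D) H * (X i * dirDeriv (Pi.single 0 1) D) := by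
        refine dvd_of_forall_eval_eq_zero hD fun x hx => ?_
        rw [map_mul, map_mul, heval, eval_X, ← pderiv_eq_dirDeriv]
        by_cases hx0 : x = 0
        · rw [hx0, Pi.zero_apply, zero_mul, mul_zero]
        · by_cases hg : gradientAt D x = 0
          · have : eval x (pderiv 0 D) = 0 := congrFun hg 0
            rw [this, mul_zero, mul_zero]
          · have h1 := hH (gradientAt D x) ⟨x, 1, hx0, hx, hg, (one_smul _ _).symm⟩
            rw [aeval_eq_eval] at h1
            rw [h1, zero_mul]
      have h1 := (hD.prime.dvd_or_dvd hdvd).resolve_right fun h1 =>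
        (hD.prime.dvd_or_dvd h1).elim hi (not_dvd_dirDeriv hD h.left hd (by simp))
      obtain ⟨T, hT⟩ := h1
      rw [hT, map_mul, hrvD, zero_mul]
    · rintro ⟨T, rfl⟩ w ⟨x, c, hx0, hx, hg, rfl⟩
      have hdvd : D ∣ aeval (fun i => pderiv i D) G := by
        refine hgen _ ((d - 1) * e) ?_ ?_
        · exact he.aeval _ fun i => h.left.pderiv
        · have h1 : aeval (r • v) (aeval (fun i => pderiv i D) G) = 0 := by
            rw [hcomp]; exact (hω G).mpr dvd_rfl
          have h2 : (aeval (fun i => pderiv i D) G).IsHomogeneous ((d - 1) * e) :=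
            he.aeval _ fun i => h.left.pderiv
          rw [aeval_smul_of_isHomogeneous h2] at h1
          exact (mul_eq_zero.mp h1).resolve_left (pow_ne_zero _ hr0)
      obtain ⟨T', hT'⟩ := hdvd
      have h1 := heval G x
      rw [hT', map_mul, hx, zero_mul] at h1
      rw [aeval_eq_eval, map_mul, eval_smul_of_isHomogeneous he, ← h1, mul_zero, zero_mul]

end DualOfIrreducible

/-! ### Generic tangent lines -/

section GenericTangent

/-! Here `v` is the generic point of the irreducible curve `D = 0` of degree at least two, and `w`
is the tangent line at `v`. -/

variable {K Ω : Type u} [Field K] [IsAlgClosed K] [CharZero K] [Field Ω] [Algebra K Ω]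
  {D : MvPolynomial (Fin 3) K} {d : ℕ} {v : Fin 3 → Ω}

/-- The generic tangent line does not pass through a rational point. -/
lemma dotProduct_generic_tangent_ne_zero (hD : Irreducible D) (hd : D.IsHomogeneous d) (hd2 : 2 ≤ d)
    (hv : ∀ H : MvPolynomial (Fin 3) K, aeval v H = 0 ↔ D ∣ H) {x : Fin 3 → K} (hx : x ≠ 0) :
    (algebraMap K Ω ∘ x) ⬝ᵥ gradientAt (D.map (algebraMap K Ω)) v ≠ 0 := by
  rw [← aeval_dirDeriv, Ne, hv]
  exact not_dvd_dirDeriv hD hd hd2 hx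

lemma generic_tangent_ne_zero (hD : Irreducible D) (hd : D.IsHomogeneous d) (hd2 : 2 ≤ d)
    (hv : ∀ H : MvPolynomial (Fin 3) K, aeval v H = 0 ↔ D ∣ H) :
    gradientAt (D.map (algebraMap K Ω)) v ≠ 0 := fun h =>
  dotProduct_generic_tangent_ne_zero hD hd hd2 hv (x := Pi.single 0 1) (by simp)
    (by rw [h, dotProduct_zero])

/-- The generic tangent line moves under some derivation. -/
lemma exists_derivation_generic_tangent (hD : Irreducible D) (hd : D.IsHomogeneous d) (hd2 : 2 ≤ d)
    (hv : ∀ H : MvPolynomial (Fin 3) K, aeval v H = 0 ↔ D ∣ H) :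
    ∃ δ : Derivation K Ω Ω, gradientAt (D.map (algebraMap K Ω)) v ⨯₃
      (δ ∘ gradientAt (D.map (algebraMap K Ω)) v) ≠ 0 := by
  apply exists_derivation_cross_ne_zero
  rintro ⟨c, x, hx⟩
  obtain ⟨y, hy, hyx⟩ := exists_dotProduct_eq_zero x
  refine dotProduct_generic_tangent_ne_zero hD hd hd2 hv hy ?_
  rw [hx, dotProduct_smul, ← RingHom.map_dotProduct, hyx, map_zero, smul_zero]

omit [IsAlgClosed K] [CharZero K] in
lemma dotProduct_derivation_tangent (hd : D.IsHomogeneous d)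
    (hvD : aeval v D = 0) (δ : Derivation K Ω Ω) :
    v ⬝ᵥ gradientAt (D.map (algebraMap K Ω)) v = 0 ∧
      (δ ∘ v) ⬝ᵥ gradientAt (D.map (algebraMap K Ω)) v = 0 := by
  constructor
  · rw [dotProduct_gradientAt (hd.map _), eval_map_algebraMap', hvD, mul_zero]
  · rw [← derivation_aeval, hvD, map_zero]

omit [IsAlgClosed K] [CharZero K] in
lemma derivation_dotProduct (δ : Derivation K Ω Ω) (a b : Fin 3 → Ω) :
    δ (a ⬝ᵥ b) = (δ ∘ a) ⬝ᵥ b + a ⬝ᵥ (δ ∘ b) := by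
  simp only [dotProduct, map_sum, Derivation.leibniz, smul_eq_mul, Function.comp_apply,
    ← Finset.sum_add_distrib]
  exact Finset.sum_congr rfl fun i _ => by ring

omit [IsAlgClosed K] [CharZero K] in
/-- Two lines `w` and `z` with two distinct points in common coincide. -/
lemma cross_eq_zero_of_dotProduct {a b w z : Fin 3 → Ω} (hab : a ⨯₃ b ≠ 0) (haw : a ⬝ᵥ w = 0)
    (hbw : b ⬝ᵥ w = 0) (haz : a ⬝ᵥ z = 0) (hbz : b ⬝ᵥ z = 0) : w ⨯₃ z = 0 := by
  obtain ⟨r, rfl⟩ := exists_smul_cross hab haw hbw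
  obtain ⟨s, rfl⟩ := exists_smul_cross hab haz hbz
  rw [map_smul, LinearMap.map_smul₂, cross_self, smul_zero, smul_zero]

/-- The generic tangent line is not tangent at a second point: under a derivation `δ` the tangent
line `w` at `v` moves to first order about `v`, since `v ⬝ᵥ δ w = 0`. If `w` is also tangent at `u`,
then `u ⬝ᵥ δ w = 0`, so `δ w` is a multiple of `w`. -/
lemma cross_eq_zero_of_bitangent (hD : Irreducible D) (hd : D.IsHomogeneous d) (hd2 : 2 ≤ d)
    (hv : ∀ H : MvPolynomial (Fin 3) K, aeval v H = 0 ↔ D ∣ H) {u : Fin 3 → Ω} (hu : u ≠ 0) {s : Ω}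
    (huw : u ⬝ᵥ gradientAt (D.map (algebraMap K Ω)) v = 0) (huD : aeval u D = 0)
    (hgrad : gradientAt (D.map (algebraMap K Ω)) u = s • gradientAt (D.map (algebraMap K Ω)) v) :
    u ⨯₃ v = 0 := by
  by_contra huv
  obtain ⟨δ, hδ⟩ := exists_derivation_generic_tangent hD hd hd2 hv
  obtain ⟨h1, h2⟩ := dotProduct_derivation_tangent hd ((hv D).mpr dvd_rfl) δ
  have h4 := (dotProduct_derivation_tangent hd huD δ).2
  -- a singular point is rational, and the generic tangent line avoids rational points
  have hs : s ≠ 0 := by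
    rintro rfl
    rw [zero_smul] at hgrad
    rcases dvd_or_exists_smul hD hd hu huD with hgen | ⟨x, c, hx, hc, hux⟩
    · refine not_dvd_dirDeriv hD hd hd2 (x := Pi.single 0 1) (by simp)
        (hgen _ _ (isHomogeneous_dirDeriv hd _) ?_)
      rw [aeval_dirDeriv, hgrad, dotProduct_zero]
    · rw [hux, smul_dotProduct, smul_eq_mul] at huw
      exact dotProduct_generic_tangent_ne_zero hD hd hd2 hv hx
        ((mul_eq_zero.mp huw).resolve_left hc)
  rw [hgrad, dotProduct_smul, smul_eq_mul] at h4
  replace h4 := (mul_eq_zero.mp h4).resolve_left hs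
  have e1 := derivation_dotProduct δ v (gradientAt (D.map (algebraMap K Ω)) v)
  have e2 := derivation_dotProduct δ u (gradientAt (D.map (algebraMap K Ω)) v)
  rw [h1, h2, map_zero, zero_add] at e1
  rw [huw, h4, map_zero, zero_add] at e2
  exact hδ (cross_eq_zero_of_dotProduct huv huw h1 e2.symm e1.symm)

omit [IsAlgClosed K] [CharZero K] in
lemma derivation_gradientAt (δ : Derivation K Ω Ω) (a : Fin 3 → Ω) :
    a ⬝ᵥ (δ ∘ gradientAt (D.map (algebraMap K Ω)) v) =
      eval v (dirDeriv (δ ∘ v) (dirDeriv a (D.map (algebraMap K Ω)))) := by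
  have h : ∀ i, δ (gradientAt (D.map (algebraMap K Ω)) v i) =
      eval v (dirDeriv (δ ∘ v) (pderiv i (D.map (algebraMap K Ω)))) := fun i => by
    rw [gradientAt_map_apply, derivation_aeval, eval_dirDeriv_eq_dotProduct, pderiv_map]
  simp only [dotProduct, Function.comp_apply, h]
  rw [dirDeriv, dirDeriv]
  simp only [dirDeriv, map_sum, Derivation.leibniz, smul_eq_mul, map_mul, eval_C,
    pderiv_C, mul_zero, add_zero, Finset.mul_sum]
  rw [Finset.sum_comm]
  refine Finset.sum_congr rfl fun i _ => Finset.sum_congr rfl fun j _ => ?_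
  simp
  ring

/-- The generic tangent line is not inflectional: otherwise a second point `a` of the tangent line
would satisfy `a ⬝ᵥ δ w = 0` as well, for every derivation `δ`. -/
lemma eval_dirDeriv_dirDeriv_ne_zero (hD : Irreducible D) (hd : D.IsHomogeneous d) (hd2 : 2 ≤ d)
    (hv : ∀ H : MvPolynomial (Fin 3) K, aeval v H = 0 ↔ D ∣ H) {a : Fin 3 → Ω}
    (haw : a ⬝ᵥ gradientAt (D.map (algebraMap K Ω)) v = 0) (hav : a ⨯₃ v ≠ 0) :
    eval v (dirDeriv a (dirDeriv a (D.map (algebraMap K Ω)))) ≠ 0 := by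
  intro h0
  obtain ⟨δ, hδ⟩ := exists_derivation_generic_tangent hD hd hd2 hv
  obtain ⟨h1, h2⟩ := dotProduct_derivation_tangent hd ((hv D).mpr dvd_rfl) δ
  obtain ⟨r, hr⟩ := exists_smul_cross hav haw h1
  have hr0 : r ≠ 0 := fun h => generic_tangent_ne_zero hD hd hd2 hv (by rw [hr, h, zero_smul])
  obtain ⟨x, y, hxy⟩ := exists_lincomb_of_dotProduct_cross (u := δ ∘ v) hav (by
    rw [hr, dotProduct_smul, smul_eq_mul] at h2
    exact (mul_eq_zero.mp h2).resolve_left hr0)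
  have e1 := derivation_dotProduct δ v (gradientAt (D.map (algebraMap K Ω)) v)
  rw [h1, h2, map_zero, zero_add] at e1
  have e2 : a ⬝ᵥ (δ ∘ gradientAt (D.map (algebraMap K Ω)) v) = 0 := by
    rw [derivation_gradientAt, hxy, dirDeriv_lincomb, map_add, map_mul, map_mul, h0, mul_zero,
      zero_add, euler_dirDeriv (isHomogeneous_dirDeriv (hd.map _) a), eval_dirDeriv_eq_dotProduct,
      haw, mul_zero, mul_zero]
  exact hδ (cross_eq_zero_of_dotProduct hav haw h1 e2 e1.symm)

end GenericTangent

section SimpleTangent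

variable {Ω : Type u} [Field Ω] [CharZero Ω]

omit [CharZero Ω] in
lemma ringHom_comp_cross {R S : Type*} [CommRing R] [CommRing S] (φ : R →+* S) (a b : Fin 3 → R) :
    φ ∘ (a ⨯₃ b) = (φ ∘ a) ⨯₃ (φ ∘ b) := by
  ext i
  fin_cases i <;> simp [cross_apply]

/-- The discriminant form vanishes to the first order at a line that is tangent at one point only,
with contact of order two: on the pencil of the lines `a ⨯₃ (v + t c)` the discriminant is
a unit times the critical value near the point of tangency `v`, which has order one in `t`. -/
theorem IsDiscriminantForm.not_sq_dvd [IsAlgClosed Ω] {P R Q : MvPolynomial (Fin 3) Ω} {d : ℕ}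
    (h : IsDiscriminantForm P d R) (hd2 : 2 ≤ d) {a v c : Fin 3 → Ω} (hv : eval v P = 0)
    (ha : eval a P ≠ 0) (haw : a ⬝ᵥ gradientAt P v = 0) (hcw : c ⬝ᵥ gradientAt P v ≠ 0)
    (haa : eval v (dirDeriv a (dirDeriv a P)) ≠ 0)
    (hsimple : ∀ y : Ω, y ≠ 0 → eval (y • a + v) P = 0 → eval (y • a + v) (dirDeriv a P) ≠ 0)
    (hQ : eval (a ⨯₃ v) Q = 0) : ¬ Q ^ 2 ∣ R := by
  rintro ⟨T, hT⟩
  obtain ⟨f₀, hf₀⟩ : ∃ f₀, f₀ = linePoly P a v := ⟨_, rfl⟩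
  have hf₀d : f₀.natDegree = d := by rw [hf₀, natDegree_linePoly h.left v ha]
  have hf₀0 : f₀ ≠ 0 := fun h0 => by rw [h0] at hf₀d; simp at hf₀d; omega
  have hder : f₀.derivative = linePoly (dirDeriv a P) a v := by rw [hf₀, derivative_linePoly]
  have hder2 : f₀.derivative.derivative = linePoly (dirDeriv a (dirDeriv a P)) a v := by
    rw [hder, derivative_linePoly]
  have hev : ∀ H : MvPolynomial (Fin 3) Ω, (linePoly H a v).eval 0 = eval v H := fun H => by
    rw [eval_linePoly, zero_smul, zero_add]
  -- the restriction to the tangent line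
  obtain ⟨a₀, ha₀⟩ : ∃ a₀ : Polynomial Ω, f₀ = Polynomial.X ^ 2 * a₀ := by
    have h0 : f₀.coeff 0 = 0 := by rw [Polynomial.coeff_zero_eq_eval_zero, hf₀, hev, hv]
    have h1 : f₀.coeff 1 = 0 := by
      have h2 : f₀.derivative.coeff 0 = 0 := by
        rw [Polynomial.coeff_zero_eq_eval_zero, hder, hev, eval_dirDeriv_eq_dotProduct, haw]
      rw [Polynomial.coeff_derivative] at h2
      simpa using h2
    rw [← dvd_def, Polynomial.X_pow_dvd_iff]
    intro i hi
    interval_cases i <;> assumption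
  have ha₀0 : a₀.eval 0 ≠ 0 := by
    intro h0
    apply haa
    rw [← hev, ← hder2, ha₀]
    simp [Polynomial.derivative_mul, h0]
  obtain ⟨g, hg⟩ : ∃ g : Polynomial Ω, g = 2 * a₀ + Polynomial.X * a₀.derivative := ⟨_, rfl⟩
  have hgX : Polynomial.X * g = f₀.derivative := by
    rw [hg, ha₀]
    rw [Polynomial.derivative_mul, Polynomial.derivative_X_pow]
    simp only [Nat.cast_ofNat, Polynomial.C_ofNat, Nat.add_one_sub_one, pow_one]
    ring
  have hg0 : g ≠ 0 := fun h0 => by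
    have : g.eval 0 = 2 * a₀.eval 0 := by rw [hg]; simp
    rw [h0, Polynomial.eval_zero] at this
    exact mul_ne_zero two_ne_zero ha₀0 this.symm
  have hgd : g.natDegree ≤ d - 1 - 1 := by
    have h1 := Polynomial.natDegree_derivative_le f₀
    rw [← hgX, Polynomial.natDegree_X_mul hg0, hf₀d] at h1
    omega
  have hres : Polynomial.resultant f₀ g d (d - 1 - 1) ≠ 0 := by
    have h1 := Polynomial.resultant_eq_prod_eval f₀ g (d - 1 - 1) hgd (IsAlgClosed.splits _)
    rw [hf₀d] at h1
    rw [h1]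
    refine mul_ne_zero (pow_ne_zero _ (Polynomial.leadingCoeff_ne_zero.mpr hf₀0)) ?_
    rw [Ne, Multiset.prod_eq_zero_iff]
    intro hmem
    obtain ⟨y, hy, hy0⟩ := Multiset.mem_map.mp hmem
    rw [Polynomial.mem_roots hf₀0, Polynomial.IsRoot] at hy
    by_cases hyz : y = 0
    · rw [hyz, hg] at hy0
      simp [ha₀0] at hy0
    · rw [hf₀, eval_linePoly] at hy
      apply hsimple y hyz hy
      rw [← eval_linePoly, ← hder, ← hgX, Polynomial.eval_mul, hy0, mul_zero]
  -- the pencil of lines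
  let S := PowerSeries Ω
  let ι : Ω →+* S := PowerSeries.C
  let κ : S →+* Ω := PowerSeries.constantCoeff
  have hκι : κ.comp ι = RingHom.id Ω := by
    ext x; exact PowerSeries.constantCoeff_C x
  have hmapmap : ∀ H : MvPolynomial (Fin 3) Ω, (H.map ι).map κ = H := fun H => by
    rw [map_map, hκι, map_id]
  obtain ⟨b, hb⟩ : ∃ b : Fin 3 → S, b = ι ∘ v + (PowerSeries.X : S) • (ι ∘ c) := ⟨_, rfl⟩
  have hκa : κ ∘ (ι ∘ a) = a := by
    rw [← Function.comp_assoc, ← RingHom.coe_comp, hκι]; rfl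
  have hκv : κ ∘ (ι ∘ v) = v := by
    rw [← Function.comp_assoc, ← RingHom.coe_comp, hκι]; rfl
  have hκb : κ ∘ b = v := by
    ext i
    have := congrFun hκv i
    rw [hb]
    simp only [Function.comp_apply, Pi.add_apply, Pi.smul_apply, smul_eq_mul, map_add,
      map_mul] at this ⊢
    rw [this, show κ PowerSeries.X = 0 from PowerSeries.constantCoeff_X, zero_mul, add_zero]
  have hS : IsDiscriminantForm (P.map ι) d (R.map ι) := h.baseChange (S := S)
  obtain ⟨f, hf⟩ : ∃ f, f = linePoly (P.map ι) (ι ∘ a) b := ⟨_, rfl⟩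
  have hfκ : f.map κ = f₀ := by rw [hf, linePoly_map, hmapmap, hκa, hκb, hf₀]
  have hlead : eval (ι ∘ a) (P.map ι) = ι (eval a P) := (ringHom_eval _ _ _).symm
  have hlead0 : IsUnit (eval (ι ∘ a) (P.map ι)) := by
    rw [hlead]; exact (isUnit_iff_ne_zero.mpr ha).map ι
  have hfd : f.natDegree = d := by rw [hf, natDegree_linePoly hS.left _ hlead0.ne_zero]
  have hfl : IsUnit f.leadingCoeff := by
    rw [hf, leadingCoeff_linePoly hS.left _ hlead0.ne_zero]; exact hlead0
  obtain ⟨γ, hγ, hγ'⟩ := exists_critical_points (s := {0}) (a := a₀) (by omega) hfd hfl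
    (by rw [Finset.prod_singleton, map_zero, sub_zero]; exact hfκ.trans ha₀)
    (fun θ hθ => by rw [Finset.mem_singleton.mp hθ]; exact ha₀0)
  obtain ⟨ρ, hρ, hρ'⟩ := hγ' g (by
    rw [Finset.prod_singleton, map_zero, sub_zero]; rw [hgX]; congr 1; exact hfκ.symm)
  rw [Finset.prod_singleton] at hρ
  have hρ0 : κ ρ ≠ 0 := by
    change PowerSeries.constantCoeff ρ ≠ 0
    rw [hρ', Finset.card_singleton]
    change Polynomial.resultant (f.map κ) g d (d - 1 - 1) ≠ 0
    rw [hfκ]; exact hres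
  -- the critical value
  obtain ⟨ψ, hψ, hψ0⟩ : ∃ ψ, f.eval (γ 0) = PowerSeries.X * ψ ∧ κ ψ ≠ 0 := by
    obtain ⟨y', hy'⟩ := PowerSeries.X_dvd_iff.mpr (hγ 0 (Finset.mem_singleton_self 0)).1
    obtain ⟨y, hy⟩ : ∃ y : Fin 3 → S, y = y' • (ι ∘ a) + ι ∘ c := ⟨_, rfl⟩
    obtain ⟨p, hp⟩ : ∃ p, p = linePoly (P.map ι) y (ι ∘ v) := ⟨_, rfl⟩
    refine ⟨p.divX.eval PowerSeries.X, ?_, ?_⟩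
    · have h1 : f.eval (γ 0) = p.eval PowerSeries.X := by
        rw [hf, hp, eval_linePoly, eval_linePoly, hy, hb, hy']
        congr 2
        ext1 i
        simp only [Pi.add_apply, Pi.smul_apply, smul_eq_mul]
        ring
      have h2 : p.coeff 0 = 0 := by
        rw [Polynomial.coeff_zero_eq_eval_zero, hp, eval_linePoly, zero_smul, zero_add,
          ← ringHom_eval, hv, map_zero]
      rw [h1]
      conv_lhs => rw [← Polynomial.divX_mul_X_add p, h2, map_zero, add_zero, Polynomial.eval_mul_X]
      rw [mul_comm]
    · have h1 : κ (p.divX.eval PowerSeries.X) = κ (p.divX.coeff 0) := by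
        rw [← Polynomial.eval₂_at_apply, show κ PowerSeries.X = 0 from PowerSeries.constantCoeff_X,
          Polynomial.eval₂_at_zero]
      have h2 : p.coeff 1 = eval (ι ∘ v) (dirDeriv y (P.map ι)) := by
        have h3 : p.derivative.coeff 0 = p.coeff 1 := by rw [Polynomial.coeff_derivative]; simp
        rw [← h3, hp, derivative_linePoly, Polynomial.coeff_zero_eq_eval_zero, eval_linePoly,
          zero_smul, zero_add]
      have h4 : κ ∘ y = κ y' • a + c := by
        ext i
        have e1 : κ (ι (a i)) = a i := PowerSeries.constantCoeff_C _
        have e2 : κ (ι (c i)) = c i := PowerSeries.constantCoeff_C _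
        rw [hy]
        simp only [Function.comp_apply, Pi.add_apply, Pi.smul_apply, smul_eq_mul, map_add, map_mul,
          e1, e2]
      rw [h1, Polynomial.coeff_divX, zero_add, h2, ringHom_eval, map_dirDeriv, hmapmap, hκv, h4,
        eval_dirDeriv_eq_dotProduct, add_dotProduct, smul_dotProduct, haw, smul_zero, zero_add]
      exact hcw
  -- if `Q ^ 2` divided `R`, then `t ^ 2` would divide the discriminant, whose order in `t` is one
  obtain ⟨s, hs⟩ := hS.resultant_dirDeriv (by omega) (ι ∘ a) b
  rw [← derivative_linePoly, ← hf] at hs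
  have hXQ : (PowerSeries.X : S) ∣ eval ((ι ∘ a) ⨯₃ b) (Q.map ι) := by
    rw [PowerSeries.X_dvd_iff]
    change κ _ = 0
    rw [ringHom_eval, hmapmap, ringHom_comp_cross, hκa, hκb, hQ]
  obtain ⟨q, hq⟩ := hXQ
  have hR : eval ((ι ∘ a) ⨯₃ b) (R.map ι) =
      (PowerSeries.X * q) ^ 2 * eval ((ι ∘ a) ⨯₃ b) (T.map ι) := by
    rw [hT, map_mul, map_mul, map_pow, map_pow, hq]
  have hfinal : (PowerSeries.X : S) ^ 2 * ((d : S) ^ (d - 1) * (ψ * ρ)) ^ 2 =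
      (PowerSeries.X : S) ^ 2 * (PowerSeries.X ^ 2 *
        ((d : S) * eval (ι ∘ a) (P.map ι) * q ^ 2 * eval ((ι ∘ a) ⨯₃ b) (T.map ι)) ^ 2) := by
    have h1 := congrArg (· ^ 2) hs
    simp only [mul_pow] at h1
    have hsgn : ((-1 : S) ^ s) ^ 2 = 1 := by rw [← pow_mul, mul_comm, pow_mul]; simp
    rw [hρ, hR, hψ, hsgn] at h1
    linear_combination h1
  have h2 := mul_left_cancel₀ (pow_ne_zero 2 PowerSeries.X_ne_zero) hfinal
  have h3 := congrArg κ h2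
  rw [map_mul κ (PowerSeries.X ^ 2), map_pow κ PowerSeries.X,
    show κ PowerSeries.X = 0 from PowerSeries.constantCoeff_X, zero_pow two_ne_zero, zero_mul] at h3
  simp only [map_pow, map_mul] at h3
  have hd0 : (d : Ω) ≠ 0 := Nat.cast_ne_zero.mpr (by omega)
  exact pow_ne_zero 2 (mul_ne_zero (pow_ne_zero _ hd0) (mul_ne_zero hψ0 hρ0)) h3

end SimpleTangent

/-! ### The discriminant form of a product -/

section Multiplicativity

variable {K : Type u} [Field K]

lemma eval_aeval_cross {R : Type*} [CommRing R] (Z : MvPolynomial (Fin 3) R) (a b : Fin 3 → R) :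
    eval a (aeval ((X : Fin 3 → MvPolynomial (Fin 3) R) ⨯₃ (C ∘ b)) Z) = eval (a ⨯₃ b) Z := by
  rw [← aeval_eq_eval, ← AlgHom.comp_apply, comp_aeval, ← aeval_eq_eval]
  have h := ringHom_comp_cross (eval a) (X : Fin 3 → MvPolynomial (Fin 3) R) (C ∘ b)
  have h1 : (eval a) ∘ (X : Fin 3 → MvPolynomial (Fin 3) R) = a := by ext i; simp
  have h2 : (eval a) ∘ ((C : R →+* MvPolynomial (Fin 3) R) ∘ b) = b := by ext i; simp
  rw [h1, h2] at h
  rw [← h]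
  rfl

/-- A form in the coordinates of lines is determined by its values on general lines through
general points. -/
lemma eq_of_forall_eval_cross [Infinite K] {G H M N : MvPolynomial (Fin 3) K} (hM : M ≠ 0)
    (hN : N ≠ 0) (h : ∀ a b : Fin 3 → K, eval a N ≠ 0 → eval (a ⨯₃ b) M ≠ 0 →
      eval (a ⨯₃ b) G = eval (a ⨯₃ b) H) : G = H := by
  suffices h0 : (G - H) * M = 0 from sub_eq_zero.mp ((mul_eq_zero.mp h0).resolve_right hM)
  apply MvPolynomial.funext
  intro w
  obtain ⟨a, ha, haw⟩ := exists_dotProduct_eq_zero w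
  obtain ⟨b, rfl⟩ := exists_cross_eq ha haw
  have h1 : N * aeval ((X : Fin 3 → MvPolynomial (Fin 3) K) ⨯₃ (C ∘ b)) ((G - H) * M) = 0 := by
    apply MvPolynomial.funext
    intro x
    rw [map_mul, eval_aeval_cross, map_mul, map_sub, map_zero]
    by_cases hx : eval x N = 0
    · rw [hx, zero_mul]
    · by_cases hxM : eval (x ⨯₃ b) M = 0
      · rw [hxM, mul_zero, mul_zero]
      · rw [h x b hx hxM, sub_self, zero_mul, mul_zero]
  rw [← eval_aeval_cross, (mul_eq_zero.mp h1).resolve_left hN, map_zero, map_zero]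

/-- Two nonzero forms whose squares are proportional are associated. -/
lemma associated_of_sq_eq [IsAlgClosed K] {G H : MvPolynomial (Fin 3) K} {c : K} (hc : c ≠ 0)
    (h : G ^ 2 = C c * H ^ 2) : Associated G H := by
  obtain ⟨e, he⟩ := IsAlgClosed.exists_pow_nat_eq c (n := 2) two_pos
  have he0 : e ≠ 0 := fun h0 => hc (by rw [← he, h0, zero_pow two_ne_zero])
  have h1 : (G - C e * H) * (G + C e * H) = 0 := by
    rw [← he, map_pow] at h
    linear_combination h
  have hu : IsUnit (C e : MvPolynomial (Fin 3) K) := (isUnit_iff_ne_zero.mpr he0).map C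
  have ha : Associated (C e * H) H := (associated_isUnit_mul_left_iff hu).mpr (Associated.refl H)
  rcases mul_eq_zero.mp h1 with h2 | h2
  · rwa [sub_eq_zero.mp h2]
  · rw [eq_neg_of_add_eq_zero_left h2]
    exact (Associated.neg_left (Associated.refl _)).trans ha

/-- The discriminant as the product of the values of the derivative at the roots, for all degrees,
up to a constant factor and sign. -/
theorem IsDiscriminantForm.exists_sq_eq [IsAlgClosed K] [CharZero K]
    {P G : MvPolynomial (Fin 3) K} {d : ℕ} (h : IsDiscriminantForm P d G) (hP : P ≠ 0) :
    ∃ c : K, c ≠ 0 ∧ ∀ a b : Fin 3 → K, eval a P ≠ 0 →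
      (eval a P ^ d * ((linePoly P a b).roots.map (linePoly P a b).derivative.eval).prod) ^ 2 =
        c * (eval a P ^ 2 * eval (a ⨯₃ b) G) ^ 2 := by
  rcases Nat.eq_zero_or_pos d with rfl | hd
  · obtain ⟨e, he, rfl⟩ := exists_eq_C_of_isUnit (isUnit_of_isHomogeneous_zero h.left hP)
    refine ⟨(e ^ 4)⁻¹, inv_ne_zero (pow_ne_zero _ he), fun a b _ => ?_⟩
    have h1 := h.resultant_eq_eval a b
    have h2 : eval (a ⨯₃ b) G = 1 := by
      rw [← h1]
      simp [dirDeriv_C, linePoly]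
    rw [h2, linePoly_C, Polynomial.roots_C, Multiset.map_zero, Multiset.prod_zero, eval_C, pow_zero]
    field_simp
  · have hd0 : (d : K) ≠ 0 := Nat.cast_ne_zero.mpr hd.ne'
    refine ⟨(d / d ^ (d - 1)) ^ 2, pow_ne_zero _ (div_ne_zero hd0 (pow_ne_zero _ hd0)),
      fun a b ha => ?_⟩
    obtain ⟨s, hs⟩ := h.resultant_dirDeriv hd a b
    rw [resultant_linePoly_eq_prod h.left (isHomogeneous_dirDeriv h.left a) b ha] at hs
    have hev : (fun x : K => eval (x • a + b) (dirDeriv a P)) =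
        (linePoly P a b).derivative.eval := by
      funext x
      rw [derivative_linePoly, eval_linePoly]
    rw [hev] at hs
    have hsgn : ((-1 : K) ^ s) ^ 2 = 1 := by rw [← pow_mul, mul_comm, pow_mul]; simp
    have h1 := congrArg (fun z => (eval a P * z / d ^ (d - 1)) ^ 2) hs
    have hpow : eval a P ^ d = eval a P * eval a P ^ (d - 1) := by
      rw [← pow_succ', Nat.sub_add_cancel hd]
    rw [hpow]
    have hdp : (d : K) ^ (d - 1) ≠ 0 := pow_ne_zero _ hd0
    generalize ((linePoly P a b).roots.map (linePoly P a b).derivative.eval).prod = Y at *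
    rw [show eval a P * ((d : K) ^ (d - 1) * (eval a P ^ (d - 1) * Y)) / d ^ (d - 1) =
      eval a P * eval a P ^ (d - 1) * Y by field_simp] at h1
    rw [h1]
    calc _ = ((-1 : K) ^ s) ^ 2 * (eval a P * (d * eval a P * eval (a ⨯₃ b) G) /
          d ^ (d - 1)) ^ 2 := by ring
      _ = _ := by rw [hsgn]; ring

/-- The discriminant of a product: on a general line the derivative of `p * q` takes the value
`p' * q` at the roots of `p` and `p * q'` at the roots of `q`, and the products of the values of one
factor at the roots of the other are resultants. -/
theorem IsDiscriminantForm.associated_mul [IsAlgClosed K] [CharZero K]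
    {P Q G G₁ G₂ R : MvPolynomial (Fin 3) K} {p q : ℕ} (hP : P ≠ 0) (hQ : Q ≠ 0)
    (h : IsDiscriminantForm (P * Q) (p + q) G) (h₁ : IsDiscriminantForm P p G₁)
    (h₂ : IsDiscriminantForm Q q G₂) (hR : IsResultantForm P Q p q R) :
    Associated G (G₁ * G₂ * R ^ 2) := by
  obtain ⟨c, hc, hG⟩ := h.exists_sq_eq (mul_ne_zero hP hQ)
  obtain ⟨c₁, hc₁, hG₁⟩ := h₁.exists_sq_eq hP
  obtain ⟨c₂, hc₂, hG₂⟩ := h₂.exists_sq_eq hQ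
  refine associated_of_sq_eq (c := c₁ * c₂ / c) (div_ne_zero (mul_ne_zero hc₁ hc₂) hc) ?_
  refine eq_of_forall_eval_cross one_ne_zero (mul_ne_zero hP hQ) fun a b ha _ => ?_
  have e := hG a b ha
  rw [map_mul] at ha
  have haP := left_ne_zero_of_mul ha
  have haQ := right_ne_zero_of_mul ha
  have e₁ := hG₁ a b haP
  have e₂ := hG₂ a b haQ
  have r₁ := resultant_linePoly_eq_prod hR.left hR.right b haP
  have r₂ := resultant_linePoly_eq_prod hR.right hR.left b haQ
  rw [Polynomial.resultant_comm, hR.resultant_eq_eval] at r₂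
  rw [hR.resultant_eq_eval] at r₁
  have hev : ∀ (U : MvPolynomial (Fin 3) K), (fun x : K => eval (x • a + b) U) =
      (linePoly U a b).eval := fun U => by
    funext x
    rw [eval_linePoly]
  rw [hev] at r₁ r₂
  have hsgn : ((-1 : K) ^ (q * p)) ^ 2 = 1 := by rw [← pow_mul, mul_comm, pow_mul]; simp
  have hf0 : linePoly P a b ≠ 0 := fun h0 => haP (by
    rw [← leadingCoeff_linePoly hR.left b haP, h0, Polynomial.leadingCoeff_zero])
  have hg0 : linePoly Q a b ≠ 0 := fun h0 => haQ (by
    rw [← leadingCoeff_linePoly hR.right b haQ, h0, Polynomial.leadingCoeff_zero])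
  rw [linePoly_mul, Polynomial.roots_mul (mul_ne_zero hf0 hg0), Multiset.map_add,
    Multiset.prod_add, Polynomial.derivative_mul, map_mul] at e
  have m₁ : (linePoly P a b).roots.map ((linePoly P a b).derivative * linePoly Q a b +
      linePoly P a b * (linePoly Q a b).derivative).eval =
      (linePoly P a b).roots.map (fun x => (linePoly P a b).derivative.eval x *
        (linePoly Q a b).eval x) := Multiset.map_congr rfl fun x hx => by
    rw [Polynomial.mem_roots hf0, Polynomial.IsRoot] at hx
    simp [hx]
  have m₂ : (linePoly Q a b).roots.map ((linePoly P a b).derivative * linePoly Q a b +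
      linePoly P a b * (linePoly Q a b).derivative).eval =
      (linePoly Q a b).roots.map (fun x => (linePoly P a b).eval x *
        (linePoly Q a b).derivative.eval x) := Multiset.map_congr rfl fun x hx => by
    rw [Polynomial.mem_roots hg0, Polynomial.IsRoot] at hx
    simp [hx]
  rw [m₁, m₂, Multiset.prod_map_mul, Multiset.prod_map_mul] at e
  simp only [map_pow, map_mul, eval_C]
  generalize ((linePoly P a b).roots.map (linePoly P a b).derivative.eval).prod = A₁ at *
  generalize ((linePoly Q a b).roots.map (linePoly Q a b).derivative.eval).prod = A₂ at *
  have s₂ : eval (a ⨯₃ b) R ^ 2 = (eval a Q ^ p *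
      ((linePoly Q a b).roots.map (linePoly P a b).eval).prod) ^ 2 := by
    rw [← r₂, mul_pow, hsgn, one_mul]
  have s₁ : eval (a ⨯₃ b) R ^ 2 = (eval a P ^ q *
      ((linePoly P a b).roots.map (linePoly Q a b).eval).prod) ^ 2 := by rw [← r₁]
  have key : c * (eval a P ^ 2 * eval a Q ^ 2) ^ 2 * eval (a ⨯₃ b) G ^ 2 =
      c₁ * c₂ * (eval a P ^ 2 * eval a Q ^ 2) ^ 2 *
        (eval (a ⨯₃ b) G₁ * eval (a ⨯₃ b) G₂ * eval (a ⨯₃ b) R ^ 2) ^ 2 := by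
    calc _ = c * ((eval a P * eval a Q) ^ 2 * eval (a ⨯₃ b) G) ^ 2 := by ring
      _ = (eval a P ^ p * A₁) ^ 2 * (eval a Q ^ q * A₂) ^ 2 * (eval a P ^ q *
          ((linePoly P a b).roots.map (linePoly Q a b).eval).prod) ^ 2 * (eval a Q ^ p *
          ((linePoly Q a b).roots.map (linePoly P a b).eval).prod) ^ 2 := by rw [← e]; ring
      _ = _ := by rw [e₁, e₂, ← s₁, ← s₂]; ring
  have h0 : (eval a P ^ 2 * eval a Q ^ 2) ^ 2 ≠ 0 :=
    pow_ne_zero _ (mul_ne_zero (pow_ne_zero _ haP) (pow_ne_zero _ haQ))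
  rw [div_mul_eq_mul_div, eq_div_iff hc]
  refine mul_left_cancel₀ h0 ?_
  linear_combination key

end Multiplicativity

/-! ### The usual dual of an irreducible curve -/

section UsualDual

variable {K : Type u} [Field K]

lemma exists_irreducible_dvd_of_aeval_eq_zero {Ω : Type*} [Field Ω] [Algebra K Ω]
    {G : MvPolynomial (Fin 3) K} (hG : G ≠ 0) {w : Fin 3 → Ω} (hw : aeval w G = 0) :
    ∃ Q, Irreducible Q ∧ Q ∣ G ∧ aeval w Q = 0 := by
  induction G using WfDvdMonoid.induction_on_irreducible with
  | zero => exact absurd rfl hG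
  | unit u hu => exact absurd hw (hu.map (aeval w)).ne_zero
  | mul a i ha hi ih =>
    rw [map_mul, mul_eq_zero] at hw
    rcases hw with h | h
    · exact ⟨i, hi, dvd_mul_right _ _, h⟩
    · obtain ⟨Q, hQ, hQa, hQw⟩ := ih ha h
      exact ⟨Q, hQ, hQa.mul_left _, hQw⟩

lemma usualDual_eq {D Q : MvPolynomial (Fin 3) K} (hQ : Irreducible Q)
    (h : vanishingIdeal K (tangentCone D) = Ideal.span {Q}) : usualDual D = primeDivisor Q := by
  have hex : ∃ Q : MvPolynomial (Fin 3) K, Irreducible Q ∧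
      vanishingIdeal K (tangentCone D) = Ideal.span {Q} := ⟨Q, hQ, h⟩
  rw [usualDual, dif_pos hex]
  exact primeDivisor_congr (Ideal.span_singleton_eq_span_singleton.mp
    (hex.choose_spec.2.symm.trans h))

lemma gradientAt_mul (P Q : MvPolynomial (Fin 3) K) (v : Fin 3 → K) :
    gradientAt (P * Q) v = eval v P • gradientAt Q v + eval v Q • gradientAt P v := by
  ext i
  simp [gradientAt]

lemma usualDual_congr {D D' : MvPolynomial (Fin 3) K} (h : Associated D D') :
    usualDual D = usualDual D' := by
  obtain ⟨u, rfl⟩ := h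
  obtain ⟨e, he, hu⟩ := exists_eq_C_of_isUnit u.isUnit
  have hgrad : ∀ v, gradientAt (D * C e) v = e • gradientAt D v := fun v => by
    rw [gradientAt_mul, eval_C]
    have : gradientAt (C e) v = 0 := by ext i; simp [gradientAt]
    rw [this, smul_zero, zero_add]
  have : tangentCone (D * C e) = tangentCone D := by
    ext w
    constructor
    · rintro ⟨v, c, hv, hvD, hg, rfl⟩
      rw [map_mul, eval_C, mul_eq_zero] at hvD
      rw [hgrad, smul_ne_zero_iff] at hg
      exact ⟨v, c * e, hv, hvD.resolve_right he, hg.2, by rw [hgrad, mul_smul]⟩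
    · rintro ⟨v, c, hv, hvD, hg, rfl⟩
      refine ⟨v, c * e⁻¹, hv, by rw [map_mul, hvD, zero_mul], ?_, ?_⟩
      · rw [hgrad]; exact smul_ne_zero he hg
      · rw [hgrad, smul_smul, inv_mul_cancel_right₀ he]
  rw [hu, usualDual, usualDual, this]

lemma gradientAt_linForm (y v : Fin 3 → K) : gradientAt (linForm y) v = y := by
  ext i
  rw [gradientAt, linForm]
  rw [map_sum, map_sum, Finset.sum_eq_single i]
  · simp
  · intro j _ hj
    simp [pderiv_X_of_ne hj]
  · simp

/-- The usual dual of a line is zero. -/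
lemma usualDual_linForm [Infinite K] {y : Fin 3 → K} (hy : y ≠ 0) : usualDual (linForm y) = 0 := by
  rw [usualDual, dif_neg]
  rintro ⟨Q, hQ, h⟩
  have hdvd : ∀ z : Fin 3 → K, z ⬝ᵥ y = 0 → Q ∣ linForm z := fun z hz => by
    rw [← Ideal.mem_span_singleton, ← h, mem_vanishingIdeal_iff]
    rintro w ⟨v, c, _, _, _, rfl⟩
    rw [aeval_eq_eval, gradientAt_linForm, eval_linForm, dotProduct_smul, hz, smul_zero]
  obtain ⟨z, hz, hzy⟩ := exists_dotProduct_eq_zero y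
  obtain ⟨t, ht⟩ := exists_cross_eq hz hzy
  have hass := hQ.associated_of_dvd (irreducible_linForm hz) (hdvd z hzy)
  obtain ⟨c, hc⟩ := exists_smul_of_linForm_dvd (hass.symm.dvd.trans (hdvd t (by
    rw [← ht]; exact dot_cross_self z t)))
  rw [hc, map_smul, cross_self, smul_zero] at ht
  exact hy ht.symm

variable [IsAlgClosed K] [CharZero K]

/-- The usual dual of an irreducible curve of degree at least two is a simple component of
the discriminant form, and it is not a line. It is the component that contains the generic tangent
line, which is a simple zero of the discriminant form because it is tangent at one point only, with
contact of order two. -/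
theorem IsDiscriminantForm.exists_usualDual {D R : MvPolynomial (Fin 3) K} {d : ℕ}
    (h : IsDiscriminantForm D d R) (hD : Irreducible D) (hd : 2 ≤ d) :
    ∃ Q, Irreducible Q ∧ vanishingIdeal K (tangentCone D) = Ideal.span {Q} ∧ Q ∣ R ∧ ¬ Q ^ 2 ∣ R ∧
      ∀ x : Fin 3 → K, x ≠ 0 → ¬ Associated Q (linForm x) := by
  have hR0 := h.ne_zero hD.squarefree
  obtain ⟨Ω, _, _, _, v, hv⟩ := exists_generic_point hD
  have : CharZero Ω := charZero_of_injective_algebraMap (algebraMap K Ω).injective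
  have hv0 : v ≠ 0 := fun h0 => not_rational_of_generic hD hv 0 0 (by rw [h0, zero_smul])
  have hΩ := h.baseChange (S := Ω)
  obtain ⟨w, hw⟩ : ∃ w, w = gradientAt (D.map (algebraMap K Ω)) v := ⟨_, rfl⟩
  have hvD : eval v (D.map (algebraMap K Ω)) = 0 := by
    rw [eval_map_algebraMap']; exact (hv D).mpr dvd_rfl
  have hvw : v ⬝ᵥ w = 0 := by rw [hw, dotProduct_gradientAt hΩ.left, hvD, mul_zero]
  have hw0 : w ≠ 0 := by rw [hw]; exact generic_tangent_ne_zero hD h.left hd hv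
  have hRw : aeval w R = 0 := by
    rw [← eval_map_algebraMap']
    exact hΩ.eval_eq_zero (by omega) (s := 1) hv0 hvw (by rw [hw, one_smul])
  obtain ⟨Q, hQ, hQR, hQw⟩ := exists_irreducible_dvd_of_aeval_eq_zero hR0 hRw
  have hlin : ∀ x : Fin 3 → K, x ≠ 0 → ¬ Associated Q (linForm x) := fun x hx hass => by
    obtain ⟨T, hT⟩ := hass.dvd
    have h1 : aeval w (linForm x) = 0 := by rw [hT, map_mul, hQw, zero_mul]
    rw [← eval_map_algebraMap', map_linForm, eval_linForm, hw] at h1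
    exact dotProduct_generic_tangent_ne_zero hD h.left hd hv hx h1
  refine ⟨Q, hQ, ?_, hQR, ?_, hlin⟩
  · rcases h.exists_of_dvd hD hd hQ hQR with ⟨x, hx, _, hass⟩ | h1
    · exact absurd hass (hlin x hx)
    · exact h1
  · intro hsq
    obtain ⟨b, hb⟩ := exists_cross_eq hv0 hvw
    have hbv : b ⨯₃ v ≠ 0 := by
      rw [← cross_anticomm, hb]; exact neg_ne_zero.mpr hw0
    have hbw : b ⬝ᵥ w = 0 := by rw [← hb]; exact dot_cross_self v b
    have hp : linePoly (D.map (algebraMap K Ω)) b v ≠ 0 := fun h0 => by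
      refine eval_dirDeriv_dirDeriv_ne_zero hD h.left hd hv (hw ▸ hbw) hbv ?_
      have h1 := congrArg (fun p => p.derivative.derivative.eval 0) h0
      simp only [derivative_linePoly, eval_linePoly, zero_smul, zero_add,
        Polynomial.derivative_zero, Polynomial.eval_zero] at h1
      exact h1
    -- a point `a` of the tangent line that is neither on the curve nor the point of tangency
    obtain ⟨x, hx⟩ : ∃ x, (linePoly (D.map (algebraMap K Ω)) b v * Polynomial.X).eval x ≠ 0 := by
      by_contra! h0
      exact mul_ne_zero hp Polynomial.X_ne_zero (Polynomial.funext fun x => by simpa using h0 x)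
    rw [Polynomial.eval_mul, Polynomial.eval_X, eval_linePoly] at hx
    obtain ⟨a, ha⟩ : ∃ a, a = x • b + v := ⟨_, rfl⟩
    have haw : a ⬝ᵥ w = 0 := by
      rw [ha, add_dotProduct, smul_dotProduct, hbw, hvw, smul_zero, zero_add]
    have hav : a ⨯₃ v ≠ 0 := by
      rw [ha, map_add, map_smul, LinearMap.add_apply, LinearMap.smul_apply, cross_self, add_zero]
      exact smul_ne_zero (right_ne_zero_of_mul hx) hbv
    obtain ⟨r, hr⟩ := exists_smul_cross hav haw hvw
    have hr0 : r ≠ 0 := fun h0 => hw0 (by rw [hr, h0, zero_smul])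
    obtain ⟨j, hj⟩ := Function.ne_iff.mp hw0
    obtain ⟨e, he⟩ := isHomogeneous_of_dvd h.isHomogeneous hR0 hQR
    refine hΩ.not_sq_dvd (Q := Q.map (algebraMap K Ω)) hd hvD (a := a) (c := Pi.single j 1)
      (by rw [ha]; exact left_ne_zero_of_mul hx) (hw ▸ haw) ?_
      (eval_dirDeriv_dirDeriv_ne_zero hD h.left hd hv (hw ▸ haw) hav) ?_ ?_ ?_
    · rw [← hw, single_dotProduct, one_mul]; exact hj
    · intro y hy hyD hyD'
      have hau : a ⨯₃ (y • a + v) = a ⨯₃ v := by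
        rw [map_add, map_smul, cross_self, smul_zero, zero_add]
      have hgrad : ∃ s : Ω, gradientAt (D.map (algebraMap K Ω)) (y • a + v) = s • (a ⨯₃ v) := by
        rw [← hau]
        refine exists_smul_cross (by rw [hau]; exact hav) ?_ ?_
        · rw [← eval_dirDeriv_eq_dotProduct]; exact hyD'
        · rw [dotProduct_gradientAt hΩ.left, hyD, mul_zero]
      obtain ⟨s, hs⟩ := hgrad
      have hu0 : y • a + v ≠ 0 := fun h0 => hav (by rw [← hau, h0, map_zero])
      have h1 := cross_eq_zero_of_bitangent hD h.left hd hv hu0 (s := s * r⁻¹)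
        (by rw [← hw, add_dotProduct, smul_dotProduct, haw, hvw, smul_zero, zero_add])
        (by rw [← eval_map_algebraMap']; exact hyD)
        (by rw [hs, ← hw, hr, smul_smul, inv_mul_cancel_right₀ hr0])
      rw [map_add, map_smul, LinearMap.add_apply, LinearMap.smul_apply, cross_self, add_zero,
        smul_eq_zero] at h1
      exact h1.elim hy hav
    · have h1 := hQw
      rw [← eval_map_algebraMap', hr, eval_smul_of_isHomogeneous (he.map _), mul_eq_zero] at h1
      exact h1.resolve_left (pow_ne_zero _ hr0)
    · rw [← map_pow]
      exact map_dvd _ hsq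

/-- The usual dual of an irreducible curve has no lines as components. -/
lemma usualDual_apply_linForm {D : MvPolynomial (Fin 3) K} {d : ℕ} (hd : D.IsHomogeneous d)
    (hD : Irreducible D) {x : Fin 3 → K} (hx : x ≠ 0) :
    usualDual D (Associates.mk (linForm x)) = 0 := by
  classical
  obtain ⟨R, hR⟩ := exists_isDiscriminantForm hd
  rcases Nat.lt_or_ge d 2 with h2 | h2
  · have hd1 : d = 1 := by have := degree_pos_of_irreducible hd hD; omega
    subst hd1
    obtain ⟨y, rfl⟩ := exists_eq_linForm hd
    rw [usualDual_linForm fun h => hD.ne_zero (by rw [h]; simp [linForm])]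
    rfl
  · obtain ⟨Q, hQ, hspan, _, _, hlin⟩ := hR.exists_usualDual hD h2
    rw [usualDual_eq hQ hspan, primeDivisor, Finsupp.single_apply, if_neg]
    rw [Associates.mk_eq_mk_iff_associated]
    exact hlin x hx

/-- The components of the discriminant form of an irreducible curve other than lines. -/
lemma IsDiscriminantForm.divisor_apply_of_irreducible {D R : MvPolynomial (Fin 3) K} {d : ℕ}
    (h : IsDiscriminantForm D d R) (hD : Irreducible D)
    {c : Associates (MvPolynomial (Fin 3) K)}
    (hc : ∀ x : Fin 3 → K, x ≠ 0 → Associates.mk (linForm x) ≠ c) :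
    divisor R c = usualDual D c := by
  classical
  have hR0 := h.ne_zero hD.squarefree
  rcases Nat.lt_or_ge d 2 with h2 | h2
  · have hd1 : d = 1 := by have := degree_pos_of_irreducible h.left hD; omega
    subst hd1
    obtain ⟨y, rfl⟩ := exists_eq_linForm h.left
    rw [usualDual_linForm fun h => hD.ne_zero (by rw [h]; simp [linForm]),
      divisor_of_isUnit (isUnit_of_isHomogeneous_zero h.isHomogeneous hR0)]
  · obtain ⟨Q, hQ, hspan, hQR, hsq, hlin⟩ := h.exists_usualDual hD h2
    rw [usualDual_eq hQ hspan, primeDivisor, Finsupp.single_apply]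
    split_ifs with hQc
    · obtain ⟨T, rfl⟩ := hQR
      have h1 := divisor_apply_eq hQ (H := T) (fun ⟨T', hT'⟩ => hsq ⟨T', by rw [hT']; ring⟩) 1
      rw [pow_one] at h1
      rw [← hQc, h1, Nat.cast_one]
    · refine divisor_apply_eq_zero fun G hG hGR hGc => ?_
      rcases h.exists_of_dvd hD h2 hG hGR with ⟨x, hx, _, hass⟩ | h1
      · exact hc x hx ((Associates.mk_eq_mk_iff_associated.mpr hass).symm.trans hGc)
      · refine hQc (Eq.trans ?_ hGc)
        rw [Associates.mk_eq_mk_iff_associated]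
        exact Ideal.span_singleton_eq_span_singleton.mp (hspan.symm.trans h1)

/-- The lines among the components of the discriminant form of an irreducible curve are dual to
singular points. -/
lemma IsDiscriminantForm.gradientAt_eq_zero_of_irreducible {D R : MvPolynomial (Fin 3) K} {d : ℕ}
    (h : IsDiscriminantForm D d R) (hD : Irreducible D) {x : Fin 3 → K} (hx : x ≠ 0)
    (hxR : linForm x ∣ R) : gradientAt D x = 0 := by
  have hR0 := h.ne_zero hD.squarefree
  rcases Nat.lt_or_ge d 2 with h2 | h2
  · have hd1 : d = 1 := by have := degree_pos_of_irreducible h.left hD; omega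
    subst hd1
    exact absurd (isUnit_of_dvd_unit hxR (isUnit_of_isHomogeneous_zero h.isHomogeneous hR0))
      (irreducible_linForm hx).not_isUnit
  · rcases h.exists_of_dvd hD h2 (irreducible_linForm hx) hxR with ⟨y, hy, hgrad, hass⟩ | h1
    · obtain ⟨c, rfl⟩ := exists_smul_of_linForm_dvd hass.symm.dvd
      rw [gradientAt_smul h.left, hgrad, smul_zero]
    · obtain ⟨Q, hQ, hspan, _, _, hlin⟩ := h.exists_usualDual hD h2
      exact absurd (Ideal.span_singleton_eq_span_singleton.mp (hspan.symm.trans h1)) (hlin x hx)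

end UsualDual

/-! ### The dual curve as the divisor of the discriminant form -/

section DualCurve

variable {K : Type u} [Field K] [IsAlgClosed K] [CharZero K]

omit [IsAlgClosed K] [CharZero K] in
lemma sum_map_factors_of_irreducible {f : MvPolynomial (Fin 3) K → Div K}
    (hf : ∀ P Q, Associated P Q → f P = f Q) {Q : MvPolynomial (Fin 3) K} (hQ : Irreducible Q) :
    ((UniqueFactorizationMonoid.factors Q).map f).sum = f Q := by
  obtain ⟨Q', hQ', h⟩ := prime_factors_irreducible hQ
    ⟨fun _ => UniqueFactorizationMonoid.prime_of_factor _,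
      UniqueFactorizationMonoid.factors_prod hQ.ne_zero⟩
  rw [h, Multiset.map_singleton, Multiset.sum_singleton, hf _ _ hQ'.symm]

/-- The components of the discriminant form of a reduced curve: apart from lines, they are the
usual duals of the components of the curve, and the lines are dual to singular points. The resultant
of two components contributes only lines dual to their common points, which are singular. -/
theorem IsDiscriminantForm.components {P : MvPolynomial (Fin 3) K} (hP : Squarefree P) {d : ℕ}
    {G : MvPolynomial (Fin 3) K} (h : IsDiscriminantForm P d G) :
    (∀ c : Associates (MvPolynomial (Fin 3) K),
      (∀ x : Fin 3 → K, x ≠ 0 → Associates.mk (linForm x) ≠ c) →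
        divisor G c = ((UniqueFactorizationMonoid.factors P).map usualDual).sum c) ∧
    ∀ x : Fin 3 → K, x ≠ 0 → linForm x ∣ G → eval x P = 0 ∧ gradientAt P x = 0 := by
  induction P using WfDvdMonoid.induction_on_irreducible generalizing d G with
  | zero => exact absurd hP not_squarefree_zero
  | unit u hu =>
    have hG0 := h.ne_zero hP
    obtain ⟨e, he, rfl⟩ := exists_eq_C_of_isUnit hu
    have hd : d = 0 := h.left.inj_right (isHomogeneous_C _ e) hP.ne_zero
    subst hd
    have hG := isUnit_of_isHomogeneous_zero h.isHomogeneous hG0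
    refine ⟨fun c _ => ?_, fun x hx hxG => absurd (isUnit_of_dvd_unit hxG hG)
      (irreducible_linForm hx).not_isUnit⟩
    rw [divisor_of_isUnit hG, UniqueFactorizationMonoid.factors_of_isUnit hu]
    rfl
  | mul A D hA hD ih =>
    have hDA0 := hP.ne_zero
    have hAs : Squarefree A := hP.squarefree_of_dvd (dvd_mul_left A D)
    obtain ⟨p, hp⟩ := isHomogeneous_of_dvd h.left hDA0 (dvd_mul_right D A)
    obtain ⟨q, hq⟩ := isHomogeneous_of_dvd h.left hDA0 (dvd_mul_left A D)
    have hd : d = p + q := h.left.inj_right (hp.mul hq) hDA0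
    subst hd
    have hrel : IsRelPrime D A := (squarefree_mul_iff.mp hP).1
    obtain ⟨G₁, h₁⟩ := exists_isDiscriminantForm hp
    obtain ⟨G₂, h₂⟩ := exists_isDiscriminantForm hq
    obtain ⟨R, hR⟩ := exists_isResultantForm hp hq
    have hG := IsDiscriminantForm.associated_mul hD.ne_zero hA h h₁ h₂ hR
    have hG₁ := h₁.ne_zero hD.squarefree
    have hG₂ := h₂.ne_zero hAs
    have hR0 := hR.ne_zero hD.ne_zero hA hrel
    obtain ⟨ih1, ih2⟩ := ih hAs h₂
    constructor
    · intro c hc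
      have hRc : divisor R c = 0 := divisor_apply_eq_zero fun Q hQ hQR hQc => by
        obtain ⟨x, hx, _, _, hass⟩ := hR.exists_associated_linForm hD.ne_zero hA hR0 hQ hQR
        exact hc x hx ((Associates.mk_eq_mk_iff_associated.mpr hass).symm.trans hQc)
      rw [sum_map_congr_of_rel_associated (fun _ _ => usualDual_congr)
        (UniqueFactorizationMonoid.factors_mul hD.ne_zero hA), Multiset.map_add, Multiset.sum_add,
        sum_map_factors_of_irreducible (fun _ _ => usualDual_congr) hD, divisor_congr hG,
        divisor_mul (mul_ne_zero hG₁ hG₂) (pow_ne_zero 2 hR0), divisor_mul hG₁ hG₂,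
        divisor_pow hR0, Finsupp.add_apply,
        Finsupp.add_apply, Finsupp.smul_apply, hRc, smul_zero, add_zero,
        h₁.divisor_apply_of_irreducible hD hc, ih1 c hc, Finsupp.add_apply]
    · intro x hx hxG
      have hprime := (irreducible_linForm hx).prime
      rw [map_mul, gradientAt_mul]
      rcases hprime.dvd_or_dvd (hG.dvd_iff_dvd_right.mp hxG) with h0 | h0
      · rcases hprime.dvd_or_dvd h0 with h1 | h1
        · have hg := h₁.gradientAt_eq_zero_of_irreducible hD hx h1
          have hx0 : eval x D = 0 := by
            have h3 := dotProduct_gradientAt hp x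
            rw [hg, dotProduct_zero] at h3
            exact (mul_eq_zero.mp h3.symm).resolve_left
              (Nat.cast_ne_zero.mpr (degree_pos_of_irreducible hp hD).ne')
          rw [hg, hx0, zero_mul, zero_smul, smul_zero, add_zero]
          exact ⟨rfl, rfl⟩
        · obtain ⟨hx0, hg⟩ := ih2 x hx h1
          rw [hg, hx0, mul_zero, zero_smul, smul_zero, add_zero]
          exact ⟨rfl, rfl⟩
      · have h1 := hprime.dvd_of_dvd_pow h0
        obtain ⟨y, hy, hyD, hyA, hass⟩ :=
          hR.exists_associated_linForm hD.ne_zero hA hR0 (irreducible_linForm hx) h1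
        obtain ⟨c, rfl⟩ := exists_smul_of_linForm_dvd hass.symm.dvd
        rw [eval_smul_of_isHomogeneous hp, eval_smul_of_isHomogeneous hq, hyD, hyA, mul_zero,
          mul_zero, zero_smul, zero_smul, mul_zero, add_zero]
        exact ⟨rfl, rfl⟩

omit [IsAlgClosed K] [CharZero K] in
lemma polar_eq_dirDeriv (P : MvPolynomial (Fin 3) K) (c : Fin 3 → K) : polar P c = dirDeriv c P :=
  rfl

omit [IsAlgClosed K] [CharZero K] in
lemma eq_of_X_pow_mul_eq {A B : Polynomial K} {m n : ℕ} (hA : A.eval 0 ≠ 0) (hB : B.eval 0 ≠ 0)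
    (h : Polynomial.X ^ m * A = Polynomial.X ^ n * B) : m = n := by
  have key : ∀ {A B : Polynomial K} {m n : ℕ}, B.eval 0 ≠ 0 →
      Polynomial.X ^ m * A = Polynomial.X ^ n * B → m ≤ n := fun {A B m n} hB h => by
    by_contra hlt
    obtain ⟨r, rfl⟩ : ∃ r, m = n + (r + 1) := ⟨m - n - 1, by omega⟩
    rw [pow_add, mul_assoc] at h
    have h1 := mul_left_cancel₀ (pow_ne_zero n Polynomial.X_ne_zero) h
    apply hB
    rw [← h1, pow_succ]
    simp
  exact le_antisymm (key hB h) (key hA h.symm)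

/-- The point `x` is the only zero `y` of `P` and of the polar of a general point `c` for which the
line through `c` and `x` passes through `y`: that line would be tangent at `y`, so it would lie on
another component of the discriminant form, but `c` is general. -/
lemma IsDiscriminantForm.linForm_dvd_of_polar {P G H : MvPolynomial (Fin 3) K} {d n : ℕ}
    (h : IsDiscriminantForm P d G) (hd : 2 ≤ d) (hP : Squarefree P) {x c y : Fin 3 → K}
    (hx : x ≠ 0) (hG : G = linForm x ^ n * H) (hc : eval c P ≠ 0) (hH : eval (c ⨯₃ x) H ≠ 0)
    (hy : y ≠ 0) (hyP : eval y P = 0) (hyc : eval y (dirDeriv c P) = 0)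
    (hyx : y ⬝ᵥ (c ⨯₃ x) = 0) : linForm x ∣ linForm y := by
  by_contra hxy
  have hcy : c ⨯₃ y ≠ 0 := fun h0 => by
    obtain ⟨j, hj⟩ := Function.ne_iff.mp hy
    have h1 : y j • c = c j • y := by
      ext i
      simpa [mul_comm] using mul_eq_mul_of_cross_eq_zero h0 i j
    have h2 := eval_smul_of_isHomogeneous h.left (y j) c
    rw [h1, eval_smul_of_isHomogeneous h.left, hyP, mul_zero] at h2
    exact hc ((mul_eq_zero.mp h2.symm).resolve_left (pow_ne_zero _ hj))
  rw [eval_dirDeriv_eq_dotProduct] at hyc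
  have hyy : y ⬝ᵥ gradientAt P y = 0 := by rw [dotProduct_gradientAt h.left, hyP, mul_zero]
  obtain ⟨s, hs⟩ := exists_smul_cross hcy hyc hyy
  obtain ⟨t, ht⟩ := exists_smul_cross hcy (dot_self_cross c x) hyx
  -- a component `Q` of the discriminant form that vanishes at the line and is not `linForm x`
  have key : ∀ Q, Irreducible Q → Q ∣ G → ¬ Associated Q (linForm x) →
      eval (c ⨯₃ x) Q = 0 → False := fun Q hQ hQG hass hQ0 => by
    rw [hG] at hQG
    rcases hQ.prime.dvd_or_dvd hQG with h1 | h1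
    · exact hass (hQ.associated_of_dvd (irreducible_linForm hx) (hQ.prime.dvd_of_dvd_pow h1))
    · obtain ⟨T, rfl⟩ := h1
      rw [map_mul, hQ0, zero_mul] at hH
      exact hH rfl
  by_cases hgrad : gradientAt P y = 0
  · refine key (linForm y) (irreducible_linForm hy) ?_ (fun hass => hxy hass.symm.dvd) ?_
    · exact linForm_dvd_of_forall hy fun w hw =>
        h.eval_eq_zero (s := 0) (by omega) hy hw (by rw [hgrad, zero_smul])
    · rw [eval_linForm, hyx]
  · have hs0 : s ≠ 0 := fun h0 => hgrad (by rw [hs, h0, zero_smul])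
    obtain ⟨D, hD, ⟨A, hA⟩, hDy⟩ := exists_irreducible_dvd_of_aeval_eq_zero (w := y) hP.ne_zero
      (by rwa [aeval_eq_eval])
    rw [aeval_eq_eval] at hDy
    have hP0 := hP.ne_zero
    have hPs := hP
    rw [hA] at hP0 hPs
    have hgradD : gradientAt P y = eval y A • gradientAt D y := by
      rw [hA, gradientAt_mul, hDy, zero_smul, zero_add]
    have hA0 : eval y A ≠ 0 := fun h0 => hgrad (by rw [hgradD, h0, zero_smul])
    have hD0 : gradientAt D y ≠ 0 := fun h0 => hgrad (by rw [hgradD, h0, smul_zero])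
    have hw : c ⨯₃ x = (t * s⁻¹ * eval y A) • gradientAt D y := by
      rw [mul_smul, ← hgradD, hs, smul_smul, inv_mul_cancel_right₀ hs0, ht]
    obtain ⟨p, hp⟩ := isHomogeneous_of_dvd h.left hP.ne_zero ⟨A, hA⟩
    obtain ⟨q, hq⟩ := isHomogeneous_of_dvd h.left hP.ne_zero ⟨D, hA.trans (mul_comm _ _)⟩
    rcases Nat.lt_or_ge p 2 with h2 | h2
    · have hp1 : p = 1 := by have := degree_pos_of_irreducible hp hD; omega
      subst hp1
      obtain ⟨z, rfl⟩ := exists_eq_linForm hp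
      rw [gradientAt_linForm] at hw hgradD
      have hcz : c ⬝ᵥ z = 0 := by
        rw [hgradD, dotProduct_smul, smul_eq_mul] at hyc
        exact (mul_eq_zero.mp hyc).resolve_left hA0
      apply hc
      rw [hA, map_mul, eval_linForm, dotProduct_comm, hcz, zero_mul]
    · obtain ⟨G₁, h₁⟩ := exists_isDiscriminantForm hp
      obtain ⟨G₂, h₂⟩ := exists_isDiscriminantForm hq
      obtain ⟨R, hR⟩ := exists_isResultantForm hp hq
      have hd' : d = p + q := h.left.inj_right (hA ▸ hp.mul hq) hP.ne_zero
      subst hd'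
      have hass := IsDiscriminantForm.associated_mul hD.ne_zero (right_ne_zero_of_mul hP0)
        (hA ▸ h) h₁ h₂ hR
      obtain ⟨Q, hQ, hspan, hQG, _, hlin⟩ := h₁.exists_usualDual hD h2
      refine key Q hQ ?_ (hlin x hx) ?_
      · exact hass.dvd_iff_dvd_right.mpr ((hQG.mul_right _).mul_right _)
      · have h1 : Q ∈ vanishingIdeal K (tangentCone D) := by
          rw [hspan]; exact Ideal.mem_span_singleton_self Q
        have h3 := h1 (c ⨯₃ x) ⟨y, _, hy, hDy, hD0, hw⟩
        rwa [aeval_eq_eval] at h3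

/-- The intersection multiplicity with a general polar at a point is the multiplicity of the dual
line in the discriminant form: on the lines through the point `c` the discriminant form agrees
with the resultant form of `P` and its polar with respect to `c`. -/
lemma IsDiscriminantForm.intersectionMultiplicity_polar {P G H : MvPolynomial (Fin 3) K} {d n : ℕ}
    (h : IsDiscriminantForm P d G) (hd : 2 ≤ d) (hP : Squarefree P) {p : ℙ K (Fin 3 → K)}
    (hG : G = linForm p.rep ^ n * H) {c : Fin 3 → K} (hpP : eval p.rep P = 0)
    (hc : eval c P ≠ 0) (hH : eval (c ⨯₃ p.rep) H ≠ 0) :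
    intersectionMultiplicity P (polar P c) p = n := by
  obtain ⟨x, hx⟩ : ∃ x, x = p.rep := ⟨_, rfl⟩
  have hx0 : x ≠ 0 := hx ▸ p.rep_nonzero
  rw [← hx] at hG hpP hH
  have hd0 : (d : K) ≠ 0 := Nat.cast_ne_zero.mpr (by omega)
  have hcx : c ⨯₃ x ≠ 0 := fun h0 => by
    obtain ⟨j, hj⟩ := Function.ne_iff.mp hx0
    have h1 : x j • c = c j • x := by
      ext i
      simpa [mul_comm] using mul_eq_mul_of_cross_eq_zero h0 i j
    have h2 := eval_smul_of_isHomogeneous h.left (x j) c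
    rw [h1, eval_smul_of_isHomogeneous h.left, hpP, mul_zero] at h2
    exact hc ((mul_eq_zero.mp h2.symm).resolve_left (pow_ne_zero _ hj))
  obtain ⟨j, hj⟩ := Function.ne_iff.mp hcx
  have hj : (c ⨯₃ x) j ≠ 0 := hj
  -- the pencil of the lines through `c`
  let S := Polynomial K
  let ι : K →+* S := algebraMap K S
  let κ : S →+* K := Polynomial.evalRingHom 0
  have hκι : κ.comp ι = RingHom.id K := by ext z; exact Polynomial.eval_C
  have hcomp : ∀ z : Fin 3 → K, κ ∘ (ι ∘ z) = z := fun z => by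
    rw [← Function.comp_assoc, ← RingHom.coe_comp, hκι]; rfl
  obtain ⟨b, hb⟩ : ∃ b : Fin 3 → S,
    b = ι ∘ x + (Polynomial.X : S) • (ι ∘ Pi.single j 1) := ⟨_, rfl⟩
  have hκX : κ Polynomial.X = 0 := Polynomial.eval_X
  have hκb : κ ∘ b = x := by
    ext i
    have := congrFun (hcomp x) i
    rw [hb]
    simp only [Function.comp_apply, Pi.add_apply, Pi.smul_apply, smul_eq_mul, map_add,
      map_mul] at this ⊢
    rw [this, hκX, zero_mul, add_zero]
  have hκeval : ∀ U : MvPolynomial (Fin 3) K,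
      κ (eval ((ι ∘ c) ⨯₃ b) (U.map ι)) = eval (c ⨯₃ x) U := fun U => by
    rw [ringHom_eval, map_map, hκι, map_id, ringHom_comp_cross, hcomp, hκb]
  obtain ⟨e, he, hlin⟩ : ∃ e : K, e ≠ 0 ∧
      eval ((ι ∘ c) ⨯₃ b) ((linForm x).map ι) = Polynomial.X * ι e := by
    refine ⟨x ⬝ᵥ (c ⨯₃ Pi.single j 1), ?_, ?_⟩
    · rw [triple_product_permutation, triple_product_permutation, single_dotProduct, one_mul,
        ← cross_anticomm, Pi.neg_apply]
      exact neg_ne_zero.mpr hj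
    · rw [map_linForm, eval_linForm, hb, map_add, map_smul, dotProduct_add, dotProduct_smul,
        dot_cross_self, zero_add, smul_eq_mul, ← ringHom_comp_cross, ← RingHom.map_dotProduct]
  have hS := h.baseChange (S := S)
  obtain ⟨s, hs⟩ := hS.resultant_dirDeriv (by omega) (ι ∘ c) b
  rw [← map_dirDeriv] at hs
  obtain ⟨W, hW⟩ := exists_isResultantForm h.left (isHomogeneous_dirDeriv h.left c)
  rw [(hW.baseChange (S := S)).resultant_eq_eval] at hs
  change (d : S) ^ (d - 1) * eval ((ι ∘ c) ⨯₃ b) (W.map ι) =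
    (-1) ^ s * (d * eval (ι ∘ c) (P.map ι)) * eval ((ι ∘ c) ⨯₃ b) (G.map ι) at hs
  rw [← ringHom_eval, hG, map_mul (map ι), map_pow (map ι), map_mul (eval _), map_pow (eval _),
    hlin] at hs
  have hκ0 : ∀ z : S, κ z ≠ 0 → z ≠ 0 := fun z hz h0 => hz (by rw [h0, map_zero])
  have hκn : ∀ m : ℕ, κ (m : S) = m := fun m => map_natCast κ m
  have hκι' : ∀ z, κ (ι z) = z := fun z => RingHom.congr_fun hκι z
  have hκneg : κ (-1) = -1 := (map_neg κ 1).trans (congrArg _ (map_one κ))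
  have hB : κ ((-1 : S) ^ s * ((d : S) * ι (eval c P)) *
      (ι e ^ n * eval ((ι ∘ c) ⨯₃ b) (H.map ι))) ≠ 0 := by
    simp only [map_mul, map_pow, hκneg, hκι', hκeval, hκn]
    exact mul_ne_zero (mul_ne_zero (pow_ne_zero _ (neg_ne_zero.mpr one_ne_zero))
      (mul_ne_zero hd0 hc)) (mul_ne_zero (pow_ne_zero _ he) hH)
  have hs' : (d : S) ^ (d - 1) * eval ((ι ∘ c) ⨯₃ b) (W.map ι) = Polynomial.X ^ n *
      ((-1 : S) ^ s * ((d : S) * ι (eval c P)) * (ι e ^ n * eval ((ι ∘ c) ⨯₃ b) (H.map ι))) := by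
    rw [hs]; ring
  have hW0 : W ≠ 0 := fun h0 => by
    rw [h0, map_zero, map_zero, mul_zero] at hs'
    exact mul_ne_zero (pow_ne_zero n Polynomial.X_ne_zero) (hκ0 _ hB) hs'.symm
  -- the multiplicities of the dual line in `W` and in `G` are the orders along the pencil
  obtain ⟨m, H', hWm, hH'⟩ := exists_eq_pow_mul hW0 (irreducible_linForm hx0)
  have hpol0 : dirDeriv c P ≠ 0 := fun h0 => by
    have h1 := euler_dirDeriv h.left c
    rw [h0, map_zero] at h1
    exact mul_ne_zero hd0 hc h1.symm
  have hHH' : eval (c ⨯₃ x) H' ≠ 0 := fun h0 => by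
    have hH'0 : H' ≠ 0 := fun h0 => hH' (h0 ▸ dvd_zero _)
    obtain ⟨Q, hQ, hQH, hQ0⟩ := exists_irreducible_dvd_of_aeval_eq_zero (w := c ⨯₃ x) hH'0
      (by rwa [aeval_eq_eval])
    obtain ⟨y, hy, hyP, hyc, hass⟩ := hW.exists_associated_linForm hP.ne_zero hpol0 hW0 hQ
      (hWm ▸ hQH.mul_left _)
    refine hH' ((h.linForm_dvd_of_polar hd hP hx0 hG hc hH hy hyP hyc ?_).trans
      (hass.symm.dvd.trans hQH))
    obtain ⟨T, hT⟩ := hass.dvd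
    rw [← eval_linForm, hT, map_mul, ← aeval_eq_eval, hQ0, zero_mul]
  have hmn : m = n := by
    rw [hWm, map_mul (map ι), map_pow (map ι), map_mul (eval _), map_pow (eval _), hlin,
      show (d : S) ^ (d - 1) * ((Polynomial.X * ι e) ^ m * eval ((ι ∘ c) ⨯₃ b) (H'.map ι)) =
        Polynomial.X ^ m * ((d : S) ^ (d - 1) * (ι e ^ m * eval ((ι ∘ c) ⨯₃ b) (H'.map ι))) by
        ring] at hs'
    refine eq_of_X_pow_mul_eq ?_ hB hs'
    change κ _ ≠ 0
    simp only [map_mul, map_pow, hκι', hκeval, hκn]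
    exact mul_ne_zero (pow_ne_zero _ hd0) (mul_ne_zero (pow_ne_zero _ he) hHH')
  rw [← hmn, intersectionMultiplicity, polar_eq_dirDeriv]
  rw [hx] at hWm hH'
  exact localMultiplicity_eq hW hP.ne_zero hpol0 (Function.ne_iff.mp p.rep_nonzero).choose_spec
    hWm hH'

/-- The multiplicity of a singular point in the dual curve is the multiplicity of its dual line in
the discriminant form. -/
lemma IsDiscriminantForm.polarMultiplicity_eq {P G H : MvPolynomial (Fin 3) K} {d n : ℕ}
    (h : IsDiscriminantForm P d G) (hd : 2 ≤ d) (hP : Squarefree P) {p : ℙ K (Fin 3 → K)}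
    (hpP : eval p.rep P = 0) (hG : G = linForm p.rep ^ n * H) (hH : ¬ linForm p.rep ∣ H) :
    polarMultiplicity P p = n := by
  obtain ⟨g, hg⟩ : ∃ g, g = P * aeval ((X : Fin 3 → MvPolynomial (Fin 3) K) ⨯₃ (C ∘ p.rep)) H :=
    ⟨_, rfl⟩
  have hgn : ∀ c, eval c g ≠ 0 → intersectionMultiplicity P (polar P c) p = n := fun c hc => by
    rw [hg, map_mul, eval_aeval_cross] at hc
    exact h.intersectionMultiplicity_polar hd hP hG hpP (left_ne_zero_of_mul hc)
      (right_ne_zero_of_mul hc)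
  have hg0 : g ≠ 0 := by
    rw [hg]
    refine mul_ne_zero hP.ne_zero fun h0 => hH (linForm_dvd_of_forall p.rep_nonzero fun w hw => ?_)
    obtain ⟨c, hc⟩ := exists_cross_eq p.rep_nonzero hw
    have h1 := eval_aeval_cross H (-c) p.rep
    rw [h0, map_zero, ← cross_anticomm, map_neg, neg_neg, hc] at h1
    exact h1.symm
  -- the infimum in `polarMultiplicity` is over one number, as two general conditions meet
  have hset : {m : ℕ | ∃ g : MvPolynomial (Fin 3) K, g ≠ 0 ∧
      ∀ c : Fin 3 → K, eval c g ≠ 0 → intersectionMultiplicity P (polar P c) p = m} = {n} := by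
    ext m
    rw [Set.mem_ofPred_eq, Set.mem_singleton_iff]
    constructor
    · rintro ⟨g', hg', hm⟩
      obtain ⟨c, hc⟩ := exists_eval_ne_zero (mul_ne_zero hg0 hg')
      rw [map_mul] at hc
      rw [← hm c (right_ne_zero_of_mul hc), hgn c (left_ne_zero_of_mul hc)]
    · rintro rfl
      exact ⟨g, hg0, hgn⟩
  rw [polarMultiplicity, hset, csInf_singleton]

/-- The dual curve of a reduced curve is the divisor of its discriminant form. -/
theorem IsDiscriminantForm.dualCurve_eq_divisor {P G : MvPolynomial (Fin 3) K} {d : ℕ}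
    (h : IsDiscriminantForm P d G) (hP : Squarefree P) : dualCurve P = divisor G := by
  have hG0 := h.ne_zero hP
  obtain ⟨hcomp, hsing⟩ := h.components hP
  have hn : ∀ p ∈ singularPoints P, ∃ H, G = linForm p.rep ^ polarMultiplicity P p * H ∧
      ¬ linForm p.rep ∣ H := by
    rintro p ⟨hp, hgrad⟩
    obtain ⟨n, H, hG, hH⟩ := exists_eq_pow_mul hG0 (irreducible_linForm_rep p)
    have hd : 2 ≤ d := by
      have h0 := degree_pos_of_eval_eq_zero h.left hP.ne_zero hp
      by_contra hd
      have hd1 : d = 1 := by omega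
      subst hd1
      obtain ⟨z, rfl⟩ := exists_eq_linForm h.left
      rw [gradientAt_linForm] at hgrad
      exact hP.ne_zero (by rw [hgrad]; simp [linForm])
    exact ⟨H, by rw [h.polarMultiplicity_eq hd hP hp hG hH]; exact hG, hH⟩
  ext c
  rw [dualCurve, Finsupp.add_apply]
  by_cases hc : ∃ x : Fin 3 → K, x ≠ 0 ∧ Associates.mk (linForm x) = c
  · obtain ⟨x, hx, rfl⟩ := hc
    obtain ⟨p, hp⟩ := exists_associated_linForm_rep hx
    rw [Associates.mk_eq_mk_iff_associated.mpr hp]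
    have h1 : ((UniqueFactorizationMonoid.factors P).map usualDual).sum
        (Associates.mk (linForm p.rep)) = 0 := by
      rw [← Finsupp.applyAddHom_apply, AddMonoidHom.map_multiset_sum, Multiset.map_map]
      refine Multiset.sum_eq_zero fun z hz => ?_
      obtain ⟨D, hD, rfl⟩ := Multiset.mem_map.mp hz
      obtain ⟨e, he⟩ := isHomogeneous_of_dvd h.left hP.ne_zero
        (UniqueFactorizationMonoid.dvd_of_mem_factors hD)
      exact usualDual_apply_linForm he (UniqueFactorizationMonoid.irreducible_of_factor D hD)
        p.rep_nonzero
    rw [h1, zero_add]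
    by_cases hps : p ∈ singularPoints P
    · exact finsum_dualLine_apply_mk _ _ hn hps
    · rw [finsum_dualLine_apply_eq_zero _ _ hn, divisor_apply_of_not_dvd]
      · exact fun hdvd => hps (hsing _ p.rep_nonzero hdvd)
      · intro q hq hqp
        exact hps (mk_linForm_injective hqp ▸ hq)
  · push Not at hc
    rw [finsum_dualLine_apply_eq_zero _ _ hn (fun q _ => hc _ q.rep_nonzero), add_zero,
      hcomp c hc]

end DualCurve

/-! ### Families of forms and their discriminants -/

section Coefficients

variable {k : Type*} [Field k]

theorem coeff_tCoeff (F : MvPolynomial (Fin 3) (PowerSeries k)) (i : ℕ) (m : Fin 3 →₀ ℕ) :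
    coeff m (tCoeff F i) = PowerSeries.coeff i (coeff m F) := by
  classical
  simp only [tCoeff, coeff_sum, coeff_monomial, Finset.sum_ite_eq']
  split_ifs with h
  · rfl
  · rw [notMem_support_iff.mp h, map_zero]

theorem tCoeff_zero_eq_map (F : MvPolynomial (Fin 3) (PowerSeries k)) :
    tCoeff F 0 = map PowerSeries.constantCoeff F := by
  ext m
  rw [coeff_tCoeff, coeff_map, PowerSeries.coeff_zero_eq_constantCoeff_apply]

theorem isHomogeneous_tCoeff {F : MvPolynomial (Fin 3) (PowerSeries k)} {d : ℕ}
    (hF : F.IsHomogeneous d) (i : ℕ) : (tCoeff F i).IsHomogeneous d := by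
  intro m hm
  refine hF fun h => hm ?_
  rw [coeff_tCoeff, h, map_zero]

/-- A polynomial with coefficients in `k[[t]]`, as a power series in `t` whose coefficients are
polynomials. -/
noncomputable def toPowerSeries :
    MvPolynomial (Fin 3) (PowerSeries k) →+* PowerSeries (MvPolynomial (Fin 3) k) :=
  eval₂Hom (PowerSeries.map C) fun i => PowerSeries.C (X i)

theorem coeff_toPowerSeries (F : MvPolynomial (Fin 3) (PowerSeries k)) (i : ℕ) :
    PowerSeries.coeff i (toPowerSeries F) = tCoeff F i := by
  have key : ∀ m : Fin 3 →₀ ℕ,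
      coeff m (PowerSeries.coeff i (toPowerSeries F)) = PowerSeries.coeff i (coeff m F) := by
    classical
    intro m
    induction F using MvPolynomial.induction_on' with
    | monomial s a =>
      have : toPowerSeries (monomial s a) =
          PowerSeries.map C a * PowerSeries.C (monomial s (1 : k)) := by
        simp only [toPowerSeries, coe_eval₂Hom, eval₂_monomial]
        rw [monomial_eq, Finsupp.prod, Finsupp.prod, map_mul, map_prod]
        simp
      rw [this, PowerSeries.coeff_mul_C, PowerSeries.coeff_map, coeff_C_mul, coeff_monomial,
        coeff_monomial]
      split_ifs <;> simp
    | add F G hF hG => rw [map_add, map_add, coeff_add, coeff_add, map_add, hF, hG]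
  ext m
  rw [key, coeff_tCoeff]

theorem toPowerSeries_map_C (P : MvPolynomial (Fin 3) k) :
    toPowerSeries (map PowerSeries.C P) = PowerSeries.C P := by
  ext i m
  rw [coeff_toPowerSeries, coeff_tCoeff, coeff_map, PowerSeries.coeff_C, PowerSeries.coeff_C]
  split_ifs <;> simp

theorem toPowerSeries_C_X_pow (n : ℕ) :
    toPowerSeries (C (PowerSeries.X ^ n : PowerSeries k)) = PowerSeries.X ^ n := by
  simp [toPowerSeries]

theorem exists_eq_C_X_pow_mul {F : MvPolynomial (Fin 3) (PowerSeries k)} {n : ℕ}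
    (h : ∀ i < n, tCoeff F i = 0) : ∃ G, F = C (PowerSeries.X ^ n) * G := by
  refine (C_dvd_iff_dvd_coeff _ _).mpr fun m => PowerSeries.X_pow_dvd_iff.mpr fun i hi => ?_
  rw [← coeff_tCoeff, h i hi, coeff_zero]

theorem eq_zero_of_forall_tCoeff {F : MvPolynomial (Fin 3) (PowerSeries k)}
    (h : ∀ i, tCoeff F i = 0) : F = 0 := by
  ext m i
  rw [← coeff_tCoeff, h i]
  simp

theorem eval_tCoeff (F : MvPolynomial (Fin 3) (PowerSeries k)) (i : ℕ) (w : Fin 3 → k) :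
    eval w (tCoeff F i) = PowerSeries.coeff i (eval (PowerSeries.C ∘ w) F) := by
  have h : (PowerSeries.map (eval w)).comp toPowerSeries =
      (eval (PowerSeries.C ∘ w) : MvPolynomial (Fin 3) (PowerSeries k) →+* PowerSeries k) := by
    refine MvPolynomial.ringHom_ext (fun a => ?_) fun j => ?_
    · ext i
      simp [toPowerSeries]
    · simp [toPowerSeries]
  rw [← h, RingHom.comp_apply, PowerSeries.coeff_map, coeff_toPowerSeries]

end Coefficients

section Discriminants

variable {k : Type*} [Field k]

theorem mul_exactQuotient {P Q : MvPolynomial (Fin 3) k} (h : Q ∣ P) :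
    Q * exactQuotient P Q = P := by
  rw [exactQuotient, dif_pos h]
  exact h.choose_spec.symm

theorem isHomogeneous_exactQuotient {P Q : MvPolynomial (Fin 3) k} {d e : ℕ} (h : Q ∣ P)
    (hP : P.IsHomogeneous (d + e)) (hQ : Q.IsHomogeneous e) (hQ0 : Q ≠ 0) :
    (exactQuotient P Q).IsHomogeneous d := by
  have hq := mul_exactQuotient h
  by_cases h0 : P = 0
  · have : exactQuotient P Q = 0 := by
      rw [h0] at hq ⊢
      exact (mul_eq_zero.mp hq).resolve_left hQ0
    rw [this]
    exact isHomogeneous_zero _ _ _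
  · obtain ⟨m, hm⟩ := isHomogeneous_of_dvd hP h0 ⟨Q, by rw [mul_comm, hq]⟩
    have h1 := hQ.mul hm
    rw [hq] at h1
    have h2 := h1.inj_right hP h0
    rwa [show d = m by omega]

theorem discriminant_succ_succ (F : ℕ → MvPolynomial (Fin 3) k) (E B : MvPolynomial (Fin 3) k)
    (n : ℕ) : discriminant F E B (n + 2) = B ^ (n + 1) * F (n + 2) - ∑ i : Fin (n + 1),
      (C (1 / 2) * exactQuotient (discriminant F E B (i + 1)) E) *
        (C (1 / 2) * exactQuotient (discriminant F E B (n + 1 - i)) E) := by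
  rw [discriminant]

/-- The degree of the discriminant `Δ_n`, if `E` has degree `e` and `B` has degree `b`. -/
theorem isHomogeneous_discriminant {F : ℕ → MvPolynomial (Fin 3) k}
    {E B : MvPolynomial (Fin 3) k} {b e : ℕ} (hF : ∀ i, (F i).IsHomogeneous (b + 2 * e))
    (hE : E.IsHomogeneous e) (hE0 : E ≠ 0) (hB : B.IsHomogeneous b) (n : ℕ)
    (h : ∀ i, i < n → E ∣ discriminant F E B (i + 1)) :
    (discriminant F E B (n + 1)).IsHomogeneous (n * b + (b + 2 * e)) := by
  induction n using Nat.strong_induction_on with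
  | _ n ih =>
    match n with
    | 0 => simpa [discriminant] using hF 1
    | n + 1 =>
      rw [discriminant_succ_succ]
      refine IsHomogeneous.sub ?_ (IsHomogeneous.sum _ _ _ fun i _ => ?_)
      · rw [show (n + 1) * b + (b + 2 * e) = b * (n + 1) + (b + 2 * e) by ring]
        exact (hB.pow (n + 1)).mul (hF (n + 2))
      · obtain ⟨j, hj⟩ : ∃ j, n = i + j := ⟨n - i, by omega⟩
        have hij : n + 1 - (i : ℕ) = j + 1 := by omega
        have key : ∀ r, r < n + 1 → (C (1 / 2) *
            exactQuotient (discriminant F E B (r + 1)) E).IsHomogeneous (r * b + b + e) := by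
          intro r hr
          have h1 := isHomogeneous_exactQuotient (d := r * b + b + e) (h r hr) (by
            rw [show r * b + b + e + e = r * b + (b + 2 * e) by ring]
            exact ih r hr fun i hi => h i (hi.trans hr)) hE hE0
          simpa using (isHomogeneous_C (Fin 3) (1 / 2 : k)).mul h1
        rw [hij]
        rw [show (n + 1) * b + (b + 2 * e) = i * b + b + e + (j * b + b + e) by
          generalize (i : ℕ) = r at hj
          rw [hj]
          ring]
        exact (key i i.2).mul (key j (by omega))

/-- If `E` divides the first `n - 1` discriminants, then `B ^ (2 * n - 1) * F(t)` is congruent to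
a square modulo `t ^ n`, and the next coefficient of the difference is `B ^ n * Δ_n`. The square
root is the sum of the terms `t ^ i * B ^ (n - i) * p_i` for `i < n`, where `p_0 = E` and
`p_i = Δ_i / (2 * E)`. -/
theorem exists_sq_approx [CharZero k] {F : MvPolynomial (Fin 3) (PowerSeries k)}
    {E B : MvPolynomial (Fin 3) k} (h0 : tCoeff F 0 = E ^ 2 * B) {n : ℕ} (hn : 1 ≤ n)
    (h : ∀ i, 1 ≤ i → i < n → E ∣ discriminant (tCoeff F) E B i) :
    ∃ H G : MvPolynomial (Fin 3) (PowerSeries k), map PowerSeries.constantCoeff H = B ^ n * E ∧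
      map PowerSeries.C B ^ (2 * n - 1) * F = H ^ 2 + C (PowerSeries.X ^ n) *
        (map PowerSeries.C B ^ n * map PowerSeries.C (discriminant (tCoeff F) E B n)) +
        C (PowerSeries.X ^ (n + 1)) * G := by
  obtain ⟨Δ, hΔ⟩ : ∃ Δ, Δ = discriminant (tCoeff F) E B := ⟨_, rfl⟩
  obtain ⟨q, hq⟩ : ∃ q : ℕ → MvPolynomial (Fin 3) k,
      q = fun i => C (1 / 2) * exactQuotient (Δ i) E := ⟨_, rfl⟩
  rw [← hΔ] at h ⊢
  have hq2 : ∀ i, 1 ≤ i → i < n → 2 * E * q i = Δ i := by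
    intro i h1 h2
    have h3 : (C (1 / 2) : MvPolynomial (Fin 3) k) * 2 = 1 := by
      rw [show (2 : MvPolynomial (Fin 3) k) = C 2 from (map_ofNat C 2).symm, ← C_mul]
      simp
    rw [hq]
    linear_combination E * exactQuotient (Δ i) E * h3 + mul_exactQuotient (h i h1 h2)
  have hrec : ∀ i, B ^ i * tCoeff F (i + 1) =
      Δ (i + 1) + ∑ r ∈ Finset.range i, q (r + 1) * q (i - r) := by
    intro i
    rw [hΔ]
    match i with
    | 0 => simp [discriminant]
    | i + 1 =>
      rw [discriminant_succ_succ, ← Fin.sum_univ_eq_sum_range (fun r => q (r + 1) * q (i + 1 - r)),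
        hq, hΔ]
      ring
  obtain ⟨p, hp⟩ : ∃ p : ℕ → MvPolynomial (Fin 3) k, p = fun i => if i = 0 then E else q i :=
    ⟨_, rfl⟩
  have hp0 : p 0 = E := by simp [hp]
  have hp1 : ∀ i, p (i + 1) = q (i + 1) := fun i => by simp [hp]
  obtain ⟨H, hH⟩ : ∃ H : MvPolynomial (Fin 3) (PowerSeries k), H = ∑ i ∈ Finset.range n,
      C (PowerSeries.X ^ i) * map PowerSeries.C (B ^ (n - i) * p i) := ⟨_, rfl⟩
  have hHT : ∀ i, PowerSeries.coeff i (toPowerSeries H) =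
      if i < n then B ^ (n - i) * p i else 0 := by
    intro i
    rw [hH, map_sum, map_sum]
    simp only [map_mul toPowerSeries, toPowerSeries_C_X_pow, toPowerSeries_map_C,
      PowerSeries.coeff_X_pow_mul', PowerSeries.coeff_C]
    have : ∀ j ∈ Finset.range n, (if j ≤ i then if i - j = 0 then B ^ (n - j) * p j else 0 else 0) =
        if i = j then B ^ (n - i) * p i else 0 := by
      intro j _
      by_cases hij : i = j
      · subst hij
        simp
      · rw [if_neg hij]
        split_ifs
        · omega
        · rfl
        · rfl
    rw [Finset.sum_congr rfl this, Finset.sum_ite_eq]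
    simp only [Finset.mem_range]
  refine ⟨H, ?_⟩
  -- the coefficients of `t ^ i` agree for `i ≤ n`
  have hlow : ∀ i < n + 1, tCoeff (map PowerSeries.C B ^ (2 * n - 1) * F - H ^ 2 -
      C (PowerSeries.X ^ n) * (map PowerSeries.C B ^ n * map PowerSeries.C (Δ n))) i = 0 := by
    intro i hi
    rw [← coeff_toPowerSeries]
    simp only [map_sub, map_mul, map_pow toPowerSeries, toPowerSeries_map_C, toPowerSeries_C_X_pow]
    rw [← map_pow PowerSeries.C B (2 * n - 1), ← map_pow PowerSeries.C B n,
      ← map_mul PowerSeries.C, PowerSeries.coeff_C_mul, coeff_toPowerSeries,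
      PowerSeries.coeff_X_pow_mul', PowerSeries.coeff_C, pow_two, PowerSeries.coeff_mul]
    simp only [hHT]
    match i with
    | 0 =>
      simp only [Finset.Nat.antidiagonal_zero, Finset.sum_singleton, h0, hp0]
      rw [if_pos (by omega), if_neg (by omega)]
      obtain ⟨l, rfl⟩ : ∃ l, n = l + 1 := ⟨n - 1, by omega⟩
      rw [show 2 * (l + 1) - 1 = 2 * l + 1 by omega, Nat.sub_zero]
      ring
    | i + 1 =>
      obtain ⟨l, rfl⟩ : ∃ l, n = i + 1 + l := ⟨n - (i + 1), by omega⟩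
      -- the outer terms of the square are `2 * E * q i = Δ_i`, unless `i = n`; the inner ones form
      -- the sum in the definition of the discriminant
      rw [Finset.Nat.sum_antidiagonal_eq_sum_range_succ (fun r s =>
        (if r < i + 1 + l then B ^ (i + 1 + l - r) * p r else 0) *
          (if s < i + 1 + l then B ^ (i + 1 + l - s) * p s else 0)), Finset.sum_range_succ,
        Finset.sum_range_succ']
      have hmid : ∀ r ∈ Finset.range i, (if r + 1 < i + 1 + l then
          B ^ (i + 1 + l - (r + 1)) * p (r + 1) else 0) * (if i + 1 - (r + 1) < i + 1 + l then
          B ^ (i + 1 + l - (i + 1 - (r + 1))) * p (i + 1 - (r + 1)) else 0) =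
          B ^ (i + 1 + 2 * l) * (q (r + 1) * q (i - r)) := by
        intro r hr
        obtain ⟨j, rfl⟩ : ∃ j, i = r + 1 + j := ⟨i - (r + 1), by
          have := Finset.mem_range.mp hr
          omega⟩
        rw [if_pos (by omega), if_pos (by omega), hp1,
          show r + 1 + j + 1 - (r + 1) = j + 1 by omega, hp1,
          show r + 1 + j - r = j + 1 by omega,
          show r + 1 + j + 1 + l - (r + 1) = j + 1 + l by omega,
          show r + 1 + j + 1 + l - (j + 1) = r + 1 + l by omega]
        ring
      rw [Finset.sum_congr rfl hmid, ← Finset.mul_sum, hp0,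
        show 2 * (i + 1 + l) - 1 = i + 1 + 2 * l + i by omega, pow_add, mul_assoc, hrec,
        Nat.sub_self, Nat.sub_zero, Nat.sub_zero, if_pos (by omega), hp0, hp1]
      rcases Nat.eq_zero_or_pos l with rfl | hl
      · rw [if_neg (by omega), if_pos (by omega), if_pos (by omega)]
        simp only [Nat.add_zero, Nat.mul_zero, Nat.sub_self, if_true]
        ring
      · rw [if_pos (by omega), if_pos (by omega), if_neg (show ¬ i + 1 + l ≤ i + 1 by omega),
          ← hq2 (i + 1) (by omega) (by omega),
          Nat.add_sub_cancel_left]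
        ring
  obtain ⟨G, hG⟩ := exists_eq_C_X_pow_mul hlow
  refine ⟨G, ?_, by rw [← hG]; ring⟩
  rw [← tCoeff_zero_eq_map, ← coeff_toPowerSeries, hHT, if_pos (by omega), hp0, Nat.sub_zero]

end Discriminants

/-! ### The discriminant of a family on a general line -/

section Line

variable {k : Type u} [Field k] [CharZero k]

/-- The critical value of `F(t)` on a line at a critical point near a point of `E = 0`: it vanishes
at `t = 0` to the order given by the type, with leading coefficient given by the discriminant. -/
theorem exists_eval_linePoly_critical {F : MvPolynomial (Fin 3) (PowerSeries k)}
    {E B : MvPolynomial (Fin 3) k} (h0 : tCoeff F 0 = E ^ 2 * B) {n : ℕ} (hn : 1 ≤ n)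
    (h : ∀ i, 1 ≤ i → i < n → E ∣ discriminant (tCoeff F) E B i) {a b : Fin 3 → k}
    {c : PowerSeries k}
    (hc : (linePoly F (PowerSeries.C ∘ a) (PowerSeries.C ∘ b)).derivative.eval c = 0)
    (hE : (linePoly E a b).eval (PowerSeries.constantCoeff c) = 0)
    (hE' : (linePoly E a b).derivative.eval (PowerSeries.constantCoeff c) ≠ 0)
    (hB : (linePoly B a b).eval (PowerSeries.constantCoeff c) ≠ 0) :
    ∃ ψ, (linePoly F (PowerSeries.C ∘ a) (PowerSeries.C ∘ b)).eval c = PowerSeries.X ^ n * ψ ∧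
      (linePoly B a b).eval (PowerSeries.constantCoeff c) ^ (n - 1) *
        PowerSeries.constantCoeff ψ =
      (linePoly (discriminant (tCoeff F) E B n) a b).eval (PowerSeries.constantCoeff c) := by
  obtain ⟨H, G, hH, hG⟩ := exists_sq_approx h0 hn h
  have hcomp : ∀ v : Fin 3 → k, (PowerSeries.constantCoeff : PowerSeries k →+* k) ∘
      (PowerSeries.C ∘ v) = v := fun v => by ext; simp
  have hmap : ∀ P : MvPolynomial (Fin 3) (PowerSeries k),
      (linePoly P (PowerSeries.C ∘ a) (PowerSeries.C ∘ b)).map PowerSeries.constantCoeff =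
        linePoly (map PowerSeries.constantCoeff P) a b := fun P => by
    rw [linePoly_map, hcomp, hcomp]
  have hcc : ∀ P : MvPolynomial (Fin 3) k,
      map PowerSeries.constantCoeff (map PowerSeries.C P) = P := fun P => by
    rw [map_map, show (PowerSeries.constantCoeff : PowerSeries k →+* k).comp PowerSeries.C =
      RingHom.id k by ext; simp, map_id]
  have heval : ∀ p : Polynomial (PowerSeries k), PowerSeries.constantCoeff (p.eval c) =
      (p.map PowerSeries.constantCoeff).eval (PowerSeries.constantCoeff c) := fun p => by
    rw [Polynomial.eval_map, Polynomial.eval₂_hom]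
  have key := congrArg (fun P => linePoly P (PowerSeries.C ∘ a) (PowerSeries.C ∘ b)) hG
  simp only [linePoly_mul, linePoly_add, linePoly_pow, linePoly_C] at key
  have h1 := exists_eval_critical_point hn key hc
  simp only [heval, ← Polynomial.derivative_map, hmap, hcc, hH] at h1
  apply h1
  · rw [linePoly_mul, Polynomial.eval_mul, hE, mul_zero]
  · rw [linePoly_mul, linePoly_pow, Polynomial.derivative_mul, Polynomial.eval_add,
      Polynomial.eval_mul, Polynomial.eval_mul, hE, mul_zero, zero_add, Polynomial.eval_pow]
    exact mul_ne_zero (pow_ne_zero _ hB) hE'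
  · exact hB

end Line

section CriticalPoints

variable {k : Type u} [Field k] [IsAlgClosed k] [CharZero k]

/-- If `f = e ^ 2 * g` at `t = 0`, the squared resultant of `f` and its derivative is computed by
the critical values near the roots of `e`, up to a factor whose value at `t = 0` is explicit. -/
theorem exists_critical_points_sq_mul {f : Polynomial (PowerSeries k)} {d : ℕ} (hd : 0 < d)
    (hfd : f.natDegree = d) (hf : IsUnit f.leadingCoeff) {e g : Polynomial k}
    (h0 : f.map PowerSeries.constantCoeff = e ^ 2 * g)
    (hsep : ∀ θ ∈ e.roots, e.derivative.eval θ ≠ 0) (heg : ∀ θ ∈ e.roots, g.eval θ ≠ 0) :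
    ∃ (c : k → PowerSeries k) (ρ : PowerSeries k),
      (∀ θ ∈ e.roots, PowerSeries.constantCoeff (c θ) = θ ∧ f.derivative.eval (c θ) = 0) ∧
      Polynomial.resultant f f.derivative d (d - 1) ^ 2 =
        ((e.roots.map fun θ => f.eval (c θ)).prod * ρ) ^ 2 ∧
      PowerSeries.constantCoeff ρ =
        (e.leadingCoeff ^ 2 * g.leadingCoeff) ^ (d - 1 - e.natDegree) *
        ((2 * e.leadingCoeff) ^ (2 * e.natDegree) * e.leadingCoeff ^ g.natDegree *
        (e.roots.map e.derivative.eval).prod ^ 2 * (e.roots.map g.eval).prod ^ 2 *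
        (g.roots.map e.eval).prod * (g.roots.map g.derivative.eval).prod) := by
  classical
  have hlead : PowerSeries.constantCoeff f.leadingCoeff ≠ 0 :=
    (hf.map PowerSeries.constantCoeff).ne_zero
  have hdeg : (f.map PowerSeries.constantCoeff).natDegree = d := by
    rw [Polynomial.natDegree_map_of_leadingCoeff_ne_zero _ hlead, hfd]
  have hf0 : e ^ 2 * g ≠ 0 := by
    intro h
    rw [h0, h, Polynomial.natDegree_zero] at hdeg
    omega
  have he0 : e ≠ 0 := fun h => hf0 (by rw [h]; ring)
  have hg0 : g ≠ 0 := fun h => hf0 (by rw [h]; ring)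
  have hdsum : d = 2 * e.natDegree + g.natDegree := by
    rw [← hdeg, h0, Polynomial.natDegree_mul (pow_ne_zero _ he0) hg0, Polynomial.natDegree_pow]
  obtain ⟨l, hl⟩ : ∃ l, l = e.leadingCoeff := ⟨_, rfl⟩
  have hl0 : l ≠ 0 := by rw [hl]; exact Polynomial.leadingCoeff_ne_zero.mpr he0
  have hnodup : e.roots.Nodup := by
    rw [Multiset.nodup_iff_count_le_one]
    intro θ
    by_contra hθ
    push Not at hθ
    have hmem : θ ∈ e.roots := Multiset.count_pos.mp (by omega)
    exact hsep θ hmem (Polynomial.one_lt_rootMultiplicity_iff_isRoot he0 |>.mp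
      (by rwa [← Polynomial.count_roots])).2
  obtain ⟨s, hs⟩ : ∃ s : Finset k, s.val = e.roots := ⟨⟨e.roots, hnodup⟩, rfl⟩
  have hmem : ∀ θ, θ ∈ s ↔ θ ∈ e.roots := fun θ => by rw [← hs]; rfl
  have hprod : e = Polynomial.C l * ∏ θ ∈ s, (Polynomial.X - Polynomial.C θ) := by
    rw [Finset.prod_eq_multiset_prod, hs, hl]
    exact (IsAlgClosed.splits e).eq_prod_roots
  have hcard : s.card = e.natDegree := by
    rw [(IsAlgClosed.splits e).natDegree_eq_card_roots, ← hs]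
    rfl
  obtain ⟨c, hc, hres⟩ := exists_critical_points hd hfd hf (s := s) (a := Polynomial.C (l ^ 2) * g)
    (by rw [h0]; conv_lhs => rw [hprod]
        rw [Polynomial.C_pow]; ring)
    (fun θ hθ => by
      rw [Polynomial.eval_mul, Polynomial.eval_C]
      exact mul_ne_zero (pow_ne_zero _ hl0) (heg θ ((hmem θ).mp hθ)))
  have hder : e * (2 * e.derivative * g + e * g.derivative) = (e ^ 2 * g).derivative := by
    rw [Polynomial.derivative_mul, Polynomial.derivative_sq,
      show Polynomial.C (2 : k) = 2 from map_ofNat _ _]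
    ring
  obtain ⟨ρ, hρ, hρ0⟩ := hres (Polynomial.C l * (2 * e.derivative * g + e * g.derivative)) (by
    rw [h0, ← mul_assoc, mul_comm _ (Polynomial.C l), ← hprod, hder])
  refine ⟨c, ρ, fun θ hθ => hc θ ((hmem θ).mpr hθ), ?_, ?_⟩
  · rw [hρ, Finset.prod_eq_multiset_prod, hs]
  rw [hρ0, hcard]
  have hq : (Polynomial.C l * (2 * e.derivative * g + e * g.derivative)).natDegree ≤
      d - 1 - e.natDegree := by
    refine (Polynomial.natDegree_C_mul_le _ _).trans ?_
    by_cases hY : 2 * e.derivative * g + e * g.derivative = 0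
    · rw [hY, Polynomial.natDegree_zero]
      exact Nat.zero_le _
    · have h1 := Polynomial.natDegree_derivative_le (e ^ 2 * g)
      rw [← hder, Polynomial.natDegree_mul he0 hY, ← h0, hdeg] at h1
      omega
  have hR := Polynomial.resultant_eq_prod_eval (f.map PowerSeries.constantCoeff) _ _ hq
    (IsAlgClosed.splits _)
  rw [hdeg] at hR
  rw [hR, h0, Polynomial.leadingCoeff_mul, Polynomial.leadingCoeff_pow, Polynomial.roots_mul hf0,
    Polynomial.roots_pow, Multiset.map_add, Multiset.prod_add, Multiset.map_nsmul,
    Multiset.prod_nsmul]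
  -- the cofactor `2 e' g + e g'` is `2 e' g` at the roots of `e` and `e g'` at the roots of `g`
  have h1 : (e.roots.map fun θ => (Polynomial.C l *
      (2 * e.derivative * g + e * g.derivative)).eval θ).prod = (2 * l) ^ e.natDegree *
      (e.roots.map e.derivative.eval).prod * (e.roots.map g.eval).prod := by
    rw [(IsAlgClosed.splits e).natDegree_eq_card_roots, ← Multiset.prod_replicate,
      ← Multiset.map_const', ← Multiset.prod_map_mul, ← Multiset.prod_map_mul]
    refine congrArg _ (Multiset.map_congr rfl fun θ hθ => ?_)
    have := (Polynomial.mem_roots'.mp hθ).2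
    rw [Polynomial.IsRoot.def] at this
    simp only [Polynomial.eval_mul, Polynomial.eval_C, Polynomial.eval_add, this,
      Polynomial.eval_ofNat]
    ring
  have h2 : (g.roots.map fun θ => (Polynomial.C l *
      (2 * e.derivative * g + e * g.derivative)).eval θ).prod = l ^ g.natDegree *
      (g.roots.map e.eval).prod * (g.roots.map g.derivative.eval).prod := by
    rw [(IsAlgClosed.splits g).natDegree_eq_card_roots, ← Multiset.prod_replicate,
      ← Multiset.map_const', ← Multiset.prod_map_mul, ← Multiset.prod_map_mul]
    refine congrArg _ (Multiset.map_congr rfl fun θ hθ => ?_)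
    have := (Polynomial.mem_roots'.mp hθ).2
    rw [Polynomial.IsRoot.def] at this
    simp only [Polynomial.eval_mul, Polynomial.eval_C, Polynomial.eval_add, this]
    ring
  rw [h1, h2, hl]
  ring

end CriticalPoints

section Products

/-- Leading coefficients of a product of power series of order `n`. -/
theorem exists_prod_eq_X_pow_mul {k ι : Type*} [Field k] (S : Multiset ι)
    (u : ι → PowerSeries k) (p q : ι → k) (n : ℕ)
    (h : ∀ θ ∈ S, ∃ ψ, u θ = PowerSeries.X ^ n * ψ ∧
      p θ * PowerSeries.constantCoeff ψ = q θ) :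
    ∃ Ψ, (S.map u).prod = PowerSeries.X ^ (n * S.card) * Ψ ∧
      (S.map p).prod * PowerSeries.constantCoeff Ψ = (S.map q).prod := by
  induction S using Multiset.induction_on with
  | empty => exact ⟨1, by simp⟩
  | cons θ S ih =>
    obtain ⟨Ψ, h1, h2⟩ := ih fun x hx => h x (Multiset.mem_cons_of_mem hx)
    obtain ⟨ψ, h3, h4⟩ := h θ (Multiset.mem_cons_self _ _)
    refine ⟨ψ * Ψ, ?_, ?_⟩
    · rw [Multiset.map_cons, Multiset.prod_cons, h1, h3, Multiset.card_cons]
      ring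
    · rw [Multiset.map_cons, Multiset.map_cons, Multiset.prod_cons, Multiset.prod_cons, map_mul,
        ← h2, ← h4]
      ring

/-- The derivative of a product of polynomials at the roots of the factors. -/
theorem prod_roots_derivative_sq_mul {k ι : Type*} [Field k] [DecidableEq ι] (s : Finset ι)
    {e g : Polynomial k} (ej b : ι → Polynomial k) (he : e = ∏ j ∈ s, ej j) (he0 : e ≠ 0)
    (hb : ∀ j ∈ s, e ^ 2 * g = ej j ^ 2 * b j) :
    (e.roots.map e.derivative.eval).prod ^ 2 * (e.roots.map g.eval).prod =
      ∏ j ∈ s, (((ej j).roots.map (ej j).derivative.eval).prod ^ 2 *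
        ((ej j).roots.map (b j).eval).prod) := by
  rw [← Multiset.prod_map_pow, ← Multiset.prod_map_mul]
  have hr : e.roots = s.val.bind fun j => (ej j).roots := by
    rw [he, Polynomial.roots_prod _ _ (by rwa [← he])]
  rw [hr, Multiset.map_bind, Multiset.prod_bind]
  refine Finset.prod_congr rfl fun j hj => ?_
  rw [← Multiset.prod_map_pow, ← Multiset.prod_map_mul]
  refine congrArg _ (Multiset.map_congr rfl fun θ hθ => ?_)
  have hj0 : ej j ≠ 0 := by
    rintro h
    exact he0 (by rw [he]; exact Finset.prod_eq_zero hj h)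
  have hθ0 := (Polynomial.mem_roots'.mp hθ).2
  rw [Polynomial.IsRoot.def] at hθ0
  obtain ⟨Q, hQ⟩ : ∃ Q, e = ej j * Q := ⟨_, by rw [he, ← Finset.mul_prod_erase s ej hj]⟩
  have hbj : b j = Q ^ 2 * g := by
    refine mul_left_cancel₀ (pow_ne_zero 2 hj0) ?_
    rw [← hb j hj, hQ]
    ring
  rw [hbj, hQ]
  simp only [Polynomial.derivative_mul, Polynomial.eval_add, Polynomial.eval_mul,
    Polynomial.eval_pow, hθ0]
  ring

end Products

/-- Elimination of the leading coefficients `l`, `α` of `E`, `A` and of the products over roots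
from the formulas for the discriminant of a line section. Here `χ` is the leading coefficient of the
discriminant of the family, `PD` that of the product of the critical values, and `ρ` the remaining
factor. `Pe`, `Pb` and `Pa` are the products of the values of the `Ej'`, the `B_j` and of `A` over
the roots of `E`, and `Pβ`, `Pa'` those of `E` and `A'` over the roots of `A`. They are compared
with the resultants `RD`, `Rb`, `RA` and the discriminants `DE`, `DA`; the squares remove
the signs. -/
theorem sq_eq_of_products {K : Type*} [Field K] {l α χ ρ PD Rbn RD M N Pe Pb Rb DE cE cA Pa Pβ Pa'
    RA DA : K} {d δ r : ℕ} (hdr : d = 2 * δ + r) (hd : 0 < d) (hl : l ≠ 0) (hα : α ≠ 0)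
    (hdK : (d : K) ≠ 0)
    (h1 : (d * (l ^ 2 * α) * χ) ^ 2 = ((d : K) ^ (d - 1) * (PD * ρ)) ^ 2)
    (h2 : l ^ d * (PD * Rbn) = RD) (h3 : (M * Pe) ^ 2 = cE * (l ^ 2 * DE) ^ 2)
    (h4 : N * Pb = Rb) (h5 : M ^ 2 * N = l ^ d)
    (h6 : ρ = (l ^ 2 * α) ^ (d - 1 - δ) *
      ((2 * l) ^ (2 * δ) * l ^ r * (Pe ^ 2 * Pb) * Pa * Pβ * Pa'))
    (h7 : l ^ r * Pa = RA) (h8 : (α ^ δ * Pβ) ^ 2 = RA ^ 2)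
    (h9 : (α ^ r * Pa') ^ 2 = cA * (α ^ 2 * DA) ^ 2) :
    (χ * Rbn) ^ 2 = ((d : K) ^ (d - 1)) ^ 2 / (d : K) ^ 2 * 2 ^ (4 * δ) * cE ^ 2 * cA *
      (RD * DE ^ 2 * Rb * RA ^ 2 * DA) ^ 2 := by
  obtain ⟨q, hq⟩ : ∃ q, q = d - 1 - δ := ⟨_, rfl⟩
  rw [← hq] at h6
  have hαq : α ^ δ * α ^ r = α ^ q * α := by
    rw [← pow_add, ← pow_succ]
    congr 1
    omega
  have hlq : l ^ d = l ^ q * l * l ^ δ := by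
    rw [← pow_succ, ← pow_add]
    congr 1
    omega
  obtain ⟨D, hD⟩ : ∃ D, D = (d : K) ^ (d - 1) := ⟨_, rfl⟩
  rw [← hD] at h1 ⊢
  have hK : ((d : K) * l ^ 2 * α * l ^ d * l ^ d * l ^ r * (α ^ δ * α ^ r)) ^ 2 ≠ 0 := by
    have hlp := fun n : ℕ => pow_ne_zero n hl
    have hαp := fun n : ℕ => pow_ne_zero n hα
    exact pow_ne_zero _ (mul_ne_zero (mul_ne_zero (mul_ne_zero (mul_ne_zero (mul_ne_zero
      (mul_ne_zero hdK (hlp _)) hα) (hlp _)) (hlp _)) (hlp _)) (mul_ne_zero (hαp _) (hαp _)))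
  refine mul_left_cancel₀ hK ?_
  calc ((d : K) * l ^ 2 * α * l ^ d * l ^ d * l ^ r * (α ^ δ * α ^ r)) ^ 2 * (χ * Rbn) ^ 2
      = (d * (l ^ 2 * α) * χ) ^ 2 * (l ^ d * Rbn * (l ^ d * l ^ r * (α ^ δ * α ^ r))) ^ 2 := by
        ring
    _ = D ^ 2 * (l ^ d * (PD * Rbn)) ^ 2 * (ρ * ((M ^ 2 * N) * l ^ r * (α ^ δ * α ^ r))) ^ 2 := by
        rw [h1, h5]
        ring
    _ = D ^ 2 * RD ^ 2 * (((l ^ 2 * α) ^ q) ^ 2 * ((2 * l) ^ (2 * δ) * l ^ r) ^ 2 *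
          ((M * Pe) ^ 2) ^ 2 * (N * Pb) ^ 2 * (l ^ r * Pa) ^ 2 * (α ^ δ * Pβ) ^ 2 *
          (α ^ r * Pa') ^ 2) := by
        rw [h2, h6]
        ring
    _ = _ := by
        rw [h3, h4, h7, h8, h9, hαq, hlq]
        field_simp
        ring

section Line

variable {k : Type u} [Field k] [IsAlgClosed k] [CharZero k] {ι : Type*} [Fintype ι]
  {d : ℕ} (hd : 0 < d) {F : MvPolynomial (Fin 3) (PowerSeries k)} {E A : MvPolynomial (Fin 3) k}
  (hF0 : tCoeff F 0 = E ^ 2 * A) {Ej B : ι → MvPolynomial (Fin 3) k} (hprod : E = ∏ j, Ej j)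
  (hB : ∀ j, E ^ 2 * A = Ej j ^ 2 * B j) {δ r : ℕ} {dj bj : ι → ℕ} (hdr : d = 2 * δ + r)
  (hdj : ∀ j, d = bj j + 2 * dj j)
  {DF : MvPolynomial (Fin 3) (PowerSeries k)} (hDF : IsDiscriminantForm F d DF)
  {DE DA RA : MvPolynomial (Fin 3) k} (hDE : IsDiscriminantForm E δ DE)
  (hRA : IsResultantForm E A δ r RA) (hDA : IsDiscriminantForm A r DA)
  {DEj RB RD : ι → MvPolynomial (Fin 3) k} (hDEj : ∀ j, IsDiscriminantForm (Ej j) (dj j) (DEj j))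
  (hRB : ∀ j, IsResultantForm (Ej j) (B j) (dj j) (bj j) (RB j))
  {n : ι → ℕ} (hn : ∀ j, 1 ≤ n j)
  (hdvd : ∀ j i, 1 ≤ i → i < n j → Ej j ∣ discriminant (tCoeff F) (Ej j) (B j) i)

include hd hF0 hprod hB hdr hdj hDF hDE hRA hDA hDEj hRB hn hdvd in
/-- The value of the discriminant form of `F(t)` at a general line over `k`: its order at `t = 0`
and its leading coefficient. -/
theorem exists_eval_discriminantForm
    (hRD : ∀ j, IsResultantForm (Ej j) (discriminant (tCoeff F) (Ej j) (B j) (n j)) (dj j)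
      ((n j - 1) * bj j + d) (RD j)) {cE : ι → k} {cA : k}
    (hcE : ∀ j, ∀ a b : Fin 3 → k, eval a (Ej j) ≠ 0 → (eval a (Ej j) ^ dj j *
      ((linePoly (Ej j) a b).roots.map (linePoly (Ej j) a b).derivative.eval).prod) ^ 2 =
        cE j * (eval a (Ej j) ^ 2 * eval (a ⨯₃ b) (DEj j)) ^ 2)
    (hcA : ∀ a b : Fin 3 → k, eval a A ≠ 0 → (eval a A ^ r *
      ((linePoly A a b).roots.map (linePoly A a b).derivative.eval).prod) ^ 2 =
        cA * (eval a A ^ 2 * eval (a ⨯₃ b) DA) ^ 2)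
    {a b : Fin 3 → k} (ha : eval a (E ^ 2 * A) ≠ 0) (hw : eval (a ⨯₃ b) (DE * RA) ≠ 0) :
    ∃ χ, eval (PowerSeries.C ∘ (a ⨯₃ b)) DF = PowerSeries.X ^ (∑ j, n j * dj j) * χ ∧
      (PowerSeries.constantCoeff χ * eval (a ⨯₃ b) (∏ j, RB j ^ (n j - 1))) ^ 2 =
        ((d : k) ^ (d - 1)) ^ 2 / (d : k) ^ 2 * 2 ^ (4 * δ) * (∏ j, cE j) ^ 2 * cA *
        eval (a ⨯₃ b) ((∏ j, RD j) * (∏ j, DEj j) ^ 2 * (∏ j, RB j) * RA ^ 2 * DA) ^ 2 := by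
  classical
  have hdk : (d : k) ≠ 0 := by exact_mod_cast hd.ne'
  rw [map_mul, map_pow] at ha
  have haA := right_ne_zero_of_mul ha
  have haE : eval a E ≠ 0 := fun h => ha (by rw [h]; ring)
  have haEj : ∀ j, eval a (Ej j) ≠ 0 := fun j h => haE (by
    rw [hprod, map_prod]
    exact Finset.prod_eq_zero (Finset.mem_univ j) h)
  rw [map_mul] at hw
  obtain ⟨e, he⟩ : ∃ e, e = linePoly E a b := ⟨_, rfl⟩
  obtain ⟨g, hg⟩ : ∃ g, g = linePoly A a b := ⟨_, rfl⟩
  obtain ⟨ej, hej⟩ : ∃ ej : ι → Polynomial k, ej = fun j => linePoly (Ej j) a b := ⟨_, rfl⟩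
  obtain ⟨β, hβ⟩ : ∃ β : ι → Polynomial k, β = fun j => linePoly (B j) a b := ⟨_, rfl⟩
  have hec : e.leadingCoeff = eval a E := by rw [he, leadingCoeff_linePoly hDE.left b haE]
  have hed : e.natDegree = δ := by rw [he, natDegree_linePoly hDE.left b haE]
  have hgc : g.leadingCoeff = eval a A := by rw [hg, leadingCoeff_linePoly hDA.left b haA]
  have hgd : g.natDegree = r := by rw [hg, natDegree_linePoly hDA.left b haA]
  have he0 : e ≠ 0 := fun h => haE (by rw [← hec, h, Polynomial.leadingCoeff_zero])
  have heprod : e = ∏ j, ej j := by rw [he, hprod, linePoly_prod, hej]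
  have hroots : e.roots = Finset.univ.val.bind fun j => (ej j).roots := by
    rw [heprod, Polynomial.roots_prod _ _ (by rwa [← heprod])]
  have hmem : ∀ j, ∀ θ ∈ (ej j).roots, θ ∈ e.roots := fun j θ hθ => by
    rw [hroots]
    exact Multiset.mem_bind.mpr ⟨j, Finset.mem_univ_val j, hθ⟩
  -- the roots of `e` are simple
  have hsep : ∀ θ ∈ e.roots, e.derivative.eval θ ≠ 0 := by
    obtain ⟨c, hc, hc'⟩ := hDE.exists_sq_eq (fun h => haE (by rw [h, map_zero]))
    have h1 := hc' a b haE
    intro θ hθ h0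
    rw [← he, Multiset.prod_eq_zero (Multiset.mem_map.mpr ⟨θ, hθ, h0⟩), mul_zero,
      zero_pow two_ne_zero, eq_comm] at h1
    exact mul_ne_zero hc (pow_ne_zero _ (mul_ne_zero (pow_ne_zero _ haE)
      (left_ne_zero_of_mul hw))) h1
  have hresEA := hRA.resultant_eq_eval a b
  rw [resultant_linePoly_eq_prod hRA.left hRA.right b haE] at hresEA
  have heg : ∀ θ ∈ e.roots, g.eval θ ≠ 0 := by
    intro θ hθ h0
    rw [hg, eval_linePoly] at h0
    rw [he] at hθ
    rw [Multiset.prod_eq_zero (Multiset.mem_map.mpr ⟨θ, hθ, h0⟩), mul_zero] at hresEA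
    exact right_ne_zero_of_mul hw hresEA.symm
  -- the critical points of `F(t)` on the line near the roots of `e`
  have hcomp : ∀ v : Fin 3 → k, (PowerSeries.constantCoeff : PowerSeries k →+* k) ∘
      (PowerSeries.C ∘ v) = v := fun v => by ext; simp
  obtain ⟨Fa, hFa⟩ : ∃ Fa, Fa = eval (PowerSeries.C ∘ a) F := ⟨_, rfl⟩
  have hFa0 : PowerSeries.constantCoeff Fa = eval a E ^ 2 * eval a A := by
    rw [hFa, ringHom_eval, hcomp, ← tCoeff_zero_eq_map, hF0, map_mul, map_pow]
  have hFau : IsUnit Fa := by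
    rw [PowerSeries.isUnit_iff_constantCoeff, hFa0]
    exact ha.isUnit
  obtain ⟨f, hf⟩ : ∃ f, f = linePoly F (PowerSeries.C ∘ a) (PowerSeries.C ∘ b) := ⟨_, rfl⟩
  have hf0 : f.map PowerSeries.constantCoeff = e ^ 2 * g := by
    rw [hf, linePoly_map, hcomp, hcomp, ← tCoeff_zero_eq_map, hF0, linePoly_mul, linePoly_pow,
      he, hg]
  have hfd : f.natDegree = d := by
    rw [hf, natDegree_linePoly hDF.left _ (by rw [← hFa]; exact hFau.ne_zero)]
  have hfu : IsUnit f.leadingCoeff := by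
    rwa [hf, leadingCoeff_linePoly hDF.left _ (by rw [← hFa]; exact hFau.ne_zero), ← hFa]
  obtain ⟨c, ρ, hc, hres, hρ⟩ := exists_critical_points_sq_mul hd hfd hfu hf0 hsep heg
  have hej0 : ∀ j, ej j ≠ 0 := fun j h => he0 (by
    rw [heprod]; exact Finset.prod_eq_zero (Finset.mem_univ j) h)
  have hbj : ∀ j, e ^ 2 * g = ej j ^ 2 * β j := fun j => by
    rw [he, hg, hej, hβ, ← linePoly_pow, ← linePoly_mul, hB j, linePoly_mul, linePoly_pow]
  -- the critical values near the roots of `Ej j` have order `n j` in `t`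
  have hvalue : ∀ j, ∃ Ψ, ((ej j).roots.map fun θ => f.eval (c θ)).prod =
      PowerSeries.X ^ (n j * (ej j).roots.card) * Ψ ∧
      ((ej j).roots.map fun θ => (β j).eval θ ^ (n j - 1)).prod * PowerSeries.constantCoeff Ψ =
      ((ej j).roots.map
        (linePoly (discriminant (tCoeff F) (Ej j) (B j) (n j)) a b).eval).prod := by
    intro j
    refine exists_prod_eq_X_pow_mul _ _ _ _ _ fun θ hθ => ?_
    obtain ⟨hc1, hc2⟩ := hc θ (hmem j θ hθ)
    obtain ⟨Q, hQ⟩ : ∃ Q, e = ej j * Q :=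
      ⟨_, by rw [heprod, ← Finset.mul_prod_erase _ ej (Finset.mem_univ j)]⟩
    have hθ0 : (ej j).eval θ = 0 := (Polynomial.mem_roots'.mp hθ).2
    have hs := hsep θ (hmem j θ hθ)
    rw [hQ, Polynomial.derivative_mul, Polynomial.eval_add, Polynomial.eval_mul,
      Polynomial.eval_mul, hθ0, zero_mul, add_zero] at hs
    have hβQ : β j = Q ^ 2 * g := by
      refine mul_left_cancel₀ (pow_ne_zero 2 (hej0 j)) ?_
      rw [← hbj j, hQ]
      ring
    have hβθ : (β j).eval θ ≠ 0 := by
      rw [hβQ, Polynomial.eval_mul, Polynomial.eval_pow]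
      exact mul_ne_zero (pow_ne_zero _ (right_ne_zero_of_mul hs)) (heg θ (hmem j θ hθ))
    have := exists_eval_linePoly_critical (hF0.trans (hB j)) (hn j) (hdvd j) (a := a) (b := b)
      (c := c θ) (by rw [← hf]; exact hc2)
    rw [hc1, ← hf] at this
    rw [hej] at hθ0 hs
    rw [hβ] at hβθ ⊢
    exact this hθ0 (left_ne_zero_of_mul hs) hβθ
  choose Ψ hΨ hΨ0 using hvalue
  have hejd : ∀ j, (ej j).roots.card = dj j := fun j => by
    rw [← (IsAlgClosed.splits (ej j)).natDegree_eq_card_roots, hej]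
    exact natDegree_linePoly (hDEj j).left b (haEj j)
  have hprodf : (e.roots.map fun θ => f.eval (c θ)).prod =
      PowerSeries.X ^ (∑ j, n j * dj j) * ∏ j, Ψ j := by
    rw [hroots, Multiset.map_bind, Multiset.prod_bind, ← Finset.prod_pow_eq_pow_sum,
      ← Finset.prod_mul_distrib]
    refine Finset.prod_congr rfl fun j _ => ?_
    rw [hΨ, hejd]
  -- comparison with the discriminant form of the family, up to sign
  obtain ⟨σ, hσ⟩ := hDF.resultant_dirDeriv hd (PowerSeries.C ∘ a) (PowerSeries.C ∘ b)
  rw [← derivative_linePoly, ← hf, ← hFa, ← ringHom_comp_cross] at hσ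
  obtain ⟨Dw, hDw⟩ : ∃ Dw, Dw = eval (PowerSeries.C ∘ (a ⨯₃ b)) DF := ⟨_, rfl⟩
  have hsq : ((d : PowerSeries k) * Fa * Dw) ^ 2 = (PowerSeries.X ^ (∑ j, n j * dj j) *
      ((d : PowerSeries k) ^ (d - 1) * ((∏ j, Ψ j) * ρ))) ^ 2 := by
    have hsign : ((-1 : PowerSeries k) ^ σ) ^ 2 = 1 := by
      rw [← pow_mul, mul_comm, pow_mul]
      simp
    calc ((d : PowerSeries k) * Fa * Dw) ^ 2
        = ((-1) ^ σ * (d * Fa) * Dw) ^ 2 := by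
          rw [mul_assoc ((-1 : PowerSeries k) ^ σ), mul_pow _ (_ * Dw), hsign, one_mul]
      _ = _ := by
          rw [hDw]
          erw [← hσ]
          rw [mul_pow, hres, hprodf]
          ring
  have hdvdX : PowerSeries.X ^ (∑ j, n j * dj j) ∣ Dw := by
    have hu : IsUnit ((d : PowerSeries k) * Fa) := by
      refine IsUnit.mul ?_ hFau
      rw [PowerSeries.isUnit_iff_constantCoeff, map_natCast]
      exact hdk.isUnit
    rw [← hu.dvd_mul_left]
    rcases sq_eq_sq_iff_eq_or_eq_neg.mp hsq with h | h
    · exact ⟨_, h⟩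
    · exact ⟨-_, by rw [h, mul_neg]⟩
  obtain ⟨χ, hχ⟩ := hdvdX
  refine ⟨χ, by rw [← hDw, hχ], ?_⟩
  have hsq' : ((d : PowerSeries k) * Fa * χ) ^ 2 =
      ((d : PowerSeries k) ^ (d - 1) * ((∏ j, Ψ j) * ρ)) ^ 2 := by
    refine mul_left_cancel₀ (pow_ne_zero 2 (pow_ne_zero (∑ j, n j * dj j)
      (PowerSeries.X_ne_zero (R := k)))) ?_
    rw [← mul_pow, ← mul_pow, ← hsq, hχ]
    ring
  have h1 := congrArg PowerSeries.constantCoeff hsq'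
  simp only [map_pow, map_mul, map_natCast, map_prod, hFa0] at h1
  -- the products over the roots as values of resultant forms
  have hRBw : ∀ j, eval a (Ej j) ^ bj j * ((ej j).roots.map (β j).eval).prod =
      eval (a ⨯₃ b) (RB j) := fun j => by
    rw [← (hRB j).resultant_eq_eval a b,
      resultant_linePoly_eq_prod (hRB j).left (hRB j).right b (haEj j), hej, hβ]
    simp only [eval_linePoly]
  have hRDw : ∀ j, eval a (Ej j) ^ d * (PowerSeries.constantCoeff (Ψ j) *
      eval (a ⨯₃ b) (RB j) ^ (n j - 1)) = eval (a ⨯₃ b) (RD j) := fun j => by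
    have h2 := hΨ0 j
    rw [Multiset.prod_map_pow] at h2
    rw [← (hRD j).resultant_eq_eval a b,
      resultant_linePoly_eq_prod (hRD j).left (hRD j).right b (haEj j), ← hRBw j]
    have h3 : ((linePoly (Ej j) a b).roots.map fun x => eval (x • a + b)
        (discriminant (tCoeff F) (Ej j) (B j) (n j))) = (ej j).roots.map
        (linePoly (discriminant (tCoeff F) (Ej j) (B j) (n j)) a b).eval := by
      rw [hej]
      simp only [eval_linePoly]
    rw [h3, ← h2]
    ring
  have hlprod : eval a E = ∏ j, eval a (Ej j) := by rw [hprod, map_prod]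
  have hsqprod := prod_roots_derivative_sq_mul Finset.univ ej β heprod he0 fun j _ => hbj j
  have key := sq_eq_of_products (χ := PowerSeries.constantCoeff χ)
    (ρ := PowerSeries.constantCoeff ρ)
    (PD := ∏ j, PowerSeries.constantCoeff (Ψ j))
    (Rbn := ∏ j, eval (a ⨯₃ b) (RB j) ^ (n j - 1)) (RD := ∏ j, eval (a ⨯₃ b) (RD j))
    (M := ∏ j, eval a (Ej j) ^ dj j) (N := ∏ j, eval a (Ej j) ^ bj j)
    (Pe := ∏ j, ((ej j).roots.map (ej j).derivative.eval).prod)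
    (Pb := ∏ j, ((ej j).roots.map (β j).eval).prod) (Rb := ∏ j, eval (a ⨯₃ b) (RB j))
    (DE := ∏ j, eval (a ⨯₃ b) (DEj j)) (cE := ∏ j, cE j) (cA := cA)
    (Pa := (e.roots.map g.eval).prod) (Pβ := (g.roots.map e.eval).prod)
    (Pa' := (g.roots.map g.derivative.eval).prod) (RA := eval (a ⨯₃ b) RA)
    (DA := eval (a ⨯₃ b) DA) hdr hd haE haA hdk h1
  simp only [map_mul, map_pow, map_prod]
  apply key
  · rw [hlprod, ← Finset.prod_pow, ← Finset.prod_mul_distrib, ← Finset.prod_mul_distrib]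
    exact Finset.prod_congr rfl fun j _ => hRDw j
  · rw [hlprod, ← Finset.prod_pow, ← Finset.prod_mul_distrib, ← Finset.prod_mul_distrib,
      ← Finset.prod_pow, ← Finset.prod_pow, ← Finset.prod_mul_distrib]
    refine Finset.prod_congr rfl fun j _ => ?_
    rw [hej]
    exact hcE j a b (haEj j)
  · rw [← Finset.prod_mul_distrib]
    exact Finset.prod_congr rfl fun j _ => hRBw j
  · rw [hlprod, ← Finset.prod_pow, ← Finset.prod_pow, ← Finset.prod_mul_distrib]
    refine Finset.prod_congr rfl fun j _ => ?_
    rw [← pow_mul, ← pow_add, hdj j]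
    congr 1
    ring
  · rw [hρ, hec, hgc, hed, hgd, ← Finset.prod_pow, ← Finset.prod_mul_distrib, ← hsqprod]
    ring
  · rw [← hresEA, he, hg]
    simp only [eval_linePoly]
  · have h2 := hRA.symm.resultant_eq_eval a b
    rw [resultant_linePoly_eq_prod hRA.right hRA.left b haA, map_mul, eval_C] at h2
    have h3 : (g.roots.map e.eval) = (linePoly A a b).roots.map fun x => eval (x • a + b) E := by
      rw [hg, he]
      simp only [eval_linePoly]
    rw [h3, h2, mul_pow, ← pow_mul, mul_comm _ 2, pow_mul]
    simp
  · rw [hg]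
    exact hcA a b haA

include hd hF0 hprod hB hdr hdj hDF hDE hRA hDA hDEj hRB hn hdvd in
/-- The discriminant form of `F(t)` is divisible by a power of `t`, and the value at `t = 0` of the
quotient is determined up to a constant. The `n j` need not be the types: with all the discriminants
divisible by `Ej j`, the power of `t` can be made arbitrarily large. -/
theorem exists_discriminantForm_eq
    (hRD : ∀ j, IsResultantForm (Ej j) (discriminant (tCoeff F) (Ej j) (B j) (n j)) (dj j)
      ((n j - 1) * bj j + d) (RD j)) (hF00 : E ^ 2 * A ≠ 0) (hDE0 : DE ≠ 0) (hRA0 : RA ≠ 0) :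
    ∃ Φ, DF = C (PowerSeries.X ^ (∑ j, n j * dj j)) * Φ ∧ ∃ c : k, c ≠ 0 ∧
      (tCoeff Φ 0 * ∏ j, RB j ^ (n j - 1)) ^ 2 =
        C c * ((∏ j, RD j) * (∏ j, DEj j) ^ 2 * (∏ j, RB j) * RA ^ 2 * DA) ^ 2 := by
  have hEj0 : ∀ j, Ej j ≠ 0 := fun j h => hF00 (by rw [hB j, h]; ring)
  choose cE hcE0 hcE using fun j => (hDEj j).exists_sq_eq (hEj0 j)
  obtain ⟨cA, hcA0, hcA⟩ := hDA.exists_sq_eq (right_ne_zero_of_mul hF00)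
  have hline := fun (a b : Fin 3 → k) (ha : eval a (E ^ 2 * A) ≠ 0)
    (hw : eval (a ⨯₃ b) (DE * RA) ≠ 0) => exists_eval_discriminantForm hd hF0 hprod hB hdr hdj hDF
      hDE hRA hDA hDEj hRB hn hdvd hRD hcE hcA ha hw
  have hlow : ∀ i < ∑ j, n j * dj j, tCoeff DF i = 0 := by
    intro i hi
    refine eq_of_forall_eval_cross (mul_ne_zero hDE0 hRA0) hF00 fun a b ha hw => ?_
    obtain ⟨χ, hχ, -⟩ := hline a b ha hw
    rw [eval_tCoeff, hχ, PowerSeries.coeff_X_pow_mul', if_neg (by omega), map_zero]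
  obtain ⟨Φ, hΦ⟩ := exists_eq_C_X_pow_mul hlow
  have hdk : (d : k) ≠ 0 := by exact_mod_cast hd.ne'
  refine ⟨Φ, hΦ, ((d : k) ^ (d - 1)) ^ 2 / (d : k) ^ 2 * 2 ^ (4 * δ) * (∏ j, cE j) ^ 2 * cA,
    mul_ne_zero (mul_ne_zero (mul_ne_zero (div_ne_zero (pow_ne_zero _ (pow_ne_zero _ hdk))
      (pow_ne_zero _ hdk)) (pow_ne_zero _ two_ne_zero))
      (pow_ne_zero _ (Finset.prod_ne_zero_iff.mpr fun j _ => hcE0 j))) hcA0, ?_⟩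
  refine eq_of_forall_eval_cross (mul_ne_zero hDE0 hRA0) hF00 fun a b ha hw => ?_
  obtain ⟨χ, hχ, hχ0⟩ := hline a b ha hw
  have h1 : eval (PowerSeries.C ∘ (a ⨯₃ b)) Φ = χ := by
    rw [hΦ, map_mul, eval_C] at hχ
    exact mul_left_cancel₀ (pow_ne_zero _ PowerSeries.X_ne_zero) hχ
  rw [map_pow, map_mul, eval_tCoeff, h1, PowerSeries.coeff_zero_eq_constantCoeff_apply, hχ0,
    map_mul (eval (a ⨯₃ b)) (C _), eval_C, map_pow]

end Line

/-! ### The limit of the dual curves -/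

section Limit

variable {k : Type u} [Field k]

lemma IsDiscriminantForm.geomGeneric {F G : MvPolynomial (Fin 3) (PowerSeries k)} {d : ℕ}
    (h : IsDiscriminantForm F d G) :
    IsDiscriminantForm (geomGeneric F) d (geomGeneric G) :=
  letI : Algebra (PowerSeries k) (GeomField k) :=
    ((algebraMap (LaurentSeries k) (GeomField k)).comp
      (algebraMap (PowerSeries k) (LaurentSeries k))).toAlgebra
  h.baseChange (S := GeomField k)

lemma charZero_geomField [CharZero k] : CharZero (GeomField k) :=
  charZero_of_injective_ringHom (f := ((algebraMap (LaurentSeries k) (GeomField k)).comp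
    (algebraMap (PowerSeries k) (LaurentSeries k))).comp PowerSeries.C) (RingHom.injective _)

lemma discriminantForm_ne_zero [CharZero k] {F G : MvPolynomial (Fin 3) (PowerSeries k)} {d : ℕ}
    (h : IsDiscriminantForm F d G) (hred : Squarefree (geomGeneric F)) : G ≠ 0 := by
  have := charZero_geomField (k := k)
  rintro rfl
  exact h.geomGeneric.ne_zero hred (map_zero _)

/-- Over the geometric generic field a power of `t` is a unit, so it does not affect the divisor of
the discriminant form. -/
lemma dualCurve_geomGeneric [CharZero k] {F G Φ : MvPolynomial (Fin 3) (PowerSeries k)} {d N : ℕ}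
    (h : IsDiscriminantForm F d G) (hred : Squarefree (geomGeneric F))
    (hΦ : G = C (PowerSeries.X ^ N) * Φ) :
    dualCurve (geomGeneric F) = divisor (geomGeneric Φ) := by
  have := charZero_geomField (k := k)
  rw [h.geomGeneric.dualCurve_eq_divisor hred]
  refine divisor_congr ?_
  rw [hΦ, geomGeneric, map_mul, map_C]
  refine associated_unit_mul_left _ _ (IsUnit.map C (Ne.isUnit ?_))
  rw [map_pow, RingHom.comp_apply]
  refine pow_ne_zero _ ((map_ne_zero _).mpr ?_)
  have hinj : Function.Injective (algebraMap (PowerSeries k) (LaurentSeries k)) :=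
    FaithfulSMul.algebraMap_injective _ _
  exact (map_ne_zero_iff _ hinj).mpr PowerSeries.X_ne_zero

lemma intersectionDual_comm_eq_divisor [IsAlgClosed k] {P Q R : MvPolynomial (Fin 3) k} {p q : ℕ}
    (h : IsResultantForm P Q p q R) (hP : P ≠ 0) (hQ : Q ≠ 0) (hR : R ≠ 0) :
    intersectionDual Q P = divisor R := by
  have hu : IsUnit (C ((-1) ^ (q * p)) : MvPolynomial (Fin 3) k) :=
    IsUnit.map C (IsUnit.pow _ isUnit_one.neg)
  rw [intersectionDual_eq_divisor h.symm hQ hP (mul_ne_zero hu.ne_zero hR)]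
  exact divisor_congr (associated_unit_mul_left _ _ hu)

/-- The type is the least index of a discriminant that `E` does not divide. -/
lemma exists_isOfType {F : ℕ → MvPolynomial (Fin 3) k} {E B : MvPolynomial (Fin 3) k}
    (h : ¬ ∀ i, 1 ≤ i → E ∣ discriminant F E B i) : ∃ n, IsOfType F E B n := by
  classical
  push Not at h
  obtain ⟨h1, h2⟩ := Nat.find_spec h
  refine ⟨Nat.find h, h1, fun i hi hi' => ?_, h2⟩
  by_contra h3
  exact Nat.find_min h hi' ⟨hi, h3⟩

lemma not_dvd_of_sq_mul_eq {E A Ej B : MvPolynomial (Fin 3) k} (hE : Squarefree E)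
    (hEA : IsRelPrime E A) (hEj : Irreducible Ej) (hdvd : Ej ∣ E) (hB : E ^ 2 * A = Ej ^ 2 * B) :
    ¬ Ej ∣ B := by
  obtain ⟨Q, rfl⟩ := hdvd
  have hBQ : B = Q ^ 2 * A := by
    refine mul_left_cancel₀ (pow_ne_zero 2 hEj.ne_zero) ?_
    rw [← hB]
    ring
  rw [hBQ]
  intro h
  rcases hEj.prime.dvd_or_dvd h with h | h
  · exact hEj.not_isUnit (hE Ej (mul_dvd_mul_left _ (hEj.prime.dvd_of_dvd_pow h)))
  · exact hEj.not_isUnit (hEA (dvd_mul_right _ _) h)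

end Limit

end PlaneCurve

open PlaneCurve

theorem corollary5p1p6 {k : Type*} [Field k] [IsAlgClosed k] [CharZero k]
    (d : ℕ) (hd : 0 < d) (F : MvPolynomial (Fin 3) (PowerSeries k)) (hF : F.IsHomogeneous d)
    (E A : MvPolynomial (Fin 3) k) (hF0 : PlaneCurve.tCoeff F 0 = E ^ 2 * A)
    (hE : Squarefree E) (hA : Squarefree A) (hEA : IsRelPrime E A)
    (m : ℕ) (Ej : Fin m → MvPolynomial (Fin 3) k) (hirr : ∀ j, Irreducible (Ej j))
    (hprod : E = ∏ j, Ej j)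
    (B : Fin m → MvPolynomial (Fin 3) k) (hB : ∀ j, E ^ 2 * A = Ej j ^ 2 * B j)
    -- the generic curve is geometrically reduced
    (hred : Squarefree (PlaneCurve.geomGeneric F)) :
    ∃ n : Fin m → ℕ,
      (∀ j, PlaneCurve.IsOfType (PlaneCurve.tCoeff F) (Ej j) (B j) (n j)) ∧
      PlaneCurve.IsLimitCurve (PlaneCurve.dualCurve (PlaneCurve.geomGeneric F))
        ((2 : ℤ) • ∑ j, PlaneCurve.dualCurve (Ej j) + PlaneCurve.dualCurve A
          + (2 : ℤ) • PlaneCurve.intersectionDual E A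
          + ∑ j, PlaneCurve.intersectionDual
              (PlaneCurve.discriminant (PlaneCurve.tCoeff F) (Ej j) (B j) (n j)) (Ej j)
          - ∑ j, ((n j : ℤ) - 2) • PlaneCurve.intersectionDual (B j) (Ej j)) := by
  classical
  have hE0 := hE.ne_zero
  have hA0 := hA.ne_zero
  have hF00 : E ^ 2 * A ≠ 0 := mul_ne_zero (pow_ne_zero _ hE0) hA0
  have hB0 : ∀ j, B j ≠ 0 := fun j h => hF00 (by rw [hB j, h, mul_zero])
  have hEjE : ∀ j, Ej j ∣ E := fun j => by
    rw [hprod]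
    exact Finset.dvd_prod_of_mem _ (Finset.mem_univ j)
  have hEjB : ∀ j, ¬ Ej j ∣ B j := fun j =>
    not_dvd_of_sq_mul_eq hE hEA (hirr j) (hEjE j) (hB j)
  -- degrees
  have hhom : (E ^ 2 * A).IsHomogeneous d := hF0 ▸ isHomogeneous_tCoeff hF 0
  obtain ⟨δ, hδ⟩ := isHomogeneous_of_dvd hhom hF00 ⟨E * A, by ring⟩
  obtain ⟨r, hr⟩ := isHomogeneous_of_dvd hhom hF00 (Dvd.intro_left _ rfl : A ∣ E ^ 2 * A)
  have hdr : d = 2 * δ + r := by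
    rw [mul_comm 2 δ]
    exact hhom.inj_right ((hδ.pow 2).mul hr) hF00
  choose dj hdj using fun j => isHomogeneous_of_dvd hδ hE0 (hEjE j)
  choose bj hbj using fun j => isHomogeneous_of_dvd hhom hF00 (⟨Ej j ^ 2, by rw [hB j, mul_comm]⟩ :
    B j ∣ E ^ 2 * A)
  have hdbj : ∀ j, d = bj j + 2 * dj j := fun j => by
    have h := ((hdj j).pow 2).mul (hbj j)
    rw [← hB j] at h
    rw [hhom.inj_right h hF00]
    ring
  -- the forms that compute the divisors
  obtain ⟨DF, hDF⟩ := exists_isDiscriminantForm hF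
  obtain ⟨DE, hDE⟩ := exists_isDiscriminantForm hδ
  obtain ⟨DA, hDA⟩ := exists_isDiscriminantForm hr
  obtain ⟨RA, hRA⟩ := exists_isResultantForm hδ hr
  choose DEj hDEj using fun j => exists_isDiscriminantForm (hdj j)
  choose RB hRB using fun j => exists_isResultantForm (hdj j) (hbj j)
  have hDE0 := hDE.ne_zero hE
  have hDA0 := hDA.ne_zero hA
  have hRA0 := hRA.ne_zero hE0 hA0 hEA
  have hDEj0 : ∀ j, DEj j ≠ 0 := fun j => (hDEj j).ne_zero (hirr j).squarefree
  have hRB0 : ∀ j, RB j ≠ 0 := fun j => (hRB j).ne_zero (hirr j).ne_zero (hB0 j)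
    ((hirr j).isRelPrime_iff_not_dvd.mpr (hEjB j))
  have hDF0 := discriminantForm_ne_zero hDF hred
  -- the degrees of the discriminants
  have hΔ : ∀ j n, 1 ≤ n → (∀ i, 1 ≤ i → i < n → Ej j ∣ discriminant (tCoeff F) (Ej j) (B j) i) →
      (discriminant (tCoeff F) (Ej j) (B j) n).IsHomogeneous ((n - 1) * bj j + d) := by
    intro j n hn h
    obtain ⟨l, rfl⟩ : ∃ l, n = l + 1 := ⟨n - 1, by omega⟩
    rw [Nat.add_sub_cancel, hdbj j]
    exact isHomogeneous_discriminant (fun i => hdbj j ▸ isHomogeneous_tCoeff hF i) (hdj j)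
      (hirr j).ne_zero (hbj j) l fun i hi => h (i + 1) (by omega) (by omega)
  -- if `Ej j` divided all discriminants, all powers of `t` would divide `DF`
  have htype : ∀ j, ∃ n, IsOfType (tCoeff F) (Ej j) (B j) n := by
    intro j
    refine exists_isOfType fun hall => hDF0 (eq_zero_of_forall_tCoeff fun N => ?_)
    have hn : ∀ i, 1 ≤ Function.update (1 : Fin m → ℕ) j (N + 1) i := fun i => by
      by_cases hij : i = j
      · subst hij
        simp
      · simp [hij]
    have hdvd : ∀ i s, 1 ≤ s → s < Function.update (1 : Fin m → ℕ) j (N + 1) i →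
        Ej i ∣ discriminant (tCoeff F) (Ej i) (B i) s := fun i s hs hs' => by
      by_cases hij : i = j
      · subst hij
        exact hall s hs
      · rw [Function.update_of_ne hij, Pi.one_apply] at hs'
        omega
    choose RD hRD using fun i => exists_isResultantForm (hdj i) (hΔ i _ (hn i) (hdvd i))
    obtain ⟨Φ, hΦ, -⟩ := exists_discriminantForm_eq hd hF0 hprod hB hdr hdbj hDF hDE hRA hDA hDEj
      hRB hn hdvd hRD hF00 hDE0 hRA0
    have hN : N < ∑ i, Function.update (1 : Fin m → ℕ) j (N + 1) i * dj i := by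
      refine lt_of_lt_of_le ?_ (Finset.single_le_sum (fun i _ => Nat.zero_le _)
        (Finset.mem_univ j))
      rw [Function.update_self]
      have := degree_pos_of_irreducible (hdj j) (hirr j)
      nlinarith
    ext s
    rw [coeff_tCoeff, hΦ, coeff_C_mul, PowerSeries.coeff_X_pow_mul', if_neg (by omega), coeff_zero]
  choose n hn using htype
  refine ⟨n, hn, ?_⟩
  choose RD hRD using fun j => exists_isResultantForm (hdj j) (hΔ j _ (hn j).1 (hn j).2.1)
  have hΔ0 : ∀ j, discriminant (tCoeff F) (Ej j) (B j) (n j) ≠ 0 := fun j h =>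
    (hn j).2.2 (h ▸ dvd_zero _)
  have hRD0 : ∀ j, RD j ≠ 0 := fun j => (hRD j).ne_zero (hirr j).ne_zero (hΔ0 j)
    ((hirr j).isRelPrime_iff_not_dvd.mpr (hn j).2.2)
  obtain ⟨Φ, hΦ, c, hc, hsq⟩ := exists_discriminantForm_eq hd hF0 hprod hB hdr hdbj hDF hDE hRA hDA
    hDEj hRB (fun j => (hn j).1) (fun j => (hn j).2.1) hRD hF00 hDE0 hRA0
  have hass := associated_of_sq_eq hc hsq
  have h1 : ∏ j, RD j ≠ 0 := Finset.prod_ne_zero_iff.mpr fun j _ => hRD0 j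
  have h2 : ∏ j, DEj j ≠ 0 := Finset.prod_ne_zero_iff.mpr fun j _ => hDEj0 j
  have h3 : ∏ j, RB j ≠ 0 := Finset.prod_ne_zero_iff.mpr fun j _ => hRB0 j
  have h4 := mul_ne_zero h1 (pow_ne_zero 2 h2)
  have h5 := mul_ne_zero h4 h3
  have h6 := mul_ne_zero h5 (pow_ne_zero 2 hRA0)
  have hΦ0 : tCoeff Φ 0 ≠ 0 := fun h => by
    rw [h, zero_mul] at hass
    exact mul_ne_zero h6 hDA0 ((associated_zero_iff_eq_zero _).mp hass.symm)
  obtain ⟨e, he⟩ := isHomogeneous_of_dvd hDF.isHomogeneous hDF0 (Dvd.intro_left _ hΦ.symm)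
  refine ⟨e, Φ, he, hΦ0, (dualCurve_geomGeneric hDF hred hΦ).symm, ?_⟩
  -- the exponent `n j - 1` of `RB j` on the left and the factor `RB j` on the right combine to
  -- the coefficient `n j - 2`
  have hdiv := divisor_congr hass
  rw [divisor_mul hΦ0 (Finset.prod_ne_zero_iff.mpr fun j _ => pow_ne_zero _ (hRB0 j)),
    divisor_mul h6 hDA0, divisor_mul h5 (pow_ne_zero 2 hRA0), divisor_mul h4 h3,
    divisor_mul h1 (pow_ne_zero 2 h2), divisor_pow h2, divisor_pow hRA0,
    divisor_prod _ _ fun j _ => hRD0 j, divisor_prod _ _ fun j _ => hDEj0 j,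
    divisor_prod _ _ fun j _ => hRB0 j, divisor_prod _ _ fun j _ => pow_ne_zero _ (hRB0 j),
    ← hDA.dualCurve_eq_divisor hA, ← intersectionDual_eq_divisor hRA hE0 hA0 hRA0,
    Finset.sum_congr rfl fun j _ => ((hDEj j).dualCurve_eq_divisor (hirr j).squarefree).symm,
    Finset.sum_congr rfl fun j _ => (intersectionDual_comm_eq_divisor (hRD j) (hirr j).ne_zero
      (hΔ0 j) (hRD0 j)).symm] at hdiv
  have hpow : ∑ j, divisor (RB j ^ (n j - 1)) =
      ∑ j, ((n j : ℤ) - 2) • intersectionDual (B j) (Ej j) + ∑ j, divisor (RB j) := by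
    rw [← Finset.sum_add_distrib]
    refine Finset.sum_congr rfl fun j _ => ?_
    rw [divisor_pow (hRB0 j), intersectionDual_comm_eq_divisor (hRB j) (hirr j).ne_zero (hB0 j)
      (hRB0 j), ← natCast_zsmul, Nat.cast_sub (hn j).1, Nat.cast_one]
    module
  rw [hpow] at hdiv
  rw [eq_sub_of_add_eq hdiv]
  module
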